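/- **Setting.** Let $r\in\{2,3,\dots,\infty\}$. Let $\mathcal M\subset\mathbb R^3$ be a compact connected domain whose boundary $\partial\mathcal M$ is of class $C^r$ and of class $C^{2,\alpha}$ for some $\alpha\in(0,1)$, and is uniformly convex (its principal curvatures are bounded below by a positive constant). "Smooth" means of class $C^r$. Let $a\in[0,1]$. *Varifolds.* $\mathcal V_2(\mathcal M)$ is the set of positive Radon measures on $\mathcal M\times G(2,3)$, and $\mathcal V_2(\partial\mathcal M)$ is the set of positive Radon measures on $\{(x,T_x\partial\mathcal M): x\in\partial\mathcal M\}$, both with weak* convergence. A surface $\Sigma$ of finite area is identified with the varifold $\mathcal H^2\llcorner\Sigma\otimes\delta_{T_x\Sigma}$. A pair $(V,W)\in\mathcal V_2(\mathcal M)\times\mathcal V_2(\partial\mathcal M)$ is *stationary* for $F_a(V,W)=\|V\|(\mathcal M)+a\|W\|(\partial\mathcal M)$ if $$\delta_{F_a}(V,W)[X]=\int \mathrm{div}_S X(x)\,dV(x,S)+a\int \mathrm{div}_{\partial\mathcal M}X(x)\,dW(x,T_x\partial\mathcal M)=0$$ for every $C^1$ vector field $X$ on $\mathcal M$ with $X(x)\in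 T_x\partial\mathcal M$ for all $x\in\partial\mathcal M$. *Families.* Let $P=[0,1]$ or $P=[0,1]^2$. A *parametrized smooth family of surfaces* is a family $\{\Sigma_t\}_{t\in P}$ of closed subsets of $\mathcal M$ of finite $\mathcal H^2$-measure for which there are finite sets $S_t$ such that: $\Sigma_t\setminus S_t$ is a smooth embedded surface with (possibly empty) boundary contained in $\partial\mathcal M$; $\sup_{x\in\Sigma_t}\mathrm{dist}(x,\Sigma_s)\to0$ as $t\to s$; $\Sigma_t\to\Sigma_s$ smoothly (in $C^r$), locally in $\mathcal M\setminus S_s$, as $t\to s$; and $t\mapsto\mathcal H^2(\Sigma_t)$ is continuous. *Sweepouts.* A *sweepout* is a pair $(\Sigma_t,\Gamma_t)_{t\in[0,1]}$ of parametrized smooth families of surfaces, with finite singular sets $S_t$ and $G_t$, for which there are relatively open sets $\Omega_t\subset\mathcal M$ of finite perimeter such that, for all $t$: $\Gamma_t\subset\partial\mathcal M$; $\Sigma_t\cap\Gamma_t=\partial\Sigma_t=\partial\Gamma_t$ outside $S_t\cup G_t$ (boundaries of surfaces); $\partial_i\Omega_t\setminus\Sigma_t\subset S_t$; $\big(\partial_b\Omega_t\setminus(\Sigma_t\cup\Gamma_t)\big)\cup\big((\Sigma_t\cap\partial\mathcal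 M)\setminus\partial_b\Omega_t\big)\cup\big(\Gamma_t\setminus\partial_b\Omega_t\big)\subset S_t\cup G_t$; moreover $\Omega_0=\emptyset$, $\Omega_1=\mathcal M$, and $\mathrm{vol}(\Omega_t\setminus\Omega_s)+\mathrm{vol}(\Omega_s\setminus\Omega_t)\to0$ as $t\to s$. Here $\partial_i\Omega=\partial^*\Omega\cap\mathrm{int}\,\mathcal M$ and $\partial_b\Omega=\overline{\partial^*\Omega\cap\partial\mathcal M}$, where $\partial^*\Omega$ is the reduced boundary of $\Omega$ in $\mathbb R^3$. Two sweepouts $(\Sigma_t,\Gamma_t)$ and $(\tilde\Sigma_t,\tilde\Gamma_t)$ are *homotopic* if there are parametrized smooth families of surfaces $\{\Sigma_{(t,s)}\}$ and $\{\Gamma_{(t,s)}\}$ over $[0,1]^2$ with $(\Sigma_{(t,0)},\Gamma_{(t,0)})=(\Sigma_t,\Gamma_t)$ and $(\Sigma_{(t,1)},\Gamma_{(t,1)})=(\tilde\Sigma_t,\tilde\Gamma_t)$ for all $t$. A non-empty set $\mathscr S$ of sweepouts is *homotopically closed* if it contains every sweepout homotopic to one of its elements. *Min-max.* Put $F_a(\Sigma,\Gamma)=\mathcal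 H^2(\Sigma)+a\mathcal H^2(\Gamma)$ and $m_0(\mathscr S)=\inf\{\max_{t}F_a(\Sigma_t,\Gamma_t):(\Sigma_t,\Gamma_t)_t\in\mathscr S\}$. A sequence $(\Sigma^k_t,\Gamma^k_t)_{t}$ in $\mathscr S$ is *minimizing* if $\max_tF_a(\Sigma^k_t,\Gamma^k_t)\to m_0(\mathscr S)$; then a sequence of slices $(\Sigma^k_{t_k},\Gamma^k_{t_k})$ is a *min-max sequence* if $F_a(\Sigma^k_{t_k},\Gamma^k_{t_k})\to m_0(\mathscr S)$. **Theorem (pull-tight).** Let $\mathscr S$ be a homotopically closed set of sweepouts of $\mathcal M$. Then there is a minimizing sequence $(\Sigma^k_t,\Gamma^k_t)_{t\in[0,1]}$ in $\mathscr S$ such that every min-max sequence $(\Sigma^k_{t_k},\Gamma^k_{t_k})$ has a subsequence that converges, as pairs of varifolds, to a pair $(V,W)\in\mathcal V_2(\mathcal M)\times\mathcal V_2(\partial\mathcal M)$ that is stationary for $F_a$; moreover every limit of a convergent subsequence of such a min-max sequence is a pair in $\mathcal V_2(\mathcal M)\times\mathcal V_2(\partial\mathcal M)$ that is stationary for $F_a$.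 -/

import Mathlib

open MeasureTheory Set Filter Topology
open scoped NNReal ENNReal

namespace Capillarity

noncomputable section

/-- The ambient Euclidean space `ℝ³`. -/
abbrev E3 : Type := EuclideanSpace ℝ (Fin 3)

/-- The parameter interval `[0,1]`. -/
abbrev I01 : Type := unitInterval

/-! ### Planes, divergences, tangent planes -/

/-- The Grassmannian `G(2,3)` of unoriented 2-dimensional linear subspaces of `ℝ³`. -/
structure Plane : Type where
  space : Submodule ℝ E3
  finrank_eq : Module.finrank ℝ space = 2

/-- The orthogonal projection `P_S`. -/
def Plane.proj (S : Plane) : E3 →L[ℝ] E3 := S.space.starProjection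

/-- The usual topology of the Grassmannian: planes are close iff their orthogonal projections are
close in operator norm. -/
instance : TopologicalSpace Plane := TopologicalSpace.induced Plane.proj inferInstance

instance : SecondCountableTopology Plane :=
  TopologicalSpace.secondCountableTopology_induced Plane (E3 →L[ℝ] E3) Plane.proj

instance : MeasurableSpace Plane := borel Plane

instance : BorelSpace Plane := ⟨rfl⟩

instance : Nonempty Plane := by
  have hb := (EuclideanSpace.basisFun (Fin 3) ℝ).toBasis.linearIndependent
  have h2 := hb.comp (Fin.castSucc : Fin 2 → Fin 3) (Fin.castSucc_injective 2)
  exact ⟨⟨_, (finrank_span_eq_card h2).trans (by simp)⟩⟩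

/-- The tangential divergence `div_S X (x) = ∑ D_{τ_i} X (x) · τ_i = tr (P_S ∘ DX(x))`. -/
def tangDiv (S : Plane) (X : E3 → E3) (x : E3) : ℝ :=
  LinearMap.trace ℝ E3 (S.proj ∘L fderiv ℝ X x).toLinearMap

/-- The full divergence of a vector field on `ℝ³`. -/
def fullDiv (X : E3 → E3) (x : E3) : ℝ :=
  LinearMap.trace ℝ E3 (fderiv ℝ X x).toLinearMap

open Classical in
/-- The tangent plane `T_x A` of a set `A` at `x`: the linear span of the tangent cone of `A` at
`x`, whenever this is 2-dimensional, as it is at each point near which `A` is an embedded `C¹`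
surface, with or without boundary (at any other point the value is arbitrary). -/
def tangentPlane (A : Set E3) (x : E3) : Plane :=
  if h : Module.finrank ℝ (Submodule.span ℝ (tangentConeAt ℝ A x)) = 2 then ⟨_, h⟩
  else Classical.arbitrary Plane

/-! ### The domain -/

/-- `M ⊂ ℝ³` is a compact domain whose boundary `∂M = frontier M` is of class `C^r` and `C^{2,α}`
for some `α ∈ (0,1)`, and uniformly convex. Near each boundary point `M = {g ≤ 0}` with
`∇g ≠ 0`; then the second fundamental form of `∂M = {g = 0}` with respect to the inner normal is
`D²g / |∇g|` restricted to `ker Dg`, and the principal curvatures are bounded below by `κ > 0`. -/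
structure IsConvexDomain (r : ℕ∞) (M : Set E3) : Prop where
  isCompact : IsCompact M
  isConnected : IsConnected M
  boundary : ∃ (α : ℝ≥0) (κ : ℝ), 0 < α ∧ α < 1 ∧ 0 < κ ∧
    ∀ p ∈ frontier M, ∃ (U : Set E3) (g : E3 → ℝ), IsOpen U ∧ p ∈ U ∧
      ContDiffOn ℝ r g U ∧ ContDiffOn ℝ 2 g U ∧
      (∃ C : ℝ≥0, HolderOnWith C α (fun x => fderiv ℝ (fderiv ℝ g) x) U) ∧
      (∀ x ∈ U, fderiv ℝ g x ≠ 0) ∧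
      (∀ x ∈ U, x ∈ M ↔ g x ≤ 0) ∧
      (∀ x ∈ U, g x = 0 → ∀ v : E3, fderiv ℝ g x v = 0 →
        κ * ‖fderiv ℝ g x‖ * ‖v‖ ^ 2 ≤ fderiv ℝ (fderiv ℝ g) x v v)

/-- The class `𝔛_t(M)` of `C¹` vector fields on `M` (restrictions to `M` of `C¹` fields on `ℝ³`)
that are tangent to `∂M` at each point of `∂M`. -/
def IsTangentialField (M : Set E3) (X : E3 → E3) : Prop :=
  ContDiff ℝ 1 X ∧ ∀ x ∈ frontier M, X x ∈ (tangentPlane (frontier M) x).space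

/-! ### Varifolds -/

/-- `𝒱₂(M)` for compact `M`: the positive Radon measures on `G₂(M) = M × G(2,3)`, i.e. the finite
Borel measures on `ℝ³ × G(2,3)` that are carried by `M × G(2,3)`. The topology of
`FiniteMeasure` is, on this set, that of weak* convergence. -/
def varifolds (M : Set E3) : Set (FiniteMeasure (E3 × Plane)) :=
  {V | (V : Measure (E3 × Plane)) {z | z.1 ∉ M} = 0}

/-- `𝒱₂(∂M)`: the positive Radon measures on `G₂(∂M) = {(x, T_x ∂M) | x ∈ ∂M}`. -/
def boundaryVarifolds (M : Set E3) : Set (FiniteMeasure (E3 × Plane)) :=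
  {W | (W : Measure (E3 × Plane))
    {z | ¬ (z.1 ∈ frontier M ∧ z.2 = tangentPlane (frontier M) z.1)} = 0}

open Classical in
/-- The varifold `ℋ²⌞A ⊗ δ_{T_x A}` induced by a surface `A` of finite area: the image of
`ℋ²⌞A` under `x ↦ (x, T_x A)`. -/
def inducedVarifold (A : Set E3) : FiniteMeasure (E3 × Plane) :=
  if _h : IsFiniteMeasure ((μHE[2] : Measure E3).restrict A) then
    ⟨((μHE[2] : Measure E3).restrict A).map (fun x => (x, tangentPlane A x)), inferInstance⟩
  else 0

/-- The first variation `δ_{F_a}(V,W)[X] = ∫ div_S X dV(x,S) + a ∫ div_{∂M} X dW`. -/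
def firstVariation (M : Set E3) (a : ℝ) (V W : FiniteMeasure (E3 × Plane)) (X : E3 → E3) : ℝ :=
  (∫ z, tangDiv z.2 X z.1 ∂(V : Measure (E3 × Plane))) +
    a * ∫ z, tangDiv (tangentPlane (frontier M) z.1) X z.1 ∂(W : Measure (E3 × Plane))

/-- `(V,W)` is stationary for the capillarity functional `F_a`. -/
def IsStationaryPair (M : Set E3) (a : ℝ) (V W : FiniteMeasure (E3 × Plane)) : Prop :=
  ∀ X : E3 → E3, IsTangentialField M X → firstVariation M a V W X = 0

/-! ### Sets of finite perimeter -/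

/-- `μ = |D𝟏_Ω|` and `ν` is the measure-theoretic outer unit normal of `Ω`: the Gauss–Green formula
`∫_Ω div T = ∫ T · ν dμ` holds for all `T ∈ C¹_c`. -/
structure IsGaussGreen (Ω : Set E3) (μ : Measure E3) (ν : E3 → E3) : Prop where
  finite : IsFiniteMeasure μ
  measurable : Measurable ν
  unit : ∀ᵐ x ∂μ, ‖ν x‖ = 1
  formula : ∀ T : E3 → E3, ContDiff ℝ 1 T → HasCompactSupport T →
    ∫ x in Ω, fullDiv T x = ∫ x, inner ℝ (T x) (ν x) ∂μ

/-- `Ω` has finite perimeter in `ℝ³`. -/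
def HasFinitePerimeter (Ω : Set E3) : Prop :=
  MeasurableSet Ω ∧ ∃ μ ν, IsGaussGreen Ω μ ν

/-- De Giorgi's reduced boundary `∂*Ω`. -/
def reducedBoundary (Ω : Set E3) : Set E3 :=
  {x | ∃ μ ν, IsGaussGreen Ω μ ν ∧ (∀ ρ > 0, 0 < μ (Metric.closedBall x ρ)) ∧
    ∃ ν₀ : E3, ‖ν₀‖ = 1 ∧
      Tendsto (fun ρ : ℝ => ⨍ y in Metric.closedBall x ρ, ν y ∂μ) (𝓝[>] 0) (𝓝 ν₀)}

/-- The internal boundary `∂_i Ω = ∂*Ω ∩ int M`. -/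
def internalBoundary (M Ω : Set E3) : Set E3 := reducedBoundary Ω ∩ interior M

/-- The external boundary `∂_b Ω`: the part of the reduced boundary on `∂M`, together with its limit
points (it is used as a surface with boundary, which contains its edge). -/
def externalBoundary (M Ω : Set E3) : Set E3 := closure (reducedBoundary Ω ∩ frontier M)

/-! ### Parametrized families of surfaces -/

/-- Near `p`, the set `A` is an embedded `C^r` surface without boundary: some `C^r` diffeomorphism
`φ` of a neighbourhood of `p` onto an open set of `ℝ³` takes `A` to the plane `{y₂ = 0}`. -/
def IsInteriorPoint (r : ℕ∞) (A : Set E3) (p : E3) : Prop :=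
  ∃ φ : OpenPartialHomeomorph E3 E3, p ∈ φ.source ∧ φ p = 0 ∧
    ContDiffOn ℝ r φ φ.source ∧ ContDiffOn ℝ r φ.symm φ.target ∧
    ∀ x ∈ φ.source, x ∈ A ↔ φ x 2 = 0

/-- Near `p`, the set `A` is an embedded `C^r` surface with boundary, and `p` lies on its boundary:
some `C^r` diffeomorphism `φ` of a neighbourhood of `p` onto an open set of `ℝ³` with `φ(p) = 0`
takes `A` to the half-plane `{y₂ = 0, y₁ ≥ 0}`. -/
def IsBoundaryPoint (r : ℕ∞) (A : Set E3) (p : E3) : Prop :=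
  ∃ φ : OpenPartialHomeomorph E3 E3, p ∈ φ.source ∧ φ p = 0 ∧
    ContDiffOn ℝ r φ φ.source ∧ ContDiffOn ℝ r φ.symm φ.target ∧
    ∀ x ∈ φ.source, x ∈ A ↔ (φ x 2 = 0 ∧ 0 ≤ φ x 1)

/-- As `t → s`, the surfaces `A t` converge to `A s` in the `C^r` sense near `p`: on a ball around
`p` there are maps `ψ t` that converge to the identity, uniformly with all derivatives of order
`≤ r`, and take the part of `A s` in the ball to the part of `A t` in the image of the ball. (A
map that is `C¹`-close to the identity on a ball is a diffeomorphism onto its image.) -/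
def ConvergesSmoothlyNear {P : Type} [TopologicalSpace P] (r : ℕ∞) (A : P → Set E3) (s : P)
    (p : E3) : Prop :=
  ∃ ρ > 0, ∃ ψ : P → E3 → E3,
    (∀ᶠ t in 𝓝 s, ContDiffOn ℝ r (ψ t) (Metric.ball p ρ) ∧
      A t ∩ ψ t '' Metric.ball p ρ = ψ t '' (A s ∩ Metric.ball p ρ)) ∧
    ∀ k : ℕ, (k : ℕ∞) ≤ r →
      TendstoUniformlyOn (fun t x => iteratedFDeriv ℝ k (fun y => ψ t y - y) x) 0 (𝓝 s)
        (Metric.ball p ρ)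

/-- `A` is a parametrized smooth (that is, `C^r`) family of surfaces in `M`, with parameter space
`P` (which is `[0,1]` or `[0,1]²`) and finite singular sets `S t`. -/
structure IsSurfaceFamily {P : Type} [TopologicalSpace P] (r : ℕ∞) (M : Set E3)
    (A S : P → Set E3) : Prop where
  isClosed : ∀ t, IsClosed (A t)
  subset : ∀ t, A t ⊆ M
  finite_area : ∀ t, μHE[2] (A t) < ∞
  finite_sing : ∀ t, (S t).Finite
  smooth : ∀ t, ∀ p ∈ A t \ S t,
    IsInteriorPoint r (A t) p ∨ (IsBoundaryPoint r (A t) p ∧ p ∈ frontier M)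
  hausdorff : ∀ s, Tendsto (fun t => ⨆ x ∈ A t, Metric.infEDist x (A s)) (𝓝 s) (𝓝 0)
  convergence : ∀ s, ∀ p ∈ M \ S s, ConvergesSmoothlyNear r A s p
  continuous_area : Continuous fun t => (μHE[2] (A t) : ℝ≥0∞)

/-! ### Sweepouts -/

/-- A pair `(Σ_t, Γ_t)_{t ∈ [0,1]}` of one-parameter families of subsets of `ℝ³`. -/
structure PairPath where
  inner : I01 → Set E3
  outer : I01 → Set E3

/-- `c = (Σ_t, Γ_t)` is a sweepout of `M`, with singular sets `S_t`, `G_t` and open sets `Ω_t`. -/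
structure IsSweepoutWith (r : ℕ∞) (M : Set E3) (c : PairPath) (S G Ω : I01 → Set E3) : Prop where
  inner_family : IsSurfaceFamily r M c.inner S
  outer_family : IsSurfaceFamily r M c.outer G
  rel_open : ∀ t, ∃ O, IsOpen O ∧ Ω t = M ∩ O
  finite_perimeter : ∀ t, HasFinitePerimeter (Ω t)
  outer_subset : ∀ t, c.outer t ⊆ frontier M
  boundary_inner : ∀ t, ∀ p ∉ S t ∪ G t,
    p ∈ c.inner t ∩ c.outer t ↔ IsBoundaryPoint r (c.inner t) p
  boundary_outer : ∀ t, ∀ p ∉ S t ∪ G t,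
    p ∈ c.inner t ∩ c.outer t ↔ IsBoundaryPoint r (c.outer t) p
  internal : ∀ t, internalBoundary M (Ω t) \ c.inner t ⊆ S t
  external : ∀ t, (externalBoundary M (Ω t) \ (c.inner t ∪ c.outer t)) ∪
    ((c.inner t ∩ frontier M) \ externalBoundary M (Ω t)) ∪
    (c.outer t \ externalBoundary M (Ω t)) ⊆ S t ∪ G t
  start : Ω 0 = ∅
  finish : Ω 1 = M
  volume_continuous : ∀ s, Tendsto (fun t => volume (Ω t \ Ω s) + volume (Ω s \ Ω t))
    (𝓝 s) (𝓝 0)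

/-- `c` is a sweepout of `M`. -/
def IsSweepout (r : ℕ∞) (M : Set E3) (c : PairPath) : Prop :=
  ∃ S G Ω : I01 → Set E3, IsSweepoutWith r M c S G Ω

/-- Two sweepouts are homotopic if they are the ends of a pair of parametrized smooth families of
surfaces with parameters in `[0,1]²`. -/
def Homotopic (r : ℕ∞) (M : Set E3) (c d : PairPath) : Prop :=
  ∃ A B : I01 × I01 → Set E3,
    (∃ S, IsSurfaceFamily r M A S) ∧ (∃ G, IsSurfaceFamily r M B G) ∧
    (∀ t, A (t, 0) = c.inner t ∧ B (t, 0) = c.outer t) ∧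
    (∀ t, A (t, 1) = d.inner t ∧ B (t, 1) = d.outer t)

/-- A non-empty set of sweepouts that contains the homotopy class of each of its elements. -/
structure IsHomotopicallyClosed (r : ℕ∞) (M : Set E3) (𝒮 : Set PairPath) : Prop where
  nonempty : 𝒮.Nonempty
  isSweepout : ∀ c ∈ 𝒮, IsSweepout r M c
  closed : ∀ c ∈ 𝒮, ∀ d, IsSweepout r M d → Homotopic r M c d → d ∈ 𝒮

/-! ### Min-max -/

/-- The capillarity energy `F_a(Σ,Γ) = ℋ²(Σ) + a ℋ²(Γ)` of a pair of surfaces. -/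
def energy (a : ℝ) (A B : Set E3) : ℝ≥0∞ := μHE[2] A + ENNReal.ofReal a * μHE[2] B

/-- `max_t F_a(Σ_t, Γ_t)`. -/
def maxEnergy (a : ℝ) (c : PairPath) : ℝ≥0∞ := ⨆ t, energy a (c.inner t) (c.outer t)

/-- The min-max value `m₀(𝒮)`. -/
def minMaxValue (a : ℝ) (𝒮 : Set PairPath) : ℝ≥0∞ := ⨅ c ∈ 𝒮, maxEnergy a c

/-- `(c_k)` is a minimizing sequence of sweepouts in `𝒮`. -/
def IsMinimizingSequence (a : ℝ) (𝒮 : Set PairPath) (c : ℕ → PairPath) : Prop :=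
  (∀ k, c k ∈ 𝒮) ∧ Tendsto (fun k => maxEnergy a (c k)) atTop (𝓝 (minMaxValue a 𝒮))

/-- The slices of `c_k` at the times `τ_k` form a min-max sequence. -/
def IsMinMaxSequence (a : ℝ) (𝒮 : Set PairPath) (c : ℕ → PairPath) (τ : ℕ → I01) : Prop :=
  Tendsto (fun k => energy a ((c k).inner (τ k)) ((c k).outer (τ k))) atTop
    (𝓝 (minMaxValue a 𝒮))

/-- The pairs of varifolds induced by the slices of `c_k` at the times `τ_k` converge to `(V,W)`
along the subsequence `φ`. -/
def SlicesConverge (c : ℕ → PairPath) (τ : ℕ → I01) (φ : ℕ → ℕ)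
    (V W : FiniteMeasure (E3 × Plane)) : Prop :=
  Tendsto (fun k => inducedVarifold ((c (φ k)).inner (τ (φ k)))) atTop (𝓝 V) ∧
  Tendsto (fun k => inducedVarifold ((c (φ k)).outer (τ (φ k)))) atTop (𝓝 W)

end

end Capillarity

open Capillarity

set_option linter.unusedVariables false

namespace Capillarity

noncomputable section

/-! ### The Grassmannian of planes -/

/-! The argument is a discrete form of Almgren's and Pitts' pull-tight. A `Deformation` is a
one-parameter family of `C^r` maps that starts at the identity and preserves `M`. For small times
its slices are diffeomorphisms. If the slices of a sweepout are moved for a time `σ t` that depends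
continuously on `t`, the result is a homotopic sweepout, the homotopy being the motion for the time
`σ t * s` (`Deformation.exists_sweepout`). So a homotopically closed set of sweepouts is stable
under such motions.

Along a deformation with initial velocity `X`, the energy changes at first order by the first
variation of the slice along `X`, with an error that is uniform over all slices of bounded energy
(`Deformation.exists_area_le`). The first variation depends continuously on the slice, because the
varifolds of a smooth family vary continuously. The sweepout can therefore be moved exactly where
its first variation along `X` is clearly negative: no energy increases, and a slice whose energy
hardly drops had first variation at least `-θ` (`Deformation.exists_tightening`). This is iterated
over a sequence of deformations in which every member of a countable dense family recurs infinitely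
often, with `θ → 0` and with each step so short that it hardly changes the earlier first variations
(`exists_iterated_tightening`). The `k`-th sweepout starts within `1/(k+1)` of the min-max value and
undergoes `k` steps. Slices with energy close to the min-max value cannot have dropped much, so in
the limit the first variation is non-negative along the dense family, hence along all deformations.

Deformations generate enough vector fields. In a chart that flattens `∂M`, a tangential `C¹` field
is approximated in `C¹` by `C^r` fields that are still tangential, and such a field moves points
along straight segments of the chart. By a partition of unity and the replacement of `X` by `-X`,
the first variation vanishes on all tangential fields (`isStationaryPair_of_deformations`).
Existence of limits is weak compactness of measures of bounded mass on a compact set.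

Two points carry most of the work. First, smooth convergence holds only away from finitely many
points. The continuity of the total area excludes concentration there, and this gives both the
continuity of the varifolds (`tendsto_planeInt_of_local`) and that of the area of the moved surfaces
(`IsSurfaceFamily.tendsto_area_image`). Second, the moved open sets must again have finite perimeter
with the right internal and external boundaries. The Piola identity transports the Gauss–Green
formula (`IsGaussGreen.exists_image`). Where `Σ` touches `∂M` along a set that may carry no
perimeter, it is shown that `Ω` is locally one side of a regular hypersurface
(`IsSlice.exists_one_sided`). -/

theorem Plane.isInducing_proj : IsInducing Plane.proj := ⟨rfl⟩

theorem Plane.continuous_proj : Continuous Plane.proj := Plane.isInducing_proj.continuous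

theorem Plane.proj_apply_mem (S : Plane) (v : E3) : S.proj v ∈ S.space :=
  S.space.starProjection_apply_mem v

theorem Plane.proj_eq_self_iff (S : Plane) {v : E3} : S.proj v = v ↔ v ∈ S.space :=
  Submodule.starProjection_eq_self_iff

theorem Plane.norm_proj_apply_le (S : Plane) (v : E3) : ‖S.proj v‖ ≤ ‖v‖ :=
  S.space.norm_starProjection_apply_le v

theorem Plane.norm_proj_le (S : Plane) : ‖S.proj‖ ≤ 1 := S.space.starProjection_norm_le

theorem Plane.isStarProjection_proj (S : Plane) : IsStarProjection S.proj :=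
  isStarProjection_starProjection

theorem Plane.adjoint_proj (S : Plane) : ContinuousLinearMap.adjoint S.proj = S.proj :=
  S.isStarProjection_proj.isSelfAdjoint

@[ext]
theorem Plane.ext {S T : Plane} (h : S.space = T.space) : S = T := by
  cases S; cases T; congr

theorem Plane.proj_injective : Function.Injective Plane.proj := by
  intro S T h
  ext v
  rw [← S.proj_eq_self_iff, h, T.proj_eq_self_iff]

theorem Plane.isEmbedding_proj : IsEmbedding Plane.proj :=
  ⟨Plane.isInducing_proj, Plane.proj_injective⟩

instance : TopologicalSpace.MetrizableSpace Plane := Plane.isEmbedding_proj.metrizableSpace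

theorem Plane.trace_proj (S : Plane) : LinearMap.trace ℝ E3 S.proj.toLinearMap = 2 := by
  have h : LinearMap.IsProj S.space S.proj.toLinearMap :=
    ⟨S.proj_apply_mem, fun v hv => S.proj_eq_self_iff.2 hv⟩
  rw [h.trace, S.finrank_eq]; norm_num

/-- The trace, as a continuous linear functional. -/
def traceL : (E3 →L[ℝ] E3) →L[ℝ] ℝ :=
  LinearMap.toContinuousLinearMap
    ((LinearMap.trace ℝ E3) ∘ₗ (ContinuousLinearMap.coeLM ℝ : (E3 →L[ℝ] E3) →ₗ[ℝ] E3 →ₗ[ℝ] E3))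

theorem traceL_apply (T : E3 →L[ℝ] E3) : traceL T = LinearMap.trace ℝ E3 T.toLinearMap := rfl

theorem abs_traceL_le (T : E3 →L[ℝ] E3) : |traceL T| ≤ 3 * ‖T‖ := by
  rw [traceL_apply, LinearMap.trace_eq_sum_inner _ (EuclideanSpace.basisFun (Fin 3) ℝ)]
  refine (Finset.abs_sum_le_sum_abs _ _).trans ?_
  have : ∀ i : Fin 3, |inner ℝ (EuclideanSpace.basisFun (Fin 3) ℝ i)
      (T.toLinearMap (EuclideanSpace.basisFun (Fin 3) ℝ i))| ≤ ‖T‖ := by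
    intro i
    refine (abs_real_inner_le_norm _ _).trans ?_
    have h := T.le_opNorm (EuclideanSpace.basisFun (Fin 3) ℝ i)
    simpa using h
  refine (Finset.sum_le_sum fun i _ => this i).trans ?_
  simp

theorem traceL_comm (A B : E3 →L[ℝ] E3) : traceL (A ∘L B) = traceL (B ∘L A) := by
  rw [traceL_apply, traceL_apply]
  exact LinearMap.trace_mul_comm ℝ A.toLinearMap B.toLinearMap

theorem traceL_adjoint (A : E3 →L[ℝ] E3) : traceL (ContinuousLinearMap.adjoint A) = traceL A := by
  rw [traceL_apply, traceL_apply,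
    LinearMap.trace_eq_sum_inner _ (EuclideanSpace.basisFun (Fin 3) ℝ),
    LinearMap.trace_eq_sum_inner _ (EuclideanSpace.basisFun (Fin 3) ℝ)]
  refine Finset.sum_congr rfl fun i _ => ?_
  simp only [ContinuousLinearMap.coe_coe]
  rw [ContinuousLinearMap.adjoint_inner_right, real_inner_comm]

theorem tangDiv_eq (S : Plane) (X : E3 → E3) (x : E3) :
    tangDiv S X x = traceL (S.proj ∘L fderiv ℝ X x) := rfl

/-- The projections onto planes are the self-adjoint idempotents of trace 2, a closed set of
operators contained in the unit ball of a finite-dimensional space. -/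
instance : CompactSpace Plane := by
  rw [← isCompact_univ_iff, Plane.isInducing_proj.isCompact_iff, image_univ]
  have hr : range Plane.proj =
      {T : E3 →L[ℝ] E3 | T ∘L T = T ∧ ContinuousLinearMap.adjoint T = T ∧ traceL T = 2} ∩
        Metric.closedBall 0 1 := by
    ext T
    constructor
    · rintro ⟨S, rfl⟩
      exact ⟨⟨S.isStarProjection_proj.isIdempotentElem, S.adjoint_proj, S.trace_proj⟩,
        by simpa using S.norm_proj_le⟩
    · rintro ⟨⟨h1, h2, h3⟩, -⟩
      have hT : IsStarProjection T := ⟨h1, h2⟩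
      obtain ⟨U, hU, rfl⟩ := isStarProjection_iff_eq_starProjection.1 hT
      have hp : LinearMap.IsProj U U.starProjection.toLinearMap :=
        ⟨U.starProjection_apply_mem, fun v hv => Submodule.starProjection_eq_self_iff.2 hv⟩
      rw [traceL_apply, hp.trace] at h3
      exact ⟨⟨U, by exact_mod_cast h3⟩, rfl⟩
  rw [hr]
  refine (isCompact_closedBall (0 : E3 →L[ℝ] E3) 1).inter_left ?_
  refine IsClosed.inter (isClosed_eq (by fun_prop) continuous_id)
    (IsClosed.inter (isClosed_eq (by fun_prop) continuous_id)
      (isClosed_eq (by fun_prop) continuous_const))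

/-- The image of a plane under a linear isomorphism. -/
def Plane.map (L : E3 ≃L[ℝ] E3) (S : Plane) : Plane :=
  ⟨S.space.map (L : E3 →ₗ[ℝ] E3), by
    rw [← S.finrank_eq]
    exact LinearEquiv.finrank_map_eq L.toLinearEquiv S.space⟩

theorem Plane.mem_map {L : E3 ≃L[ℝ] E3} {S : Plane} {v : E3} :
    v ∈ (S.map L).space ↔ ∃ w ∈ S.space, L w = v := Submodule.mem_map

theorem Plane.norm_sub_proj_le (S : Plane) (v w : E3) (hw : w ∈ S.space) :
    ‖v - S.proj v‖ ≤ ‖v - w‖ := by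
  have h := Submodule.starProjection_minimal (U := S.space) v
  rw [Plane.proj, h]
  exact ciInf_le ⟨0, by rintro _ ⟨x, rfl⟩; positivity⟩ (⟨w, hw⟩ : S.space)

/-- With `P` and `Q` the projections onto `S` and `L(S)`, one has `Q - P = (1 - P)Q - P(1 - Q)`.
Vectors of `L(S)` are relatively close to vectors of `S`, which bounds the first term. The second is
the adjoint of `(1 - Q)P`, bounded in the same way with the roles exchanged. -/
theorem Plane.norm_proj_map_sub_le (S : Plane) (L : E3 ≃L[ℝ] E3)
    (hL : ‖(L : E3 →L[ℝ] E3) - ContinuousLinearMap.id ℝ E3‖ ≤ 1 / 2) :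
    ‖(S.map L).proj - S.proj‖ ≤ 3 * ‖(L : E3 →L[ℝ] E3) - ContinuousLinearMap.id ℝ E3‖ := by
  set ε := ‖(L : E3 →L[ℝ] E3) - ContinuousLinearMap.id ℝ E3‖ with hε
  set P := S.proj
  set Q := (S.map L).proj
  have hLw : ∀ w, ‖L w - w‖ ≤ ε * ‖w‖ := fun w => by
    have := ((L : E3 →L[ℝ] E3) - ContinuousLinearMap.id ℝ E3).le_opNorm w
    simpa using this
  have h1 : ‖(ContinuousLinearMap.id ℝ E3 - P) ∘L Q‖ ≤ 2 * ε := by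
    refine ContinuousLinearMap.opNorm_le_bound _ (by positivity) fun v => ?_
    obtain ⟨w, hw, hwv⟩ := Plane.mem_map.1 ((S.map L).proj_apply_mem v)
    have h2 := S.norm_sub_proj_le (Q v) w hw
    have h3 := hLw w
    rw [hwv] at h3
    have h4 : ‖w‖ ≤ ‖Q v‖ + ε * ‖w‖ := by
      calc ‖w‖ = ‖Q v - (Q v - w)‖ := by congr 1; abel
        _ ≤ ‖Q v‖ + ‖Q v - w‖ := norm_sub_le _ _
        _ ≤ _ := by gcongr
    have h5 : ‖Q v‖ ≤ ‖v‖ := (S.map L).norm_proj_apply_le v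
    have h6 : ‖w‖ ≤ 2 * ‖v‖ := by nlinarith [norm_nonneg w, norm_nonneg v]
    simp only [ContinuousLinearMap.coe_comp, Function.comp_apply, FunLike.coe_sub,
      Pi.sub_apply, ContinuousLinearMap.id_apply]
    calc _ ≤ ε * ‖w‖ := h2.trans h3
      _ ≤ ε * (2 * ‖v‖) := by gcongr
      _ = _ := by ring
  have h2 : ‖(ContinuousLinearMap.id ℝ E3 - Q) ∘L P‖ ≤ ε := by
    refine ContinuousLinearMap.opNorm_le_bound _ (by positivity) fun v => ?_
    have h3 := (S.map L).norm_sub_proj_le (P v) (L (P v))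
      (Plane.mem_map.2 ⟨_, S.proj_apply_mem v, rfl⟩)
    simp only [ContinuousLinearMap.coe_comp, Function.comp_apply, FunLike.coe_sub,
      Pi.sub_apply, ContinuousLinearMap.id_apply]
    refine h3.trans ?_
    rw [norm_sub_rev]
    refine (hLw _).trans ?_
    gcongr
    exact S.norm_proj_apply_le v
  have h3 : ‖P ∘L (ContinuousLinearMap.id ℝ E3 - Q)‖ ≤ ε := by
    have h4 : ContinuousLinearMap.adjoint ((ContinuousLinearMap.id ℝ E3 - Q) ∘L P) =
        P ∘L (ContinuousLinearMap.id ℝ E3 - Q) := by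
      rw [ContinuousLinearMap.adjoint_comp, map_sub, S.adjoint_proj, (S.map L).adjoint_proj,
        ContinuousLinearMap.adjoint_id]
    rw [← h4, LinearIsometryEquiv.norm_map]
    exact h2
  have h4 : Q - P = (ContinuousLinearMap.id ℝ E3 - P) ∘L Q -
      P ∘L (ContinuousLinearMap.id ℝ E3 - Q) := by
    ext1 v; simp
  rw [h4]
  calc _ ≤ _ := norm_sub_le _ _
    _ ≤ 2 * ε + ε := add_le_add h1 h3
    _ = _ := by ring

theorem Plane.map_map (S : Plane) (L K : E3 ≃L[ℝ] E3) : (S.map L).map K = S.map (L.trans K) := by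
  ext v
  simp [Plane.mem_map]

/-- Planes depend continuously on the linear isomorphisms that carry a fixed plane to them. -/
theorem Plane.tendsto_map {ι : Type*} {l : Filter ι} (S : Plane) {L : ι → E3 ≃L[ℝ] E3}
    {L₀ : E3 ≃L[ℝ] E3} (h : Tendsto (fun i => (L i : E3 →L[ℝ] E3)) l (𝓝 (L₀ : E3 →L[ℝ] E3))) :
    Tendsto (fun i => S.map (L i)) l (𝓝 (S.map L₀)) := by
  rw [Plane.isInducing_proj.tendsto_nhds_iff, tendsto_iff_norm_sub_tendsto_zero]
  have h1 : Tendsto (fun i => ‖((L₀.symm.trans (L i) : E3 ≃L[ℝ] E3) : E3 →L[ℝ] E3) -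
      ContinuousLinearMap.id ℝ E3‖) l (𝓝 0) := by
    rw [← tendsto_iff_norm_sub_tendsto_zero]
    have h2 : Tendsto (fun i => (L i : E3 →L[ℝ] E3) ∘L (L₀.symm : E3 →L[ℝ] E3)) l
        (𝓝 ((L₀ : E3 →L[ℝ] E3) ∘L (L₀.symm : E3 →L[ℝ] E3))) :=
      ((ContinuousLinearMap.compL ℝ E3 E3 E3).flip
        (L₀.symm : E3 →L[ℝ] E3)).continuous.continuousAt.tendsto.comp h
    simpa using h2
  have h2 := h1.const_mul 3
  rw [mul_zero] at h2
  refine squeeze_zero' (Eventually.of_forall fun _ => norm_nonneg _) ?_ h2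
  filter_upwards [h1.eventually (ge_mem_nhds (show (0 : ℝ) < 1 / 2 by norm_num))] with i hi
  have h3 := (S.map L₀).norm_proj_map_sub_le _ hi
  have h4 : (S.map L₀).map (L₀.symm.trans (L i)) = S.map (L i) := by
    rw [Plane.map_map]; congr 1; ext1; ext1; simp
  rwa [h4] at h3

theorem continuous_tangDiv {X : E3 → E3} (hX : ContDiff ℝ 1 X) :
    Continuous fun z : E3 × Plane => tangDiv z.2 X z.1 := by
  have h1 : Continuous fun z : E3 × Plane => fderiv ℝ X z.1 :=
    (hX.continuous_fderiv one_ne_zero).comp continuous_fst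
  have h2 : Continuous fun z : E3 × Plane => z.2.proj := Plane.continuous_proj.comp continuous_snd
  exact traceL.continuous.comp (h2.clm_comp h1)

theorem abs_tangDiv_sub_le (S : Plane) (X Y : E3 → E3) (x : E3) :
    |tangDiv S X x - tangDiv S Y x| ≤ 3 * ‖fderiv ℝ X x - fderiv ℝ Y x‖ := by
  rw [tangDiv_eq, tangDiv_eq, ← map_sub, ← ContinuousLinearMap.comp_sub]
  refine (abs_traceL_le _).trans ?_
  gcongr
  refine (ContinuousLinearMap.opNorm_comp_le _ _).trans ?_
  exact mul_le_of_le_one_left (norm_nonneg _) S.norm_proj_le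

/-! ### The area factor of a linear map on a plane -/

/-- Half the squared Hilbert–Schmidt norm of the restriction of `L` to `S`. -/
def dirichlet (S : Plane) (L : E3 →L[ℝ] E3) : ℝ :=
  traceL (S.proj ∘L (ContinuousLinearMap.adjoint L ∘L L)) / 2

theorem traceL_proj_comp (S : Plane) (B : E3 →L[ℝ] E3) {ι : Type*} [Fintype ι]
    (b : OrthonormalBasis ι ℝ S.space) :
    traceL (S.proj ∘L B) = ∑ i, inner ℝ (b i : E3) (B (b i)) := by
  have h1 : (S.proj ∘L B).toLinearMap =
      S.space.subtype ∘ₗ (S.space.orthogonalProjectionOnto.toLinearMap ∘ₗ B.toLinearMap) := by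
    ext v; rfl
  rw [traceL_apply, h1, LinearMap.trace_comp_comm', LinearMap.trace_eq_sum_inner _ b]
  refine Finset.sum_congr rfl fun i _ => ?_
  have h2 := Submodule.inner_starProjection_left_eq_right S.space (b i : E3) (B (b i))
  rw [Submodule.starProjection_eq_self_iff.2 (b i).2] at h2
  simpa using h2.symm

/-- The square of the area factor is a Gram determinant, at most `|Lb₀|²|Lb₁|²`, and the
arithmetic-geometric mean inequality does the rest. The Dirichlet density replaces the Jacobian from
here on: it is quadratic in `L`, and has the same first-order expansion at the identity. -/
theorem normDet_le_dirichlet (S : Plane) (L : E3 →L[ℝ] E3) :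
    (L.toLinearMap ∘ₗ S.space.subtype).normDet ≤ dirichlet S L := by
  have hf : Module.finrank ℝ S.space = 2 := S.finrank_eq
  let b : OrthonormalBasis (Fin 2) ℝ S.space := (stdOrthonormalBasis ℝ S.space).reindex
    (finCongr hf)
  have h1 := (L.toLinearMap ∘ₗ S.space.subtype).normDet_sq_eq_det_gram b
  rw [Matrix.det_fin_two] at h1
  simp only [Matrix.gram_apply, LinearMap.comp_apply, Submodule.subtype_apply,
    ContinuousLinearMap.coe_coe, real_inner_self_eq_norm_sq] at h1
  have h2 : dirichlet S L = (‖L (b 0)‖ ^ 2 + ‖L (b 1)‖ ^ 2) / 2 := by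
    rw [dirichlet, traceL_proj_comp S _ b]
    simp [Fin.sum_univ_two, ContinuousLinearMap.adjoint_inner_right]
  rw [h2]
  have h3 : 0 ≤ (L.toLinearMap ∘ₗ S.space.subtype).normDet := LinearMap.normDet_nonneg _
  have h4 : (L.toLinearMap ∘ₗ S.space.subtype).normDet ^ 2 =
      ‖L (b 0)‖ ^ 2 * ‖L (b 1)‖ ^ 2 - inner ℝ (L (b 0)) (L (b 1)) * inner ℝ (L (b 1)) (L (b 0)) := by
    exact_mod_cast h1
  rw [real_inner_comm (L (b 0)) (L (b 1))] at h4
  refine le_of_sq_le_sq ?_ (by positivity)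
  nlinarith [sq_nonneg (‖L (b 0)‖ ^ 2 - ‖L (b 1)‖ ^ 2), mul_self_nonneg (inner ℝ (L (b 1)) (L (b 0)))]

/-- The expansion is exact. The two linear terms, with `E` and its adjoint, have the same trace
because `S.proj` is self-adjoint; for `E = DX` the linear part is the tangential divergence of `X`.
-/
theorem dirichlet_id_add (S : Plane) (E : E3 →L[ℝ] E3) :
    dirichlet S (ContinuousLinearMap.id ℝ E3 + E) =
      1 + traceL (S.proj ∘L E) +
        traceL (S.proj ∘L (ContinuousLinearMap.adjoint E ∘L E)) / 2 := by
  have h1 : S.proj ∘L (ContinuousLinearMap.adjoint (ContinuousLinearMap.id ℝ E3 + E) ∘L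
      (ContinuousLinearMap.id ℝ E3 + E)) = S.proj + S.proj ∘L E +
        S.proj ∘L ContinuousLinearMap.adjoint E +
        S.proj ∘L (ContinuousLinearMap.adjoint E ∘L E) := by
    rw [map_add, ContinuousLinearMap.adjoint_id]
    ext1 v
    simp; abel
  have h2 : traceL (S.proj ∘L ContinuousLinearMap.adjoint E) = traceL (S.proj ∘L E) := by
    rw [← traceL_adjoint, ContinuousLinearMap.adjoint_comp, ContinuousLinearMap.adjoint_adjoint,
      S.adjoint_proj, traceL_comm]
  have h3 : traceL S.proj = 2 := S.trace_proj
  rw [dirichlet, h1, map_add, map_add, map_add, h2, h3]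
  ring

theorem continuous_dirichlet : Continuous fun q : Plane × (E3 →L[ℝ] E3) => dirichlet q.1 q.2 := by
  have h1 : Continuous fun q : Plane × (E3 →L[ℝ] E3) => q.1.proj :=
    Plane.continuous_proj.comp continuous_fst
  have h2 : Continuous fun q : Plane × (E3 →L[ℝ] E3) => ContinuousLinearMap.adjoint q.2 :=
    (ContinuousLinearMap.adjoint (𝕜 := ℝ) (E := E3) (F := E3)).continuous.comp continuous_snd
  exact (traceL.continuous.comp (h1.clm_comp (h2.clm_comp continuous_snd))).div_const 2

theorem dirichlet_nonneg (S : Plane) (L : E3 →L[ℝ] E3) : 0 ≤ dirichlet S L :=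
  (LinearMap.normDet_nonneg _).trans (normDet_le_dirichlet S L)

theorem dirichlet_id_add_le (S : Plane) (E : E3 →L[ℝ] E3) :
    dirichlet S (ContinuousLinearMap.id ℝ E3 + E) ≤
      1 + traceL (S.proj ∘L E) + 3 / 2 * ‖E‖ ^ 2 := by
  rw [dirichlet_id_add]
  have h1 := (abs_le.1 (abs_traceL_le (S.proj ∘L (ContinuousLinearMap.adjoint E ∘L E)))).2
  have h2 : ‖S.proj ∘L (ContinuousLinearMap.adjoint E ∘L E)‖ ≤ ‖E‖ ^ 2 := by
    refine (ContinuousLinearMap.opNorm_comp_le _ _).trans ?_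
    refine (mul_le_of_le_one_left (norm_nonneg _) S.norm_proj_le).trans ?_
    refine (ContinuousLinearMap.opNorm_comp_le _ _).trans ?_
    rw [LinearIsometryEquiv.norm_map, sq]
  linarith

/-- Area of the image of a subset of a plane under a linear map. -/
theorem euclideanHausdorffMeasure_image_le (S : Plane) (L : E3 →L[ℝ] E3) {G : Set E3}
    (hG : G ⊆ S.space) : μHE[2] (L '' G) ≤ ENNReal.ofReal (dirichlet S L) * μHE[2] G := by
  have hf : Module.finrank ℝ S.space = 2 := S.finrank_eq
  have h1 := (L.toLinearMap ∘ₗ S.space.subtype).euclideanHausdorffMeasure_image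
    (Subtype.val ⁻¹' G)
  rw [hf] at h1
  have h2 : (L.toLinearMap ∘ₗ S.space.subtype) '' (Subtype.val ⁻¹' G) = L '' G := by
    ext y
    constructor
    · rintro ⟨x, hx, rfl⟩; exact ⟨x, hx, rfl⟩
    · rintro ⟨x, hx, rfl⟩; exact ⟨⟨x, hG hx⟩, hx, rfl⟩
  have h3 : μHE[2] (Subtype.val ⁻¹' G : Set S.space) = μHE[2] G := by
    rw [isometry_subtype_coe.euclideanHausdorffMeasure_preimage]
    congr 1
    simpa using hG
  rw [h2, h3] at h1
  rw [h1]
  gcongr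
  exact normDet_le_dirichlet S L


/-! ### Tangent planes of surfaces -/

/-- `S` is the span of the tangent cone of `A` at `x`. -/
def HasTangentPlane (A : Set E3) (x : E3) (S : Plane) : Prop :=
  Submodule.span ℝ (tangentConeAt ℝ A x) = S.space

theorem HasTangentPlane.tangentPlane_eq {A : Set E3} {x : E3} {S : Plane}
    (h : HasTangentPlane A x S) : tangentPlane A x = S := by
  have h1 : Module.finrank ℝ (Submodule.span ℝ (tangentConeAt ℝ A x)) = 2 := by
    rw [h]; exact S.finrank_eq
  rw [tangentPlane, dif_pos h1]
  exact Plane.ext h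

theorem mapsTo_tangentConeAt (e : OpenPartialHomeomorph E3 E3) {x : E3} (hx : x ∈ e.source)
    {L : E3 →L[ℝ] E3} (hL : HasFDerivAt e L x) {A A' : Set E3}
    (h : ∀ z ∈ e.source, z ∈ A ↔ e z ∈ A') :
    MapsTo L (tangentConeAt ℝ A x) (tangentConeAt ℝ A' (e x)) := by
  have h1 : A ∩ e.source ⊆ A := inter_subset_left
  rw [← tangentConeAt_inter_nhds (s := A) (e.open_source.mem_nhds hx)]
  have h2 := (hL.hasFDerivWithinAt (s := A ∩ e.source)).mapsTo_tangent_cone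
  refine h2.mono_right (tangentConeAt_mono ?_)
  rintro _ ⟨z, hz, rfl⟩
  exact (h z hz.2).1 hz.1

/-- A derivative maps tangent cones into tangent cones; applied to `e` and to its inverse this gives
equality. -/
theorem HasTangentPlane.map {A A' : Set E3} {x : E3} {S : Plane} (hS : HasTangentPlane A x S)
    (e : OpenPartialHomeomorph E3 E3) (hx : x ∈ e.source) {L : E3 ≃L[ℝ] E3}
    (hL : HasFDerivAt e (L : E3 →L[ℝ] E3) x) (h : ∀ z ∈ e.source, z ∈ A ↔ e z ∈ A') :
    HasTangentPlane A' (e x) (S.map L) := by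
  have hx' : e x ∈ e.target := e.map_source hx
  have hL' : HasFDerivAt e.symm (L.symm : E3 →L[ℝ] E3) (e x) :=
    e.hasFDerivAt_symm hx' (by rwa [e.left_inv hx])
  have h' : ∀ z ∈ e.symm.source, z ∈ A' ↔ e.symm z ∈ A := fun z hz => by
    rw [h _ (e.map_target hz), e.right_inv hz]
  have m1 := mapsTo_tangentConeAt e hx hL h
  have m2 := mapsTo_tangentConeAt e.symm hx' hL' h'
  rw [e.left_inv hx] at m2
  have h3 : tangentConeAt ℝ A' (e x) = (L : E3 →ₗ[ℝ] E3) '' tangentConeAt ℝ A x := by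
    apply Subset.antisymm
    · intro v hv
      exact ⟨L.symm v, m2 hv, by simp⟩
    · rintro _ ⟨v, hv, rfl⟩
      exact m1 hv
  rw [HasTangentPlane, h3, Submodule.span_image, hS]
  rfl

/-- The coordinate plane `{y₂ = 0}`. -/
def flatPlane : Set E3 := {y | y 2 = 0}

/-- The half-plane `{y₂ = 0, y₁ ≥ 0}`. -/
def flatHalf : Set E3 := {y | y 2 = 0 ∧ 0 ≤ y 1}

/-- The coordinate function `y ↦ y i`. -/
def coordL (i : Fin 3) : E3 →L[ℝ] ℝ := EuclideanSpace.proj i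

@[simp] theorem coordL_apply (i : Fin 3) (y : E3) : coordL i y = y i := rfl

/-- The standard basis vectors. -/
def stdE (i : Fin 3) : E3 := EuclideanSpace.single i 1

theorem stdE_apply (i j : Fin 3) : stdE i j = if j = i then 1 else 0 := by
  simp [stdE]

theorem eq_sum_stdE (y : E3) : y = y 0 • stdE 0 + y 1 • stdE 1 + y 2 • stdE 2 := by
  ext j; fin_cases j <;> simp [stdE_apply]

/-- The coordinate plane as an element of the Grassmannian. -/
def horizontal : Plane where
  space := (coordL 2).ker
  finrank_eq := by
    have h := LinearMap.finrank_range_add_finrank_ker (coordL 2).toLinearMap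
    have h2 : LinearMap.range (coordL 2).toLinearMap = ⊤ := by
      rw [LinearMap.range_eq_top]
      intro c
      exact ⟨c • stdE 2, by simp [stdE_apply]⟩
    rw [h2] at h
    simp at h
    have h3 : Module.finrank ℝ (coordL 2).toLinearMap.ker = 2 := by omega
    exact h3

theorem mem_horizontal {v : E3} : v ∈ horizontal.space ↔ v 2 = 0 := by
  simp [horizontal, LinearMap.mem_ker]

/-- The third coordinate maps `A` into `{0}`, and the tangent cone of `{0}` at its isolated point
contains only zero. -/
theorem tangentConeAt_flatPlane_subset {A : Set E3} (hA : A ⊆ flatPlane) {y : E3}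
    (hy : y ∈ flatPlane) : tangentConeAt ℝ A y ⊆ (horizontal.space : Set E3) := by
  have h1 : HasFDerivWithinAt (coordL 2) (coordL 2) A y := (coordL 2).hasFDerivWithinAt
  have h2 := h1.mapsTo_tangent_cone
  intro v hv
  have h3 := h2 hv
  have h4 : (coordL 2) '' A ⊆ {(0 : ℝ)} := by
    rintro _ ⟨z, hz, rfl⟩; exact hA hz
  have h5 := tangentConeAt_mono (𝕜 := ℝ) (x := coordL 2 y) h4 h3
  have h6 := tangentConeAt_subset_zero (𝕜 := ℝ) (s := {(0 : ℝ)}) (x := coordL 2 y) (by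
    have : coordL 2 y = 0 := hy
    rw [this, accPt_iff_frequently]
    intro h
    obtain ⟨z, hz1, hz2⟩ := h.exists
    exact hz1 (by simpa using hz2)) h5
  rw [SetLike.mem_coe, mem_horizontal]
  exact h6

theorem convex_flatHalf : Convex ℝ flatHalf := by
  intro x hx y hy a b ha hb hab
  refine ⟨by simp [hx.1, hy.1], ?_⟩
  have := hx.2; have := hy.2
  simp; positivity

/-- At an edge point the cone is only a half-plane, but it contains two independent directions. This
is why tangent planes are defined by the span of the cone. -/
theorem hasTangentPlane_flatHalf {y : E3} (hy : y ∈ flatHalf) :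
    HasTangentPlane flatHalf y horizontal := by
  refine le_antisymm (Submodule.span_le.2
    (tangentConeAt_flatPlane_subset (fun z hz => hz.1) hy.1)) ?_
  have hm : ∀ v : E3, v 2 = 0 → 0 ≤ v 1 → v ∈ Submodule.span ℝ (tangentConeAt ℝ flatHalf y) := by
    intro v h2 h1
    have h3 : y + v ∈ flatHalf := ⟨by simp [hy.1, h2], by have := hy.2; simp; positivity⟩
    have h4 := mem_tangentConeAt_of_segment_subset (convex_flatHalf.segment_subset hy h3)
    rw [add_sub_cancel_left] at h4
    exact Submodule.subset_span h4
  intro v hv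
  rw [mem_horizontal] at hv
  rw [eq_sum_stdE v, hv, zero_smul, add_zero]
  exact add_mem (Submodule.smul_mem _ _ (hm _ (by simp [stdE_apply]) (by simp [stdE_apply])))
    (Submodule.smul_mem _ _ (hm _ (by simp [stdE_apply]) (by simp [stdE_apply])))

theorem hasTangentPlane_flatPlane {y : E3} (hy : y ∈ flatPlane) :
    HasTangentPlane flatPlane y horizontal := by
  refine le_antisymm (Submodule.span_le.2
    (tangentConeAt_flatPlane_subset subset_rfl hy)) ?_
  intro v hv
  rw [mem_horizontal] at hv
  have hc : Convex ℝ flatPlane := by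
    intro x hx y hy a b ha hb hab
    have h1 : x 2 = 0 := hx
    have h2 : y 2 = 0 := hy
    simp [flatPlane, h1, h2]
  have hy' : y 2 = 0 := hy
  have h4 := mem_tangentConeAt_of_segment_subset
    (hc.segment_subset hy (show y + v ∈ flatPlane by simp [flatPlane, hy', hv]))
  rw [add_sub_cancel_left] at h4
  exact Submodule.subset_span h4

theorem one_le_coe_of_two_le {r : ℕ∞} (hr : 2 ≤ r) : (1 : WithTop ℕ∞) ≤ r := by
  exact_mod_cast (show (1 : ℕ∞) ≤ 2 by norm_num).trans hr

theorem two_le_coe {r : ℕ∞} (hr : 2 ≤ r) : (2 : WithTop ℕ∞) ≤ r := WithTop.coe_le_coe.2 hr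

theorem coe_ne_zero_of_two_le {r : ℕ∞} (hr : 2 ≤ r) : (r : WithTop ℕ∞) ≠ 0 := by
  intro h
  have := one_le_coe_of_two_le hr
  rw [h] at this
  exact absurd this (by norm_num)

/-- The derivative of a `C¹` diffeomorphism between open sets, as a linear isomorphism. -/
theorem exists_chart_deriv {n : WithTop ℕ∞} (hn : 1 ≤ n) (φ : OpenPartialHomeomorph E3 E3)
    (h : ContDiffOn ℝ n φ φ.source) (h' : ContDiffOn ℝ n φ.symm φ.target) :
    ∃ L : E3 → E3 ≃L[ℝ] E3, (∀ x ∈ φ.source, HasFDerivAt φ (L x : E3 →L[ℝ] E3) x) ∧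
      (∀ x ∈ φ.source, HasFDerivAt φ.symm ((L x).symm : E3 →L[ℝ] E3) (φ x)) ∧
      ContinuousOn (fun x => ((L x).symm : E3 →L[ℝ] E3)) φ.source := by
  have hn0 : n ≠ 0 := by rintro rfl; exact absurd hn (by norm_num)
  have h1 : ∀ x ∈ φ.source, HasFDerivAt φ (fderiv ℝ φ x) x := fun x hx =>
    ((h.differentiableOn hn0).differentiableAt (φ.open_source.mem_nhds hx)).hasFDerivAt
  have h2 : ∀ x ∈ φ.source, HasFDerivAt φ.symm (fderiv ℝ φ.symm (φ x)) (φ x) := fun x hx =>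
    ((h'.differentiableOn hn0).differentiableAt
      (φ.open_target.mem_nhds (φ.map_source hx))).hasFDerivAt
  have h3 : ∀ x ∈ φ.source, ∃ L : E3 ≃L[ℝ] E3, (L : E3 →L[ℝ] E3) = fderiv ℝ φ x ∧
      (L.symm : E3 →L[ℝ] E3) = fderiv ℝ φ.symm (φ x) := by
    intro x hx
    have e1 : (fderiv ℝ φ.symm (φ x)).comp (fderiv ℝ φ x) = ContinuousLinearMap.id ℝ E3 := by
      have := (h2 x hx).comp x (h1 x hx)
      exact this.unique ((hasFDerivAt_id x).congr_of_eventuallyEq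
        (φ.eventually_left_inverse hx))
    have e2 : (fderiv ℝ φ x).comp (fderiv ℝ φ.symm (φ x)) = ContinuousLinearMap.id ℝ E3 := by
      have h4 : HasFDerivAt φ (fderiv ℝ φ x) (φ.symm (φ x)) := by
        rw [φ.left_inv hx]; exact h1 x hx
      have := h4.comp (φ x) (h2 x hx)
      exact this.unique ((hasFDerivAt_id (φ x)).congr_of_eventuallyEq
        (φ.eventually_right_inverse (φ.map_source hx)))
    exact ⟨ContinuousLinearEquiv.equivOfInverse _ _ (fun v => congrArg (fun T => T v) e1)
      (fun v => congrArg (fun T => T v) e2), rfl, rfl⟩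
  classical
  refine ⟨fun x => if hx : x ∈ φ.source then (h3 x hx).choose else .refl ℝ E3, ?_, ?_, ?_⟩
  · intro x hx
    simp only [dif_pos hx]
    rw [(h3 x hx).choose_spec.1]; exact h1 x hx
  · intro x hx
    simp only [dif_pos hx]
    rw [(h3 x hx).choose_spec.2]; exact h2 x hx
  · have h5 : ContinuousOn (fun x => fderiv ℝ φ.symm (φ x)) φ.source :=
      (h'.continuousOn_fderiv_of_isOpen φ.open_target hn).comp φ.continuousOn φ.mapsTo
    refine h5.congr fun x hx => ?_
    simp only [dif_pos hx]
    rw [(h3 x hx).choose_spec.2]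

/-- `A` is near `p` the image of one of the two flat models under a diffeomorphism. -/
def IsRegularPoint (r : ℕ∞) (A : Set E3) (p : E3) : Prop :=
  IsInteriorPoint r A p ∨ IsBoundaryPoint r A p

theorem exists_chart {r : ℕ∞} {A : Set E3} {p : E3} (h : IsRegularPoint r A p) :
    ∃ (φ : OpenPartialHomeomorph E3 E3) (K : Set E3), p ∈ φ.source ∧ φ p = 0 ∧
      ContDiffOn ℝ r φ φ.source ∧ ContDiffOn ℝ r φ.symm φ.target ∧
      (∀ x ∈ φ.source, x ∈ A ↔ φ x ∈ K) ∧ (K = flatPlane ∨ K = flatHalf) := by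
  rcases h with ⟨φ, h1, h2, h3, h4, h5⟩ | ⟨φ, h1, h2, h3, h4, h5⟩
  · exact ⟨φ, flatPlane, h1, h2, h3, h4, h5, Or.inl rfl⟩
  · exact ⟨φ, flatHalf, h1, h2, h3, h4, h5, Or.inr rfl⟩

theorem hasTangentPlane_of_flat {K : Set E3} (hK : K = flatPlane ∨ K = flatHalf) {y : E3}
    (hy : y ∈ K) : HasTangentPlane K y horizontal := by
  rcases hK with rfl | rfl
  · exact hasTangentPlane_flatPlane hy
  · exact hasTangentPlane_flatHalf hy

theorem hasTangentPlane_of_chart {A K : Set E3} (φ : OpenPartialHomeomorph E3 E3)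
    (hK : K = flatPlane ∨ K = flatHalf) (hA : ∀ x ∈ φ.source, x ∈ A ↔ φ x ∈ K) {x : E3}
    (hx : x ∈ φ.source) (hxA : x ∈ A) {L : E3 ≃L[ℝ] E3}
    (hL : HasFDerivAt φ.symm (L : E3 →L[ℝ] E3) (φ x)) :
    HasTangentPlane A x (horizontal.map L) := by
  have h1 := (hasTangentPlane_of_flat hK ((hA x hx).1 hxA)).map (A' := A) φ.symm
    (φ.map_source hx) hL (fun z hz => by
      rw [hA _ (φ.map_target hz), φ.right_inv hz])
  rwa [φ.left_inv hx] at h1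

/-- In a chart the tangent plane at `x` is the image of the horizontal plane under the derivative of
the inverse chart, which is continuous in `x`. -/
theorem IsRegularPoint.exists_nhds {r : ℕ∞} (hr : 2 ≤ r) {A : Set E3} {p : E3}
    (h : IsRegularPoint r A p) : ∃ U : Set E3, IsOpen U ∧ p ∈ U ∧
      (∀ x ∈ U ∩ A, HasTangentPlane A x (tangentPlane A x)) ∧
      ContinuousOn (tangentPlane A) (U ∩ A) := by
  obtain ⟨φ, K, hp, -, h1, h2, hA, hK⟩ := exists_chart h
  obtain ⟨L, -, hL, hc⟩ := exists_chart_deriv (one_le_coe_of_two_le hr) φ h1 h2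
  have h3 : ∀ x ∈ φ.source ∩ A, HasTangentPlane A x (horizontal.map (L x).symm) := fun x hx =>
    hasTangentPlane_of_chart φ hK hA hx.1 hx.2 (hL x hx.1)
  refine ⟨φ.source, φ.open_source, hp, fun x hx => ?_, ?_⟩
  · rw [(h3 x hx).tangentPlane_eq]; exact h3 x hx
  · have h4 : ContinuousOn (fun x => horizontal.map (L x).symm) (φ.source ∩ A) := by
      intro x hx
      exact Plane.tendsto_map horizontal ((hc x hx.1).mono inter_subset_left)
    exact h4.congr fun x hx => (h3 x hx).tangentPlane_eq

theorem IsRegularPoint.hasTangentPlane {r : ℕ∞} (hr : 2 ≤ r) {A : Set E3} {p : E3}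
    (h : IsRegularPoint r A p) (hp : p ∈ A) : HasTangentPlane A p (tangentPlane A p) := by
  obtain ⟨U, -, hpU, h1, -⟩ := h.exists_nhds hr
  exact h1 p ⟨hpU, hp⟩

theorem IsInteriorPoint.mem {r : ℕ∞} {A : Set E3} {p : E3} (h : IsInteriorPoint r A p) :
    p ∈ A := by
  obtain ⟨φ, hp, h0, -, -, hA⟩ := h
  rw [hA p hp, h0]; rfl

/-- A point cannot be both an interior and a boundary point of a surface. -/
theorem IsInteriorPoint.not_isBoundaryPoint {r : ℕ∞} (hr : 2 ≤ r) {A : Set E3} {p : E3}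
    (h : IsInteriorPoint r A p) : ¬ IsBoundaryPoint r A p := by
  rintro ⟨χ, hpχ, hχ0, hχ1, hχ2, hχA⟩
  obtain ⟨φ, hpφ, hφ0, hφ1, hφ2, hφA⟩ := h
  obtain ⟨L, hL, hL', -⟩ := exists_chart_deriv (one_le_coe_of_two_le hr) φ hφ1 hφ2
  obtain ⟨N, hN, hN', -⟩ := exists_chart_deriv (one_le_coe_of_two_le hr) χ hχ1 hχ2
  have hpA : p ∈ A := by rw [hφA p hpφ, hφ0]; rfl
  have t1 := (hasTangentPlane_of_chart φ (Or.inl rfl) hφA hpφ hpA (hL' p hpφ)).tangentPlane_eq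
  have t2 := (hasTangentPlane_of_chart χ (Or.inr rfl) hχA hpχ hpA (hN' p hpχ)).tangentPlane_eq
  rw [t1] at t2
  -- Both charts give the same tangent plane, so the inward direction of the boundary chart is
  -- realized by a line `t • v` in the interior chart. Along that curve, which stays in `A` on both
  -- sides of `p`, the coordinate `y₁` of the boundary chart would have derivative 1 at a minimum.
  have h1 : (N p).symm (stdE 1) ∈ (horizontal.map (L p).symm).space := by
    rw [t2, Plane.mem_map]
    exact ⟨stdE 1, by rw [mem_horizontal]; simp [stdE_apply], rfl⟩
  obtain ⟨v, hv, hv1⟩ := Plane.mem_map.1 h1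
  rw [mem_horizontal] at hv
  have hd : HasFDerivAt (fun y => χ (φ.symm y)) ((N p : E3 →L[ℝ] E3) ∘L
      ((L p).symm : E3 →L[ℝ] E3)) 0 := by
    have e1 := hL' p hpφ
    rw [hφ0] at e1
    have e2 : HasFDerivAt χ (N p : E3 →L[ℝ] E3) (φ.symm 0) := by
      rw [← hφ0, φ.left_inv hpφ]; exact hN p hpχ
    exact e2.comp 0 e1
  have hd2 : HasDerivAt (fun t : ℝ => χ (φ.symm (t • v)) 1) 1 0 := by
    have e1 : HasDerivAt (fun t : ℝ => t • v) v 0 := by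
      simpa using (hasDerivAt_id (0 : ℝ)).smul_const v
    have e2 : HasFDerivAt (fun y => χ (φ.symm y)) ((N p : E3 →L[ℝ] E3) ∘L
      ((L p).symm : E3 →L[ℝ] E3)) ((0 : ℝ) • v) := by simpa using hd
    have e3 := e2.comp_hasDerivAt 0 e1
    have e4 := (coordL 1).hasFDerivAt.comp_hasDerivAt 0 e3
    have e5 : (coordL 1) (((N p : E3 →L[ℝ] E3) ∘L ((L p).symm : E3 →L[ℝ] E3)) v) = 1 := by
      have : (L p).symm v = (N p).symm (stdE 1) := hv1
      simp [this, stdE_apply]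
    rw [e5] at e4
    exact e4
  have hmin : IsLocalMin (fun t : ℝ => χ (φ.symm (t • v)) 1) 0 := by
    have c1 : Tendsto (fun t : ℝ => t • v) (𝓝 0) (𝓝 0) := by
      have : Continuous fun t : ℝ => t • v := by fun_prop
      simpa using this.tendsto 0
    have h0t : (0 : E3) ∈ φ.target := by rw [← hφ0]; exact φ.map_source hpφ
    have c2 : ∀ᶠ t : ℝ in 𝓝 0, t • v ∈ φ.target := c1 (φ.open_target.mem_nhds h0t)
    have c3 : Tendsto (fun t : ℝ => φ.symm (t • v)) (𝓝 0) (𝓝 p) := by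
      have := (φ.symm.continuousAt h0t).tendsto.comp c1
      rwa [← hφ0, φ.left_inv hpφ] at this
    have c4 : ∀ᶠ t : ℝ in 𝓝 0, φ.symm (t • v) ∈ χ.source := c3 (χ.open_source.mem_nhds hpχ)
    filter_upwards [c2, c4] with t h2 h4
    have e1 : φ.symm (t • v) ∈ A := by
      rw [hφA _ (φ.map_target h2), φ.right_inv h2]; simp [hv]
    have e2 := ((hχA _ h4).1 e1).2
    have e3 : χ (φ.symm ((0 : ℝ) • v)) 1 = 0 := by
      rw [zero_smul, ← hφ0, φ.left_inv hpφ, hχ0]; rfl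
    rw [e3]; exact e2
  have := hmin.hasDerivAt_eq_zero hd2
  norm_num at this

/-- Points with `y₁ > 0` in a boundary chart are interior points. -/
theorem isInteriorPoint_of_half_chart {r : ℕ∞} {A : Set E3} (φ : OpenPartialHomeomorph E3 E3)
    (h1 : ContDiffOn ℝ r φ φ.source) (h2 : ContDiffOn ℝ r φ.symm φ.target)
    (hA : ∀ x ∈ φ.source, x ∈ A ↔ (φ x 2 = 0 ∧ 0 ≤ φ x 1)) {q : E3} (hq : q ∈ φ.source)
    (hqA : q ∈ A) (hq1 : 0 < φ q 1) : IsInteriorPoint r A q := by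
  have hop : IsOpen (φ.source ∩ φ ⁻¹' {y : E3 | 0 < y 1}) :=
    φ.isOpen_inter_preimage (isOpen_lt continuous_const (coordL 1).continuous)
  let φ' := (φ.restrOpen _ hop).trans (Homeomorph.addRight (-φ q)).toOpenPartialHomeomorph
  have hs : φ'.source = φ.source ∩ φ ⁻¹' {y : E3 | 0 < y 1} := by
    simp [φ']
  have hv : ∀ x, φ' x = φ x + -φ q := fun x => rfl
  have hvs : ∀ y, φ'.symm y = φ.symm (y + φ q) := fun y => by
    simp [φ', Homeomorph.addRight]
  refine ⟨φ', by rw [hs]; exact ⟨hq, hq1⟩, by rw [hv]; simp, ?_, ?_, ?_⟩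
  · exact (h1.mono (by rw [hs]; exact inter_subset_left)).add contDiffOn_const
  · have : ∀ y ∈ φ'.target, y + φ q ∈ φ.target := by
      intro y hy
      have e1 := φ'.map_target hy
      rw [hs, hvs] at e1
      have e2 := φ'.right_inv hy
      rw [hvs] at e2
      have e3 : (y + φ q) ∈ (φ.restrOpen _ hop).target := by
        have : y ∈ φ'.target := hy
        simpa [φ', Homeomorph.addRight] using this
      exact e3.1
    have h3 : ContDiffOn ℝ r (fun y => φ.symm (y + φ q)) φ'.target :=
      h2.comp (contDiff_id.add contDiff_const).contDiffOn this
    exact h3.congr fun y _ => hvs y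
  · intro x hx
    rw [hs] at hx
    have e2 : φ q 2 = 0 := ((hA q hq).1 hqA).1
    rw [hA x hx.1, hv]
    have : 0 < φ x 1 := hx.2
    simp [e2, this.le]

/-! ### Surfaces with finitely many singular points -/

/-- A closed set of finite area that is an embedded surface with boundary outside a finite set. -/
structure IsSurface (r : ℕ∞) (A S : Set E3) : Prop where
  isClosed : IsClosed A
  finite_area : μHE[2] A < ∞
  finite_sing : S.Finite
  regular : ∀ p ∈ A \ S, IsRegularPoint r A p

theorem IsSurfaceFamily.isSurface {P : Type} [TopologicalSpace P] {r : ℕ∞} {M : Set E3}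
    {A S : P → Set E3} (h : IsSurfaceFamily r M A S) (t : P) : IsSurface r (A t) (S t) where
  isClosed := h.isClosed t
  finite_area := h.finite_area t
  finite_sing := h.finite_sing t
  regular p hp := (h.smooth t p hp).imp_right And.left

instance : NullSingletonClass (μH[2] : Measure E3) :=
  Measure.nullSingletonClass_hausdorff E3 (by norm_num)

instance : NullSingletonClass (μHE[2] : Measure E3) := by
  refine ⟨fun x => ?_⟩
  rw [Measure.euclideanHausdorffMeasure_def, Measure.smul_apply]
  have : (μH[(2 : ℕ)] : Measure E3) {x} = 0 := by
    exact_mod_cast measure_singleton (μ := (μH[2] : Measure E3)) x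
  rw [this, smul_zero]

theorem IsSurface.measure_sing {r : ℕ∞} {A S : Set E3} (h : IsSurface r A S) :
    (μHE[2] : Measure E3) S = 0 := h.finite_sing.measure_zero _

theorem IsSurface.ae_restrict {r : ℕ∞} {A S : Set E3} (h : IsSurface r A S) :
    ∀ᵐ x ∂((μHE[2] : Measure E3).restrict A), x ∈ A \ S := by
  have h1 : ∀ᵐ x ∂((μHE[2] : Measure E3).restrict A), x ∉ S :=
    ae_restrict_of_ae (measure_eq_zero_iff_ae_notMem.1 h.measure_sing)
  filter_upwards [ae_restrict_mem h.isClosed.measurableSet, h1] with x hx hx'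
  exact ⟨hx, hx'⟩

theorem IsSurface.isFiniteMeasure {r : ℕ∞} {A S : Set E3} (h : IsSurface r A S) :
    IsFiniteMeasure ((μHE[2] : Measure E3).restrict A) :=
  ⟨by rw [Measure.restrict_apply_univ]; exact h.finite_area⟩

theorem IsSurface.continuousOn_tangentPlane {r : ℕ∞} (hr : 2 ≤ r) {A S : Set E3}
    (h : IsSurface r A S) : ContinuousOn (tangentPlane A) (A \ S) := by
  intro x hx
  obtain ⟨U, hU, hxU, -, hc⟩ := (h.regular x hx).exists_nhds hr
  have h1 := hc x ⟨hxU, hx.1⟩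
  refine (h1.mono_of_mem_nhdsWithin ?_)
  exact inter_mem_nhdsWithin' hU hxU hx
where
  inter_mem_nhdsWithin' {A S U : Set E3} {x : E3} (hU : IsOpen U) (hxU : x ∈ U)
      (_ : x ∈ A \ S) : U ∩ A ∈ 𝓝[A \ S] x :=
    inter_mem (mem_nhdsWithin_of_mem_nhds (hU.mem_nhds hxU))
      (mem_of_superset self_mem_nhdsWithin sdiff_subset)

/-- Continuity off the null set `S` suffices. Without this measurability the image measure in
`inducedVarifold` would be zero by convention. -/
theorem IsSurface.aemeasurable_tangentPlane {r : ℕ∞} (hr : 2 ≤ r) {A S : Set E3}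
    (h : IsSurface r A S) : AEMeasurable (fun x => (x, tangentPlane A x))
      ((μHE[2] : Measure E3).restrict A) := by
  have hm : MeasurableSet (A \ S) := h.isClosed.measurableSet.diff h.finite_sing.measurableSet
  have h1 : (μHE[2] : Measure E3).restrict A = (μHE[2] : Measure E3).restrict (A \ S) := by
    refine Measure.restrict_congr_set ?_
    filter_upwards [measure_eq_zero_iff_ae_notMem.1 h.measure_sing] with x hx
    exact propext ⟨fun h => ⟨h, hx⟩, fun h => h.1⟩
  rw [h1]
  exact (continuousOn_id.prodMk (h.continuousOn_tangentPlane hr)).aemeasurable hm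

theorem IsSurface.toMeasure_inducedVarifold {r : ℕ∞} {A S : Set E3} (h : IsSurface r A S) :
    (inducedVarifold A : Measure (E3 × Plane)) =
      ((μHE[2] : Measure E3).restrict A).map (fun x => (x, tangentPlane A x)) := by
  have h1 := h.isFiniteMeasure
  have h2 : inducedVarifold A =
      ⟨((μHE[2] : Measure E3).restrict A).map (fun x => (x, tangentPlane A x)), inferInstance⟩ :=
    dif_pos h1
  rw [h2]
  rfl

theorem IsSurface.lintegral_inducedVarifold {r : ℕ∞} (hr : 2 ≤ r) {A S : Set E3}
    (h : IsSurface r A S) {f : E3 × Plane → ℝ≥0∞} (hf : Measurable f) :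
    ∫⁻ z, f z ∂(inducedVarifold A : Measure (E3 × Plane)) =
      ∫⁻ x in A, f (x, tangentPlane A x) ∂(μHE[2] : Measure E3) := by
  rw [h.toMeasure_inducedVarifold, lintegral_map' hf.aemeasurable (h.aemeasurable_tangentPlane hr)]

theorem IsSurface.mass_inducedVarifold {r : ℕ∞} (hr : 2 ≤ r) {A S : Set E3}
    (h : IsSurface r A S) :
    (inducedVarifold A : Measure (E3 × Plane)) univ = μHE[2] A := by
  have := h.lintegral_inducedVarifold hr (f := fun _ => 1) measurable_const
  simpa using this


/-! ### Comparison of areas -/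

theorem area_image_le_of_lipschitzOn {K : ℝ≥0} {f : E3 → E3} {s : Set E3}
    (h : LipschitzOnWith K f s) : μHE[2] (f '' s) ≤ (K : ℝ≥0∞) ^ 2 * μHE[2] s := by
  have h1 := h.hausdorffMeasure_image_le (d := ((2 : ℕ) : ℝ)) (by norm_num)
  rw [ENNReal.rpow_natCast] at h1
  rw [Measure.euclideanHausdorffMeasure_def, Measure.smul_apply, Measure.smul_apply,
    ENNReal.smul_def, ENNReal.smul_def, smul_eq_mul, smul_eq_mul, mul_left_comm]
  gcongr

/-- If `f` spreads points at most `K` times as far apart as `g`, it increases area by `K²`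
at most. -/
theorem area_image_le_of_dist_le {K : ℝ≥0} {f g : E3 → E3} {s : Set E3}
    (h : ∀ x ∈ s, ∀ y ∈ s, dist (f x) (f y) ≤ K * dist (g x) (g y)) :
    μHE[2] (f '' s) ≤ (K : ℝ≥0∞) ^ 2 * μHE[2] (g '' s) := by
  classical
  rcases s.eq_empty_or_nonempty with rfl | hs
  · simp
  have : Nonempty s := hs.to_subtype
  let k : E3 → E3 := Function.invFunOn g s
  have hk : ∀ z ∈ g '' s, k z ∈ s ∧ g (k z) = z := fun z hz =>
    ⟨Function.invFunOn_mem hz, Function.invFunOn_eq hz⟩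
  have hf : f '' s = (f ∘ k) '' (g '' s) := by
    ext y; constructor
    · rintro ⟨x, hx, rfl⟩
      refine ⟨g x, mem_image_of_mem g hx, ?_⟩
      have h1 := hk (g x) (mem_image_of_mem g hx)
      have h2 := h _ h1.1 _ hx
      rw [h1.2, dist_self, mul_zero] at h2
      exact dist_le_zero.1 h2
    · rintro ⟨z, hz, rfl⟩
      exact mem_image_of_mem f (hk z hz).1
  rw [hf]
  refine area_image_le_of_lipschitzOn (LipschitzOnWith.of_dist_le_mul fun x hx y hy => ?_)
  have h1 := h _ (hk x hx).1 _ (hk y hy).1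
  rwa [(hk x hx).2, (hk y hy).2] at h1

/-- As measures, area on `ψ '' E` is at most `K²` times the push-forward of area on `E`. No
measurability of `f` is needed, which spares that of the tangent planes of an arbitrary set. -/
theorem lintegral_image_le {K : ℝ≥0} {ψ : E3 → E3} {E : Set E3} (hE : MeasurableSet E)
    (h : ∀ x ∈ E, ∀ y ∈ E, dist (ψ x) (ψ y) ≤ K * dist x y) (f : E3 → ℝ≥0∞) :
    ∫⁻ y in ψ '' E, f y ∂(μHE[2] : Measure E3) ≤
      (K : ℝ≥0∞) ^ 2 * ∫⁻ x in E, f (ψ x) ∂(μHE[2] : Measure E3) := by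
  have hL : LipschitzOnWith K ψ E := LipschitzOnWith.of_dist_le_mul h
  have hm : AEMeasurable ψ ((μHE[2] : Measure E3).restrict E) := hL.continuousOn.aemeasurable hE
  have h1 : (μHE[2] : Measure E3).restrict (ψ '' E) ≤
      (K : ℝ≥0∞) ^ 2 • ((μHE[2] : Measure E3).restrict E).map ψ := by
    refine Measure.le_iff.2 fun s hs => ?_
    rw [Measure.restrict_apply hs, Measure.smul_apply, Measure.map_apply_of_aemeasurable hm hs,
      smul_eq_mul]
    have h2 : s ∩ ψ '' E = ψ '' (ψ ⁻¹' s ∩ E) := by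
      rw [inter_comm, inter_comm _ E, image_inter_preimage]
    rw [h2]
    refine (area_image_le_of_lipschitzOn (hL.mono inter_subset_right)).trans ?_
    exact mul_le_mul_right (Measure.le_restrict_apply _ _) _
  calc _ ≤ ∫⁻ y, f y ∂((K : ℝ≥0∞) ^ 2 • ((μHE[2] : Measure E3).restrict E).map ψ) :=
        lintegral_mono' h1 le_rfl
    _ = (K : ℝ≥0∞) ^ 2 * ∫⁻ y, f y ∂(((μHE[2] : Measure E3).restrict E).map ψ) := by
        rw [lintegral_smul_measure, smul_eq_mul]
    _ ≤ _ := mul_le_mul_right (lintegral_map_le _ _) _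

theorem measurableSet_image_of_dist_le {K K' : ℝ≥0} {ψ : E3 → E3} {E : Set E3}
    (hE : MeasurableSet E) (h : ∀ x ∈ E, ∀ y ∈ E, dist (ψ x) (ψ y) ≤ K * dist x y)
    (h' : ∀ x ∈ E, ∀ y ∈ E, dist x y ≤ K' * dist (ψ x) (ψ y)) : MeasurableSet (ψ '' E) := by
  have hL : LipschitzOnWith K ψ E := LipschitzOnWith.of_dist_le_mul h
  refine hE.image_of_continuousOn_injOn hL.continuousOn fun x hx y hy hxy => ?_
  have := h' x hx y hy
  rw [hxy, dist_self, mul_zero] at this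
  exact dist_le_zero.1 this

/-- The previous estimate for the inverse of `ψ` on `ψ '' E`. -/
theorem lintegral_le_image {K K' : ℝ≥0} {ψ : E3 → E3} {E : Set E3} (hE : MeasurableSet E)
    (h : ∀ x ∈ E, ∀ y ∈ E, dist (ψ x) (ψ y) ≤ K' * dist x y)
    (h' : ∀ x ∈ E, ∀ y ∈ E, dist x y ≤ K * dist (ψ x) (ψ y)) (f : E3 → ℝ≥0∞) :
    ∫⁻ x in E, f (ψ x) ∂(μHE[2] : Measure E3) ≤
      (K : ℝ≥0∞) ^ 2 * ∫⁻ y in ψ '' E, f y ∂(μHE[2] : Measure E3) := by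
  classical
  rcases E.eq_empty_or_nonempty with rfl | hs
  · simp
  have : Nonempty E := hs.to_subtype
  let k : E3 → E3 := Function.invFunOn ψ E
  have hk : ∀ z ∈ ψ '' E, k z ∈ E ∧ ψ (k z) = z := fun z hz =>
    ⟨Function.invFunOn_mem hz, Function.invFunOn_eq hz⟩
  have hkE : k '' (ψ '' E) = E := by
    ext x; constructor
    · rintro ⟨z, hz, rfl⟩; exact (hk z hz).1
    · intro hx
      refine ⟨ψ x, mem_image_of_mem ψ hx, ?_⟩
      have h1 := hk _ (mem_image_of_mem ψ hx)
      have h2 := h' _ h1.1 _ hx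
      rw [h1.2, dist_self, mul_zero] at h2
      exact dist_le_zero.1 h2
  have hm := measurableSet_image_of_dist_le hE h h'
  have h1 := lintegral_image_le (K := K) (ψ := k) hm (fun x hx y hy => by
    have := h' _ (hk x hx).1 _ (hk y hy).1
    rwa [(hk x hx).2, (hk y hy).2] at this) (fun x => f (ψ x))
  rw [hkE] at h1
  refine h1.trans (le_of_eq ?_)
  congr 1
  exact setLIntegral_congr_fun hm fun z hz => by
    show f (ψ (k z)) = f z
    rw [(hk z hz).2]

/-! ### The area of the image of a surface -/

theorem exists_nhds_norm_sub_le {E F : Type*} [NormedAddCommGroup E] [NormedSpace ℝ E]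
    [NormedAddCommGroup F] [NormedSpace ℝ F] {f : E → F} {f' : E →L[ℝ] F} {p : E}
    (h : HasStrictFDerivAt f f' p) {ε : ℝ} (hε : 0 < ε) :
    ∃ W ∈ 𝓝 p, ∀ x ∈ W, ∀ y ∈ W, ‖f x - f y - f' (x - y)‖ ≤ ε * ‖x - y‖ := by
  obtain ⟨W, hW, hW'⟩ := h.approximates_deriv_on_nhds (c := ⟨ε, hε.le⟩) (Or.inr hε)
  exact ⟨W, hW, fun x hx y hy => hW' x hx y hy⟩

/-- A surface is nearly flat near a regular point. -/
theorem IsRegularPoint.flat {r : ℕ∞} (hr : 2 ≤ r) {A : Set E3} {p : E3}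
    (h : IsRegularPoint r A p) (hp : p ∈ A) {ε : ℝ} (hε : 0 < ε) :
    ∃ U : Set E3, IsOpen U ∧ p ∈ U ∧ ∀ x ∈ A ∩ U, ∀ y ∈ A ∩ U,
      ‖(x - y) - (tangentPlane A p).proj (x - y)‖ ≤ ε * ‖x - y‖ := by
  obtain ⟨φ, K, hpφ, h0, h1, h2, hA, hK⟩ := exists_chart h
  have hr1 := one_le_coe_of_two_le hr
  obtain ⟨L, hL, hL', -⟩ := exists_chart_deriv hr1 φ h1 h2
  have hT := (hasTangentPlane_of_chart φ hK hA hpφ hp (hL' p hpφ)).tangentPlane_eq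
  have hs1 : HasStrictFDerivAt φ (L p : E3 →L[ℝ] E3) p := by
    have := ((h1.contDiffAt (φ.open_source.mem_nhds hpφ)).of_le hr1).hasStrictFDerivAt one_ne_zero
    rwa [(hL p hpφ).fderiv] at this
  have hs2 : HasStrictFDerivAt φ.symm ((L p).symm : E3 →L[ℝ] E3) (φ p) := by
    have := ((h2.contDiffAt (φ.open_target.mem_nhds (φ.map_source hpφ))).of_le
      hr1).hasStrictFDerivAt one_ne_zero
    rwa [(hL' p hpφ).fderiv] at this
  obtain ⟨C, V, hV, hC⟩ := hs1.exists_lipschitzOnWith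
  -- `C` is a Lipschitz constant of the chart, so a relative error `ε / (C + 1)` in the chart costs
  -- at most `ε` on the surface.
  have hε' : 0 < ε / (C + 1) := by positivity
  obtain ⟨W, hW, hW'⟩ := exists_nhds_norm_sub_le hs2 hε'
  have hN : φ.source ∩ V ∩ φ ⁻¹' {y | y ∈ W} ∈ 𝓝 p :=
    inter_mem (inter_mem (φ.open_source.mem_nhds hpφ) hV) ((φ.continuousAt hpφ) hW)
  obtain ⟨U, hUN, hU, hpU⟩ := mem_nhds_iff.1 hN
  refine ⟨U, hU, hpU, fun x hx y hy => ?_⟩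
  have hx1 := hUN hx.2
  have hy1 := hUN hy.2
  have h4 := hW' _ hx1.2 _ hy1.2
  rw [φ.left_inv hx1.1.1, φ.left_inv hy1.1.1] at h4
  have hKf : K ⊆ flatPlane := by
    rcases hK with rfl | rfl
    · exact subset_rfl
    · exact fun z hz => hz.1
  have hx2 : φ x 2 = 0 := hKf ((hA x hx1.1.1).1 hx.1)
  have hy2 : φ y 2 = 0 := hKf ((hA y hy1.1.1).1 hy.1)
  have h5 := (tangentPlane A p).norm_sub_proj_le (x - y) ((L p).symm (φ x - φ y)) (by
    rw [hT, Plane.mem_map]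
    exact ⟨_, mem_horizontal.2 (by simp [hx2, hy2]), rfl⟩)
  have h6 := hC.dist_le_mul x hx1.1.2 y hy1.1.2
  rw [dist_eq_norm, dist_eq_norm] at h6
  calc _ ≤ _ := h5
    _ ≤ ε / (C + 1) * ‖φ x - φ y‖ := h4
    _ ≤ ε / (C + 1) * (C * ‖x - y‖) := by gcongr
    _ = ε * (C / (C + 1)) * ‖x - y‖ := by ring
    _ ≤ ε * 1 * ‖x - y‖ := by
        gcongr
        rw [div_le_one (by positivity)]
        linarith
    _ = _ := by ring

theorem half_norm_le_of_norm_sub_id_le {D : E3 →L[ℝ] E3}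
    (hD : ‖D - ContinuousLinearMap.id ℝ E3‖ ≤ 1 / 2) (v : E3) : ‖v‖ / 2 ≤ ‖D v‖ := by
  have h1 := (D - ContinuousLinearMap.id ℝ E3).le_of_opNorm_le hD v
  simp only [FunLike.coe_sub, Pi.sub_apply, ContinuousLinearMap.id_apply] at h1
  have h2 := norm_sub_norm_le v (v - D v)
  rw [norm_sub_rev] at h1
  have h3 : v - (v - D v) = D v := by abel
  rw [h3] at h2
  linarith

theorem norm_le_of_norm_sub_id_le {D : E3 →L[ℝ] E3}
    (hD : ‖D - ContinuousLinearMap.id ℝ E3‖ ≤ 1 / 2) : ‖D‖ ≤ 3 / 2 := by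
  have h1 : D = (D - ContinuousLinearMap.id ℝ E3) + ContinuousLinearMap.id ℝ E3 := by abel
  rw [h1]
  refine (norm_add_le _ _).trans ?_
  have := ContinuousLinearMap.norm_id_le (𝕜 := ℝ) (E := E3)
  linarith

/-- Differences of nearby points of the surface almost lie in the tangent plane at `p`, so `Φ`
spreads these points at most `1 + δ` times as far as the linear map `D ∘ P`. The projection `P` does
not increase area, and `D` on the plane is controlled by the Dirichlet density. -/
theorem IsRegularPoint.exists_area_image_le {r : ℕ∞} (hr : 2 ≤ r) {A : Set E3} {p : E3}
    (h : IsRegularPoint r A p) (hp : p ∈ A) {Φ : E3 → E3} (hΦ : ContDiff ℝ 1 Φ)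
    (hD : ‖fderiv ℝ Φ p - ContinuousLinearMap.id ℝ E3‖ ≤ 1 / 2) {δ : ℝ≥0} (hδ : 0 < δ) :
    ∃ U : Set E3, IsOpen U ∧ p ∈ U ∧ ∀ F ⊆ A ∩ U, μHE[2] (Φ '' F) ≤
      ((1 + δ : ℝ≥0) : ℝ≥0∞) ^ 2 *
        ENNReal.ofReal (dirichlet (tangentPlane A p) (fderiv ℝ Φ p)) * μHE[2] F := by
  set D := fderiv ℝ Φ p
  set P := (tangentPlane A p).proj
  -- The errors add up to `(3/2 + 1) ε ‖v‖`, and `‖v‖ ≤ 4 ‖D (P v)‖`; hence the factor 10.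
  obtain ⟨ε, hε, hε1, hεδ⟩ : ∃ ε : ℝ, 0 < ε ∧ ε ≤ 1 / 2 ∧ 10 * ε ≤ δ :=
    ⟨min (1 / 2) (δ / 10), by positivity, min_le_left _ _, by
      have := min_le_right (1 / 2 : ℝ) (δ / 10); linarith⟩
  obtain ⟨U, hU, hpU, hflat⟩ := h.flat hr hp hε
  obtain ⟨W, hW, hW'⟩ := exists_nhds_norm_sub_le
    (hΦ.contDiffAt.hasStrictFDerivAt one_ne_zero : HasStrictFDerivAt Φ D p) hε
  obtain ⟨W₁, hW₁, hW₁o, hpW₁⟩ := mem_nhds_iff.1 hW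
  refine ⟨U ∩ W₁, hU.inter hW₁o, ⟨hpU, hpW₁⟩, fun F hF => ?_⟩
  have hdist : ∀ x ∈ F, ∀ y ∈ F,
      dist (Φ x) (Φ y) ≤ (1 + δ : ℝ≥0) * dist ((D ∘L P) x) ((D ∘L P) y) := by
    intro x hx y hy
    have hx' := hF hx; have hy' := hF hy
    have e1 := hflat x ⟨hx'.1, hx'.2.1⟩ y ⟨hy'.1, hy'.2.1⟩
    have e2 := hW' x (hW₁ hx'.2.2) y (hW₁ hy'.2.2)
    rw [dist_eq_norm, dist_eq_norm, ← map_sub]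
    set v := x - y
    have e3 : ‖D (v - P v)‖ ≤ 3 / 2 * (ε * ‖v‖) :=
      (D.le_opNorm _).trans (mul_le_mul (norm_le_of_norm_sub_id_le hD) e1 (norm_nonneg _)
        (by norm_num))
    have e4 : ‖P v‖ / 2 ≤ ‖D (P v)‖ := half_norm_le_of_norm_sub_id_le hD _
    have e5 : ‖v‖ ≤ ‖P v‖ + ε * ‖v‖ := by
      calc ‖v‖ = ‖P v + (v - P v)‖ := by congr 1; abel
        _ ≤ _ := (norm_add_le _ _).trans (by gcongr)
    have e6 : ‖v‖ / 4 ≤ ‖D (P v)‖ := by nlinarith [norm_nonneg v]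
    have e7 : ‖Φ x - Φ y‖ ≤ ‖D (P v)‖ + ‖D (v - P v)‖ + ε * ‖v‖ := by
      have h8 : D (P v) + D (v - P v) = D v := by rw [← map_add]; congr 1; abel
      have : Φ x - Φ y = D (P v) + D (v - P v) + (Φ x - Φ y - D v) := by
        rw [h8]; abel
      rw [this]
      exact (norm_add_le _ _).trans (add_le_add (norm_add_le _ _) e2)
    rw [show (D ∘L P) v = D (P v) from rfl]
    push_cast
    have e8 : ε * ‖v‖ ≤ 4 * ε * ‖D (P v)‖ := by nlinarith
    have e9 : 10 * ε * ‖D (P v)‖ ≤ δ * ‖D (P v)‖ := by gcongr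
    nlinarith
  have h4 := area_image_le_of_dist_le hdist
  have h5 : (D ∘L P) '' F = D '' (P '' F) := by rw [image_image]; rfl
  have h6 : μHE[2] (P '' F) ≤ μHE[2] F := by
    have : LipschitzOnWith 1 P F := (LipschitzWith.of_dist_le_mul fun x y => by
      rw [dist_eq_norm, dist_eq_norm, ← map_sub]
      simpa using (tangentPlane A p).norm_proj_apply_le (x - y)).lipschitzOnWith
    simpa using area_image_le_of_lipschitzOn this
  have h7 := euclideanHausdorffMeasure_image_le (tangentPlane A p) D (G := P '' F) (by
    rintro _ ⟨x, -, rfl⟩; exact (tangentPlane A p).proj_apply_mem x)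
  rw [h5] at h4
  refine h4.trans ?_
  rw [mul_assoc]
  gcongr
  exact h7.trans (by gcongr)

theorem IsSurface.continuousOn_dirichlet {r : ℕ∞} (hr : 2 ≤ r) {A S : Set E3}
    (hA : IsSurface r A S) {D : E3 → E3 →L[ℝ] E3} (hD : Continuous D) :
    ContinuousOn (fun x => dirichlet (tangentPlane A x) (D x)) (A \ S) := by
  have h1 : ContinuousOn (fun x => (tangentPlane A x, D x)) (A \ S) :=
    (hA.continuousOn_tangentPlane hr).prodMk hD.continuousOn
  intro x hx
  exact ((continuous_dirichlet.tendsto _).comp (h1 x hx) :)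

/-- Countably many neighbourhoods from the local estimate cover the regular part. They are made
disjoint, chosen so small that the density at the centre exceeds the density on the piece by at most
`δ`, and the estimates are summed; then `δ → 0`. The singular set and its image are finite, hence
null. -/
theorem IsSurface.area_image_le {r : ℕ∞} (hr : 2 ≤ r) {A S : Set E3} (hA : IsSurface r A S)
    {Φ : E3 → E3} (hΦ : ContDiff ℝ 1 Φ)
    (hD : ∀ x, ‖fderiv ℝ Φ x - ContinuousLinearMap.id ℝ E3‖ ≤ 1 / 2) :
    μHE[2] (Φ '' A) ≤ ∫⁻ x in A, ENNReal.ofReal (dirichlet (tangentPlane A x) (fderiv ℝ Φ x))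
      ∂(μHE[2] : Measure E3) := by
  set d : E3 → ℝ := fun x => dirichlet (tangentPlane A x) (fderiv ℝ Φ x)
  have hdc : ContinuousOn d (A \ S) :=
    hA.continuousOn_dirichlet hr (hΦ.continuous_fderiv one_ne_zero)
  have hm : MeasurableSet (A \ S) := hA.isClosed.measurableSet.diff hA.finite_sing.measurableSet
  have hSΦ : (μHE[2] : Measure E3) (Φ '' S) = 0 := (hA.finite_sing.image Φ).measure_zero _
  have key : ∀ δ : ℝ≥0, 0 < δ → μHE[2] (Φ '' A) ≤ ((1 + δ : ℝ≥0) : ℝ≥0∞) ^ 2 *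
      (∫⁻ x in A, ENNReal.ofReal (d x) ∂(μHE[2] : Measure E3) + δ * μHE[2] A) := by
    intro δ hδ
    have hU : ∀ p ∈ A \ S, ∃ U : Set E3, IsOpen U ∧ p ∈ U ∧ (∀ F ⊆ A ∩ U, μHE[2] (Φ '' F) ≤
        ((1 + δ : ℝ≥0) : ℝ≥0∞) ^ 2 * ENNReal.ofReal (d p) * μHE[2] F) ∧
        ∀ x ∈ (A \ S) ∩ U, d p ≤ d x + δ := by
      intro p hp
      obtain ⟨U, hU, hpU, h1⟩ := (hA.regular p hp).exists_area_image_le hr hp.1 hΦ (hD p) hδ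
      have h2 : ∀ᶠ x in 𝓝[A \ S] p, d p ≤ d x + δ := by
        have h3 := (hdc p hp).eventually (lt_mem_nhds (show d p - δ < d p by
          have : (0 : ℝ) < δ := hδ
          linarith))
        filter_upwards [h3] with x hx
        linarith
      obtain ⟨V, hV, hpV, h3⟩ := mem_nhdsWithin.1 h2
      refine ⟨U ∩ V, hU.inter hV, ⟨hpU, hpV⟩, fun F hF => h1 F (hF.trans
        (inter_subset_inter_right _ inter_subset_left)), fun x hx => h3 ⟨hx.2.2, hx.1⟩⟩
    choose! U hUo hpU hU1 hU2 using hU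
    obtain ⟨T, hTA, hTc, hTU⟩ := TopologicalSpace.countable_cover_nhdsWithin
      (s := A \ S) (f := U) fun p hp => mem_nhdsWithin_of_mem_nhds ((hUo p hp).mem_nhds (hpU p hp))
    rcases T.eq_empty_or_nonempty with rfl | hTne
    · have h1 : A ⊆ S := by
        intro x hx
        by_contra h
        simpa using hTU ⟨hx, h⟩
      have : μHE[2] (Φ '' A) = 0 := measure_mono_null (image_mono h1) hSΦ
      rw [this]; exact zero_le
    obtain ⟨q, hq⟩ := hTc.exists_eq_range hTne
    have hqA : ∀ n, q n ∈ A \ S := fun n => hTA (hq ▸ mem_range_self n)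
    let F : ℕ → Set E3 := fun n => (A \ S) ∩ disjointed (fun n => U (q n)) n
    have hFm : ∀ n, MeasurableSet (F n) := fun n =>
      hm.inter (MeasurableSet.disjointed (fun n => (hUo _ (hqA n)).measurableSet) n)
    have hFU : ∀ n, F n ⊆ (A \ S) ∩ U (q n) := fun n =>
      inter_subset_inter_right _ (disjointed_subset _ n)
    have hFd : Pairwise (fun i j => Disjoint (F i) (F j)) := fun i j hij =>
      (disjoint_disjointed _ hij).mono inter_subset_right inter_subset_right
    have hFu : ⋃ n, F n = A \ S := by
      rw [← inter_iUnion, iUnion_disjointed, inter_eq_left]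
      refine hTU.trans ?_
      rw [hq, biUnion_range]
    have h1 : Φ '' A ⊆ (⋃ n, Φ '' F n) ∪ Φ '' S := by
      rw [← image_iUnion, hFu, ← image_union]
      exact image_mono (by simp)
    have h2 : ∀ n, μHE[2] (Φ '' F n) ≤ ((1 + δ : ℝ≥0) : ℝ≥0∞) ^ 2 *
        ∫⁻ x in F n, (ENNReal.ofReal (d x) + δ) ∂(μHE[2] : Measure E3) := by
      intro n
      have e1 := hU1 (q n) (hqA n) (F n) ((hFU n).trans (inter_subset_inter_left _ sdiff_subset))
      refine e1.trans ?_
      rw [mul_assoc]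
      gcongr
      rw [← setLIntegral_const]
      refine setLIntegral_mono' (hFm n) fun x hx => ?_
      have e2 := hU2 (q n) (hqA n) x (hFU n hx)
      refine (ENNReal.ofReal_le_ofReal e2).trans ?_
      refine ENNReal.ofReal_add_le.trans ?_
      rw [ENNReal.ofReal_coe_nnreal]
    calc μHE[2] (Φ '' A) ≤ μHE[2] (⋃ n, Φ '' F n) + μHE[2] (Φ '' S) :=
          (measure_mono h1).trans (measure_union_le _ _)
      _ ≤ ∑' n, μHE[2] (Φ '' F n) := by rw [hSΦ, add_zero]; exact measure_iUnion_le _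
      _ ≤ ∑' n, ((1 + δ : ℝ≥0) : ℝ≥0∞) ^ 2 *
            ∫⁻ x in F n, (ENNReal.ofReal (d x) + δ) ∂(μHE[2] : Measure E3) :=
          ENNReal.tsum_le_tsum h2
      _ = ((1 + δ : ℝ≥0) : ℝ≥0∞) ^ 2 *
            ∫⁻ x in A \ S, (ENNReal.ofReal (d x) + δ) ∂(μHE[2] : Measure E3) := by
          rw [ENNReal.tsum_mul_left, ← hFu, lintegral_iUnion hFm hFd]
      _ ≤ ((1 + δ : ℝ≥0) : ℝ≥0∞) ^ 2 *
            ∫⁻ x in A, (ENNReal.ofReal (d x) + δ) ∂(μHE[2] : Measure E3) := by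
          gcongr; exact sdiff_subset
      _ = _ := by
          rw [lintegral_add_right _ measurable_const, setLIntegral_const]
  have hlim : Tendsto (fun δ : ℝ≥0 => ((1 + δ : ℝ≥0) : ℝ≥0∞) ^ 2 *
      (∫⁻ x in A, ENNReal.ofReal (d x) ∂(μHE[2] : Measure E3) + δ * μHE[2] A)) (𝓝[>] 0)
      (𝓝 (((1 + (0 : ℝ≥0) : ℝ≥0) : ℝ≥0∞) ^ 2 *
      (∫⁻ x in A, ENNReal.ofReal (d x) ∂(μHE[2] : Measure E3) + (0 : ℝ≥0) * μHE[2] A))) := by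
    have c1 : Tendsto (fun δ : ℝ≥0 => ((1 + δ : ℝ≥0) : ℝ≥0∞) ^ 2) (𝓝[>] 0)
        (𝓝 (((1 + (0 : ℝ≥0) : ℝ≥0) : ℝ≥0∞) ^ 2)) := by
      have : Continuous fun δ : ℝ≥0 => (((1 + δ) ^ 2 : ℝ≥0) : ℝ≥0∞) :=
        ENNReal.continuous_coe.comp (by fun_prop)
      have h2 := (this.tendsto 0).mono_left (nhdsWithin_le_nhds (s := Ioi 0))
      simpa using h2
    have c2 : Tendsto (fun δ : ℝ≥0 => (δ : ℝ≥0∞) * μHE[2] A) (𝓝[>] 0)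
        (𝓝 (((0 : ℝ≥0) : ℝ≥0∞) * μHE[2] A)) :=
      ENNReal.Tendsto.mul_const ((ENNReal.continuous_coe.tendsto 0).mono_left nhdsWithin_le_nhds)
        (Or.inr hA.finite_area.ne)
    exact ENNReal.Tendsto.mul c1 (Or.inl (by simp)) (tendsto_const_nhds.add c2) (Or.inr (by simp))
  have h3 := ge_of_tendsto hlim (eventually_nhdsWithin_of_forall fun δ hδ => key δ hδ)
  simpa using h3


/-! ### Surfaces moved by maps close to the identity -/

/-- Uniform continuity on the compact product of a thickening of `K` with the Grassmannian, metrized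
by the distance of projections. Only `x` has to lie in `K`; the comparison point `y` may leave it.
-/
theorem exists_modulus {u : E3 × Plane → ℝ} (hu : Continuous u) {K : Set E3} (hK : IsCompact K)
    {ω : ℝ} (hω : 0 < ω) : ∃ ε > 0, ∀ x ∈ K, ∀ y, ∀ S T : Plane, dist y x ≤ ε →
      ‖T.proj - S.proj‖ ≤ ε → |u (y, T) - u (x, S)| ≤ ω := by
  let _ : MetricSpace Plane := MetricSpace.induced Plane.proj Plane.proj_injective inferInstance
  have hK' : IsCompact (Metric.cthickening 1 K ×ˢ (univ : Set Plane)) :=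
    hK.cthickening.prod isCompact_univ
  have h1 := hK'.uniformContinuousOn_of_continuous (f := u) hu.continuousOn
  rw [Metric.uniformContinuousOn_iff_le] at h1
  obtain ⟨δ, hδ, h⟩ := h1 ω hω
  refine ⟨min δ 1, by positivity, fun x hx y S T hyx hTS => ?_⟩
  have hd : dist (y, T) (x, S) ≤ δ := by
    rw [Prod.dist_eq]
    refine max_le (hyx.trans (min_le_left _ _)) ?_
    have : dist T S = dist T.proj S.proj := rfl
    rw [this, dist_eq_norm]
    exact hTS.trans (min_le_left _ _)
  refine h _ ⟨?_, mem_univ _⟩ _ ⟨?_, mem_univ _⟩ hd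
  · exact Metric.mem_cthickening_of_dist_le y x 1 K hx (hyx.trans (min_le_right _ _))
  · exact Metric.self_subset_cthickening K hx

/-- The integral of a function of the point and the tangent plane over a surface. -/
def planeInt (A : Set E3) (u : E3 × Plane → ℝ≥0) : ℝ≥0∞ :=
  ∫⁻ x in A, u (x, tangentPlane A x) ∂(μHE[2] : Measure E3)

/-- `ψ` is `C¹`-close to the identity on the open convex set `B`. -/
structure IsCloseToId (ψ : E3 → E3) (B : Set E3) (ε : ℝ≥0) : Prop where
  isOpen : IsOpen B
  convex : Convex ℝ B
  diff : DifferentiableOn ℝ ψ B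
  dist_le : ∀ x ∈ B, dist (ψ x) x ≤ ε
  fderiv_le : ∀ x ∈ B, ‖fderiv ℝ ψ x - ContinuousLinearMap.id ℝ E3‖ ≤ ε

namespace IsCloseToId

variable {ψ : E3 → E3} {B : Set E3} {ε : ℝ≥0}

theorem approximates (h : IsCloseToId ψ B ε) :
    ApproximatesLinearOn ψ ((ContinuousLinearEquiv.refl ℝ E3 : E3 ≃L[ℝ] E3) : E3 →L[ℝ] E3) B ε := by
  intro x hx y hy
  have h1 := h.convex.norm_image_sub_le_of_norm_hasFDerivWithin_le
    (f := fun x => ψ x - x) (f' := fun x => fderiv ℝ ψ x - ContinuousLinearMap.id ℝ E3)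
    (fun z hz => (((h.diff.differentiableAt (h.isOpen.mem_nhds hz)).hasFDerivAt).sub
      (hasFDerivAt_id z)).hasFDerivWithinAt) h.fderiv_le hy hx
  have h2 : ψ x - ψ y - (x - y) = ψ x - x - (ψ y - y) := by abel
  simpa [h2] using h1

theorem norm_sub_sub_le (h : IsCloseToId ψ B ε) {x y : E3} (hx : x ∈ B) (hy : y ∈ B) :
    ‖ψ x - ψ y - (x - y)‖ ≤ ε * ‖x - y‖ := by
  simpa using h.approximates x hx y hy

theorem dist_image_le (h : IsCloseToId ψ B ε) {x y : E3} (hx : x ∈ B) (hy : y ∈ B) :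
    dist (ψ x) (ψ y) ≤ (1 + ε) * dist x y := by
  have h1 := h.norm_sub_sub_le hx hy
  rw [dist_eq_norm, dist_eq_norm]
  have h2 := norm_sub_norm_le (ψ x - ψ y) (x - y)
  linarith

theorem dist_le_image (h : IsCloseToId ψ B ε) (hε : ε ≤ 1 / 4) {x y : E3} (hx : x ∈ B)
    (hy : y ∈ B) : dist x y ≤ (1 + 2 * ε) * dist (ψ x) (ψ y) := by
  have h1 := h.norm_sub_sub_le hx hy
  rw [dist_eq_norm, dist_eq_norm]
  have h2 := norm_sub_norm_le (x - y) (ψ x - ψ y)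
  rw [norm_sub_rev (x - y)] at h2
  have hε' : (ε : ℝ) ≤ 1 / 4 := by exact_mod_cast hε
  have h0 : (0 : ℝ) ≤ ε := ε.2
  nlinarith [norm_nonneg (x - y), mul_nonneg h0 (norm_nonneg (x - y))]

theorem lt_inv (hε : ε ≤ 1 / 4) : Subsingleton E3 ∨
    ε < ‖((ContinuousLinearEquiv.refl ℝ E3).symm : E3 →L[ℝ] E3)‖₊⁻¹ := by
  right
  have h1 : ‖((ContinuousLinearEquiv.refl ℝ E3).symm : E3 →L[ℝ] E3)‖₊ = 1 := by
    have : ((ContinuousLinearEquiv.refl ℝ E3).symm : E3 →L[ℝ] E3) =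
      ContinuousLinearMap.id ℝ E3 := rfl
    rw [this]; exact ContinuousLinearMap.nnnorm_id
  rw [h1, inv_one]
  exact hε.trans_lt (by rw [div_lt_one] <;> norm_num)

/-- A map close to the identity, as a homeomorphism onto its image. -/
def toOPH (h : IsCloseToId ψ B ε) (hε : ε ≤ 1 / 4) : OpenPartialHomeomorph E3 E3 :=
  h.approximates.toOpenPartialHomeomorph ψ B (lt_inv hε) h.isOpen

theorem toOPH_target (h : IsCloseToId ψ B ε) (hε : ε ≤ 1 / 4) : (h.toOPH hε).target = ψ '' B := rfl

theorem injOn (h : IsCloseToId ψ B ε) (hε : ε ≤ 1 / 4) : InjOn ψ B := (h.toOPH hε).injOn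

theorem exists_fderiv_equiv (h : IsCloseToId ψ B ε) (hε : ε ≤ 1 / 4) {x : E3} (hx : x ∈ B) :
    ∃ L : E3 ≃L[ℝ] E3, (L : E3 →L[ℝ] E3) = fderiv ℝ ψ x := by
  have h1 : ‖ContinuousLinearMap.id ℝ E3 - fderiv ℝ ψ x‖ < 1 := by
    rw [norm_sub_rev]
    refine (h.fderiv_le x hx).trans_lt ?_
    have hε' : (ε : ℝ) ≤ 1 / 4 := by exact_mod_cast hε
    linarith
  let w : (E3 →L[ℝ] E3)ˣ := Units.oneSub _ h1
  refine ⟨ContinuousLinearEquiv.unitsEquiv ℝ E3 w, ?_⟩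
  have h2 : (w : E3 →L[ℝ] E3) = 1 - (ContinuousLinearMap.id ℝ E3 - fderiv ℝ ψ x) := rfl
  have h3 : ((ContinuousLinearEquiv.unitsEquiv ℝ E3 w : E3 ≃L[ℝ] E3) : E3 →L[ℝ] E3) = w := by
    ext1 v; rfl
  rw [h3, h2]
  show ContinuousLinearMap.id ℝ E3 - (ContinuousLinearMap.id ℝ E3 - fderiv ℝ ψ x) = _
  abel

/-- The derivative of `ψ` carries tangent planes of `A` to those of `A'`, and it is `ε`-close to the
identity. -/
theorem tangentPlane_image (h : IsCloseToId ψ B ε) (hε : ε ≤ 1 / 4) {A A' : Set E3}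
    (hA : A' ∩ ψ '' B = ψ '' (A ∩ B)) {x : E3} (hx : x ∈ B)
    (hT : HasTangentPlane A x (tangentPlane A x)) :
    ‖(tangentPlane A' (ψ x)).proj - (tangentPlane A x).proj‖ ≤ 3 * ε := by
  obtain ⟨L, hL⟩ := h.exists_fderiv_equiv hε hx
  have h1 : HasFDerivAt (h.toOPH hε) (L : E3 →L[ℝ] E3) x := by
    rw [hL]
    exact (h.diff.differentiableAt (h.isOpen.mem_nhds hx)).hasFDerivAt
  have h2 := hT.map (A' := A') (h.toOPH hε) hx h1 (fun z hz => by
    constructor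
    · intro hzA
      exact (hA.symm ▸ mem_image_of_mem ψ ⟨hzA, hz⟩ : ψ z ∈ A' ∩ ψ '' B).1
    · intro hzA
      have h3 : ψ z ∈ ψ '' (A ∩ B) := hA ▸ ⟨hzA, mem_image_of_mem ψ hz⟩
      obtain ⟨w, hw, hwz⟩ := h3
      rw [← h.injOn hε hw.2 hz hwz]
      exact hw.1)
  have h3 : tangentPlane A' (ψ x) = (tangentPlane A x).map L := h2.tangentPlane_eq
  rw [h3]
  have h4 : ‖(L : E3 →L[ℝ] E3) - ContinuousLinearMap.id ℝ E3‖ ≤ ε := by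
    rw [hL]; exact h.fderiv_le x hx
  have hε' : (ε : ℝ) ≤ 1 / 4 := by exact_mod_cast hε
  refine (Plane.norm_proj_map_sub_le _ L (by linarith)).trans (by linarith)

/-- Both `ψ` and its inverse are `(1 + 2ε)`-Lipschitz, which compares areas. Under `ψ` points and
tangent planes move by `ε` and `3ε` at most, which changes `u` by at most `ω`. -/
theorem lintegral_compare (h : IsCloseToId ψ B ε) (hε : ε ≤ 1 / 4) {r : ℕ∞} (hr : 2 ≤ r)
    {A S A' : Set E3} (hAS : IsSurface r A S) (hA : A' ∩ ψ '' B = ψ '' (A ∩ B))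
    {u : E3 × Plane → ℝ≥0} {ω : ℝ≥0}
    (hmod : ∀ x ∈ A ∩ B, ∀ y, ∀ S T : Plane, dist y x ≤ ε → ‖T.proj - S.proj‖ ≤ 3 * ε →
      |(u (y, T) : ℝ) - u (x, S)| ≤ ω) :
    ∫⁻ y in A' ∩ ψ '' B, u (y, tangentPlane A' y) ∂(μHE[2] : Measure E3) ≤
      ((1 + 2 * ε : ℝ≥0) : ℝ≥0∞) ^ 2 *
        (∫⁻ x in A ∩ B, u (x, tangentPlane A x) ∂(μHE[2] : Measure E3) + ω * μHE[2] A) ∧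
    ∫⁻ x in A ∩ B, u (x, tangentPlane A x) ∂(μHE[2] : Measure E3) ≤
      ((1 + 2 * ε : ℝ≥0) : ℝ≥0∞) ^ 2 *
        ∫⁻ y in A' ∩ ψ '' B, u (y, tangentPlane A' y) ∂(μHE[2] : Measure E3) + ω * μHE[2] A := by
  have hE : MeasurableSet (A ∩ B) := hAS.isClosed.measurableSet.inter h.isOpen.measurableSet
  have hd1 : ∀ x ∈ A ∩ B, ∀ y ∈ A ∩ B, dist (ψ x) (ψ y) ≤ (1 + 2 * ε : ℝ≥0) * dist x y := by
    intro x hx y hy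
    refine (h.dist_image_le hx.2 hy.2).trans ?_
    push_cast
    have : (0 : ℝ) ≤ ε := ε.2
    gcongr
    linarith
  have hd2 : ∀ x ∈ A ∩ B, ∀ y ∈ A ∩ B, dist x y ≤ (1 + 2 * ε : ℝ≥0) * dist (ψ x) (ψ y) := by
    intro x hx y hy
    have := h.dist_le_image hε hx.2 hy.2
    exact_mod_cast this
  have hae : ∀ᵐ x ∂((μHE[2] : Measure E3).restrict (A ∩ B)),
      (u (ψ x, tangentPlane A' (ψ x)) : ℝ≥0∞) ≤ u (x, tangentPlane A x) + ω ∧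
      (u (x, tangentPlane A x) : ℝ≥0∞) ≤ u (ψ x, tangentPlane A' (ψ x)) + ω := by
    have h1 := ae_mono (Measure.restrict_mono (μ := (μHE[2] : Measure E3))
      (inter_subset_left (s := A) (t := B)) le_rfl) hAS.ae_restrict
    filter_upwards [h1, ae_restrict_mem hE] with x hx hxE
    have h2 := h.tangentPlane_image hε hA hxE.2 ((hAS.regular x hx).hasTangentPlane hr hx.1)
    have h3 := abs_le.1 (hmod x hxE (ψ x) _ _ (h.dist_le x hxE.2) h2)
    constructor
    · have : u (ψ x, tangentPlane A' (ψ x)) ≤ u (x, tangentPlane A x) + ω := by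
        rw [← NNReal.coe_le_coe]; push_cast; linarith [h3.2]
      exact_mod_cast this
    · have : u (x, tangentPlane A x) ≤ u (ψ x, tangentPlane A' (ψ x)) + ω := by
        rw [← NNReal.coe_le_coe]; push_cast; linarith [h3.1]
      exact_mod_cast this
  have hm : ∫⁻ x in A ∩ B, (ω : ℝ≥0∞) ∂(μHE[2] : Measure E3) ≤ ω * μHE[2] A := by
    rw [setLIntegral_const]
    gcongr
    exact inter_subset_left
  rw [hA]
  constructor
  · refine (lintegral_image_le hE hd1 _).trans ?_
    gcongr
    calc _ ≤ ∫⁻ x in A ∩ B, (u (x, tangentPlane A x) + ω : ℝ≥0∞) ∂(μHE[2] : Measure E3) :=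
          lintegral_mono_ae (hae.mono fun x hx => hx.1)
      _ ≤ _ := by
          rw [lintegral_add_right _ measurable_const]
          gcongr
  · calc _ ≤ ∫⁻ x in A ∩ B, (u (ψ x, tangentPlane A' (ψ x)) + ω : ℝ≥0∞)
          ∂(μHE[2] : Measure E3) := lintegral_mono_ae (hae.mono fun x hx => hx.2)
      _ ≤ _ := by
          rw [lintegral_add_right _ measurable_const]
          gcongr
          exact lintegral_le_image hE hd1 hd2 (fun y => (u (y, tangentPlane A' y) : ℝ≥0∞))

end IsCloseToId

/-- The hypothesis has the shape of the two inequalities of `IsCloseToId.lintegral_compare`, with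
`m` in the role of the area. -/
theorem tendsto_of_forall_eventually_le {ι : Type*} {l : Filter ι} {f : ι → ℝ≥0∞} {a m : ℝ≥0∞}
    (hm : m ≠ ∞)
    (h : ∀ η : ℝ≥0, 0 < η → ∀ᶠ t in l, f t ≤ ((1 + η : ℝ≥0) : ℝ≥0∞) ^ 2 * (a + η * m) ∧
      a ≤ ((1 + η : ℝ≥0) : ℝ≥0∞) ^ 2 * f t + η * m) : Tendsto f l (𝓝 a) := by
  have c1 : Tendsto (fun η : ℝ≥0 => ((1 + η : ℝ≥0) : ℝ≥0∞) ^ 2) (𝓝[>] 0) (𝓝 1) := by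
    have : Continuous fun δ : ℝ≥0 => (((1 + δ) ^ 2 : ℝ≥0) : ℝ≥0∞) :=
      ENNReal.continuous_coe.comp (by fun_prop)
    have h2 := (this.tendsto 0).mono_left (nhdsWithin_le_nhds (s := Ioi 0))
    simpa using h2
  have c2 : Tendsto (fun δ : ℝ≥0 => (δ : ℝ≥0∞) * m) (𝓝[>] 0) (𝓝 0) := by
    have := ENNReal.Tendsto.mul_const (b := m)
      ((ENNReal.continuous_coe.tendsto 0).mono_left (nhdsWithin_le_nhds (s := Ioi (0 : ℝ≥0))))
      (Or.inr hm)
    simpa using this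
  rw [tendsto_order]
  constructor
  · intro b hb
    have hbt : b ≠ ∞ := (hb.trans_le le_top).ne
    have c3 : Tendsto (fun η : ℝ≥0 => ((1 + η : ℝ≥0) : ℝ≥0∞) ^ 2 * b + η * m) (𝓝[>] 0)
        (𝓝 b) := by
      have := (ENNReal.Tendsto.mul_const (b := b) c1 (Or.inr hbt)).add c2
      simpa using this
    obtain ⟨η, hη, hη0⟩ := ((c3.eventually (gt_mem_nhds hb)).and self_mem_nhdsWithin).exists
    filter_upwards [h η hη0] with t ht
    by_contra hlt
    push Not at hlt
    refine absurd (ht.2.trans ?_) (not_le.2 hη)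
    gcongr
  · intro b hb
    have c3 : Tendsto (fun η : ℝ≥0 => ((1 + η : ℝ≥0) : ℝ≥0∞) ^ 2 * (a + η * m)) (𝓝[>] 0)
        (𝓝 a) := by
      have := ENNReal.Tendsto.mul c1 (Or.inl one_ne_zero) (c2.const_add a) (Or.inr (by simp))
      simpa using this
    obtain ⟨η, hη, hη0⟩ := ((c3.eventually (gt_mem_nhds hb)).and self_mem_nhdsWithin).exists
    filter_upwards [h η hη0] with t ht
    exact ht.1.trans_lt hη


/-! ### Continuity of the varifolds of a family of surfaces -/

/-- The image of the ball of radius `δ` about `y` contains the ball of radius `(1 - ε) δ` about `ψ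
y`, by the quantitative inverse function theorem, and `y` is within `ε` of `ψ y`. -/
theorem IsCloseToId.mem_image_closedBall {ψ : E3 → E3} {B : Set E3} {ε : ℝ≥0}
    (h : IsCloseToId ψ B ε) (hε : ε ≤ 1 / 4) {y : E3} {δ : ℝ} (hδ : 2 * ε ≤ δ)
    (hB : Metric.closedBall y δ ⊆ B) : y ∈ ψ '' Metric.closedBall y δ := by
  have h0 : (0 : ℝ) ≤ ε := ε.2
  have hδ0 : 0 ≤ δ := by linarith
  have h1 := h.approximates.surjOn_closedBall_of_nonlinearRightInverse
    (ContinuousLinearEquiv.refl ℝ E3).toNonlinearRightInverse hδ0 hB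
  have h2 : ((ContinuousLinearEquiv.refl ℝ E3).toNonlinearRightInverse.nnnorm : ℝ) = 1 := by
    show ‖((ContinuousLinearEquiv.refl ℝ E3).symm : E3 →L[ℝ] E3)‖ = 1
    exact ContinuousLinearMap.norm_id
  refine h1 ?_
  rw [h2, Metric.mem_closedBall, dist_comm]
  refine (h.dist_le y (hB (Metric.mem_closedBall_self hδ0))).trans ?_
  have hε' : (ε : ℝ) ≤ 1 / 4 := by exact_mod_cast hε
  have : (ε : ℝ) ≤ δ / 2 := by linarith
  nlinarith

theorem setLIntegral_inter_of_eq_zero {X : Type*} [MeasurableSpace X] {μ : Measure X}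
    {A V : Set X} (hV : MeasurableSet V) {f : X → ℝ≥0∞} (h : ∀ x ∉ V, f x = 0) :
    ∫⁻ x in A ∩ V, f x ∂μ = ∫⁻ x in A, f x ∂μ := by
  rw [inter_comm, ← Measure.restrict_restrict hV, ← lintegral_indicator hV]
  congr 1 with x
  by_cases hx : x ∈ V <;> simp [hx, h]

theorem eventually_isCloseToId {P : Type} [TopologicalSpace P] {r : ℕ∞} (hr : 2 ≤ r) {s : P}
    {ψ : P → E3 → E3} {p : E3} {ρ : ℝ}
    (hd : ∀ᶠ t in 𝓝 s, ContDiffOn ℝ r (ψ t) (Metric.ball p ρ))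
    (hψ : ∀ k : ℕ, (k : ℕ∞) ≤ r →
      TendstoUniformlyOn (fun t x => iteratedFDeriv ℝ k (fun y => ψ t y - y) x) 0 (𝓝 s)
        (Metric.ball p ρ)) {ε : ℝ≥0} (hε : 0 < ε) :
    ∀ᶠ t in 𝓝 s, IsCloseToId (ψ t) (Metric.ball p ρ) ε := by
  have h0 := Metric.tendstoUniformlyOn_iff.1 (hψ 0 (by simp)) ε (by exact_mod_cast hε)
  have h1 := Metric.tendstoUniformlyOn_iff.1 (hψ 1 (by exact_mod_cast one_le_two.trans hr)) ε
    (by exact_mod_cast hε)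
  filter_upwards [hd, h0, h1] with t ht h0 h1
  have hdiff : DifferentiableOn ℝ (ψ t) (Metric.ball p ρ) :=
    ht.differentiableOn (coe_ne_zero_of_two_le hr)
  refine ⟨Metric.isOpen_ball, convex_ball _ _, hdiff, fun x hx => ?_, fun x hx => ?_⟩
  · have := (h0 x hx).le
    rwa [Pi.zero_apply, dist_zero_left, norm_iteratedFDeriv_zero, ← dist_eq_norm] at this
  · have := (h1 x hx).le
    rw [Pi.zero_apply, dist_zero_left, norm_iteratedFDeriv_one] at this
    have h2 : fderiv ℝ (fun y => ψ t y - y) x = fderiv ℝ (ψ t) x - ContinuousLinearMap.id ℝ E3 :=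
      (((hdiff.differentiableAt (Metric.isOpen_ball.mem_nhds hx)).hasFDerivAt).sub
        (hasFDerivAt_id x)).fderiv
    rwa [h2] at this

/-- The maps `ψ t` describe `A t` only inside the image of the ball. For `t` near `s` this image
contains the concentric ball of half the radius, so for test functions supported there no part of `A
t` is missed. -/
theorem ConvergesSmoothlyNear.exists_tendsto_planeInt {P : Type} [TopologicalSpace P] {r : ℕ∞}
    (hr : 2 ≤ r) {A : P → Set E3} {s : P} {S : Set E3} {p : E3} (hA : IsSurface r (A s) S)
    (h : ConvergesSmoothlyNear r A s p) :
    ∃ ρ > 0, ∀ u : E3 × Plane → ℝ≥0, Continuous u → (∀ z, z.1 ∉ Metric.ball p ρ → u z = 0) →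
      Tendsto (fun t => planeInt (A t) u) (𝓝 s) (𝓝 (planeInt (A s) u)) := by
  obtain ⟨ρ, hρ, ψ, h1, h2⟩ := h
  refine ⟨ρ / 2, by positivity, fun u hu hu0 => ?_⟩
  refine tendsto_of_forall_eventually_le hA.finite_area.ne fun η hη => ?_
  obtain ⟨ε₁, hε₁, hmod⟩ := exists_modulus (u := fun z => (u z : ℝ))
    (NNReal.continuous_coe.comp hu) (isCompact_closedBall p ρ) (NNReal.coe_pos.2 hη)
  obtain ⟨ε, hε, hεle⟩ : ∃ ε : ℝ≥0, 0 < ε ∧ ((ε : ℝ) ≤ 1 / 4 ∧ (ε : ℝ) ≤ ε₁ / 3 ∧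
      (ε : ℝ) ≤ ρ / 8 ∧ (ε : ℝ) ≤ η / 2) := by
    have hη' : (0 : ℝ) < η := NNReal.coe_pos.2 hη
    have hm : 0 < min (min (1 / 4) (ε₁ / 3)) (min (ρ / 8) ((η : ℝ) / 2)) := by positivity
    refine ⟨Real.toNNReal (min (min (1 / 4) (ε₁ / 3)) (min (ρ / 8) ((η : ℝ) / 2))),
      Real.toNNReal_pos.2 hm, ?_⟩
    rw [Real.coe_toNNReal _ hm.le]
    exact ⟨(min_le_left _ _).trans (min_le_left _ _), (min_le_left _ _).trans (min_le_right _ _),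
      (min_le_right _ _).trans (min_le_left _ _), (min_le_right _ _).trans (min_le_right _ _)⟩
  obtain ⟨e1, e2, e3, e4⟩ := hεle
  have e1' : ε ≤ 1 / 4 := by rw [← NNReal.coe_le_coe]; push_cast; linarith
  have e4' : 2 * ε ≤ η := by rw [← NNReal.coe_le_coe]; push_cast; linarith
  filter_upwards [h1, eventually_isCloseToId hr (h1.mono fun t ht => ht.1) h2 hε] with t ht hc
  obtain ⟨c1, c2⟩ := hc.lintegral_compare e1' hr hA ht.2 (u := u) (ω := η)
    (fun x hx y T T' hyx hT => hmod x (Metric.ball_subset_closedBall hx.2) y T T'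
      (by linarith) (by linarith))
  have hz1 : ∀ x ∉ Metric.ball p ρ, (u (x, tangentPlane (A s) x) : ℝ≥0∞) = 0 := fun x hx => by
    rw [hu0 (x, tangentPlane (A s) x) fun h => hx (Metric.ball_subset_ball (half_le_self hρ.le) h)]
    rfl
  have hz2 : ∀ x ∉ ψ t '' Metric.ball p ρ, (u (x, tangentPlane (A t) x) : ℝ≥0∞) = 0 := by
    intro x hx
    rw [ENNReal.coe_eq_zero]
    refine hu0 (x, tangentPlane (A t) x) fun h => hx ?_
    have hsub : Metric.closedBall x (ρ / 4) ⊆ Metric.ball p ρ := fun z hz => by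
      have := Metric.mem_closedBall.1 hz
      have h' := Metric.mem_ball.1 h
      rw [Metric.mem_ball]
      calc dist z p ≤ dist z x + dist x p := dist_triangle _ _ _
        _ < ρ := by simp only at h'; linarith
    exact image_mono hsub (hc.mem_image_closedBall e1' (by linarith) hsub)
  have hV : MeasurableSet (ψ t '' Metric.ball p ρ) :=
    (hc.toOPH_target e1' ▸ (hc.toOPH e1').open_target).measurableSet
  rw [setLIntegral_inter_of_eq_zero Metric.isOpen_ball.measurableSet hz1,
    setLIntegral_inter_of_eq_zero hV hz2] at c1 c2
  have hle : ((1 + 2 * ε : ℝ≥0) : ℝ≥0∞) ^ 2 ≤ ((1 + η : ℝ≥0) : ℝ≥0∞) ^ 2 := by gcongr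
  exact ⟨c1.trans (by gcongr; exact le_rfl), c2.trans (by gcongr; exact le_rfl)⟩

theorem IsSurface.aemeasurable_planeInt {r : ℕ∞} (hr : 2 ≤ r) {A S : Set E3}
    (hA : IsSurface r A S) {u : E3 × Plane → ℝ≥0} (hu : Measurable u) :
    AEMeasurable (fun x => (u (x, tangentPlane A x) : ℝ≥0∞)) ((μHE[2] : Measure E3).restrict A) :=
  (measurable_coe_nnreal_ennreal.comp hu).comp_aemeasurable
    (hA.aemeasurable_tangentPlane hr)

/-- Continuous functions supported in the balls of a cover of `T`, whose sums tend to `1` on `T`. -/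
theorem exists_cutoffs (T : Set E3) (ρ : E3 → ℝ) (hρ : ∀ p ∈ T, 0 < ρ p) :
    ∃ h : ℕ → ℕ → E3 → ℝ≥0, (∀ n i, Continuous (h n i)) ∧
      (∀ n i, h n i = 0 ∨ ∃ p ∈ T, ∀ x ∉ Metric.ball p (ρ p), h n i x = 0) ∧
      (∀ n x, ∑ i ∈ Finset.range n, h n i x ≤ 1) ∧
      ∀ x ∈ T, Tendsto (fun n => ∑ i ∈ Finset.range n, h n i x) atTop (𝓝 1) := by
  obtain ⟨T', hT, hTc, hTcov⟩ := TopologicalSpace.countable_cover_nhdsWithin (s := T)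
    (f := fun p => Metric.ball p (ρ p))
    (fun p hp => mem_nhdsWithin_of_mem_nhds (Metric.ball_mem_nhds _ (hρ p hp)))
  rcases T'.eq_empty_or_nonempty with rfl | hTne
  · refine ⟨0, fun _ _ => continuous_zero, fun _ _ => Or.inl rfl, fun _ _ => by simp,
      fun x hx => ?_⟩
    simpa using hTcov hx
  obtain ⟨q, hq⟩ := hTc.exists_eq_range hTne
  have hqm : ∀ n, q n ∈ T := fun n => hT (hq ▸ mem_range_self n)
  let f : ℕ → E3 → ℝ≥0 := fun n x => Real.toNNReal (ρ (q n) - dist x (q n))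
  have hfc : ∀ n, Continuous (f n) := fun n => by fun_prop
  have hf0 : ∀ n x, x ∉ Metric.ball (q n) (ρ (q n)) → f n x = 0 := fun n x hx => by
    rw [Metric.mem_ball, not_lt] at hx
    exact Real.toNNReal_of_nonpos (by linarith)
  have hfpos : ∀ n x, x ∈ Metric.ball (q n) (ρ (q n)) → 0 < f n x := fun n x hx =>
    Real.toNNReal_pos.2 (by rw [Metric.mem_ball] at hx; linarith)
  let F : ℕ → E3 → ℝ≥0 := fun n x => ∑ i ∈ Finset.range n, f i x
  have hFc : ∀ n, Continuous (F n) := fun n => continuous_finsetSum _ fun i _ => hfc i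
  -- Added to the denominators, `e n` keeps them positive where no ball contributes; on `T` its
  -- effect disappears as `n → ∞`.
  let e : ℕ → ℝ≥0 := fun n => 1 / ((n : ℝ≥0) + 1)
  have he : ∀ n, 0 < e n := fun n => by positivity
  have hsum : ∀ n x, ∑ i ∈ Finset.range n, f i x / (F n x + e n) = F n x / (F n x + e n) :=
    fun n x => (Finset.sum_div _ _ _).symm
  have hg1 : ∀ n x, F n x / (F n x + e n) ≤ 1 := fun n x =>
    div_le_one_of_le₀ le_self_add zero_le
  refine ⟨fun n i x => f i x / (F n x + e n), fun n i => (hfc i).div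
    ((hFc n).add continuous_const) (fun z => (add_pos_of_nonneg_of_pos zero_le (he n)).ne'),
    fun n i => Or.inr ⟨q i, hqm i, fun x hx => by simp [hf0 i x hx]⟩, fun n x => ?_,
    fun x hx => ?_⟩
  · rw [hsum]; exact hg1 n x
  simp only [hsum]
  obtain ⟨p, hpT, hxp⟩ := mem_iUnion₂.1 (hTcov hx)
  obtain ⟨N, rfl⟩ : p ∈ range q := hq ▸ hpT
  have hpos := hfpos N x hxp
  have hge : ∀ n ≥ N + 1, f N x ≤ F n x := fun n hn =>
    Finset.single_le_sum (f := fun i => f i x) (fun i _ => zero_le)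
      (Finset.mem_range.2 (by omega))
  have he0 : Tendsto (fun n => (e n : ℝ)) atTop (𝓝 0) := by
    simpa [e] using (tendsto_one_div_add_atTop_nhds_zero_nat (𝕜 := ℝ))
  have h1 : Tendsto (fun n => (1 : ℝ) - e n / f N x) atTop (𝓝 1) := by
    simpa using (he0.div_const (f N x : ℝ)).const_sub 1
  rw [← NNReal.tendsto_coe]
  refine tendsto_of_tendsto_of_tendsto_of_le_of_le' h1 tendsto_const_nhds ?_
    (Eventually.of_forall fun n => by exact_mod_cast hg1 n x)
  filter_upwards [eventually_ge_atTop (N + 1)] with n hn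
  have hp : (0 : ℝ) < f N x := by exact_mod_cast hpos
  have hF : (f N x : ℝ) ≤ F n x := by exact_mod_cast hge n hn
  have hen : (0 : ℝ) < e n := by exact_mod_cast he n
  show (1 : ℝ) - e n / f N x ≤ ((F n x / (F n x + e n) : ℝ≥0) : ℝ)
  push_cast
  have h3 : (F n x : ℝ) / (F n x + e n) = 1 - e n / (F n x + e n) := by
    field_simp; ring
  rw [h3]
  have : (e n : ℝ) / (F n x + e n) ≤ e n / f N x := by gcongr; linarith
  linarith

theorem tendsto_planeInt_cutoff {P : Type} [TopologicalSpace P] {r : ℕ∞} (hr : 2 ≤ r)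
    {A : P → Set E3} {s : P} (hS : ∀ t, ∃ S, IsSurface r (A t) S) {T : Set E3} {ρ : E3 → ℝ}
    (hloc : ∀ p ∈ T, ∀ u : E3 × Plane → ℝ≥0, Continuous u →
      (∀ z, z.1 ∉ Metric.ball p (ρ p) → u z = 0) →
      Tendsto (fun t => planeInt (A t) u) (𝓝 s) (𝓝 (planeInt (A s) u)))
    {h : ℕ → E3 → ℝ≥0} (hc : ∀ i, Continuous (h i))
    (h0 : ∀ i, h i = 0 ∨ ∃ p ∈ T, ∀ x ∉ Metric.ball p (ρ p), h i x = 0)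
    {u : E3 × Plane → ℝ≥0} (hu : Continuous u) (n : ℕ) :
    Tendsto (fun t => planeInt (A t) (fun z => (∑ i ∈ Finset.range n, h i z.1) * u z)) (𝓝 s)
      (𝓝 (planeInt (A s) (fun z => (∑ i ∈ Finset.range n, h i z.1) * u z))) := by
  have hwc : ∀ i, Continuous fun z : E3 × Plane => h i z.1 * u z := fun i =>
    ((hc i).comp continuous_fst).mul hu
  have hplane : ∀ t, planeInt (A t) (fun z => (∑ i ∈ Finset.range n, h i z.1) * u z) =
      ∑ i ∈ Finset.range n, planeInt (A t) (fun z => h i z.1 * u z) := fun t => by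
    obtain ⟨S', hS'⟩ := hS t
    simp only [planeInt]
    rw [← lintegral_finsetSum' _ (fun i _ => hS'.aemeasurable_planeInt hr (hwc i).measurable)]
    refine lintegral_congr fun x => ?_
    rw [Finset.sum_mul]
    push_cast; rfl
  simp only [hplane]
  refine tendsto_finsetSum _ fun i _ => ?_
  rcases h0 i with hi | ⟨p, hp, hi⟩
  · simp only [hi, Pi.zero_apply, zero_mul]
    simp [planeInt]
  · exact hloc p hp _ (hwc i) fun z hz => by simp [hi _ hz]

/-- The integrals over the surfaces of a family are lower semicontinuous if they are continuous
locally, away from finitely many points. -/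
theorem eventually_lt_planeInt_of_local {P : Type} [TopologicalSpace P] {r : ℕ∞} (hr : 2 ≤ r)
    {A : P → Set E3} {s : P} {S : Set E3} (hA : IsSurface r (A s) S)
    (hS : ∀ t, ∃ S, IsSurface r (A t) S)
    (h : ∀ p ∈ A s \ S, ∃ ρ > 0, ∀ u : E3 × Plane → ℝ≥0, Continuous u →
      (∀ z, z.1 ∉ Metric.ball p ρ → u z = 0) →
      Tendsto (fun t => planeInt (A t) u) (𝓝 s) (𝓝 (planeInt (A s) u)))
    {u : E3 × Plane → ℝ≥0} (hu : Continuous u) {C : ℝ≥0} (hC : ∀ z, u z ≤ C) {b : ℝ≥0∞}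
    (hb : b < planeInt (A s) u) : ∀ᶠ t in 𝓝 s, b < planeInt (A t) u := by
  choose! ρ hρ hloc using h
  obtain ⟨f, hfc, hf0, hf1, hflim⟩ := exists_cutoffs (A s \ S) ρ hρ
  have hlim : Tendsto (fun n => planeInt (A s) (fun z => (∑ i ∈ Finset.range n, f n i z.1) * u z))
      atTop (𝓝 (planeInt (A s) u)) := by
    have := hA.isFiniteMeasure
    refine tendsto_lintegral_of_dominated_convergence' (fun _ => (C : ℝ≥0∞))
      (fun n => hA.aemeasurable_planeInt hr (u := fun z => (∑ i ∈ Finset.range n, f n i z.1) * u z)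
        (Continuous.measurable ?_)) (fun n => ae_of_all _ fun x => ?_) ?_ ?_
    · exact (continuous_finsetSum _ fun i _ => (hfc n i).comp continuous_fst).mul hu
    · refine ENNReal.coe_le_coe.2 ?_
      calc (∑ i ∈ Finset.range n, f n i x) * u (x, tangentPlane (A s) x) ≤ 1 * C :=
            mul_le_mul' (hf1 n x) (hC _)
        _ = C := one_mul _
    · rw [lintegral_const]
      exact ENNReal.mul_ne_top ENNReal.coe_ne_top (measure_ne_top _ _)
    · filter_upwards [hA.ae_restrict] with x hx
      have := (ENNReal.tendsto_coe.2 ((hflim x hx).mul_const (u (x, tangentPlane (A s) x))))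
      simpa using this
  obtain ⟨n, hn⟩ := (hlim.eventually (lt_mem_nhds hb)).exists
  filter_upwards [(tendsto_planeInt_cutoff hr hS hloc (hfc n) (hf0 n) hu n).eventually
    (lt_mem_nhds hn)] with t ht
  refine ht.trans_le (lintegral_mono fun x => ?_)
  refine ENNReal.coe_le_coe.2 ?_
  exact mul_le_of_le_one_left zero_le (hf1 n x)

/-- If neither summand can drop in the limit and the sum converges to the sum of the limits, then
neither can rise; finiteness of `b` allows it to be cancelled. -/
theorem tendsto_of_eventually_lt_of_tendsto_add {ι : Type*} {l : Filter ι} {f g : ι → ℝ≥0∞}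
    {a b : ℝ≥0∞} (hb : b ≠ ∞) (hf : ∀ c < a, ∀ᶠ t in l, c < f t)
    (hg : ∀ c < b, ∀ᶠ t in l, c < g t) (h : Tendsto (fun t => f t + g t) l (𝓝 (a + b))) :
    Tendsto f l (𝓝 a) := by
  rw [tendsto_order]
  refine ⟨hf, fun c hc => ?_⟩
  rcases eq_or_ne b 0 with rfl | hb0
  · filter_upwards [h.eventually (gt_mem_nhds (by simpa using hc))] with t ht
    exact le_self_add.trans_lt ht
  · have h1 : a + b < c + b := ENNReal.add_lt_add_right hb hc
    have h2 : ∀ᶠ x in 𝓝[<] b, a + b < c + x :=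
      nhdsWithin_le_nhds (((continuous_const_add c).tendsto b).eventually (lt_mem_nhds h1))
    have : (𝓝[<] b).NeBot := nhdsLT_neBot_of_exists_lt ⟨0, pos_iff_ne_zero.2 hb0⟩
    obtain ⟨b', hb', hbb⟩ := (h2.and self_mem_nhdsWithin).exists
    filter_upwards [h.eventually (gt_mem_nhds hb'), hg b' hbb] with t ht ht'
    by_contra hlt
    push Not at hlt
    exact absurd ht (not_lt.2 (add_le_add hlt ht'.le))

/-- Local convergence gives lower semicontinuity for `u` and for `C - u`, and the two integrals add
up to `C` times the area, which is continuous. This is how the continuity of the area prevents mass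
from appearing at the singular points. -/
theorem tendsto_planeInt_of_local {P : Type} [TopologicalSpace P] {r : ℕ∞} (hr : 2 ≤ r)
    {A : P → Set E3} {s : P} {S : Set E3} (hA : IsSurface r (A s) S)
    (hS : ∀ t, ∃ S, IsSurface r (A t) S)
    (h : ∀ p ∈ A s \ S, ∃ ρ > 0, ∀ u : E3 × Plane → ℝ≥0, Continuous u →
      (∀ z, z.1 ∉ Metric.ball p ρ → u z = 0) →
      Tendsto (fun t => planeInt (A t) u) (𝓝 s) (𝓝 (planeInt (A s) u)))
    (harea : Tendsto (fun t => (μHE[2] : Measure E3) (A t)) (𝓝 s) (𝓝 (μHE[2] (A s))))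
    {u : E3 × Plane → ℝ≥0} (hu : Continuous u) {C : ℝ≥0} (hC : ∀ z, u z ≤ C) :
    Tendsto (fun t => planeInt (A t) u) (𝓝 s) (𝓝 (planeInt (A s) u)) := by
  have hsum : ∀ t, planeInt (A t) u + planeInt (A t) (fun z => C - u z) = C * μHE[2] (A t) := by
    intro t
    obtain ⟨S', hS'⟩ := hS t
    rw [planeInt, planeInt, ← lintegral_add_left' (hS'.aemeasurable_planeInt hr hu.measurable),
      ← setLIntegral_const]
    refine lintegral_congr fun x => ?_
    norm_cast
    exact add_tsub_cancel_of_le (hC _)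
  have hfin : C * (μHE[2] : Measure E3) (A s) ≠ ∞ :=
    ENNReal.mul_ne_top ENNReal.coe_ne_top hA.finite_area.ne
  have hcont : Continuous fun z => C - u z := by fun_prop
  refine tendsto_of_eventually_lt_of_tendsto_add (g := fun t => planeInt (A t) (fun z => C - u z))
    (b := planeInt (A s) (fun z => C - u z)) ?_
    (fun c hc => eventually_lt_planeInt_of_local hr hA hS h hu hC hc)
    (fun c hc => eventually_lt_planeInt_of_local hr hA hS h hcont (fun z => tsub_le_self) hc) ?_
  · exact ne_top_of_le_ne_top hfin (hsum s ▸ le_add_self)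
  · simp only [hsum]
    exact ENNReal.Tendsto.const_mul harea (Or.inr ENNReal.coe_ne_top)

theorem IsSurfaceFamily.tendsto_planeInt {P : Type} [TopologicalSpace P] {r : ℕ∞} (hr : 2 ≤ r)
    {M : Set E3} {A S : P → Set E3} (h : IsSurfaceFamily r M A S) {u : E3 × Plane → ℝ≥0}
    (hu : Continuous u) {C : ℝ≥0} (hC : ∀ z, u z ≤ C) (s : P) :
    Tendsto (fun t => planeInt (A t) u) (𝓝 s) (𝓝 (planeInt (A s) u)) :=
  tendsto_planeInt_of_local hr (h.isSurface s) (fun t => ⟨_, h.isSurface t⟩)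
    (fun p hp => (h.convergence s p ⟨h.subset s hp.1, hp.2⟩).exists_tendsto_planeInt hr
      (h.isSurface s)) (h.continuous_area.tendsto s) hu hC

theorem IsSurface.lintegral_coe_inducedVarifold {r : ℕ∞} (hr : 2 ≤ r) {A S : Set E3}
    (hA : IsSurface r A S) {u : E3 × Plane → ℝ≥0} (hu : Measurable u) :
    ∫⁻ z, u z ∂(inducedVarifold A : Measure (E3 × Plane)) = planeInt A u :=
  hA.lintegral_inducedVarifold hr (measurable_coe_nnreal_ennreal.comp hu)

theorem IsSurfaceFamily.continuous_inducedVarifold {P : Type} [TopologicalSpace P] {r : ℕ∞}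
    (hr : 2 ≤ r) {M : Set E3} {A S : P → Set E3} (h : IsSurfaceFamily r M A S) :
    Continuous fun t => inducedVarifold (A t) := by
  rw [continuous_iff_continuousAt]
  intro s
  rw [ContinuousAt, FiniteMeasure.tendsto_iff_forall_lintegral_tendsto]
  intro f
  simp only [(h.isSurface _).lintegral_coe_inducedVarifold hr f.continuous.measurable]
  refine h.tendsto_planeInt hr f.continuous (C := nndist f 0) (fun z => ?_) s
  exact BoundedContinuousFunction.NNReal.upper_bound f z


/-! ### Convergence of jets -/

/-- The jets of order `n` of the maps `G i` at the points `x i` converge to the jet of `g` at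
`x₀`. -/
structure JetTendsto {ι E F : Type*} [NormedAddCommGroup E] [NormedSpace ℝ E]
    [NormedAddCommGroup F] [NormedSpace ℝ F] (n : ℕ∞) (l : Filter ι) (G : ι → E → F) (x : ι → E)
    (g : E → F) (x₀ : E) : Prop where
  contDiffAt : ∀ᶠ i in l, ContDiffAt ℝ n (G i) (x i)
  contDiffAt_lim : ContDiffAt ℝ n g x₀
  tendsto : ∀ k : ℕ, (k : ℕ∞) ≤ n →
    Tendsto (fun i => iteratedFDeriv ℝ k (G i) (x i)) l (𝓝 (iteratedFDeriv ℝ k g x₀))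

namespace JetTendsto

variable {ι E F G : Type*} [NormedAddCommGroup E] [NormedSpace ℝ E]
    [NormedAddCommGroup F] [NormedSpace ℝ F] [NormedAddCommGroup G] [NormedSpace ℝ G]
    {n : ℕ∞} {l : Filter ι}

theorem apply {f : ι → E → F} {x : ι → E} {g : E → F} {x₀ : E} (h : JetTendsto n l f x g x₀) :
    Tendsto (fun i => f i (x i)) l (𝓝 (g x₀)) := by
  have h1 := h.tendsto 0 (by simp)
  have h2 := (ContinuousMultilinearMap.apply ℝ (fun _ : Fin 0 => E) F 0).continuous.tendsto
    (iteratedFDeriv ℝ 0 g x₀)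
  exact (h2.comp h1 :)

theorem const {g : E → F} (hg : ContDiff ℝ n g) {x : ι → E} {x₀ : E} (hx : Tendsto x l (𝓝 x₀)) :
    JetTendsto n l (fun _ => g) x g x₀ where
  contDiffAt := .of_forall fun _ => hg.contDiffAt
  contDiffAt_lim := hg.contDiffAt
  tendsto k hk := ((hg.continuous_iteratedFDeriv (by exact_mod_cast hk)).tendsto x₀).comp hx

/-- By Faà di Bruno's formula the `k`-th derivative of a composition is a finite sum of continuous
multilinear expressions in the derivatives of order at most `k` of the two maps. -/
theorem comp {f : ι → E → F} {x : ι → E} {g : E → F} {x₀ : E} {f' : ι → F → G} {g' : F → G}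
    (h' : JetTendsto n l f' (fun i => f i (x i)) g' (g x₀)) (h : JetTendsto n l f x g x₀) :
    JetTendsto n l (fun i => f' i ∘ f i) x (g' ∘ g) x₀ where
  contDiffAt := by
    filter_upwards [h.contDiffAt, h'.contDiffAt] with i hi hi' using hi'.comp _ hi
  contDiffAt_lim := h'.contDiffAt_lim.comp _ h.contDiffAt_lim
  tendsto k hk := by
    have hk' : (k : WithTop ℕ∞) ≤ n := by exact_mod_cast hk
    rw [iteratedFDeriv_comp h'.contDiffAt_lim h.contDiffAt_lim hk']
    have h1 : (fun i => (ftaylorSeries ℝ (f' i) (f i (x i))).taylorComp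
        (ftaylorSeries ℝ (f i) (x i)) k) =ᶠ[l] fun i => iteratedFDeriv ℝ k (f' i ∘ f i) (x i) := by
      filter_upwards [h.contDiffAt, h'.contDiffAt] with i hi hi'
      rw [iteratedFDeriv_comp hi' hi hk']
    refine Tendsto.congr' h1 ?_
    refine tendsto_finsetSum _ fun c _ => ?_
    have h2 := h'.tendsto c.length ((Nat.cast_le.2 c.length_le).trans hk)
    have h3 : Tendsto (fun i (m : Fin c.length) => iteratedFDeriv ℝ (c.partSize m) (f i) (x i)) l
        (𝓝 fun m => iteratedFDeriv ℝ (c.partSize m) g x₀) :=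
      tendsto_pi_nhds.2 fun m => h.tendsto _ ((Nat.cast_le.2 (c.partSize_le m)).trans hk)
    have h4 := ((c.compAlongOrderedFinpartitionL ℝ E F G).continuous.tendsto _).comp h2
    exact (h4.eval h3 :)

theorem sub {f f' : ι → E → F} {x : ι → E} {g g' : E → F} {x₀ : E}
    (h : JetTendsto n l f x g x₀) (h' : JetTendsto n l f' x g' x₀) :
    JetTendsto n l (fun i y => f i y - f' i y) x (fun y => g y - g' y) x₀ where
  contDiffAt := by
    filter_upwards [h.contDiffAt, h'.contDiffAt] with i hi hi' using hi.sub hi'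
  contDiffAt_lim := h.contDiffAt_lim.sub h'.contDiffAt_lim
  tendsto k hk := by
    have hk' : (k : WithTop ℕ∞) ≤ n := by exact_mod_cast hk
    rw [fun_iteratedFDeriv_sub_apply (h.contDiffAt_lim.of_le hk') (h'.contDiffAt_lim.of_le hk')]
    refine Tendsto.congr' ?_ ((h.tendsto k hk).sub (h'.tendsto k hk))
    filter_upwards [h.contDiffAt, h'.contDiffAt] with i hi hi'
    rw [fun_iteratedFDeriv_sub_apply (hi.of_le hk') (hi'.of_le hk')]

theorem add {f f' : ι → E → F} {x : ι → E} {g g' : E → F} {x₀ : E}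
    (h : JetTendsto n l f x g x₀) (h' : JetTendsto n l f' x g' x₀) :
    JetTendsto n l (fun i y => f i y + f' i y) x (fun y => g y + g' y) x₀ where
  contDiffAt := by
    filter_upwards [h.contDiffAt, h'.contDiffAt] with i hi hi' using hi.add hi'
  contDiffAt_lim := h.contDiffAt_lim.add h'.contDiffAt_lim
  tendsto k hk := by
    have hk' : (k : WithTop ℕ∞) ≤ n := by exact_mod_cast hk
    rw [fun_iteratedFDeriv_add_apply (h.contDiffAt_lim.of_le hk') (h'.contDiffAt_lim.of_le hk')]
    refine Tendsto.congr' ?_ ((h.tendsto k hk).add (h'.tendsto k hk))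
    filter_upwards [h.contDiffAt, h'.contDiffAt] with i hi hi'
    rw [fun_iteratedFDeriv_add_apply (hi.of_le hk') (hi'.of_le hk')]

end JetTendsto

/-- Reduces uniform convergence of derivatives on a compact set to convergence of jets along
converging points, where the chain rule applies directly. -/
theorem tendstoUniformlyOn_of_forall_tendsto {P E F : Type*} [TopologicalSpace P]
    [NormedAddCommGroup E] [NormedAddCommGroup F] {K : Set E} (hK : IsCompact K) {s : P}
    {f : P → E → F} (h : ∀ x ∈ K, Tendsto (fun z : P × E => f z.1 z.2) (𝓝 s ×ˢ 𝓝 x) (𝓝 0)) :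
    TendstoUniformlyOn f 0 (𝓝 s) K := by
  rw [Metric.tendstoUniformlyOn_iff]
  intro ε hε
  refine hK.eventually_forall_of_forall_eventually fun x hx => ?_
  rw [nhds_prod_eq]
  filter_upwards [h x hx (Metric.ball_mem_nhds 0 hε)] with z hz
  rw [Pi.zero_apply, dist_comm]
  exact hz

/-- A partial derivative is the full iterated derivative restricted to the directions of the second
factor. It supplies the joint continuity of the jets of a deformation in time and space. -/
theorem continuous_iteratedFDeriv_partial {E F G : Type*} [NormedAddCommGroup E] [NormedSpace ℝ E]
    [NormedAddCommGroup F] [NormedSpace ℝ F] [NormedAddCommGroup G] [NormedSpace ℝ G] {n : ℕ∞}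
    {Φ : E × F → G} (hΦ : ContDiff ℝ n Φ) {k : ℕ} (hk : (k : ℕ∞) ≤ n) :
    Continuous fun z : E × F => iteratedFDeriv ℝ k (fun y => Φ (z.1, y)) z.2 := by
  have hk' : (k : WithTop ℕ∞) ≤ n := by exact_mod_cast hk
  have h1 : ∀ z : E × F, iteratedFDeriv ℝ k (fun y => Φ (z.1, y)) z.2 =
      (iteratedFDeriv ℝ k Φ z).compContinuousLinearMap
        fun _ => ContinuousLinearMap.inr ℝ E F := by
    intro z
    have h2 : (fun y => Φ (z.1, y)) =
        (fun w => Φ (w + (z.1, 0))) ∘ ContinuousLinearMap.inr ℝ E F := by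
      ext y; simp
    have h3 : ContDiff ℝ n fun w => Φ (w + (z.1, (0 : F))) :=
      hΦ.comp (contDiff_id.add contDiff_const)
    rw [h2, (ContinuousLinearMap.inr ℝ E F).iteratedFDeriv_comp_right h3 _ hk',
      iteratedFDeriv_comp_add_right]
    simp
  simp only [h1]
  exact (ContinuousMultilinearMap.compContinuousLinearMapL
    (fun _ => ContinuousLinearMap.inr ℝ E F)).continuous.comp (hΦ.continuous_iteratedFDeriv hk')

/-! ### Diffeomorphisms close to the identity -/

/-- A map close to the identity on `ℝ³`, as a homeomorphism. -/
def IsCloseToId.homeo {ψ : E3 → E3} {ε : ℝ≥0} (h : IsCloseToId ψ univ ε) (hε : ε ≤ 1 / 4) :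
    E3 ≃ₜ E3 :=
  (h.toOPH hε).toHomeomorphOfSourceEqUnivTargetEqUniv rfl (by
    rw [h.toOPH_target hε]
    refine eq_univ_of_forall fun y => image_mono (subset_univ _)
      (h.mem_image_closedBall hε (δ := 2 * ε) le_rfl (subset_univ _)))

theorem IsCloseToId.coe_homeo {ψ : E3 → E3} {ε : ℝ≥0} (h : IsCloseToId ψ univ ε)
    (hε : ε ≤ 1 / 4) : ⇑(h.homeo hε) = ψ := rfl

/-- A `C^r` diffeomorphism of `ℝ³` that is `C¹`-close to the identity. -/
structure IsNearDiffeo (r : ℕ∞) (Ψ : E3 ≃ₜ E3) : Prop where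
  contDiff : ContDiff ℝ r Ψ
  close : IsCloseToId Ψ univ (1 / 4)

namespace IsNearDiffeo

variable {r : ℕ∞} {Ψ : E3 ≃ₜ E3}

theorem exists_hasFDerivAt (h : IsNearDiffeo r Ψ) (hr : 2 ≤ r) (x : E3) :
    ∃ L : E3 ≃L[ℝ] E3, HasFDerivAt Ψ (L : E3 →L[ℝ] E3) x := by
  obtain ⟨L, hL⟩ := h.close.exists_fderiv_equiv le_rfl (mem_univ x)
  refine ⟨L, hL ▸ ?_⟩
  exact (h.contDiff.differentiable (coe_ne_zero_of_two_le hr) x).hasFDerivAt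

theorem contDiff_symm (h : IsNearDiffeo r Ψ) (hr : 2 ≤ r) : ContDiff ℝ r Ψ.symm := by
  rw [contDiff_iff_contDiffAt]
  intro y
  obtain ⟨L, hL⟩ := h.exists_hasFDerivAt hr (Ψ.symm y)
  exact Ψ.toOpenPartialHomeomorph.contDiffAt_symm (mem_univ y) hL h.contDiff.contDiffAt

theorem dist_le (h : IsNearDiffeo r Ψ) (x y : E3) : dist (Ψ x) (Ψ y) ≤ 2 * dist x y := by
  refine (h.close.dist_image_le (mem_univ x) (mem_univ y)).trans ?_
  have : (0 : ℝ) ≤ dist x y := dist_nonneg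
  push_cast
  linarith

theorem le_dist (h : IsNearDiffeo r Ψ) (x y : E3) : dist x y ≤ 2 * dist (Ψ x) (Ψ y) := by
  refine (h.close.dist_le_image le_rfl (mem_univ x) (mem_univ y)).trans ?_
  have : (0 : ℝ) ≤ dist (Ψ x) (Ψ y) := dist_nonneg
  push_cast
  linarith

theorem isInteriorPoint_image (h : IsNearDiffeo r Ψ) (hr : 2 ≤ r) {A : Set E3} {p : E3}
    (hp : IsInteriorPoint r A p) : IsInteriorPoint r (Ψ '' A) (Ψ p) := by
  obtain ⟨φ, hpφ, h0, h1, h2, h3⟩ := hp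
  refine ⟨Ψ.symm.toOpenPartialHomeomorph.trans φ, by simpa using hpφ, by simpa using h0,
    ?_, ?_, ?_⟩
  · refine (h1.comp (h.contDiff_symm hr).contDiffOn ?_)
    intro x hx; simpa using hx
  · refine h.contDiff.comp_contDiffOn (h2.mono ?_)
    intro x hx; simpa using hx
  · intro x hx
    have hx' : Ψ.symm x ∈ φ.source := by simpa using hx
    have := h3 _ hx'
    constructor
    · rintro ⟨y, hy, rfl⟩
      simpa using this.1 (by simpa using hy)
    · intro hx0
      exact ⟨Ψ.symm x, this.2 (by simpa using hx0), by simp⟩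

theorem isBoundaryPoint_image (h : IsNearDiffeo r Ψ) (hr : 2 ≤ r) {A : Set E3} {p : E3}
    (hp : IsBoundaryPoint r A p) : IsBoundaryPoint r (Ψ '' A) (Ψ p) := by
  obtain ⟨φ, hpφ, h0, h1, h2, h3⟩ := hp
  refine ⟨Ψ.symm.toOpenPartialHomeomorph.trans φ, by simpa using hpφ, by simpa using h0,
    ?_, ?_, ?_⟩
  · refine (h1.comp (h.contDiff_symm hr).contDiffOn ?_)
    intro x hx; simpa using hx
  · refine h.contDiff.comp_contDiffOn (h2.mono ?_)
    intro x hx; simpa using hx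
  · intro x hx
    have hx' : Ψ.symm x ∈ φ.source := by simpa using hx
    have := h3 _ hx'
    constructor
    · rintro ⟨y, hy, rfl⟩
      simpa using this.1 (by simpa using hy)
    · intro hx0
      exact ⟨Ψ.symm x, this.2 (by simpa using hx0), by simp⟩

theorem isBoundaryPoint_of_image (h : IsNearDiffeo r Ψ) (hr : 2 ≤ r) {A : Set E3} {p : E3}
    (hp : IsBoundaryPoint r (Ψ '' A) (Ψ p)) : IsBoundaryPoint r A p := by
  obtain ⟨φ, hpφ, h0, h1, h2, h3⟩ := hp
  refine ⟨Ψ.toOpenPartialHomeomorph.trans φ, by simpa using hpφ, by simpa using h0, ?_, ?_, ?_⟩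
  · refine (h1.comp h.contDiff.contDiffOn ?_)
    intro x hx; simpa using hx
  · refine (h.contDiff_symm hr).comp_contDiffOn (h2.mono ?_)
    intro x hx; simpa using hx
  · intro x hx
    have hx' : Ψ x ∈ φ.source := by simpa using hx
    have := h3 _ hx'
    rw [Ψ.injective.mem_set_image] at this
    simpa using this

theorem isBoundaryPoint_image_iff (h : IsNearDiffeo r Ψ) (hr : 2 ≤ r) {A : Set E3} {p : E3} :
    IsBoundaryPoint r (Ψ '' A) (Ψ p) ↔ IsBoundaryPoint r A p :=
  ⟨h.isBoundaryPoint_of_image hr, h.isBoundaryPoint_image hr⟩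

theorem area_image_le (h : IsNearDiffeo r Ψ) (A : Set E3) :
    μHE[2] (Ψ '' A) ≤ 4 * μHE[2] A := by
  have := area_image_le_of_dist_le (K := 2) (f := Ψ) (g := id) (s := A)
    (fun x _ y _ => by simpa using h.dist_le x y)
  rw [image_id] at this
  refine this.trans (le_of_eq ?_)
  norm_num

end IsNearDiffeo


/-! ### Families of surfaces moved by families of diffeomorphisms -/

/-- A continuous family of `C^r` diffeomorphisms of `ℝ³`, `C¹`-close to the identity, that preserve
`M`. -/
structure IsNearDiffeoFamily {P : Type} [TopologicalSpace P] (r : ℕ∞) (M : Set E3)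
    (Ψ : P → E3 ≃ₜ E3) : Prop where
  near : ∀ t, IsNearDiffeo r (Ψ t)
  jets : ∀ k : ℕ, (k : ℕ∞) ≤ r → Continuous fun z : P × E3 => iteratedFDeriv ℝ k (Ψ z.1) z.2
  mem_iff : ∀ t x, Ψ t x ∈ M ↔ x ∈ M

namespace IsNearDiffeoFamily

variable {P : Type} [TopologicalSpace P] {r : ℕ∞} {M : Set E3} {Ψ : P → E3 ≃ₜ E3}

theorem image_eq (h : IsNearDiffeoFamily r M Ψ) (t : P) : Ψ t '' M = M := by
  ext x
  constructor
  · rintro ⟨y, hy, rfl⟩; exact (h.mem_iff t y).2 hy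
  · intro hx
    exact ⟨(Ψ t).symm x, (h.mem_iff t _).1 (by simpa using hx), by simp⟩

theorem image_frontier (h : IsNearDiffeoFamily r M Ψ) (t : P) :
    Ψ t '' frontier M = frontier M := by
  rw [(Ψ t).image_frontier, h.image_eq]

theorem mem_frontier_iff (h : IsNearDiffeoFamily r M Ψ) (t : P) (x : E3) :
    Ψ t x ∈ frontier M ↔ x ∈ frontier M := by
  conv_lhs => rw [← h.image_frontier t]
  exact (Ψ t).injective.mem_set_image

theorem mem_interior_iff (h : IsNearDiffeoFamily r M Ψ) (t : P) (x : E3) :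
    Ψ t x ∈ interior M ↔ x ∈ interior M := by
  conv_lhs => rw [← h.image_eq t, ← (Ψ t).image_interior]
  exact (Ψ t).injective.mem_set_image

theorem jetTendsto (h : IsNearDiffeoFamily r M Ψ) {ι : Type*} {l : Filter ι} {t : ι → P}
    {x : ι → E3} {s : P} {x₀ : E3} (ht : Tendsto t l (𝓝 s)) (hx : Tendsto x l (𝓝 x₀)) :
    JetTendsto r l (fun i => Ψ (t i)) x (Ψ s) x₀ where
  contDiffAt := .of_forall fun i => (h.near (t i)).contDiff.contDiffAt
  contDiffAt_lim := (h.near s).contDiff.contDiffAt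
  tendsto k hk := ((h.jets k hk).tendsto (s, x₀)).comp (ht.prodMk_nhds hx)

theorem continuous (h : IsNearDiffeoFamily r M Ψ) : Continuous fun z : P × E3 => Ψ z.1 z.2 := by
  rw [continuous_iff_continuousAt]
  intro z
  exact (h.jetTendsto (continuous_fst.tendsto z) (continuous_snd.tendsto z)).apply

end IsNearDiffeoFamily

theorem ConvergesSmoothlyNear.comp {P Q : Type} [TopologicalSpace P] [TopologicalSpace Q] {r : ℕ∞}
    {A : P → Set E3} {f : Q → P} (hf : Continuous f) {q : Q} {p : E3}
    (h : ConvergesSmoothlyNear r A (f q) p) : ConvergesSmoothlyNear r (fun q => A (f q)) q p := by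
  obtain ⟨ρ, hρ, ψ, h1, h2⟩ := h
  exact ⟨ρ, hρ, fun q => ψ (f q), (hf.tendsto q).eventually h1,
    fun k hk u hu => (hf.tendsto q).eventually (h2 k hk u hu)⟩

theorem IsSurfaceFamily.comp {P Q : Type} [TopologicalSpace P] [TopologicalSpace Q] {r : ℕ∞}
    {M : Set E3} {A S : P → Set E3} (h : IsSurfaceFamily r M A S) {f : Q → P} (hf : Continuous f) :
    IsSurfaceFamily r M (fun q => A (f q)) (fun q => S (f q)) where
  isClosed q := h.isClosed _
  subset q := h.subset _
  finite_area q := h.finite_area _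
  finite_sing q := h.finite_sing _
  smooth q := h.smooth _
  hausdorff q := (h.hausdorff (f q)).comp (hf.tendsto q)
  convergence q p hp := (h.convergence (f q) p hp).comp hf
  continuous_area := h.continuous_area.comp hf

theorem jetTendsto_of_tendstoUniformlyOn {P : Type} [TopologicalSpace P] {r : ℕ∞} {s : P}
    {ψ : P → E3 → E3} {p : E3} {ρ : ℝ}
    (hd : ∀ᶠ t in 𝓝 s, ContDiffOn ℝ r (ψ t) (Metric.ball p ρ))
    (hψ : ∀ k : ℕ, (k : ℕ∞) ≤ r →
      TendstoUniformlyOn (fun t x => iteratedFDeriv ℝ k (fun y => ψ t y - y) x) 0 (𝓝 s)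
        (Metric.ball p ρ)) {ι : Type*} {l : Filter ι} {t : ι → P} {x : ι → E3} {x₀ : E3}
    (ht : Tendsto t l (𝓝 s)) (hx : Tendsto x l (𝓝 x₀)) (hx₀ : x₀ ∈ Metric.ball p ρ) :
    JetTendsto r l (fun i => ψ (t i)) x id x₀ := by
  have hd' : ∀ᶠ i in l, ContDiffAt ℝ r (ψ (t i)) (x i) := by
    filter_upwards [ht.eventually hd, hx.eventually (Metric.isOpen_ball.mem_nhds hx₀)] with i h1 h2
    exact h1.contDiffAt (Metric.isOpen_ball.mem_nhds h2)
  have h1 : JetTendsto r l (fun i y => ψ (t i) y - y) x (fun _ => 0) x₀ := by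
    refine ⟨hd'.mono fun i hi => hi.sub contDiffAt_id, contDiffAt_const, fun k hk => ?_⟩
    have h0 : iteratedFDeriv ℝ k (fun _ : E3 => (0 : E3)) x₀ = 0 := by
      rw [iteratedFDeriv_fun_zero]; rfl
    rw [h0, Metric.tendsto_nhds]
    intro ε hε
    filter_upwards [ht.eventually (Metric.tendstoUniformlyOn_iff.1 (hψ k hk) ε hε),
      hx.eventually (Metric.isOpen_ball.mem_nhds hx₀)] with i h1 h2
    rw [dist_comm]
    exact h1 _ h2
  have h2 := h1.add (JetTendsto.const (n := r) (g := (id : E3 → E3)) contDiff_id hx)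
  have e1 : (fun i y => ψ (t i) y - y + id y) = fun i => ψ (t i) := by
    ext i y; simp
  have e2 : (fun y : E3 => (0 : E3) + id y) = id := by ext y; simp
  rwa [e1, e2] at h2

theorem image_inter_image_eq {X : Type*} {A A' B B' : Set X} {ψ : X → X} (hψ : InjOn ψ B)
    (h : A' ∩ ψ '' B = ψ '' (A ∩ B)) (hB : B' ⊆ B) : A' ∩ ψ '' B' = ψ '' (A ∩ B') := by
  ext y
  constructor
  · rintro ⟨hy, x, hx, rfl⟩
    obtain ⟨z, hz, hzx⟩ := (h ▸ ⟨hy, mem_image_of_mem ψ (hB hx)⟩ : ψ x ∈ ψ '' (A ∩ B))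
    rw [hψ hz.2 (hB hx) hzx] at hz
    exact ⟨x, ⟨hz.1, hx⟩, rfl⟩
  · rintro ⟨x, hx, rfl⟩
    exact ⟨(h.symm ▸ ⟨x, ⟨hx.1, hB hx.2⟩, rfl⟩ : ψ x ∈ A' ∩ ψ '' B).1, x, hx.2, rfl⟩

/-- The maps `Ψ t ∘ ψ t ∘ (Ψ s)⁻¹` carry the image of `A s` to that of `A t`. Their jets converge to
those of `Ψ s ∘ (Ψ s)⁻¹ = id` by the chain rule, and compactness of a closed ball makes the
convergence uniform. -/
theorem ConvergesSmoothlyNear.image {P : Type} [TopologicalSpace P] {r : ℕ∞} (hr : 2 ≤ r)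
    {M : Set E3} {Ψ : P → E3 ≃ₜ E3} (hΨ : IsNearDiffeoFamily r M Ψ) {A : P → Set E3} {s : P}
    {p : E3} (h : ConvergesSmoothlyNear r A s p) :
    ConvergesSmoothlyNear r (fun t => Ψ t '' A t) s (Ψ s p) := by
  obtain ⟨ρ, hρ, ψ, h1, h2⟩ := h
  have hnh : (Ψ s).symm ⁻¹' Metric.ball p ρ ∈ 𝓝 (Ψ s p) :=
    (Ψ s).symm.continuous.continuousAt.preimage_mem_nhds
      (by simpa using Metric.ball_mem_nhds p hρ)
  obtain ⟨ρ', hρ', hsub⟩ := Metric.nhds_basis_closedBall.mem_iff.1 hnh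
  have hsub' : Metric.ball (Ψ s p) ρ' ⊆ (Ψ s).symm ⁻¹' Metric.ball p ρ :=
    Metric.ball_subset_closedBall.trans hsub
  have hsymm := (hΨ.near s).contDiff_symm hr
  refine ⟨ρ', hρ', fun t => Ψ t ∘ ψ t ∘ (Ψ s).symm, ?_, fun k hk => ?_⟩
  · filter_upwards [h1, eventually_isCloseToId hr (h1.mono fun t ht => ht.1) h2
      (ε := 1 / 4) (by positivity)] with t ht hc
    refine ⟨(hΨ.near t).contDiff.comp_contDiffOn (ht.1.comp hsymm.contDiffOn hsub'), ?_⟩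
    have hB : (Ψ s).symm '' Metric.ball (Ψ s p) ρ' ⊆ Metric.ball p ρ := image_subset_iff.2 hsub'
    have h3 := image_inter_image_eq (hc.injOn le_rfl) ht.2 hB
    have h4 : (Ψ s).symm '' (Ψ s '' A s ∩ Metric.ball (Ψ s p) ρ') =
        A s ∩ (Ψ s).symm '' Metric.ball (Ψ s p) ρ' := by
      rw [image_inter (Ψ s).symm.injective, ← image_comp]
      simp
    rw [image_comp, image_comp, image_comp, image_comp, h4, ← h3, image_inter (Ψ t).injective]
  · refine TendstoUniformlyOn.mono ?_ Metric.ball_subset_closedBall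
    refine tendstoUniformlyOn_of_forall_tendsto (isCompact_closedBall _ _) fun x hx => ?_
    have j1 : JetTendsto r (𝓝 s ×ˢ 𝓝 x) (fun _ : P × E3 => ⇑(Ψ s).symm) Prod.snd (Ψ s).symm x :=
      JetTendsto.const hsymm tendsto_snd
    have j2 : JetTendsto r (𝓝 s ×ˢ 𝓝 x) (fun z : P × E3 => ψ z.1) (fun z => (Ψ s).symm z.2) id
        ((Ψ s).symm x) :=
      jetTendsto_of_tendstoUniformlyOn (h1.mono fun t ht => ht.1) h2 tendsto_fst j1.apply
        (hsub hx)
    have j3 := j2.comp j1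
    have j4 : JetTendsto r (𝓝 s ×ˢ 𝓝 x) (fun z : P × E3 => ⇑(Ψ z.1))
        (fun z => (ψ z.1 ∘ (Ψ s).symm) z.2) (Ψ s) ((id ∘ (Ψ s).symm) x) :=
      hΨ.jetTendsto tendsto_fst j3.apply
    have j5 := (j4.comp j3).sub (JetTendsto.const (g := (id : E3 → E3)) contDiff_id
      (x := Prod.snd) (tendsto_snd : Tendsto _ (𝓝 s ×ˢ 𝓝 x) _))
    have e1 : (fun y => (Ψ s ∘ id ∘ (Ψ s).symm) y - id y) = fun _ : E3 => (0 : E3) := by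
      ext y; simp
    have h5 := j5.tendsto k hk
    rw [e1, iteratedFDeriv_fun_zero] at h5
    exact h5

theorem IsNearDiffeo.infEDist_image_le {r : ℕ∞} {Ψ : E3 ≃ₜ E3} (h : IsNearDiffeo r Ψ) (A : Set E3)
    (x : E3) : Metric.infEDist (Ψ x) (Ψ '' A) ≤ 2 * Metric.infEDist x A := by
  rw [mul_comm, ← ENNReal.div_le_iff_le_mul (by simp) (by simp)]
  rw [Metric.le_infEDist]
  intro y hy
  rw [ENNReal.div_le_iff_le_mul (by simp) (by simp)]
  refine (Metric.infEDist_le_edist_of_mem (mem_image_of_mem Ψ hy)).trans ?_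
  have := ENNReal.ofReal_le_ofReal (h.dist_le x y)
  rwa [ENNReal.ofReal_mul (by norm_num), ENNReal.ofReal_ofNat, ← edist_dist, ← edist_dist,
    mul_comm] at this

theorem IsNearDiffeoFamily.isSurface_image {P : Type} [TopologicalSpace P] {r : ℕ∞} (hr : 2 ≤ r)
    {M : Set E3} {Ψ : P → E3 ≃ₜ E3} (hΨ : IsNearDiffeoFamily r M Ψ) {A S : Set E3}
    (h : IsSurface r A S) (t : P) : IsSurface r (Ψ t '' A) (Ψ t '' S) where
  isClosed := (Ψ t).isClosed_image.2 h.isClosed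
  finite_area := ((hΨ.near t).area_image_le A).trans_lt
    (ENNReal.mul_lt_top (by simp) h.finite_area)
  finite_sing := h.finite_sing.image _
  regular := by
    rw [← image_sdiff (Ψ t).injective]
    rintro _ ⟨p, hp, rfl⟩
    exact (h.regular p hp).imp ((hΨ.near t).isInteriorPoint_image hr)
      ((hΨ.near t).isBoundaryPoint_image hr)

theorem planeInt_one (A : Set E3) : planeInt A (fun _ => 1) = μHE[2] A := by
  simp [planeInt]

/-- Lower semicontinuity is local. For the upper bound, cutoffs `G n` split off the part near the
singular points. The image of that part has at most 4 times its area, and its area in `A t` is small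
for `t` near `s`, because the weighted integrals over the unmoved family are already known to be
continuous. -/
theorem IsSurfaceFamily.tendsto_area_image {P : Type} [TopologicalSpace P] {r : ℕ∞} (hr : 2 ≤ r)
    {M : Set E3} (hM : IsCompact M) {Ψ : P → E3 ≃ₜ E3} (hΨ : IsNearDiffeoFamily r M Ψ)
    {A S : P → Set E3} (h : IsSurfaceFamily r M A S) (s : P) :
    Tendsto (fun t => (μHE[2] : Measure E3) (Ψ t '' A t)) (𝓝 s) (𝓝 (μHE[2] (Ψ s '' A s))) := by
  have hS : ∀ t, IsSurface r (Ψ t '' A t) (Ψ t '' S t) := fun t =>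
    hΨ.isSurface_image hr (h.isSurface t) t
  have hloc : ∀ p ∈ Ψ s '' A s \ Ψ s '' S s, ∃ ρ > 0, ∀ u : E3 × Plane → ℝ≥0, Continuous u →
      (∀ z, z.1 ∉ Metric.ball p ρ → u z = 0) →
      Tendsto (fun t => planeInt (Ψ t '' A t) u) (𝓝 s) (𝓝 (planeInt (Ψ s '' A s) u)) := by
    rw [← image_sdiff (Ψ s).injective]
    rintro _ ⟨p, hp, rfl⟩
    exact ((h.convergence s p ⟨h.subset s hp.1, hp.2⟩).image hr hΨ).exists_tendsto_planeInt hr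
      (hS s)
  rw [tendsto_order]
  constructor
  · intro b hb
    rw [← planeInt_one] at hb
    have := eventually_lt_planeInt_of_local (A := fun t => Ψ t '' A t) hr (hS s)
      (fun t => ⟨_, hS t⟩) hloc
      (u := fun _ => 1) continuous_const (C := 1) (fun _ => le_rfl) hb
    simpa only [planeInt_one] using this
  intro b hb
  choose! ρ hρ hloc using hloc
  obtain ⟨f, hfc, hf0, hf1, hflim⟩ := exists_cutoffs _ ρ hρ
  let G : ℕ → E3 → ℝ≥0 := fun n x => ∑ i ∈ Finset.range n, f n i x
  have hGc : ∀ n, Continuous (G n) := fun n => continuous_finsetSum _ fun i _ => hfc n i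
  have hA := h.isSurface s
  have hfin := hA.isFiniteMeasure
  have hlim : Tendsto (fun n => planeInt (A s) (fun z => 1 - G n (Ψ s z.1))) atTop (𝓝 0) := by
    have h1 : Tendsto (fun n => planeInt (A s) (fun z => 1 - G n (Ψ s z.1))) atTop
        (𝓝 (∫⁻ x in A s, 0 ∂(μHE[2] : Measure E3))) := by
      refine tendsto_lintegral_of_dominated_convergence' (fun _ => 1)
        (fun n => hA.aemeasurable_planeInt hr (u := fun z => 1 - G n (Ψ s z.1))
          (Continuous.measurable ?_)) (fun n => ae_of_all _ fun x => ?_) ?_ ?_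
      · exact continuous_const.sub ((hGc n).comp ((Ψ s).continuous.comp continuous_fst))
      · exact ENNReal.coe_le_coe.2 tsub_le_self
      · rw [lintegral_const]
        exact ENNReal.mul_ne_top ENNReal.one_ne_top (measure_ne_top _ _)
      · filter_upwards [hA.ae_restrict] with x hx
        have h2 := hflim (Ψ s x) (by
          rw [← image_sdiff (Ψ s).injective]; exact mem_image_of_mem _ hx)
        have h3 : Tendsto (fun n => 1 - G n (Ψ s x)) atTop (𝓝 (1 - 1)) :=
          ((continuous_const.sub continuous_id).tendsto (1 : ℝ≥0)).comp h2
        rw [tsub_self] at h3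
        exact ENNReal.tendsto_coe.2 h3
    simpa using h1
  -- The slack `η` pays for replacing `Ψ t` by `Ψ s` inside the cutoff, after which the test
  -- function no longer depends on `t`.
  obtain ⟨η, hη, hηb⟩ : ∃ η : ℝ≥0, 0 < η ∧
      μHE[2] (Ψ s '' A s) + 4 * (η * μHE[2] (A s)) < b := by
    have : Tendsto (fun η : ℝ≥0 => (μHE[2] : Measure E3) (Ψ s '' A s) + 4 * (η * μHE[2] (A s)))
        (𝓝[>] 0) (𝓝 (μHE[2] (Ψ s '' A s) + 4 * ((0 : ℝ≥0) * μHE[2] (A s)))) := by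
      refine tendsto_const_nhds.add (ENNReal.Tendsto.const_mul (ENNReal.Tendsto.mul_const
        (ENNReal.tendsto_coe.2 tendsto_id) (Or.inr hA.finite_area.ne)) (Or.inr (by simp))) 
        |>.mono_left nhdsWithin_le_nhds
    simp only [ENNReal.coe_zero, zero_mul, mul_zero, add_zero] at this
    obtain ⟨η, h1, h2⟩ := ((this.eventually (gt_mem_nhds hb)).and self_mem_nhdsWithin).exists
    exact ⟨η, h2, h1⟩
  obtain ⟨n, hn⟩ : ∃ n, μHE[2] (Ψ s '' A s) +
      4 * (planeInt (A s) (fun z => 1 - G n (Ψ s z.1)) + η * μHE[2] (A s)) < b := by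
    have : Tendsto (fun n => (μHE[2] : Measure E3) (Ψ s '' A s) +
      4 * (planeInt (A s) (fun z => 1 - G n (Ψ s z.1)) + η * μHE[2] (A s))) atTop
        (𝓝 (μHE[2] (Ψ s '' A s) + 4 * (0 + η * μHE[2] (A s)))) :=
      tendsto_const_nhds.add (ENNReal.Tendsto.const_mul (hlim.add tendsto_const_nhds)
        (Or.inr (by simp)))
    rw [zero_add] at this
    exact (this.eventually (gt_mem_nhds hηb)).exists
  have hmain : Tendsto (fun t => planeInt (Ψ t '' A t) (fun z => G n z.1 * 1) +
      4 * (planeInt (A t) (fun z => 1 - G n (Ψ s z.1)) + η * μHE[2] (A t))) (𝓝 s)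
      (𝓝 (planeInt (Ψ s '' A s) (fun z => G n z.1 * 1) +
      4 * (planeInt (A s) (fun z => 1 - G n (Ψ s z.1)) + η * μHE[2] (A s)))) := by
    refine (tendsto_planeInt_cutoff hr (fun t => ⟨_, hS t⟩) hloc (hfc n) (hf0 n)
      continuous_const n).add (ENNReal.Tendsto.const_mul ((h.tendsto_planeInt hr
        (u := fun z => 1 - G n (Ψ s z.1)) ?_ (C := 1) (fun z => tsub_le_self) s).add
        (ENNReal.Tendsto.const_mul (h.continuous_area.tendsto s) (Or.inr (by simp))))
        (Or.inr (by simp)))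
    exact continuous_const.sub ((hGc n).comp ((Ψ s).continuous.comp continuous_fst))
  have hlt : planeInt (Ψ s '' A s) (fun z => G n z.1 * 1) +
      4 * (planeInt (A s) (fun z => 1 - G n (Ψ s z.1)) + η * μHE[2] (A s)) < b := by
    refine lt_of_le_of_lt ?_ hn
    gcongr
    rw [← planeInt_one]
    refine lintegral_mono fun x => ENNReal.coe_le_coe.2 ?_
    simpa using hf1 n x
  have hunif : ∀ᶠ t in 𝓝 s, ∀ x ∈ M, 1 - G n (Ψ t x) ≤ 1 - G n (Ψ s x) + η := by
    refine hM.eventually_forall_of_forall_eventually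
      (P := fun t x => 1 - G n (Ψ t x) ≤ 1 - G n (Ψ s x) + η) fun x _ => ?_
    have c1 : Continuous fun z : P × E3 => 1 - G n (Ψ z.1 z.2) :=
      continuous_const.sub ((hGc n).comp hΨ.continuous)
    have c2 : Continuous fun z : P × E3 => 1 - G n (Ψ s z.2) + η :=
      (continuous_const.sub ((hGc n).comp ((Ψ s).continuous.comp continuous_snd))).add
        continuous_const
    have : ∀ᶠ z : P × E3 in 𝓝 (s, x), 1 - G n (Ψ z.1 z.2) < 1 - G n (Ψ s z.2) + η :=
      c1.continuousAt.eventually_lt c2.continuousAt (lt_add_of_pos_right _ hη)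
    exact this.mono fun z hz => hz.le
  filter_upwards [hmain.eventually (gt_mem_nhds hlt), hunif] with t ht htu
  refine lt_of_le_of_lt ?_ ht
  have e1 : (μHE[2] : Measure E3) (Ψ t '' A t) = planeInt (Ψ t '' A t) (fun z => G n z.1 * 1) +
      ∫⁻ x in Ψ t '' A t, ((1 - G n x : ℝ≥0) : ℝ≥0∞) ∂(μHE[2] : Measure E3) := by
    rw [planeInt, ← lintegral_add_left (by
      exact measurable_coe_nnreal_ennreal.comp ((hGc n).mul continuous_const).measurable),
      ← planeInt_one]
    refine lintegral_congr fun x => ?_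
    norm_cast
    rw [mul_one, add_tsub_cancel_of_le (hf1 n x)]
  rw [e1]
  gcongr
  refine (lintegral_image_le (K := 2) (h.isClosed t).measurableSet
    (fun x _ y _ => (hΨ.near t).dist_le x y) _).trans ?_
  have e4 : ((2 : ℝ≥0) : ℝ≥0∞) ^ 2 = 4 := by norm_num
  rw [e4]
  gcongr
  rw [← setLIntegral_const, planeInt, ← lintegral_add_right _ measurable_const]
  refine setLIntegral_mono_ae' (h.isClosed t).measurableSet (ae_of_all _ fun x hx => ?_)
  exact_mod_cast htu x (h.subset t hx)

theorem IsSurfaceFamily.image {P : Type} [TopologicalSpace P] {r : ℕ∞} (hr : 2 ≤ r)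
    {M : Set E3} (hM : IsCompact M) {Ψ : P → E3 ≃ₜ E3} (hΨ : IsNearDiffeoFamily r M Ψ)
    {A S : P → Set E3} (h : IsSurfaceFamily r M A S) :
    IsSurfaceFamily r M (fun t => Ψ t '' A t) (fun t => Ψ t '' S t) where
  isClosed t := (Ψ t).isClosed_image.2 (h.isClosed t)
  subset t := by
    rintro _ ⟨x, hx, rfl⟩
    exact (hΨ.mem_iff t x).2 (h.subset t hx)
  finite_area t := (hΨ.isSurface_image hr (h.isSurface t) t).finite_area
  finite_sing t := (h.finite_sing t).image _
  smooth t := by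
    rw [← image_sdiff (Ψ t).injective]
    rintro _ ⟨p, hp, rfl⟩
    exact (h.smooth t p hp).imp ((hΨ.near t).isInteriorPoint_image hr)
      fun hb => ⟨(hΨ.near t).isBoundaryPoint_image hr hb.1, (hΨ.mem_frontier_iff t p).2 hb.2⟩
  hausdorff s := by
    have h1 : ∀ ε : ℝ≥0∞, 0 < ε → ∀ᶠ t in 𝓝 s, ∀ x ∈ M, edist (Ψ t x) (Ψ s x) ≤ ε := by
      intro ε hε
      refine hM.eventually_forall_of_forall_eventually
        (P := fun t x => edist (Ψ t x) (Ψ s x) ≤ ε) fun x _ => ?_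
      have c : Continuous fun z : P × E3 => edist (Ψ z.1 z.2) (Ψ s z.2) :=
        hΨ.continuous.edist ((Ψ s).continuous.comp continuous_snd)
      have h0 : (fun z : P × E3 => edist (Ψ z.1 z.2) (Ψ s z.2)) (s, x) < ε := by simpa using hε
      exact (c.continuousAt.eventually (gt_mem_nhds h0)).mono fun z hz => hz.le
    rw [ENNReal.tendsto_nhds_zero]
    intro ε hε
    have h2 := ENNReal.tendsto_nhds_zero.1 (h.hausdorff s) (ε / 4)
      (ENNReal.div_pos hε.ne' (by simp))
    filter_upwards [h1 (ε / 2) (ENNReal.div_pos hε.ne' (by simp)), h2] with t ht1 ht2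
    refine iSup₂_le fun y hy => ?_
    obtain ⟨x, hx, rfl⟩ := hy
    have e1 : Metric.infEDist (Ψ t x) (Ψ s '' A s) ≤
        Metric.infEDist (Ψ s x) (Ψ s '' A s) + edist (Ψ t x) (Ψ s x) := by
      exact Metric.infEDist_le_infEDist_add_edist
    refine e1.trans ?_
    have e2 := ((hΨ.near s).infEDist_image_le (A s) x).trans
      (mul_le_mul_right ((le_iSup₂ (f := fun x _ => Metric.infEDist x (A s)) x hx).trans ht2) 2)
    calc _ ≤ 2 * (ε / 4) + ε / 2 := add_le_add e2 (ht1 x (h.subset t hx))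
      _ = ε := by
        rw [show (4 : ℝ≥0∞) = 2 * 2 by norm_num, ENNReal.div_eq_inv_mul,
          ENNReal.mul_inv (by simp) (by simp), ← mul_assoc, ← mul_assoc,
          ENNReal.mul_inv_cancel (by simp) (by simp), one_mul, ← ENNReal.div_eq_inv_mul,
          ENNReal.add_halves]
  convergence s := by
    have : M \ Ψ s '' S s = Ψ s '' (M \ S s) := by
      rw [image_sdiff (Ψ s).injective, hΨ.image_eq]
    rw [this]
    rintro _ ⟨p, hp, rfl⟩
    exact (h.convergence s p hp).image hr hΨ
  continuous_area := continuous_iff_continuousAt.2 (h.tendsto_area_image hr hM hΨ)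


/-! ### The perimeter measure and the reduced boundary -/

theorem inner_stdE (i : Fin 3) (y : E3) : inner ℝ (stdE i) y = y i := by
  rw [stdE, EuclideanSpace.inner_single_left]
  simp

theorem fullDiv_eq_sum (X : E3 → E3) (x : E3) : fullDiv X x = ∑ j, fderiv ℝ X x (stdE j) j := by
  rw [fullDiv, LinearMap.trace_eq_sum_inner _ (EuclideanSpace.basisFun (Fin 3) ℝ)]
  refine Finset.sum_congr rfl fun j _ => ?_
  rw [EuclideanSpace.basisFun_apply]
  exact inner_stdE j _

/-- `Ω` has no perimeter in `U`. -/
def PerimeterNull (Ω U : Set E3) : Prop :=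
  ∀ T : E3 → E3, ContDiff ℝ 1 T → HasCompactSupport T → tsupport T ⊆ U →
    ∫ x in Ω, fullDiv T x = 0

namespace IsGaussGreen

variable {Ω : Set E3} {μ : Measure E3} {ν : E3 → E3}

theorem integrable (h : IsGaussGreen Ω μ ν) : Integrable ν μ := by
  have := h.finite
  exact Integrable.of_bound h.measurable.aestronglyMeasurable 1 (h.unit.mono fun x hx => hx.le)

theorem measure_eq_zero_of_forall (h : IsGaussGreen Ω μ ν) {U : Set E3} (hU : IsOpen U)
    (h0 : ∀ᵐ x ∂μ, x ∈ U → ν x = 0) : μ U = 0 := by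
  have h1 : ∀ᵐ x ∂μ, x ∉ U := by
    filter_upwards [h0, h.unit] with x h1 h2 h3
    rw [h1 h3, norm_zero] at h2
    exact zero_ne_one h2
  exact measure_eq_zero_iff_ae_notMem.2 h1

theorem locallyIntegrable_inner (h : IsGaussGreen Ω μ ν) {V : E3 → E3} (hV : Continuous V) :
    LocallyIntegrable (fun x => inner ℝ (V x) (ν x)) μ := by
  have := h.finite
  rw [locallyIntegrable_iff]
  intro K hK
  obtain ⟨C, hC⟩ := hK.exists_bound_of_continuousOn hV.continuousOn
  refine Measure.integrableOn_of_bounded (M := C) hK.measure_lt_top.ne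
    (hV.aestronglyMeasurable.inner h.measurable.aestronglyMeasurable) ?_
  filter_upwards [ae_restrict_mem hK.measurableSet, ae_restrict_of_ae h.unit] with x hx h1
  refine (norm_inner_le_norm _ _).trans ?_
  rw [h1, mul_one]
  exact hC x hx

/-- The fundamental lemma of the calculus of variations, applied to the density `V · ν`: by
Gauss–Green its integrals against `g` are those of `div (g V)` over `Ω`. -/
theorem ae_coord_eq_zero (h : IsGaussGreen Ω μ ν) {U : Set E3} (hU : IsOpen U)
    {V : E3 → E3} (hV : ContDiff ℝ 1 V)
    (h0 : ∀ g : E3 → ℝ, ContDiff ℝ 1 g → HasCompactSupport g → tsupport g ⊆ U →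
      ∫ x in Ω, fullDiv (fun y => g y • V y) x = 0) :
    ∀ᵐ x ∂μ, x ∈ U → inner ℝ (V x) (ν x) = 0 := by
  have := h.finite
  refine hU.ae_eq_zero_of_integral_contDiff_smul_eq_zero ?_ fun g hg hgc hgU => ?_
  · exact (h.locallyIntegrable_inner hV.continuous).locallyIntegrableOn _
  · have hg1 : ContDiff ℝ 1 g := hg.of_le (by exact_mod_cast le_top)
    have h3 := h.formula (fun y => g y • V y) (hg1.smul hV) hgc.smul_right
    rw [h0 g hg1 hgc hgU] at h3
    rw [h3]
    refine integral_congr_ae (ae_of_all _ fun x => ?_)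
    simp only [smul_eq_mul, inner_smul_left]
    rfl

/-- The right-hand side involves only `Ω`, so whether an open set carries perimeter does not depend
on the chosen pair `μ, ν`. This is what makes points of `reducedBoundary`, which come with their own
pair, comparable to a given one. -/
theorem measure_eq_zero_iff (h : IsGaussGreen Ω μ ν) {U : Set E3} (hU : IsOpen U) :
    μ U = 0 ↔ PerimeterNull Ω U := by
  constructor
  · intro h0 T hT hTc hTU
    rw [h.formula T hT hTc]
    refine integral_eq_zero_of_ae ?_
    filter_upwards [measure_eq_zero_iff_ae_notMem.1 h0] with x hx
    rw [image_eq_zero_of_notMem_tsupport fun h => hx (hTU h), inner_zero_left]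
    rfl
  · intro h0
    refine h.measure_eq_zero_of_forall hU ?_
    have h1 : ∀ i : Fin 3, ∀ᵐ x ∂μ, x ∈ U → inner ℝ (stdE i) (ν x) = 0 := fun i =>
      h.ae_coord_eq_zero hU (V := fun _ => stdE i) contDiff_const fun g hg hgc hgU =>
        h0 _ (hg.smul contDiff_const) hgc.smul_right ((tsupport_smul_subset_left _ _).trans hgU)
    filter_upwards [h1 0, h1 1, h1 2] with x h1 h2 h3 hx
    rw [inner_stdE] at h1 h2 h3
    rw [eq_sum_stdE (ν x), h1 hx, h2 hx, h3 hx]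
    simp

/-- Besicovitch's differentiation theorem: almost every point of the support is a Lebesgue point of
`ν`, and there `|ν| = 1`. -/
theorem ae_mem_reducedBoundary (h : IsGaussGreen Ω μ ν) : ∀ᵐ x ∂μ, x ∈ reducedBoundary Ω := by
  have := h.finite
  have h1 := (Besicovitch.vitaliFamily μ).ae_tendsto_average h.integrable.locallyIntegrable
  filter_upwards [h1, h.unit, Measure.support_mem_ae (μ := μ)] with x hx hx1 hx2
  refine ⟨μ, ν, h, fun ρ hρ => ?_, ν x, hx1, hx.comp (Besicovitch.tendsto_filterAt μ x)⟩
  exact ((Measure.mem_support_iff_forall x).1 hx2 _ (Metric.closedBall_mem_nhds x hρ))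

theorem measure_ne_zero_of_mem (h : IsGaussGreen Ω μ ν) {x : E3} (hx : x ∈ reducedBoundary Ω)
    {U : Set E3} (hU : IsOpen U) (hxU : x ∈ U) : μ U ≠ 0 := by
  obtain ⟨μ', ν', h', hpos, -⟩ := hx
  rw [Ne, h.measure_eq_zero_iff hU, ← h'.measure_eq_zero_iff hU]
  obtain ⟨ρ, hρ, hsub⟩ := Metric.nhds_basis_closedBall.mem_iff.1 (hU.mem_nhds hxU)
  exact ((hpos ρ hρ).trans_le (measure_mono hsub)).ne'

end IsGaussGreen


/-! ### The Piola identity -/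

/-- The entries of the Jacobian matrix. -/
def jac (Ψ : E3 → E3) (i j : Fin 3) (x : E3) : ℝ := fderiv ℝ Ψ x (stdE j) i

/-- The cofactors of the Jacobian matrix. -/
def cofactor (Ψ : E3 → E3) (i j : Fin 3) (x : E3) : ℝ :=
  jac Ψ (i + 1) (j + 1) x * jac Ψ (i + 2) (j + 2) x -
    jac Ψ (i + 1) (j + 2) x * jac Ψ (i + 2) (j + 1) x

/-- The Piola transform of a vector field. -/
def piola (Ψ T : E3 → E3) (x : E3) : E3 :=
  ∑ j, (∑ i, T (Ψ x) i * cofactor Ψ i j x) • stdE j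

theorem det_fderiv_eq (Ψ : E3 → E3) (x : E3) : (fderiv ℝ Ψ x).det =
    ∑ j, jac Ψ 0 j x * cofactor Ψ 0 j x := by
  have h1 : (fderiv ℝ Ψ x).det = (Matrix.of fun i j => jac Ψ i j x).det := by
    rw [ContinuousLinearMap.det, ← LinearMap.det_toMatrix (EuclideanSpace.basisFun (Fin 3) ℝ).toBasis]
    congr 1
  rw [h1, Matrix.det_fin_three]
  simp only [Fin.sum_univ_three, cofactor, Matrix.of_apply, Fin.isValue, Fin.reduceAdd, zero_add]
  ring

section

variable {Ψ T : E3 → E3}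

theorem hasFDerivAt_coord {X : E3 → E3} {L : E3 →L[ℝ] E3} {x : E3} (h : HasFDerivAt X L x)
    (i : Fin 3) : HasFDerivAt (fun y => X y i) (coordL i ∘L L) x :=
  (coordL i).hasFDerivAt.comp x h

theorem hasFDerivAt_jac (hΨ : ContDiff ℝ 2 Ψ) (i j : Fin 3) (x : E3) :
    HasFDerivAt (jac Ψ i j)
      (coordL i ∘L (ContinuousLinearMap.apply ℝ E3 (stdE j)) ∘L fderiv ℝ (fderiv ℝ Ψ) x) x := by
  have h1 : HasFDerivAt (fderiv ℝ Ψ) (fderiv ℝ (fderiv ℝ Ψ) x) x :=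
    ((hΨ.fderiv_right (m := 1) (by norm_num)).differentiable one_ne_zero x).hasFDerivAt
  have h2 : HasFDerivAt (fun y => fderiv ℝ Ψ y (stdE j))
      ((ContinuousLinearMap.apply ℝ E3 (stdE j)) ∘L fderiv ℝ (fderiv ℝ Ψ) x) x :=
    (ContinuousLinearMap.apply ℝ E3 (stdE j)).hasFDerivAt.comp x h1
  exact hasFDerivAt_coord h2 i

theorem contDiff_jac (hΨ : ContDiff ℝ 2 Ψ) (i j : Fin 3) : ContDiff ℝ 1 (jac Ψ i j) :=
  (coordL i).contDiff.comp
    ((hΨ.fderiv_right (m := 1) (by norm_num)).clm_apply contDiff_const)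

theorem contDiff_cofactor (hΨ : ContDiff ℝ 2 Ψ) (i j : Fin 3) :
    ContDiff ℝ 1 (cofactor Ψ i j) :=
  ((contDiff_jac hΨ _ _).mul (contDiff_jac hΨ _ _)).sub
    ((contDiff_jac hΨ _ _).mul (contDiff_jac hΨ _ _))

theorem contDiff_piola (hΨ : ContDiff ℝ 2 Ψ) (hT : ContDiff ℝ 1 T) :
    ContDiff ℝ 1 (piola Ψ T) := by
  have h : ∀ j, ContDiff ℝ 1 fun x => ∑ i, T (Ψ x) i * cofactor Ψ i j x := fun j => ?_
  · exact ContDiff.sum fun j _ => (h j).fun_smul contDiff_const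
  refine ContDiff.sum fun i _ => ?_
  refine ContDiff.mul ?_ (contDiff_cofactor hΨ i j)
  exact (coordL i).contDiff.comp (hT.comp (hΨ.of_le (by norm_num)))

theorem piola_apply (x : E3) (j : Fin 3) :
    piola Ψ T x j = ∑ i, T (Ψ x) i * cofactor Ψ i j x := by
  rw [← coordL_apply, piola, map_sum]
  simp only [map_smul, coordL_apply, stdE_apply, smul_eq_mul, mul_ite, mul_one, mul_zero]
  simp

/-- The rows of the cofactor matrix are divergence-free because second derivatives commute, so only
the derivatives of `T` survive, and these combine by the cofactor expansion of the determinant. The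
cyclic indices of `cofactor` absorb the signs. -/
theorem fullDiv_piola (hΨ : ContDiff ℝ 2 Ψ) (hT : ContDiff ℝ 1 T) (x : E3) :
    fullDiv (piola Ψ T) x = (fderiv ℝ Ψ x).det * fullDiv T (Ψ x) := by
  let b : Fin 3 → Fin 3 → Fin 3 → ℝ := fun i j k => fderiv ℝ (fderiv ℝ Ψ) x (stdE k) (stdE j) i
  have hb : ∀ i j k, b i j k = b i k j := fun i j k => by
    have := (hΨ.contDiffAt (x := x)).isSymmSndFDerivAt (by simp) (stdE k) (stdE j)
    show (fderiv ℝ (fderiv ℝ Ψ) x (stdE k) (stdE j)) i = (fderiv ℝ (fderiv ℝ Ψ) x (stdE j) (stdE k)) i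
    rw [this]
  let τ : Fin 3 → Fin 3 → ℝ := fun i l => fderiv ℝ T (Ψ x) (stdE l) i
  have hΨd : HasFDerivAt Ψ (fderiv ℝ Ψ x) x := (hΨ.differentiable two_ne_zero x).hasFDerivAt
  have hTd : HasFDerivAt T (fderiv ℝ T (Ψ x)) (Ψ x) :=
    (hT.differentiable one_ne_zero (Ψ x)).hasFDerivAt
  have hexp : ∀ i k, (fderiv ℝ T (Ψ x) (fderiv ℝ Ψ x (stdE k))) i =
      ∑ l, τ i l * jac Ψ l k x := fun i k => by
    have e := eq_sum_stdE (fderiv ℝ Ψ x (stdE k))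
    rw [e, ← coordL_apply]
    simp only [map_add, map_smul, coordL_apply, smul_eq_mul, Fin.sum_univ_three, τ, jac]
    ring
  have key : ∀ j, fderiv ℝ (piola Ψ T) x (stdE j) j = ∑ i,
      ((∑ l, τ i l * jac Ψ l j x) * cofactor Ψ i j x + T (Ψ x) i *
        (b (i + 1) (j + 1) j * jac Ψ (i + 2) (j + 2) x + jac Ψ (i + 1) (j + 1) x * b (i + 2) (j + 2) j
        - b (i + 1) (j + 2) j * jac Ψ (i + 2) (j + 1) x
        - jac Ψ (i + 1) (j + 2) x * b (i + 2) (j + 1) j)) := fun j => by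
    have h1 : HasFDerivAt (fun y => piola Ψ T y j) (coordL j ∘L fderiv ℝ (piola Ψ T) x) x :=
      hasFDerivAt_coord ((contDiff_piola hΨ hT).differentiable one_ne_zero x).hasFDerivAt j
    have h2 : HasFDerivAt (fun y => ∑ i, T (Ψ y) i * cofactor Ψ i j y) _ x :=
      HasFDerivAt.fun_sum fun i (_ : i ∈ Finset.univ) =>
        (hasFDerivAt_coord (hTd.comp x hΨd) i).mul
          (((hasFDerivAt_jac hΨ (i + 1) (j + 1) x).mul (hasFDerivAt_jac hΨ (i + 2) (j + 2) x)).sub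
          ((hasFDerivAt_jac hΨ (i + 1) (j + 2) x).mul (hasFDerivAt_jac hΨ (i + 2) (j + 1) x)))
    simp only [piola_apply] at h1
    have h3 := congrArg (fun L : E3 →L[ℝ] ℝ => L (stdE j)) (h1.unique h2)
    simp only [ContinuousLinearMap.comp_apply, coordL_apply] at h3
    rw [h3]
    simp only [sum_apply]
    refine Finset.sum_congr rfl fun i _ => ?_
    simp only [FunLike.coe_add, FunLike.coe_sub, FunLike.coe_smul, Pi.add_apply, Pi.sub_apply,
      Pi.smul_apply, ContinuousLinearMap.comp_apply, coordL_apply, smul_eq_mul,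
      ContinuousLinearMap.apply_apply, hexp]
    simp only [cofactor, b, Function.comp]
    ring
  rw [fullDiv_eq_sum, fullDiv_eq_sum, det_fderiv_eq]
  simp only [key]
  have t : ∀ l, fderiv ℝ T (Ψ x) (stdE l) l = τ l l := fun l => rfl
  simp only [t]
  simp only [Fin.sum_univ_three, cofactor, Fin.isValue, Fin.reduceAdd]
  rw [hb 0 1 0, hb 0 2 0, hb 0 2 1, hb 1 1 0, hb 1 2 0, hb 1 2 1, hb 2 1 0, hb 2 2 0, hb 2 2 1]
  ring

end


/-! ### Sets of finite perimeter moved by diffeomorphisms -/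

namespace IsNearDiffeo

variable {r : ℕ∞} {Ψ : E3 ≃ₜ E3}

/-- All maps on the segment from the identity to `DΨ` are invertible by the Neumann series, so the
determinant cannot pass through zero. -/
theorem det_pos (h : IsNearDiffeo r Ψ) (x : E3) : 0 < (fderiv ℝ Ψ x).det := by
  by_contra hneg
  push Not at hneg
  let E : E3 →L[ℝ] E3 := fderiv ℝ Ψ x - ContinuousLinearMap.id ℝ E3
  have hE : ‖E‖ ≤ 1 / 4 := by
    have := h.close.fderiv_le x (mem_univ x)
    push_cast at this
    exact this
  let g : ℝ → ℝ := fun s => (ContinuousLinearMap.id ℝ E3 + s • E).det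
  have hg : Continuous g := ContinuousLinearMap.continuous_det.comp (by fun_prop)
  have h0 : g 0 = 1 := by
    have e : ContinuousLinearMap.id ℝ E3 + (0 : ℝ) • E = ContinuousLinearMap.id ℝ E3 := by
      ext1 v; simp
    simp only [g, e]
    simp [ContinuousLinearMap.det]
  have h1 : g 1 = (fderiv ℝ Ψ x).det := by
    simp only [g, one_smul]
    congr 1
    show ContinuousLinearMap.id ℝ E3 + (fderiv ℝ Ψ x - ContinuousLinearMap.id ℝ E3) = _
    abel
  obtain ⟨s, hs, hgs⟩ := intermediate_value_Icc' zero_le_one hg.continuousOn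
    (show (0 : ℝ) ∈ Icc (g 1) (g 0) from ⟨h1 ▸ hneg, by rw [h0]; exact zero_le_one⟩)
  have hn : ‖-(s • E)‖ < 1 := by
    rw [norm_neg, norm_smul, Real.norm_of_nonneg hs.1]
    have := mul_le_mul hs.2 hE (norm_nonneg E) zero_le_one
    linarith
  let w : (E3 →L[ℝ] E3)ˣ := Units.oneSub _ hn
  have hw : (w : E3 →L[ℝ] E3) = ContinuousLinearMap.id ℝ E3 + s • E := by
    show 1 - -(s • E) = _
    rw [sub_neg_eq_add]; rfl
  have h2 : IsUnit (LinearMap.det ((ContinuousLinearMap.id ℝ E3 + s • E : E3 →L[ℝ] E3) :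
      E3 →ₗ[ℝ] E3)) := by
    rw [← hw]
    exact ((ContinuousLinearEquiv.unitsEquiv ℝ E3 w).toLinearEquiv.isUnit_det')
  exact h2.ne_zero hgs

theorem abs_jac_le (h : IsNearDiffeo r Ψ) (i j : Fin 3) (x : E3) : |jac Ψ i j x| ≤ 2 := by
  have h1 := h.close.fderiv_le x (mem_univ x)
  have h2 : ‖fderiv ℝ Ψ x‖ ≤ 2 := by
    have := norm_sub_norm_le (fderiv ℝ Ψ x) (ContinuousLinearMap.id ℝ E3)
    have h3 := ContinuousLinearMap.norm_id_le (𝕜 := ℝ) (E := E3)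
    push_cast at h1
    linarith
  have h3 := (fderiv ℝ Ψ x).le_opNorm (stdE j)
  have h4 : ‖stdE j‖ = 1 := by simp [stdE]
  rw [h4, mul_one] at h3
  exact (PiLp.norm_apply_le (fderiv ℝ Ψ x (stdE j)) i).trans (h3.trans h2)

theorem abs_cofactor_le (h : IsNearDiffeo r Ψ) (i j : Fin 3) (x : E3) :
    |cofactor Ψ i j x| ≤ 8 := by
  refine (abs_sub _ _).trans ?_
  rw [abs_mul, abs_mul]
  have h1 := mul_le_mul (h.abs_jac_le (i + 1) (j + 1) x) (h.abs_jac_le (i + 2) (j + 2) x)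
    (abs_nonneg _) zero_le_two
  have h2 := mul_le_mul (h.abs_jac_le (i + 1) (j + 2) x) (h.abs_jac_le (i + 2) (j + 1) x)
    (abs_nonneg _) zero_le_two
  linarith

end IsNearDiffeo

/-- The normal of the image of a set, up to a factor. -/
def cofNormal (Ψ ν : E3 → E3) (x : E3) : E3 :=
  ∑ i, (∑ j, cofactor Ψ i j x * ν x j) • stdE i

theorem cofNormal_apply (Ψ ν : E3 → E3) (x : E3) (i : Fin 3) :
    cofNormal Ψ ν x i = ∑ j, cofactor Ψ i j x * ν x j := by
  rw [← coordL_apply, cofNormal, map_sum]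
  simp only [map_smul, coordL_apply, stdE_apply, smul_eq_mul, mul_ite, mul_one, mul_zero]
  simp

theorem inner_eq_sum (v w : E3) : inner ℝ v w = ∑ i, v i * w i := by
  rw [PiLp.inner_apply]
  exact Finset.sum_congr rfl fun i _ => mul_comm _ _

theorem inner_piola (Ψ T ν : E3 → E3) (x : E3) :
    inner ℝ (piola Ψ T x) (ν x) = inner ℝ (T (Ψ x)) (cofNormal Ψ ν x) := by
  rw [inner_eq_sum, inner_eq_sum]
  simp only [piola_apply, cofNormal_apply, Fin.sum_univ_three]
  ring

/-- The identity `(DΨ)ᵀ cof = det`; it shows that `cofNormal` does not vanish where `ν` does not. -/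
theorem sum_jac_mul_cofNormal (Ψ ν : E3 → E3) (x : E3) (k : Fin 3) :
    ∑ i, jac Ψ i k x * cofNormal Ψ ν x i = (fderiv ℝ Ψ x).det * ν x k := by
  rw [det_fderiv_eq]
  simp only [cofNormal_apply]
  fin_cases k <;>
  · simp only [Fin.sum_univ_three, cofactor, Fin.isValue, Fin.reduceAdd, zero_add, Fin.zero_eta,
      Fin.mk_one, Fin.reduceFinMk]
    ring

/-- After the change of variables, Gauss–Green for `Ω` is applied to the Piola transform of `T`, and
the cofactors are moved from `T` to the normal. So `μ'` is the push-forward of `|cof ν| μ`. As this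
density is almost everywhere non-zero, null sets correspond; that correspondence is all the boundary
comparison needs. -/
theorem IsGaussGreen.exists_image {r : ℕ∞} (hr : 2 ≤ r) {Ψ : E3 ≃ₜ E3} (hΨ : IsNearDiffeo r Ψ)
    {Ω : Set E3} (hΩ : MeasurableSet Ω) {μ : Measure E3} {ν : E3 → E3}
    (h : IsGaussGreen Ω μ ν) :
    ∃ μ' ν', IsGaussGreen (Ψ '' Ω) μ' ν' ∧ ∀ B, (μ' (Ψ '' B) = 0 ↔ μ B = 0) := by
  have hfin := h.finite
  have hΨ2 : ContDiff ℝ 2 Ψ := hΨ.contDiff.of_le (two_le_coe hr)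
  let w : E3 → E3 := cofNormal Ψ ν
  have hcm : ∀ i j, Measurable (cofactor Ψ i j) := fun i j =>
    (contDiff_cofactor hΨ2 i j).continuous.measurable
  have hνm : ∀ j, Measurable fun x => ν x j := fun j =>
    (coordL j).continuous.measurable.comp h.measurable
  have hw : Measurable w := by
    refine Finset.measurable_fun_sum _ fun i _ => Measurable.smul_const ?_ _
    exact Finset.measurable_fun_sum _ fun j _ => (hcm i j).mul (hνm j)
  have hw0 : ∀ᵐ x ∂μ, w x ≠ 0 := by
    filter_upwards [h.unit] with x hx h0
    have h1 : ν x = 0 := by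
      ext k
      have h2 := sum_jac_mul_cofNormal Ψ ν x k
      have h3 : cofNormal Ψ ν x = 0 := h0
      rw [h3] at h2
      simp only [PiLp.zero_apply, mul_zero, Finset.sum_const_zero] at h2
      simpa [(hΨ.det_pos x).ne'] using h2.symm
    rw [h1, norm_zero] at hx
    exact zero_ne_one hx
  have hwi : Integrable w μ := by
    -- Three components, each a sum of three products bounded by 8.
    refine Integrable.of_bound hw.aestronglyMeasurable 72 ?_
    filter_upwards [h.unit] with x hx
    have h1 : ∀ i, ‖(∑ j, cofactor Ψ i j x * ν x j) • stdE i‖ ≤ 24 := fun i => by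
      have h4 : ‖stdE i‖ = 1 := by simp [stdE]
      rw [norm_smul, h4, mul_one]
      have h5 : ∀ j ∈ Finset.univ, ‖cofactor Ψ i j x * ν x j‖ ≤ (8 : ℝ) := fun j _ => by
        rw [norm_mul]
        have := mul_le_mul (hΨ.abs_cofactor_le i j x) (PiLp.norm_apply_le (ν x) j) (norm_nonneg _)
          (by norm_num)
        rw [hx, mul_one] at this
        exact this
      refine (norm_sum_le_of_le _ h5).trans ?_
      norm_num
    refine (norm_sum_le_of_le (f := fun i => (∑ j, cofactor Ψ i j x * ν x j) • stdE i)
      _ fun i _ => h1 i).trans ?_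
    norm_num
  let ρ : E3 → ℝ≥0∞ := fun x => ENNReal.ofReal ‖w x‖
  have hρ : Measurable ρ := hw.norm.ennreal_ofReal
  let ν' : E3 → E3 := fun y => ‖w (Ψ.symm y)‖⁻¹ • w (Ψ.symm y)
  have hν' : Measurable ν' :=
    ((hw.norm.inv).smul hw).comp Ψ.symm.continuous.measurable
  have hemb : MeasurableEmbedding Ψ := Ψ.measurableEmbedding
  refine ⟨(μ.withDensity ρ).map Ψ, ν', ⟨?_, hν', ?_, fun T hT hTc => ?_⟩, fun B => ?_⟩
  · have : IsFiniteMeasure (μ.withDensity ρ) :=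
      isFiniteMeasure_withDensity_ofReal hwi.norm.hasFiniteIntegral
    infer_instance
  · rw [hemb.ae_map_iff]
    refine (withDensity_absolutelyContinuous μ ρ).ae_le ?_
    filter_upwards [hw0] with x hx
    simp only [ν', Homeomorph.symm_apply_apply, norm_smul, norm_inv, norm_norm]
    exact inv_mul_cancel₀ (norm_ne_zero_iff.2 hx)
  · have e1 : ∫ y in Ψ '' Ω, fullDiv T y = ∫ x in Ω, fullDiv (piola Ψ T) x := by
      rw [integral_image_eq_integral_abs_det_fderiv_smul volume hΩ
        (fun x _ => (hΨ2.differentiable two_ne_zero x).hasFDerivAt.hasFDerivWithinAt)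
        Ψ.injective.injOn]
      refine integral_congr_ae (ae_of_all _ fun x => ?_)
      simp only [fullDiv_piola hΨ2 hT, abs_of_pos (hΨ.det_pos x), smul_eq_mul]
    have hc : HasCompactSupport (piola Ψ T) := by
      refine (hTc.comp_homeomorph Ψ).mono fun x hx h0 => hx ?_
      have h0' : T (Ψ x) = 0 := h0
      simp [piola, h0']
    rw [e1, h.formula _ (contDiff_piola hΨ2 hT) hc, hemb.integral_map,
      integral_withDensity_eq_integral_toReal_smul hρ (ae_of_all _ fun x => ENNReal.ofReal_lt_top)]
    refine integral_congr_ae ?_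
    filter_upwards [hw0] with x hx
    rw [inner_piola]
    simp only [ρ, ν', Homeomorph.symm_apply_apply, ENNReal.toReal_ofReal (norm_nonneg _),
      inner_smul_right, smul_eq_mul]
    rw [← mul_assoc, mul_inv_cancel₀ (norm_ne_zero_iff.2 hx), one_mul]
  · rw [hemb.map_apply, preimage_image_eq _ Ψ.injective, withDensity_apply_eq_zero hρ]
    have h1 : ({x | ρ x ≠ 0} ∩ B : Set E3) =ᵐ[μ] B := by
      filter_upwards [hw0] with x hx
      have : ρ x ≠ 0 := by simpa [ρ] using hx
      refine propext ⟨fun h => h.2, fun h => ⟨this, h⟩⟩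
    rw [measure_congr h1]

theorem HasFinitePerimeter.image {r : ℕ∞} (hr : 2 ≤ r) {Ψ : E3 ≃ₜ E3} (hΨ : IsNearDiffeo r Ψ)
    {Ω : Set E3} (h : HasFinitePerimeter Ω) : HasFinitePerimeter (Ψ '' Ω) := by
  obtain ⟨hm, μ, ν, hg⟩ := h
  obtain ⟨μ', ν', hg', -⟩ := hg.exists_image hr hΨ hm
  exact ⟨Ψ.measurableEmbedding.measurableSet_image.2 hm, μ', ν', hg'⟩


/-! ### Constancy -/

theorem fullDiv_smul {g : E3 → ℝ} {V : E3 → E3} {x : E3} (hg : DifferentiableAt ℝ g x)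
    (hV : DifferentiableAt ℝ V x) :
    fullDiv (fun y => g y • V y) x = g x * fullDiv V x + fderiv ℝ g x (V x) := by
  have h1 := (hg.hasFDerivAt.fun_smul hV.hasFDerivAt).fderiv
  rw [fullDiv_eq_sum, fullDiv_eq_sum, h1, Finset.mul_sum]
  have h2 : fderiv ℝ g x (V x) = ∑ j, fderiv ℝ g x (stdE j) * V x j := by
    conv_lhs => rw [eq_sum_stdE (V x)]
    simp only [map_add, map_smul, smul_eq_mul, Fin.sum_univ_three]
    ring
  rw [h2, ← Finset.sum_add_distrib]
  refine Finset.sum_congr rfl fun j _ => ?_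
  simp

theorem fullDiv_smul_const {g : E3 → ℝ} {v x : E3} (hg : DifferentiableAt ℝ g x) :
    fullDiv (fun y => g y • v) x = fderiv ℝ g x v := by
  rw [fullDiv_smul hg (differentiableAt_const v)]
  simp [fullDiv]

/-- The directional derivatives of the mollified indicator of `Ω` are, up to sign, integrals over
`Ω` of divergences of test fields supported in `U`, hence zero on a small ball. The mollifications
are constant there and converge almost everywhere to the indicator, which is therefore constant. -/
theorem PerimeterNull.exists_ball {Ω U : Set E3} (hΩ : MeasurableSet Ω) (hU : IsOpen U)
    (h : PerimeterNull Ω U) {x₀ : E3} (hx₀ : x₀ ∈ U) : ∃ ρ > 0,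
    (∀ᵐ x, x ∈ Metric.ball x₀ ρ → x ∈ Ω) ∨ ∀ᵐ x, x ∈ Metric.ball x₀ ρ → x ∉ Ω := by
  obtain ⟨R, hR, hRU⟩ := Metric.isOpen_iff.1 hU x₀ hx₀
  let ρ : ℝ := R / 2
  have hρ : 0 < ρ := by positivity
  let φ : ℕ → ContDiffBump (0 : E3) := fun n =>
    { rIn := ρ / (2 * (n + 2))
      rOut := ρ / (n + 2)
      rIn_pos := by positivity
      rIn_lt_rOut := by
        apply div_lt_div_of_pos_left hρ (by positivity)
        have : (0 : ℝ) ≤ n := by positivity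
        linarith }
  have hout : ∀ n, (φ n).rOut < ρ := fun n => by
    show ρ / (n + 2) < ρ
    rw [div_lt_iff₀ (by positivity)]
    have : (0 : ℝ) ≤ n := by positivity
    nlinarith
  let f : E3 → ℝ := Ω.indicator 1
  have hf : LocallyIntegrable f volume :=
    (locallyIntegrable_const (1 : ℝ)).indicator hΩ
  let F : ℕ → E3 → ℝ := fun n =>
    MeasureTheory.convolution f ((φ n).normed volume) (ContinuousLinearMap.mul ℝ ℝ) volume
  have hφd : ∀ n, ContDiff ℝ 1 ((φ n).normed (volume : Measure E3)) := fun n =>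
    (φ n).contDiff_normed
  have hφc : ∀ n, HasCompactSupport ((φ n).normed (volume : Measure E3)) := fun n =>
    (φ n).hasCompactSupport_normed
  have hFd : ∀ n x, HasFDerivAt (F n) (MeasureTheory.convolution f
      (fderiv ℝ ((φ n).normed volume)) ((ContinuousLinearMap.mul ℝ ℝ).precompR E3) volume x) x :=
    fun n x => (hφc n).hasFDerivAt_convolution_right _ hf (hφd n) x
  have hF0 : ∀ n, ∀ x ∈ Metric.ball x₀ ρ, fderiv ℝ (F n) x = 0 := by
    intro n x hx
    rw [(hFd n x).fderiv]
    ext v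
    rw [convolution_precompR_apply _ hf ((hφc n).fderiv ℝ)
      ((hφd n).continuous_fderiv one_ne_zero)]
    let T : E3 → E3 := fun y => (φ n).normed volume (x - y) • v
    have hgd : ContDiff ℝ 1 fun y => (φ n).normed (volume : Measure E3) (x - y) :=
      (hφd n).comp (contDiff_const.sub contDiff_id)
    have hdiv : ∀ y, fullDiv T y = -fderiv ℝ ((φ n).normed volume) (x - y) v := fun y => by
      rw [fullDiv_smul_const (hgd.differentiable one_ne_zero y)]
      have h1 : HasFDerivAt (fun y => (φ n).normed (volume : Measure E3) (x - y))
          ((fderiv ℝ ((φ n).normed volume) (x - y)) ∘L (-ContinuousLinearMap.id ℝ E3)) y :=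
        (((hφd n).differentiable one_ne_zero (x - y)).hasFDerivAt).comp y
          ((hasFDerivAt_id y).const_sub x)
      rw [h1.fderiv]
      simp
    have hsupp : tsupport T ⊆ Metric.closedBall x ρ := by
      refine closure_minimal (fun y hy => ?_) Metric.isClosed_closedBall
      have h1 : (φ n).normed (volume : Measure E3) (x - y) ≠ 0 := fun h0 => hy (by simp [T, h0])
      have h2 : x - y ∈ Function.support ((φ n).normed (volume : Measure E3)) := h1
      rw [(φ n).support_normed_eq, mem_ball_zero_iff] at h2
      rw [Metric.mem_closedBall, dist_comm, dist_eq_norm]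
      exact (h2.trans (hout n)).le
    have h0 := h T (hgd.smul contDiff_const)
      (HasCompactSupport.of_support_subset_isCompact (isCompact_closedBall x ρ)
        (subset_closure.trans hsupp)) (hsupp.trans fun y hy => hRU ?_)
    · simp only [hdiv, integral_neg, neg_eq_zero] at h0
      refine Eq.trans ?_ h0
      rw [← integral_indicator hΩ, convolution_def]
      refine integral_congr_ae (ae_of_all _ fun y => ?_)
      by_cases hy : y ∈ Ω <;> simp [f, hy]
    · rw [Metric.mem_ball]
      have h1 := Metric.mem_closedBall.1 hy
      have h2 := Metric.mem_ball.1 hx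
      have h3 : R = ρ + ρ := by simp [ρ]
      linarith [dist_triangle y x x₀]
  have hconst : ∀ n, ∀ x ∈ Metric.ball x₀ ρ, ∀ y ∈ Metric.ball x₀ ρ, F n x = F n y := fun n x hx y hy =>
    Metric.isOpen_ball.is_const_of_fderiv_eq_zero (convex_ball x₀ ρ).isPreconnected
      (fun z _ => (hFd n z).differentiableAt.differentiableWithinAt) (fun z hz => hF0 n z hz) hx hy
  have hlim0 : Tendsto (fun n => (φ n).rOut) atTop (𝓝 0) := by
    have h1 : Tendsto (fun n : ℕ => ((n + 2 : ℕ) : ℝ)) atTop atTop :=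
      tendsto_natCast_atTop_atTop.comp (tendsto_add_atTop_nat 2)
    have := h1.const_div_atTop ρ
    simpa [φ] using this
  have hlim := ContDiffBump.ae_convolution_tendsto_right_of_locallyIntegrable (φ := φ) (l := atTop)
    (K := 2) (μ := (volume : Measure E3)) hlim0 (Eventually.of_forall fun n => by
      show ρ / (n + 2) ≤ 2 * (ρ / (2 * (n + 2)))
      apply le_of_eq; field_simp) hf
  have hswap : ∀ n x, MeasureTheory.convolution ((φ n).normed volume) f
      (ContinuousLinearMap.lsmul ℝ ℝ) volume x = F n x := by
    intro n x
    rw [convolution_eq_swap]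
    simp only [F, convolution_def]
    refine integral_congr_ae (ae_of_all _ fun y => ?_)
    simp [mul_comm]
  simp only [hswap] at hlim
  refine ⟨ρ, hρ, ?_⟩
  by_cases hex : ∃ x ∈ Metric.ball x₀ ρ, x ∈ Ω ∧ Tendsto (fun n => F n x) atTop (𝓝 (f x))
  · left
    obtain ⟨x, hx, hxΩ, hxl⟩ := hex
    filter_upwards [hlim] with y hy hyb
    by_contra hyΩ
    have h1 : (fun n => F n y) = fun n => F n x := funext fun n => hconst n y hyb x hx
    rw [h1] at hy
    have := tendsto_nhds_unique hxl hy
    simp [f, hxΩ, hyΩ] at this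
  · right
    push Not at hex
    filter_upwards [hlim] with y hy hyb hyΩ
    exact hex y hyb hyΩ hy

/-- A set without perimeter in a connected open set is null or of full measure there. -/
theorem PerimeterNull.ae_const {Ω U : Set E3} (hΩ : MeasurableSet Ω) (hU : IsOpen U)
    (hU' : IsPreconnected U) (h : PerimeterNull Ω U) :
    (∀ᵐ x, x ∈ U → x ∈ Ω) ∨ ∀ᵐ x, x ∈ U → x ∉ Ω := by
  -- The open set of points near which `P` holds almost everywhere. For `P` and its negation these
  -- sets cannot meet, so preconnectedness of `U` selects one of them.
  let W : (E3 → Prop) → Set E3 := fun P => {x | ∃ V, IsOpen V ∧ x ∈ V ∧ ∀ᵐ y, y ∈ V → P y}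
  have hW : ∀ P, IsOpen (W P) := fun P => by
    rw [isOpen_iff_forall_mem_open]
    rintro x ⟨V, hV, hxV, hP⟩
    exact ⟨V, fun y hy => ⟨V, hV, hy, hP⟩, hV, hxV⟩
  have hnull : ∀ P : E3 → Prop, U ⊆ W P → ∀ᵐ x, x ∈ U → P x := fun P hP => by
    have h0 : volume {x | x ∈ U ∧ ¬ P x} = 0 := by
      refine measure_null_of_locally_null _ fun x hx => ?_
      obtain ⟨V, hV, hxV, hVP⟩ := hP hx.1
      refine ⟨V ∩ {x | x ∈ U ∧ ¬ P x}, inter_mem (mem_nhdsWithin_of_mem_nhds (hV.mem_nhds hxV))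
        self_mem_nhdsWithin, ?_⟩
      refine measure_mono_null (fun y hy => ?_) (ae_iff.1 hVP)
      simpa using ⟨hy.1, hy.2.2⟩
    rw [ae_iff]
    simpa using h0
  have hcov : U ⊆ W (· ∈ Ω) ∪ W (· ∉ Ω) := fun x hx => by
    obtain ⟨ρ, hρ, h1 | h1⟩ := h.exists_ball hΩ hU hx
    · exact Or.inl ⟨_, Metric.isOpen_ball, Metric.mem_ball_self hρ, h1⟩
    · exact Or.inr ⟨_, Metric.isOpen_ball, Metric.mem_ball_self hρ, h1⟩
  by_cases h1 : (U ∩ W (· ∈ Ω)).Nonempty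
  · by_cases h2 : (U ∩ W (· ∉ Ω)).Nonempty
    · obtain ⟨x, -, ⟨V, hV, hxV, hVP⟩, V', hV', hxV', hVP'⟩ := hU' _ _ (hW _) (hW _) hcov h1 h2
      exfalso
      have h3 : volume (V ∩ V') = 0 := by
        rw [measure_eq_zero_iff_ae_notMem]
        filter_upwards [hVP, hVP'] with y h1 h2 h3
        exact h2 h3.2 (h1 h3.1)
      exact ((hV.inter hV').measure_pos volume ⟨x, hxV, hxV'⟩).ne' h3
    · left
      refine hnull _ fun x hx => (hcov hx).resolve_right fun h3 => h2 ⟨x, hx, h3⟩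
  · right
    refine hnull _ fun x hx => (hcov hx).resolve_left fun h3 => h1 ⟨x, hx, h3⟩


/-! ### The reduced boundary near smooth points -/

/-- The indicator of `K` is a dominated limit of smooth functions supported in shrinking thickenings
of `K`. -/
theorem setIntegral_nonpos_of_forall_contDiff {μ : Measure E3} {U : Set E3}
    (hU : IsOpen U) {F : E3 → ℝ} (hF : LocallyIntegrable F μ)
    (h : ∀ g : E3 → ℝ, ContDiff ℝ 1 g → HasCompactSupport g → tsupport g ⊆ U → (∀ x, 0 ≤ g x) →
      ∫ x, g x * F x ∂μ ≤ 0) {K : Set E3} (hK : IsCompact K) (hKU : K ⊆ U) :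
    ∫ x in K, F x ∂μ ≤ 0 := by
  obtain ⟨δ, hδ, hδU⟩ := hK.exists_cthickening_subset_open hU hKU
  obtain ⟨u, -, hu, hu0⟩ := exists_seq_strictAnti_tendsto' hδ
  have hg : ∀ n, ∃ g : E3 → ℝ, ContDiff ℝ 1 g ∧ range g ⊆ Icc 0 1 ∧
      Function.support g = Metric.thickening (u n) K ∧ ∀ x, x ∈ K ↔ g x = 1 := fun n => by
    obtain ⟨g, h1, h2⟩ := exists_contMDiff_support_eq_eq_one_iff (n := 1) (modelWithCornersSelf ℝ E3)
      (Metric.isOpen_thickening (δ := u n) (E := K)) hK.isClosed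
      (Metric.self_subset_thickening (hu n).1 K)
    exact ⟨g, h1.contDiff, h2⟩
  choose g hgd hgr hgs hg1 using hg
  have hgI : ∀ n x, g n x ∈ Icc (0 : ℝ) 1 := fun n x => hgr n (mem_range_self x)
  have hts : ∀ n, tsupport (g n) ⊆ Metric.cthickening δ K := fun n => by
    rw [tsupport, hgs]
    exact closure_minimal (Metric.thickening_subset_cthickening_of_le (hu n).2.le K)
      Metric.isClosed_cthickening
  have hKc : IsCompact (Metric.cthickening δ K) := hK.cthickening
  have hlim : Tendsto (fun n => ∫ x, g n x * F x ∂μ) atTop (𝓝 (∫ x in K, F x ∂μ)) := by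
    rw [← integral_indicator hK.measurableSet]
    refine tendsto_integral_of_dominated_convergence
      ((Metric.cthickening δ K).indicator fun x => ‖F x‖)
      (fun n => (hgd n).continuous.aestronglyMeasurable.mul hF.aestronglyMeasurable) ?_
      (fun n => ae_of_all _ fun x => ?_) (ae_of_all _ fun x => ?_)
    · rw [integrable_indicator_iff hKc.measurableSet]
      exact (hF.integrableOn_isCompact hKc).norm
    · by_cases hx : x ∈ Metric.cthickening δ K
      · rw [indicator_of_mem hx, norm_mul, Real.norm_of_nonneg (hgI n x).1]
        exact mul_le_of_le_one_left (norm_nonneg _) (hgI n x).2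
      · rw [image_eq_zero_of_notMem_tsupport fun h => hx (hts n h)]
        simp [indicator_of_notMem hx]
    · by_cases hx : x ∈ K
      · simp [indicator_of_mem hx, (hg1 _ x).1 hx]
      · rw [indicator_of_notMem hx]
        refine tendsto_const_nhds.congr' ?_
        obtain ⟨ε, hε, hxε⟩ : ∃ ε, 0 < ε ∧ x ∉ Metric.thickening ε K := by
          rw [← hK.isClosed.closure_eq, Metric.closure_eq_iInter_thickening] at hx
          simpa using hx
        filter_upwards [(tendsto_order.1 hu0).2 ε hε] with n hn
        have : g n x = 0 := by
          rw [← Function.notMem_support, hgs]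
          exact fun h => hxε (Metric.thickening_mono hn.le K h)
        rw [this, zero_mul]
  refine le_of_tendsto' hlim fun n => h _ (hgd n) ?_ ((hts n).trans hδU) fun x => (hgI n x).1
  exact hKc.of_isClosed_subset (isClosed_tsupport _) (hts n)

/-- If `F` were positive on a set of positive measure, it would be so on a compact subset, by inner
regularity. -/
theorem ae_nonpos_of_forall_contDiff {μ : Measure E3} [IsFiniteMeasure μ] {U : Set E3}
    (hU : IsOpen U) {F : E3 → ℝ} (hFm : Measurable F) (hF : LocallyIntegrable F μ)
    (h : ∀ g : E3 → ℝ, ContDiff ℝ 1 g → HasCompactSupport g → tsupport g ⊆ U → (∀ x, 0 ≤ g x) →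
      ∫ x, g x * F x ∂μ ≤ 0) : ∀ᵐ x ∂μ, x ∈ U → F x ≤ 0 := by
  let A : Set E3 := U ∩ {x | 0 < F x}
  have hA : MeasurableSet A := hU.measurableSet.inter (measurableSet_lt measurable_const hFm)
  have h0 : μ A = 0 := by
    by_contra hne
    obtain ⟨K, hKA, hK, hKpos⟩ := hA.exists_lt_isCompact (pos_iff_ne_zero.2 hne)
    have h1 := setIntegral_nonpos_of_forall_contDiff hU hF h hK (hKA.trans inter_subset_left)
    have h2 : 0 < ∫ x in K, F x ∂μ := by
      rw [setIntegral_pos_iff_support_of_nonneg_ae]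
      · refine hKpos.trans_le (measure_mono fun x hx => ⟨(hKA hx).2.ne', hx⟩)
      · filter_upwards [ae_restrict_mem hK.measurableSet] with x hx using (hKA hx).2.le
      · exact hF.integrableOn_isCompact hK
    exact absurd h1 (not_le.2 h2)
  filter_upwards [measure_eq_zero_iff_ae_notMem.1 h0] with x hx hxU
  by_contra hlt
  exact hx ⟨hxU, not_le.1 hlt⟩

theorem continuous_fullDiv {T : E3 → E3} (hT : ContDiff ℝ 1 T) : Continuous (fullDiv T) := by
  have : fullDiv T = fun x => ∑ j, coordL j (fderiv ℝ T x (stdE j)) := funext (fullDiv_eq_sum T)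
  rw [this]
  have h1 := hT.continuous_fderiv one_ne_zero
  exact continuous_finsetSum _ fun j _ => (coordL j).continuous.comp (h1.clm_apply continuous_const)

theorem fullDiv_eq_zero_of_notMem {T : E3 → E3} {x : E3} (hx : x ∉ tsupport T) :
    fullDiv T x = 0 := by
  rw [fullDiv_eq_sum, fderiv_of_notMem_tsupport (𝕜 := ℝ) hx]
  simp

theorem hasCompactSupport_fullDiv {T : E3 → E3} (hT : HasCompactSupport T) :
    HasCompactSupport (fullDiv T) :=
  hT.mono' fun x hx => by
    by_contra h
    exact hx (fullDiv_eq_zero_of_notMem h)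

theorem integral_fullDiv_eq_zero {T : E3 → E3} (hT : ContDiff ℝ 1 T) (hTc : HasCompactSupport T) :
    ∫ x, fullDiv T x = 0 := by
  have hcj : ∀ j, ContDiff ℝ 1 fun x => T x j := fun j => (coordL j).contDiff.comp hT
  have hcc : ∀ j, HasCompactSupport fun x => T x j := fun j =>
    hTc.comp_left (g := fun v : E3 => v j) rfl
  have hd : ∀ j x, fderiv ℝ T x (stdE j) j = fderiv ℝ (fun x => T x j) x (stdE j) := fun j x => by
    rw [(hasFDerivAt_coord (hT.differentiable one_ne_zero x).hasFDerivAt j).fderiv]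
    rfl
  have hint : ∀ j, Integrable fun x => fderiv ℝ (fun x => T x j) x (stdE j) := fun j =>
    (((hcj j).continuous_fderiv one_ne_zero).clm_apply continuous_const).integrable_of_hasCompactSupport
      ((hcc j).fderiv_apply ℝ (stdE j))
  simp only [fullDiv_eq_sum, hd]
  rw [integral_finsetSum _ fun j _ => hint j]
  refine Finset.sum_eq_zero fun j _ => ?_
  have := integral_mul_fderiv_eq_neg_fderiv_mul_of_integrable (μ := (volume : Measure E3))
    (f := fun _ => (1 : ℝ)) (g := fun x => T x j) (v := stdE j) (by simp)
    (by simpa using hint j)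
    (by simpa using (hcj j).continuous.integrable_of_hasCompactSupport (hcc j))
    (fun _ _ => differentiableAt_const _) (fun x _ => (hcj j).differentiable one_ne_zero x)
  simpa using this

/-- The functions `η n`, smooth steps of `n f`, tend to the indicator of `{f > 0}` and increase
along `T`. Since `div (η T)` has integral zero and `∇η · T ≥ 0`, the integral of `η div T` is at
most zero. -/
theorem setIntegral_fullDiv_nonpos {Ω N : Set E3} (hΩ : MeasurableSet Ω) {f : E3 → ℝ}
    (hf : ContDiff ℝ 1 f) (hfΩ : ∀ᵐ x, x ∈ N → (x ∈ Ω ↔ 0 < f x)) {T : E3 → E3}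
    (hT : ContDiff ℝ 1 T) (hTc : HasCompactSupport T) (hTN : tsupport T ⊆ N)
    (hTf : ∀ x, 0 ≤ fderiv ℝ f x (T x)) : ∫ x in Ω, fullDiv T x ≤ 0 := by
  let η : ℕ → E3 → ℝ := fun n x => Real.smoothTransition (n * f x)
  have hη : ∀ n, ContDiff ℝ 1 (η n) := fun n =>
    (Real.smoothTransition.contDiff (n := 1)).comp (contDiff_const.mul hf)
  have hmono : ∀ t, 0 ≤ deriv Real.smoothTransition t := fun t =>
    Real.smoothTransition.monotone.deriv_nonneg
  have hηT : ∀ n x, 0 ≤ fderiv ℝ (η n) x (T x) := fun n x => by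
    have h1 : HasFDerivAt (η n) _ x :=
      ((Real.smoothTransition.contDiff (n := 1)).differentiable one_ne_zero _).hasDerivAt.comp_hasFDerivAt
        x ((hf.differentiable one_ne_zero x).hasFDerivAt.const_mul (n : ℝ))
    rw [h1.fderiv]
    simp only [FunLike.coe_smul, Pi.smul_apply, smul_eq_mul]
    exact mul_nonneg (hmono _) (mul_nonneg (Nat.cast_nonneg n) (hTf x))
  have hi : ∀ n, ∫ x, η n x * fullDiv T x ≤ 0 := fun n => by
    have h0 := integral_fullDiv_eq_zero ((hη n).smul hT) (hTc.smul_left (f := η n))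
    rw [← h0]
    refine integral_mono ?_ ?_ fun x => ?_
    · exact ((hη n).continuous.mul (continuous_fullDiv hT)).integrable_of_hasCompactSupport
        ((hasCompactSupport_fullDiv hTc).mul_left)
    · exact (continuous_fullDiv ((hη n).smul hT)).integrable_of_hasCompactSupport
        (hasCompactSupport_fullDiv hTc.smul_left)
    · have := fullDiv_smul ((hη n).differentiable one_ne_zero x) (hT.differentiable one_ne_zero x)
      show _ ≤ fullDiv (fun y => η n y • T y) x
      rw [this]
      linarith [hηT n x]
  have hlim : Tendsto (fun n => ∫ x, η n x * fullDiv T x) atTop (𝓝 (∫ x in Ω, fullDiv T x)) := by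
    rw [← integral_indicator hΩ]
    refine tendsto_integral_of_dominated_convergence (fun x => ‖fullDiv T x‖)
      (fun n => ((hη n).continuous.mul (continuous_fullDiv hT)).aestronglyMeasurable)
      ((continuous_fullDiv hT).integrable_of_hasCompactSupport
        (hasCompactSupport_fullDiv hTc)).norm (fun n => ae_of_all _ fun x => ?_) ?_
    · rw [norm_mul, Real.norm_of_nonneg (Real.smoothTransition.nonneg _)]
      exact mul_le_of_le_one_left (norm_nonneg _) (Real.smoothTransition.le_one _)
    · filter_upwards [hfΩ] with x hx
      by_cases hxN : x ∈ tsupport T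
      · have hx' := hx (hTN hxN)
        by_cases hxΩ : x ∈ Ω
        · rw [indicator_of_mem hxΩ]
          have hpos := hx'.1 hxΩ
          refine tendsto_const_nhds.congr' ?_
          have h1 : Tendsto (fun n : ℕ => (n : ℝ) * f x) atTop atTop :=
            tendsto_natCast_atTop_atTop.atTop_mul_const hpos
          filter_upwards [h1.eventually_ge_atTop 1] with n hn
          simp [η, Real.smoothTransition.one_of_one_le hn]
        · rw [indicator_of_notMem hxΩ]
          have hneg : f x ≤ 0 := not_lt.1 fun h => hxΩ (hx'.2 h)
          refine tendsto_const_nhds.congr fun n => ?_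
          have : (n : ℝ) * f x ≤ 0 := mul_nonpos_of_nonneg_of_nonpos (Nat.cast_nonneg n) hneg
          simp [η, Real.smoothTransition.zero_of_nonpos this]
      · have h0 := fullDiv_eq_zero_of_notMem hxN
        simp [h0, indicator]
  exact le_of_tendsto' hlim hi

/-- The gradient of a function. -/
def grad (f : E3 → ℝ) (x : E3) : E3 := ∑ j, fderiv ℝ f x (stdE j) • stdE j

theorem grad_apply (f : E3 → ℝ) (x : E3) (i : Fin 3) : grad f x i = fderiv ℝ f x (stdE i) := by
  rw [← coordL_apply, grad, map_sum]
  simp only [map_smul, coordL_apply, stdE_apply, smul_eq_mul, mul_ite, mul_one, mul_zero]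
  simp

theorem fderiv_eq_inner_grad (f : E3 → ℝ) (x v : E3) : fderiv ℝ f x v = inner ℝ (grad f x) v := by
  rw [inner_eq_sum]
  conv_lhs => rw [eq_sum_stdE v]
  simp only [map_add, map_smul, smul_eq_mul, Fin.sum_univ_three, grad_apply]
  ring

theorem contDiff_grad {f : E3 → ℝ} (hf : ContDiff ℝ 2 f) : ContDiff ℝ 1 (grad f) :=
  ContDiff.sum fun j _ => ((hf.fderiv_right (m := 1) (by norm_num)).clm_apply
    contDiff_const).fun_smul contDiff_const

theorem setIntegral_fullDiv_eq_zero {Ω N : Set E3} (hΩ : MeasurableSet Ω) {f : E3 → ℝ}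
    (hf : ContDiff ℝ 1 f) (hfΩ : ∀ᵐ x, x ∈ N → (x ∈ Ω ↔ 0 < f x)) {T : E3 → E3}
    (hT : ContDiff ℝ 1 T) (hTc : HasCompactSupport T) (hTN : tsupport T ⊆ N)
    (hTf : ∀ x, fderiv ℝ f x (T x) = 0) : ∫ x in Ω, fullDiv T x = 0 := by
  refine le_antisymm (setIntegral_fullDiv_nonpos hΩ hf hfΩ hT hTc hTN fun x => (hTf x).ge) ?_
  have hc : HasCompactSupport (-T) := hTc.neg
  have hs : tsupport (-T) ⊆ N := by rwa [tsupport_neg]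
  have h1 := setIntegral_fullDiv_nonpos (T := -T) hΩ hf hfΩ hT.neg hc hs fun x => by
    simp [hTf x]
  have h2 : ∀ x, fullDiv (-T) x = -fullDiv T x := fun x => by
    rw [fullDiv_eq_sum, fullDiv_eq_sum, fderiv_neg]
    simp
  simp only [h2, integral_neg] at h1
  linarith

/-- Test with fields `g Y` where `Y`, the part of `|∇f|² v` orthogonal to `∇f`, is tangent to the
level sets of `f`. The identity is kept free of denominators so that it makes sense at critical
points. -/
theorem IsGaussGreen.ae_parallel_grad {Ω : Set E3} (hΩ : MeasurableSet Ω) {μ : Measure E3}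
    {ν : E3 → E3} (h : IsGaussGreen Ω μ ν) {N : Set E3} (hN : IsOpen N)
    {f : E3 → ℝ} (hf : ContDiff ℝ 2 f) (hfΩ : ∀ᵐ x, x ∈ N → (x ∈ Ω ↔ 0 < f x)) (v : E3) :
    ∀ᵐ x ∂μ, x ∈ N → inner ℝ (grad f x) (grad f x) * inner ℝ v (ν x) =
      inner ℝ (grad f x) v * inner ℝ (grad f x) (ν x) := by
  have hf1 : ContDiff ℝ 1 f := hf.of_le (by norm_num)
  have hV : ContDiff ℝ 1 (grad f) := contDiff_grad hf
  let Y : E3 → E3 := fun x => inner ℝ (grad f x) (grad f x) • v - inner ℝ (grad f x) v • grad f x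
  have hY : ContDiff ℝ 1 Y :=
    ((hV.inner ℝ hV).fun_smul contDiff_const).sub ((hV.inner ℝ contDiff_const).fun_smul hV)
  have hY0 : ∀ x, fderiv ℝ f x (Y x) = 0 := fun x => by
    rw [fderiv_eq_inner_grad, inner_sub_right, inner_smul_right, inner_smul_right]
    ring
  have := h.ae_coord_eq_zero hN hY fun g hg hgc hgN =>
    setIntegral_fullDiv_eq_zero hΩ hf1 hfΩ (hg.fun_smul hY) hgc.smul_right
      ((tsupport_smul_subset_left _ _).trans hgN) fun x => by rw [map_smul, hY0, smul_zero]
  filter_upwards [this] with x hx hxN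
  have := hx hxN
  rw [inner_sub_left, inner_smul_left, inner_smul_left] at this
  simpa [sub_eq_zero] using this

theorem IsGaussGreen.ae_inner_grad_nonpos {Ω : Set E3} (hΩ : MeasurableSet Ω) {μ : Measure E3}
    {ν : E3 → E3} (h : IsGaussGreen Ω μ ν) {N : Set E3} (hN : IsOpen N)
    {f : E3 → ℝ} (hf : ContDiff ℝ 2 f) (hfΩ : ∀ᵐ x, x ∈ N → (x ∈ Ω ↔ 0 < f x)) :
    ∀ᵐ x ∂μ, x ∈ N → inner ℝ (grad f x) (ν x) ≤ 0 := by
  have hfin := h.finite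
  have hf1 : ContDiff ℝ 1 f := hf.of_le (by norm_num)
  have hV : ContDiff ℝ 1 (grad f) := contDiff_grad hf
  refine ae_nonpos_of_forall_contDiff hN (hV.continuous.measurable.inner h.measurable) ?_
    fun g hg hgc hgN hg0 => ?_
  · exact h.locallyIntegrable_inner hV.continuous
  · have h1 := setIntegral_fullDiv_nonpos hΩ hf1 hfΩ (hg.fun_smul hV) hgc.smul_right
      ((tsupport_smul_subset_left _ _).trans hgN) fun x => by
        show 0 ≤ fderiv ℝ f x (g x • grad f x)
        rw [map_smul, fderiv_eq_inner_grad]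
        exact mul_nonneg (hg0 x) real_inner_self_nonneg
    rw [h.formula _ (hg.fun_smul hV) hgc.smul_right] at h1
    refine le_of_eq_of_le (integral_congr_ae (ae_of_all _ fun x => ?_)) h1
    show _ = inner ℝ (g x • grad f x) (ν x)
    rw [inner_smul_left]
    rfl

/-- The normal is parallel to `∇f`, has length 1, and satisfies `∇f · ν ≤ 0`. -/
theorem IsGaussGreen.ae_eq_grad {Ω : Set E3} (hΩ : MeasurableSet Ω) {μ : Measure E3}
    {ν : E3 → E3} (h : IsGaussGreen Ω μ ν) {N : Set E3} (hN : IsOpen N)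
    {f : E3 → ℝ} (hf : ContDiff ℝ 2 f) (hfΩ : ∀ᵐ x, x ∈ N → (x ∈ Ω ↔ 0 < f x)) :
    ∀ᵐ x ∂μ, x ∈ N → grad f x ≠ 0 → ν x = -(‖grad f x‖⁻¹ • grad f x) := by
  filter_upwards [h.ae_parallel_grad hΩ hN hf hfΩ (stdE 0), h.ae_parallel_grad hΩ hN hf hfΩ (stdE 1),
    h.ae_parallel_grad hΩ hN hf hfΩ (stdE 2), h.ae_inner_grad_nonpos hΩ hN hf hfΩ, h.unit]
    with x h0 h1 h2 hs hu hxN hxV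
  have h0 := h0 hxN
  have h1 := h1 hxN
  have h2 := h2 hxN
  have hs := hs hxN
  simp only [inner_stdE, real_inner_comm (stdE _) (grad f x)] at h0 h1 h2
  rw [real_inner_self_eq_norm_sq] at h0 h1 h2
  set c : ℝ := inner ℝ (grad f x) (ν x) with hc
  have hn : 0 < ‖grad f x‖ := norm_pos_iff.2 hxV
  have e1 : ‖grad f x‖ ^ 2 • ν x = c • grad f x := by
    ext i
    fin_cases i
    · simpa [mul_comm] using h0
    · simpa [mul_comm] using h1
    · simpa [mul_comm] using h2
  have e2 : ‖grad f x‖ ^ 2 = |c| * ‖grad f x‖ := by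
    have := congrArg norm e1
    rwa [norm_smul, norm_smul, hu, mul_one, norm_pow, norm_norm, Real.norm_eq_abs] at this
  have e3 : c = -‖grad f x‖ := by
    rw [abs_of_nonpos hs] at e2
    have : ‖grad f x‖ = -c := by
      apply mul_right_cancel₀ hn.ne'
      rw [← e2]; ring
    linarith
  rw [e3] at e1
  have e4 : ν x = (‖grad f x‖ ^ 2)⁻¹ • (-‖grad f x‖ • grad f x) := by
    rw [← e1, smul_smul, inv_mul_cancel₀ (by positivity), one_smul]
  rw [e4, smul_smul, ← neg_smul]
  congr 1
  field_simp

/-- If `Ω` agrees near `p` with a superlevel set of a regular `C²` function, and has perimeter near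
`p`, then `p` is in the reduced boundary. -/
theorem IsGaussGreen.mem_reducedBoundary {Ω : Set E3} (hΩ : MeasurableSet Ω) {μ : Measure E3}
    {ν : E3 → E3} (h : IsGaussGreen Ω μ ν) {N : Set E3} (hN : IsOpen N) {p : E3} (hp : p ∈ N)
    {f : E3 → ℝ} (hf : ContDiff ℝ 2 f) (hfp : fderiv ℝ f p ≠ 0)
    (hfΩ : ∀ᵐ x, x ∈ N → (x ∈ Ω ↔ 0 < f x)) (hμ : ∀ ρ > 0, 0 < μ (Metric.closedBall p ρ)) :
    p ∈ reducedBoundary Ω := by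
  have hfin := h.finite
  let V := grad f
  have hV : ContDiff ℝ 1 V := contDiff_grad hf
  have hVp : V p ≠ 0 := fun h0 => hfp (by
    ext v
    rw [fderiv_eq_inner_grad]
    have : grad f p = 0 := h0
    simp [this])
  have hall : ∀ᵐ x ∂μ, x ∈ N → V x ≠ 0 → ν x = -(‖V x‖⁻¹ • V x) := h.ae_eq_grad hΩ hN hf hfΩ
  -- Near `p` the normal agrees almost everywhere with the continuous field `m`, so its averages
  -- converge at `p` itself and not merely at almost every point.
  let m : E3 → E3 := fun x => -(‖V x‖⁻¹ • V x)
  have hm : ContinuousAt m p :=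
    (((hV.continuous.continuousAt.norm).inv₀ (norm_ne_zero_iff.2 hVp)).smul
      hV.continuous.continuousAt).neg
  refine ⟨μ, ν, h, hμ, m p, ?_, ?_⟩
  · simp only [m, norm_neg, norm_smul, norm_inv, norm_norm]
    exact inv_mul_cancel₀ (norm_ne_zero_iff.2 hVp)
  · rw [Metric.nhds_basis_closedBall.tendsto_right_iff]
    intro ε hε
    have hnear : ∀ᶠ x in 𝓝 p, x ∈ N ∧ V x ≠ 0 ∧ m x ∈ Metric.closedBall (m p) ε := by
      filter_upwards [hN.mem_nhds hp, hV.continuous.continuousAt.eventually_ne hVp,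
        hm (Metric.closedBall_mem_nhds _ hε)] with x h1 h2 h3 using ⟨h1, h2, h3⟩
    obtain ⟨δ, hδ, hsub⟩ := Metric.nhds_basis_closedBall.mem_iff.1 hnear
    filter_upwards [Ioc_mem_nhdsGT hδ] with ρ hρ
    refine (convex_closedBall _ _).set_average_mem Metric.isClosed_closedBall (hμ ρ hρ.1).ne'
      (measure_ne_top _ _) ?_ h.integrable.integrableOn
    filter_upwards [ae_restrict_mem Metric.isClosed_closedBall.measurableSet,
      ae_restrict_of_ae hall] with x hx hall
    obtain ⟨h1, h2, h3⟩ := hsub (Metric.closedBall_subset_closedBall hρ.2 hx)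
    rw [hall h1 h2]
    exact h3


/-! ### Slices of sweepouts moved by diffeomorphisms -/

theorem IsNearDiffeo.volume_image_le {r : ℕ∞} (hr : 2 ≤ r) {Ψ : E3 ≃ₜ E3} (h : IsNearDiffeo r Ψ)
    {A : Set E3} (hA : MeasurableSet A) : volume (Ψ '' A) ≤ 48 * volume A := by
  refine (addHaar_image_le_lintegral_abs_det_fderiv volume hA (f' := fderiv ℝ Ψ) fun x _ =>
    ((h.contDiff.differentiable (coe_ne_zero_of_two_le hr) x).hasFDerivAt).hasFDerivWithinAt).trans ?_
  rw [← setLIntegral_const]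
  refine lintegral_mono fun x => ?_
  -- Three terms, each an entry bounded by 2 times a cofactor bounded by 8.
  have h1 : |(fderiv ℝ Ψ x).det| ≤ 48 := by
    rw [det_fderiv_eq]
    have h2 : ∀ j ∈ Finset.univ, ‖jac Ψ 0 j x * cofactor Ψ 0 j x‖ ≤ 16 := fun j _ => by
      rw [norm_mul]
      have := mul_le_mul (h.abs_jac_le 0 j x) (h.abs_cofactor_le 0 j x) (abs_nonneg _) zero_le_two
      exact this.trans (by norm_num)
    refine (norm_sum_le_of_le _ h2).trans ?_
    norm_num
  refine (ENNReal.ofReal_le_ofReal h1).trans ?_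
  simp

theorem IsNearDiffeo.volume_image_eq_zero {r : ℕ∞} (hr : 2 ≤ r) {Ψ : E3 ≃ₜ E3}
    (h : IsNearDiffeo r Ψ) {A : Set E3} (hA : volume A = 0) : volume (Ψ '' A) = 0 := by
  have h1 := h.volume_image_le hr (measurableSet_toMeasurable volume A)
  rw [measure_toMeasurable, hA, mul_zero] at h1
  exact measure_mono_null (image_mono (subset_toMeasurable volume A)) (le_antisymm h1 zero_le)

theorem IsBoundaryPoint.mem_closure {r : ℕ∞} {A : Set E3} {p : E3} (h : IsBoundaryPoint r A p) :
    p ∈ closure {q | IsInteriorPoint r A q} := by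
  obtain ⟨φ, hp, h0, h1, h2, h3⟩ := h
  have ht : (0 : E3) ∈ φ.target := h0 ▸ φ.map_source hp
  have hc : Tendsto (fun ε : ℝ => ε • stdE 1) (𝓝[>] 0) (𝓝 (0 : E3)) := by
    have : Continuous fun ε : ℝ => ε • stdE 1 := by fun_prop
    simpa using (this.tendsto 0).mono_left (nhdsWithin_le_nhds (s := Ioi 0))
  have hs : Tendsto (fun ε : ℝ => φ.symm (ε • stdE 1)) (𝓝[>] 0) (𝓝 p) := by
    have := (φ.continuousAt_symm ht).tendsto.comp hc
    rwa [← h0, φ.left_inv hp] at this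
  refine mem_closure_of_tendsto hs ?_
  filter_upwards [hc (φ.open_target.mem_nhds ht), self_mem_nhdsWithin] with ε hε hpos
  have hq : φ.symm (ε • stdE 1) ∈ φ.source := φ.map_target hε
  have e : φ (φ.symm (ε • stdE 1)) = ε • stdE 1 := φ.right_inv hε
  have hpos' : (0 : ℝ) < ε := hpos
  refine isInteriorPoint_of_half_chart φ h1 h2 h3 hq ((h3 _ hq).2 ?_) ?_
  · rw [e]; simp [stdE_apply, hpos'.le]
  · rw [e]; simp [stdE_apply, hpos']

theorem volume_flat : volume {y : E3 | y 2 = 0} = 0 := by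
  have h : ((LinearMap.ker (coordL 2 : E3 →ₗ[ℝ] ℝ)) : Set E3) = {y : E3 | y 2 = 0} := by
    ext y; simp
  rw [← h]
  refine Measure.addHaar_submodule _ _ fun htop => ?_
  have : stdE 2 ∈ LinearMap.ker (coordL 2 : E3 →ₗ[ℝ] ℝ) := htop ▸ Submodule.mem_top
  simp [stdE_apply] at this

/-- The properties of the slices of a sweepout. -/
structure IsSlice (r : ℕ∞) (M A B S G Ω : Set E3) : Prop where
  isClosed_M : IsClosed M
  isClosed_inner : IsClosed A
  isClosed_outer : IsClosed B
  finite_inner : S.Finite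
  finite_outer : G.Finite
  regular_inner : ∀ p ∈ A \ S, IsRegularPoint r A p
  outer_subset : B ⊆ frontier M
  boundary_inner : ∀ p ∉ S ∪ G, p ∈ A ∩ B ↔ IsBoundaryPoint r A p
  boundary_outer : ∀ p ∉ S ∪ G, p ∈ A ∩ B ↔ IsBoundaryPoint r B p
  internal : internalBoundary M Ω \ A ⊆ S
  external : (externalBoundary M Ω \ (A ∪ B)) ∪ ((A ∩ frontier M) \ externalBoundary M Ω) ∪
    (B \ externalBoundary M Ω) ⊆ S ∪ G
  finite_perimeter : HasFinitePerimeter Ω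
  subset : Ω ⊆ M

namespace IsSlice

variable {r : ℕ∞} {M A B S G Ω : Set E3} {μ : Measure E3} {ν : E3 → E3}

theorem reducedBoundary_subset_M (h : IsSlice r M A B S G Ω) (hg : IsGaussGreen Ω μ ν) :
    reducedBoundary Ω ⊆ M := by
  intro x hx
  by_contra hxM
  refine hg.measure_ne_zero_of_mem hx h.isClosed_M.isOpen_compl hxM
    ((hg.measure_eq_zero_iff h.isClosed_M.isOpen_compl).2 fun T hT hTc hTM => ?_)
  refine setIntegral_eq_zero_of_forall_eq_zero fun y hy => ?_
  exact fullDiv_eq_zero_of_notMem fun h' => hTM h' (h.subset hy)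

/-- The surfaces and the finite exceptional sets are closed, so nothing is lost by closing up. This
matters because the reduced boundary itself is tracked under diffeomorphisms only up to closure. -/
theorem closure_reducedBoundary_subset (h : IsSlice r M A B S G Ω) (hg : IsGaussGreen Ω μ ν) :
    closure (reducedBoundary Ω) ⊆ (A ∪ B) ∪ (S ∪ G) := by
  refine closure_minimal (fun x hx => ?_) ((h.isClosed_inner.union h.isClosed_outer).union
    (h.finite_inner.isClosed.union h.finite_outer.isClosed))
  by_contra hn
  simp only [mem_union, not_or] at hn
  obtain ⟨⟨h1, h2⟩, h3, h4⟩ := hn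
  by_cases hi : x ∈ interior M
  · exact h3 (h.internal ⟨⟨hx, hi⟩, h1⟩)
  · have hf : x ∈ frontier M := ⟨subset_closure (h.reducedBoundary_subset_M hg hx), hi⟩
    have : x ∈ S ∪ G := h.external (Or.inl (Or.inl ⟨subset_closure ⟨hx, hf⟩, by
      simp only [mem_union, not_or]; exact ⟨h1, h2⟩⟩))
    exact this.elim h3 h4

theorem closure_internal_subset (h : IsSlice r M A B S G Ω) :
    closure (internalBoundary M Ω) ⊆ A ∪ S := by
  refine closure_minimal (fun x hx => ?_) (h.isClosed_inner.union h.finite_inner.isClosed)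
  by_cases hA : x ∈ A
  · exact Or.inl hA
  · exact Or.inr (h.internal ⟨hx, hA⟩)

theorem measure_ne_zero (hg : IsGaussGreen Ω μ ν) {p : E3} (hp : p ∈ externalBoundary M Ω)
    {U : Set E3} (hU : IsOpen U) (hpU : p ∈ U) : μ U ≠ 0 := by
  obtain ⟨y, hyU, hy⟩ := mem_closure_iff.1 hp U hU hpU
  exact hg.measure_ne_zero_of_mem hy.1 hU hyU

/-- On an open set without points of `Γ` the perimeter is carried by `Σ`. -/
theorem ae_mem (h : IsSlice r M A B S G Ω) (hg : IsGaussGreen Ω μ ν) :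
    ∀ᵐ x ∂μ, x ∈ (A ∪ B) ∪ (S ∪ G) :=
  hg.ae_mem_reducedBoundary.mono fun _ hx =>
    h.closure_reducedBoundary_subset hg (subset_closure hx)

theorem isOpen_compl_sing (h : IsSlice r M A B S G Ω) : IsOpen (S ∪ G)ᶜ :=
  (h.finite_inner.union h.finite_outer).isClosed.isOpen_compl

variable {Ψ : E3 ≃ₜ E3} {μ' : Measure E3} {ν' : E3 → E3}

/-- The reduced boundary carries the perimeter, and null sets correspond under `Ψ`. As the external
boundary is a closure, positive perimeter on `∂M` in every neighbourhood suffices. -/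
theorem mem_external_of_measure (hf : ∀ x, Ψ x ∈ frontier M ↔ x ∈ frontier M)
    (hg' : IsGaussGreen (Ψ '' Ω) μ' ν') (hμ : ∀ B, (μ' (Ψ '' B) = 0 ↔ μ B = 0)) {p : E3}
    (hp : ∀ U, IsOpen U → p ∈ U → μ (U ∩ frontier M) ≠ 0) :
    Ψ p ∈ externalBoundary M (Ψ '' Ω) := by
  refine mem_closure_iff.2 fun O hO hpO => ?_
  have h1 := hp (Ψ ⁻¹' O) (hO.preimage Ψ.continuous) hpO
  rw [Ne, ← hμ] at h1
  obtain ⟨x, hx1, hx2⟩ : ∃ x ∈ Ψ '' (Ψ ⁻¹' O ∩ frontier M), x ∈ reducedBoundary (Ψ '' Ω) := by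
    by_contra hne
    push Not at hne
    refine h1 (measure_eq_zero_iff_ae_notMem.2 ?_)
    filter_upwards [hg'.ae_mem_reducedBoundary] with x hx hx'
    exact hne x hx' hx
  obtain ⟨y, ⟨hy1, hy2⟩, rfl⟩ := hx1
  exact ⟨Ψ y, hy1, hx2, (hf y).2 hy2⟩

/-- Near a regular point of `Γ` off `Σ` the perimeter lives on `Γ ⊆ ∂M`, so the measure criterion
applies. A point of `Γ ∩ Σ` is a boundary point of `Γ`, hence a limit of interior points of `Γ`;
these are off `Σ`, and the external boundary is closed. -/
theorem mem_external_of_mem_outer (h : IsSlice r M A B S G Ω) (hr : 2 ≤ r)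
    (hg : IsGaussGreen Ω μ ν) (hf : ∀ x, Ψ x ∈ frontier M ↔ x ∈ frontier M)
    (hg' : IsGaussGreen (Ψ '' Ω) μ' ν') (hμ : ∀ B, (μ' (Ψ '' B) = 0 ↔ μ B = 0)) {p : E3}
    (hp : p ∈ B) (hpS : p ∉ S ∪ G) : Ψ p ∈ externalBoundary M (Ψ '' Ω) := by
  have key : ∀ q ∈ B, q ∉ S ∪ G → q ∉ A → Ψ q ∈ externalBoundary M (Ψ '' Ω) := by
    intro q hq hqS hqA
    refine mem_external_of_measure hf hg' hμ fun U hU hqU h0 => ?_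
    have hqe : q ∈ externalBoundary M Ω := by
      by_contra hne
      exact hqS (h.external (Or.inr ⟨hq, hne⟩))
    have hU' : IsOpen (U ∩ Aᶜ ∩ (S ∪ G)ᶜ) :=
      (hU.inter h.isClosed_inner.isOpen_compl).inter h.isOpen_compl_sing
    refine measure_ne_zero hg hqe hU' ⟨⟨hqU, hqA⟩, hqS⟩ ?_
    rw [measure_eq_zero_iff_ae_notMem] at h0 ⊢
    filter_upwards [h0, h.ae_mem hg] with x hx hx2 hx3
    rcases hx2 with (h1 | h1) | h1
    · exact hx3.1.2 h1
    · exact hx ⟨hx3.1.1, h.outer_subset h1⟩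
    · exact hx3.2 h1
  by_cases hpA : p ∈ A
  · have hb := (h.boundary_outer p hpS).1 ⟨hpA, hp⟩
    have hcl : Ψ p ∈ closure (Ψ '' ((S ∪ G)ᶜ ∩ {q | IsInteriorPoint r B q})) := by
      refine image_closure_subset_closure_image Ψ.continuous (mem_image_of_mem _ ?_)
      exact h.isOpen_compl_sing.inter_closure ⟨hpS, hb.mem_closure⟩
    refine closure_minimal ?_ isClosed_closure hcl
    rintro _ ⟨q, ⟨hqS, hq⟩, rfl⟩
    exact key q hq.mem hqS fun hqA => hq.not_isBoundaryPoint hr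
      ((h.boundary_outer q hqS).1 ⟨hqA, hq.mem⟩)
  · exact key p hp hpS hpA

end IsSlice


/-! ### Points where `Σ` touches `∂M` away from `Γ`. -/

namespace IsSlice

variable {r : ℕ∞} {M A B S G Ω : Set E3} {μ : Measure E3} {ν : E3 → E3}

/-- In a small chart ball, `Σ` separates two connected halves that carry no perimeter, so `Ω` is
null or full in each. It cannot be the same in both, since `p` carries perimeter. Hence `Ω` is, up
to a null set, one side of `Σ`. -/
theorem exists_one_sided (h : IsSlice r M A B S G Ω) (hr : 2 ≤ r)
    (hg : IsGaussGreen Ω μ ν) {p : E3} (hp : IsInteriorPoint r A p) (hpB : p ∉ B)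
    (hpS : p ∉ S ∪ G) (hμ : ∀ U, IsOpen U → p ∈ U → μ U ≠ 0) :
    ∃ f : E3 → ℝ, ContDiff ℝ 2 f ∧ fderiv ℝ f p ≠ 0 ∧ ∃ N, IsOpen N ∧ p ∈ N ∧
      ∀ᵐ x, x ∈ N → (x ∈ Ω ↔ 0 < f x) := by
  obtain ⟨φ, hpφ, h0, hd, hds, hA⟩ := hp
  have hΩ := h.finite_perimeter.1
  have ht : (0 : E3) ∈ φ.target := h0 ▸ φ.map_source hpφ
  have hs0 : φ.symm 0 = p := by rw [← h0, φ.left_inv hpφ]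
  have hN0 : IsOpen (Bᶜ ∩ (S ∪ G)ᶜ) := h.isClosed_outer.isOpen_compl.inter h.isOpen_compl_sing
  obtain ⟨ρ, hρ, hball⟩ := Metric.isOpen_iff.1 (φ.symm.isOpen_inter_preimage hN0) 0
    ⟨ht, by rw [mem_preimage, hs0]; exact ⟨hpB, hpS⟩⟩
  let side : Set E3 → Set E3 := fun P => φ.symm '' (Metric.ball 0 ρ ∩ P)
  have hsub : Metric.ball 0 ρ ⊆ φ.target := fun y hy => (hball hy).1
  have hside : ∀ P, ∀ x ∈ side P, x ∈ φ.source ∧ x ∉ B ∧ x ∉ S ∪ G ∧ φ x ∈ P := by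
    rintro P _ ⟨y, hy, rfl⟩
    refine ⟨φ.map_target (hsub hy.1), (hball hy.1).2.1, (hball hy.1).2.2, ?_⟩
    rw [φ.right_inv (hsub hy.1)]; exact hy.2
  have hopen : ∀ P, IsOpen P → IsOpen (side P) := fun P hP =>
    φ.symm.isOpen_image_of_subset_source (Metric.isOpen_ball.inter hP)
      (inter_subset_left.trans hsub)
  have hconn : ∀ P, Convex ℝ P → IsPreconnected (side P) := fun P hP =>
    ((convex_ball (0 : E3) ρ).inter hP).isPreconnected.image _
      (φ.continuousOn_symm.mono (inter_subset_left.trans hsub))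
  have hc2 : Continuous fun y : E3 => y 2 := (coordL 2).continuous
  have hconst : ∀ P : Set E3, IsOpen P → Convex ℝ P → (∀ y ∈ P, y 2 ≠ 0) →
      (∀ᵐ x, x ∈ side P → x ∈ Ω) ∨ ∀ᵐ x, x ∈ side P → x ∉ Ω := fun P hP hPc hP0 => by
    refine PerimeterNull.ae_const hΩ (hopen P hP) (hconn P hPc)
      ((hg.measure_eq_zero_iff (hopen P hP)).1 ?_)
    rw [measure_eq_zero_iff_ae_notMem]
    filter_upwards [h.ae_mem hg] with x hx hxP
    obtain ⟨h1, h2, h3, h4⟩ := hside P x hxP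
    rcases hx with (hx | hx) | hx
    · exact hP0 _ h4 ((hA x h1).1 hx)
    · exact h2 hx
    · exact h3 hx
  have hlin : IsLinearMap ℝ fun y : E3 => y 2 := (coordL 2).isLinear
  have hplus := hconst {y | 0 < y 2} (isOpen_lt continuous_const hc2)
    (convex_halfSpace_gt hlin 0) fun y hy => (ne_of_lt hy).symm
  have hminus := hconst {y | y 2 < 0} (isOpen_lt hc2 continuous_const)
    (convex_halfSpace_lt hlin 0) fun y hy => ne_of_lt hy
  have hnull : ∀ᵐ x, x ∉ side {y | y 2 = 0} := by
    refine measure_eq_zero_iff_ae_notMem.1 ?_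
    refine addHaar_image_eq_zero_of_differentiableOn_of_addHaar_eq_zero volume
      ((hds.differentiableOn (coe_ne_zero_of_two_le hr)).mono (inter_subset_left.trans hsub)) ?_
    exact measure_mono_null inter_subset_right volume_flat
  let N : Set E3 := side univ
  have hNo : IsOpen N := hopen _ isOpen_univ
  have hpN : p ∈ N := ⟨0, ⟨Metric.mem_ball_self hρ, mem_univ _⟩, hs0⟩
  have hNP : ∀ P, ∀ x ∈ N, φ x ∈ P → x ∈ side P := by
    rintro P _ ⟨y, hy, rfl⟩ hyP
    rw [φ.right_inv (hsub hy.1)] at hyP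
    exact ⟨y, ⟨hy.1, hyP⟩, rfl⟩
  have htri : ∀ᵐ x, x ∈ N → (x ∈ side {y | 0 < y 2} ∧ 0 < φ x 2) ∨
      (x ∈ side {y | y 2 < 0} ∧ φ x 2 < 0) := by
    filter_upwards [hnull] with x hx hxN
    rcases lt_trichotomy (φ x 2) 0 with h1 | h1 | h1
    · exact Or.inr ⟨hNP {y | y 2 < 0} x hxN h1, h1⟩
    · exact absurd (hNP {y | y 2 = 0} x hxN h1) hx
    · exact Or.inl ⟨hNP {y | 0 < y 2} x hxN h1, h1⟩
  have hno : ¬ PerimeterNull Ω N := fun hn => hμ N hNo hpN ((hg.measure_eq_zero_iff hNo).2 hn)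
  -- The sign `s` records the side. If `Ω` were full on both sides or null on both, every test field
  -- supported in `N` would have zero integral of its divergence over `Ω`.
  obtain ⟨s, hs, hsN⟩ : ∃ s : ℝ, s ≠ 0 ∧ ∀ᵐ x, x ∈ N → (x ∈ Ω ↔ 0 < s * φ x 2) := by
    rcases hplus with hplus | hplus <;> rcases hminus with hminus | hminus
    · refine absurd (fun T hT hTc hTN => ?_) hno
      rw [← integral_fullDiv_eq_zero hT hTc]
      refine setIntegral_eq_integral_of_ae_compl_eq_zero ?_
      filter_upwards [hplus, hminus, htri] with x h1 h2 h3 h4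
      refine fullDiv_eq_zero_of_notMem fun h5 => h4 ?_
      rcases h3 (hTN h5) with h3 | h3
      exacts [h1 h3.1, h2 h3.1]
    · refine ⟨1, one_ne_zero, ?_⟩
      filter_upwards [hplus, hminus, htri] with x h1 h2 h3 hx
      rw [one_mul]
      rcases h3 hx with h3 | h3
      · exact ⟨fun _ => h3.2, fun _ => h1 h3.1⟩
      · exact ⟨fun h' => absurd h' (h2 h3.1), fun h' => absurd h' (not_lt.2 h3.2.le)⟩
    · refine ⟨-1, by norm_num, ?_⟩
      filter_upwards [hplus, hminus, htri] with x h1 h2 h3 hx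
      rw [neg_one_mul, neg_pos]
      rcases h3 hx with h3 | h3
      · exact ⟨fun h' => absurd h' (h1 h3.1), fun h' => absurd h' (not_lt.2 h3.2.le)⟩
      · exact ⟨fun _ => h3.2, fun _ => h2 h3.1⟩
    · refine absurd (fun T hT hTc hTN => ?_) hno
      refine setIntegral_eq_zero_of_ae_eq_zero ?_
      filter_upwards [hplus, hminus, htri] with x h1 h2 h3 h4
      refine fullDiv_eq_zero_of_notMem fun h5 => ?_
      rcases h3 (hTN h5) with h3 | h3
      exacts [h1 h3.1 h4, h2 h3.1 h4]
  obtain ⟨R, hR, hRN⟩ := Metric.nhds_basis_closedBall.mem_iff.1 (hNo.mem_nhds hpN)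
  -- The bump extends the chart coordinate to a globally `C²` function without changing it near `p`.
  let χ : ContDiffBump p := ⟨R / 2, R, by positivity, by linarith⟩
  let f : E3 → ℝ := fun x => χ x * (s * φ x 2)
  have hχ1 : ∀ x ∈ Metric.ball p (R / 2), χ x = 1 := fun x hx =>
    χ.one_of_mem_closedBall (Metric.ball_subset_closedBall hx)
  refine ⟨f, ?_, ?_, Metric.ball p (R / 2), Metric.isOpen_ball,
    Metric.mem_ball_self (by positivity), ?_⟩
  · rw [contDiff_iff_contDiffAt]
    intro x
    by_cases hx : x ∈ N
    · have hxs := (hside _ x hx).1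
      have h1 : ContDiffAt ℝ 2 φ x :=
        (hd.contDiffAt (φ.open_source.mem_nhds hxs)).of_le (two_le_coe hr)
      exact χ.contDiff.contDiffAt.mul (contDiffAt_const.mul ((coordL 2).contDiff.contDiffAt.comp x h1))
    · have hx' : x ∉ tsupport χ := fun h' => hx (hRN (by rwa [χ.tsupport_eq] at h'))
      have h1 : f =ᶠ[𝓝 x] fun _ => 0 := by
        filter_upwards [notMem_tsupport_iff_eventuallyEq.1 hx'] with y hy
        have hy' : χ y = 0 := hy
        simp [f, hy']
      exact contDiffAt_const.congr_of_eventuallyEq h1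
  · have h1 : f =ᶠ[𝓝 p] fun x => s * φ x 2 := by
      filter_upwards [Metric.ball_mem_nhds p (half_pos hR)] with x hx
      simp only [f, hχ1 x hx, one_mul]
    rw [h1.fderiv_eq]
    obtain ⟨L, hL⟩ := exists_chart_deriv (one_le_coe_of_two_le hr) φ hd hds
    have h2 : HasFDerivAt (fun x => s * φ x 2) (s • (coordL 2 ∘L (L p : E3 →L[ℝ] E3))) p :=
      (hasFDerivAt_coord (hL.1 p hpφ) 2).const_mul s
    rw [h2.fderiv]
    intro h3
    have h4 := congrArg (fun L' : E3 →L[ℝ] ℝ => L' ((L p).symm (stdE 2))) h3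
    simp [stdE_apply, hs] at h4
  · filter_upwards [hsN] with x hx hxb
    rw [hx (hRN (Metric.ball_subset_closedBall (Metric.ball_subset_ball (by linarith) hxb)))]
    simp only [f, hχ1 x hxb, one_mul]

variable {Ψ : E3 ≃ₜ E3} {μ' : Measure E3} {ν' : E3 → E3}

/-- Here `Σ` may meet `∂M` in a set without perimeter, even in a single point, so no
almost-everywhere argument can work. Instead, being one side of a regular level set is preserved by
`Ψ` and places `Ψ p` itself in the reduced boundary. -/
theorem mem_external_of_isInteriorPoint (h : IsSlice r M A B S G Ω) (hr : 2 ≤ r)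
    (hΨ : IsNearDiffeo r Ψ)
    (hg : IsGaussGreen Ω μ ν) (hf : ∀ x, Ψ x ∈ frontier M ↔ x ∈ frontier M)
    (hg' : IsGaussGreen (Ψ '' Ω) μ' ν') (hμ : ∀ B, (μ' (Ψ '' B) = 0 ↔ μ B = 0)) {p : E3}
    (hp : IsInteriorPoint r A p) (hpM : p ∈ frontier M) (hpB : p ∉ B) (hpS : p ∉ S ∪ G) :
    Ψ p ∈ externalBoundary M (Ψ '' Ω) := by
  have hpe : p ∈ externalBoundary M Ω := by
    by_contra hne
    exact hpS (h.external (Or.inl (Or.inr ⟨⟨hp.mem, hpM⟩, hne⟩)))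
  obtain ⟨f, hf2, hfp, N, hN, hpN, hfN⟩ := h.exists_one_sided hr hg hp hpB hpS
    fun U hU hpU => measure_ne_zero hg hpe hU hpU
  have hsymm : ContDiff ℝ 2 Ψ.symm := (hΨ.contDiff_symm hr).of_le (two_le_coe hr)
  have hΨd := hΨ.contDiff.differentiable (coe_ne_zero_of_two_le hr)
  refine subset_closure ⟨?_, (hf p).2 hpM⟩
  refine hg'.mem_reducedBoundary (Ψ.measurableEmbedding.measurableSet_image.2 h.finite_perimeter.1)
    (N := Ψ '' N) (Ψ.isOpenMap _ hN) (mem_image_of_mem _ hpN) (hf2.comp hsymm) ?_ ?_ ?_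
  · intro h0
    apply hfp
    have h1 : f = (f ∘ Ψ.symm) ∘ Ψ := by ext x; simp
    rw [h1, fderiv_comp p ((hf2.comp hsymm).differentiable two_ne_zero _) (hΨd p), h0]
    simp
  · have h1 : volume (Ψ '' {x | ¬ (x ∈ N → (x ∈ Ω ↔ 0 < f x))}) = 0 :=
      hΨ.volume_image_eq_zero hr (ae_iff.1 hfN)
    filter_upwards [measure_eq_zero_iff_ae_notMem.1 h1] with y hy hyN
    obtain ⟨x, rfl⟩ := Ψ.surjective y
    rw [Ψ.injective.mem_set_image] at hy hyN ⊢
    simp only [mem_ofPred_eq, not_not] at hy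
    simpa using hy hyN
  · intro ρ hρ
    obtain ⟨V, hV⟩ : ∃ V, V = Ψ ⁻¹' Metric.ball (Ψ p) ρ := ⟨_, rfl⟩
    have hpV : p ∈ V := by rw [hV, mem_preimage]; exact Metric.mem_ball_self hρ
    have hVo : IsOpen V := by rw [hV]; exact Metric.isOpen_ball.preimage Ψ.continuous
    have hVi : Ψ '' V = Metric.ball (Ψ p) ρ := by rw [hV, image_preimage_eq _ Ψ.surjective]
    have h0 : μ V ≠ 0 := measure_ne_zero hg hpe hVo hpV
    have h1 : μ' (Metric.ball (Ψ p) ρ) ≠ 0 := fun h => h0 ((hμ V).1 (hVi ▸ h))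
    exact (pos_iff_ne_zero.2 h1).trans_le (measure_mono Metric.ball_subset_closedBall)

/-- Every neighbourhood of a reduced boundary point of the image carries perimeter, hence so does
its preimage, which therefore meets `reducedBoundary Ω`. -/
theorem reducedBoundary_image_subset (h : IsSlice r M A B S G Ω) (hg : IsGaussGreen Ω μ ν)
    (hg' : IsGaussGreen (Ψ '' Ω) μ' ν') (hμ : ∀ B, (μ' (Ψ '' B) = 0 ↔ μ B = 0)) :
    reducedBoundary (Ψ '' Ω) ⊆ Ψ '' closure (reducedBoundary Ω) := by
  intro y hy
  obtain ⟨x, rfl⟩ := Ψ.surjective y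
  refine mem_image_of_mem _ (mem_closure_iff.2 fun U hU hxU => ?_)
  have h1 := hg'.measure_ne_zero_of_mem hy (Ψ.isOpenMap U hU) (mem_image_of_mem _ hxU)
  rw [Ne, hμ] at h1
  by_contra hne
  refine h1 (measure_eq_zero_iff_ae_notMem.2 ?_)
  filter_upwards [hg.ae_mem_reducedBoundary] with z hz hzU
  exact hne ⟨z, hzU, hz⟩

/-- The internal and external boundaries of the sets of a sweepout are transformed along with the
surfaces. -/
theorem image_boundaries (h : IsSlice r M A B S G Ω) (hr : 2 ≤ r) (hΨ : IsNearDiffeo r Ψ)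
    (hM : ∀ x, Ψ x ∈ interior M ↔ x ∈ interior M)
    (hf : ∀ x, Ψ x ∈ frontier M ↔ x ∈ frontier M) :
    internalBoundary M (Ψ '' Ω) \ Ψ '' A ⊆ Ψ '' S ∧
    (externalBoundary M (Ψ '' Ω) \ (Ψ '' A ∪ Ψ '' B)) ∪
      ((Ψ '' A ∩ frontier M) \ externalBoundary M (Ψ '' Ω)) ∪
      (Ψ '' B \ externalBoundary M (Ψ '' Ω)) ⊆ Ψ '' S ∪ Ψ '' G := by
  obtain ⟨hm, μ, ν, hg⟩ := h.finite_perimeter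
  obtain ⟨μ', ν', hg', hμ⟩ := hg.exists_image hr hΨ hm
  have hsub := h.reducedBoundary_image_subset hg hg' hμ
  refine ⟨?_, ?_⟩
  · rintro y ⟨⟨hy, hyM⟩, hyA⟩
    obtain ⟨x, hx, rfl⟩ := hsub hy
    rw [hM] at hyM
    rw [Ψ.injective.mem_set_image] at hyA ⊢
    have h1 := isOpen_interior.inter_closure ⟨hyM, hx⟩
    rw [inter_comm] at h1
    exact (h.closure_internal_subset h1).resolve_left hyA
  · rw [← image_union, ← image_union]
    rintro y ((⟨hy, hyAB⟩ | ⟨⟨hyA, hyM⟩, hy⟩) | ⟨hyB, hy⟩)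
    · have h1 : y ∈ Ψ '' closure (reducedBoundary Ω) := by
        refine closure_minimal (inter_subset_left.trans hsub)
          (Ψ.isClosed_image.2 isClosed_closure) hy
      obtain ⟨x, hx, rfl⟩ := h1
      rw [Ψ.injective.mem_set_image] at hyAB ⊢
      exact (h.closure_reducedBoundary_subset hg hx).resolve_left hyAB
    · obtain ⟨x, hx, rfl⟩ := hyA
      rw [Ψ.injective.mem_set_image]
      by_contra hxS
      rw [hf] at hyM
      by_cases hxB : x ∈ B
      · exact hy (h.mem_external_of_mem_outer hr hg hf hg' hμ hxB hxS)
      · rcases h.regular_inner x ⟨hx, fun h' => hxS (Or.inl h')⟩ with hi | hb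
        · exact hy (h.mem_external_of_isInteriorPoint hr hΨ hg hf hg' hμ hi hyM hxB hxS)
        · exact hxB ((h.boundary_inner x hxS).2 hb).2
    · obtain ⟨x, hx, rfl⟩ := hyB
      rw [Ψ.injective.mem_set_image]
      by_contra hxS
      exact hy (h.mem_external_of_mem_outer hr hg hf hg' hμ hx hxS)

end IsSlice

/-! ### Sweepouts moved by families of diffeomorphisms -/

/-- The inverses are Lipschitz with the common constant 2, so it is enough to compare `y` with `Ψ t`
at the fixed point `(Ψ s)⁻¹ y`. -/
theorem IsNearDiffeoFamily.continuous_symm {P : Type} [TopologicalSpace P] {r : ℕ∞} {M : Set E3}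
    {Ψ : P → E3 ≃ₜ E3} (h : IsNearDiffeoFamily r M Ψ) :
    Continuous fun z : P × E3 => (Ψ z.1).symm z.2 := by
  rw [continuous_iff_continuousAt]
  rintro ⟨s, y⟩
  rw [ContinuousAt, tendsto_iff_dist_tendsto_zero]
  have h1 : Continuous fun z : P × E3 => 2 * dist z.2 (Ψ z.1 ((Ψ s).symm y)) :=
    (continuous_snd.dist (h.continuous.comp (continuous_fst.prodMk continuous_const))).const_mul 2
  have h2 := h1.tendsto (s, y)
  simp only [Homeomorph.apply_symm_apply, dist_self, mul_zero] at h2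
  refine squeeze_zero (fun _ => dist_nonneg) (fun z => ?_) h2
  have := (h.near z.1).le_dist ((Ψ z.1).symm z.2) ((Ψ s).symm y)
  simpa using this

/-- The set `Ω s` is squeezed between a compact `K` and an open `W` of almost the same volume. For
`t` near `s`, the maps `(Ψ s)⁻¹ ∘ Ψ t` and `(Ψ t)⁻¹ ∘ Ψ s` send `K` into `W`, so the images of `Ω s`
under `Ψ t` and `Ψ s` differ by little. -/
theorem IsNearDiffeoFamily.tendsto_volume {P : Type} [TopologicalSpace P] {r : ℕ∞} (hr : 2 ≤ r)
    {M : Set E3} (hM : IsCompact M) {Ψ : P → E3 ≃ₜ E3} (h : IsNearDiffeoFamily r M Ψ)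
    {Ω : P → Set E3} (hΩ : ∀ t, MeasurableSet (Ω t)) (hΩM : ∀ t, Ω t ⊆ M) (s : P)
    (hc : Tendsto (fun t => volume (Ω t \ Ω s) + volume (Ω s \ Ω t)) (𝓝 s) (𝓝 0)) :
    Tendsto (fun t => volume (Ψ t '' Ω t \ Ψ s '' Ω s) + volume (Ψ s '' Ω s \ Ψ t '' Ω t))
      (𝓝 s) (𝓝 0) := by
  rw [ENNReal.tendsto_nhds_zero]
  intro ε hε
  rcases eq_or_ne ε ∞ with rfl | hεt
  · simp
  -- The final sum consists of five contributions of `48 δ`: four from replacing `Ψ t` by `Ψ s`, one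
  -- from replacing `Ω t` by `Ω s`.
  let δ : ℝ≥0∞ := ε / 240
  have hδ : δ ≠ 0 := (ENNReal.div_pos hε.ne' (by simp)).ne'
  have hfin : volume (Ω s) ≠ ∞ := ne_top_of_le_ne_top hM.measure_lt_top.ne (measure_mono (hΩM s))
  obtain ⟨K, hKs, hK, hKδ⟩ := (hΩ s).exists_isCompact_sdiff_lt hfin hδ
  obtain ⟨W, hWs, hW, -, hWδ⟩ := (hΩ s).exists_isOpen_sdiff_lt hfin hδ
  have e1 : ∀ᶠ t in 𝓝 s, ∀ x ∈ K, (Ψ s).symm (Ψ t x) ∈ W := by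
    refine hK.eventually_forall_of_forall_eventually (P := fun t x => (Ψ s).symm (Ψ t x) ∈ W)
      fun x hx => ?_
    refine ((Ψ s).symm.continuous.comp h.continuous).continuousAt (x := (s, x)) |>.preimage_mem_nhds ?_
    simpa using hW.mem_nhds (hWs (hKs hx))
  have e2 : ∀ᶠ t in 𝓝 s, ∀ x ∈ K, (Ψ t).symm (Ψ s x) ∈ W := by
    refine hK.eventually_forall_of_forall_eventually (P := fun t x => (Ψ t).symm (Ψ s x) ∈ W)
      fun x hx => ?_
    have hcs : Continuous fun z : P × E3 => (Ψ z.1).symm (Ψ s z.2) :=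
      h.continuous_symm.comp (continuous_fst.prodMk ((Ψ s).continuous.comp continuous_snd))
    refine hcs.continuousAt (x := (s, x)) |>.preimage_mem_nhds ?_
    simpa using hW.mem_nhds (hWs (hKs hx))
  have key : ∀ t t', (∀ x ∈ K, (Ψ t').symm (Ψ t x) ∈ W) →
      volume (Ψ t '' Ω s \ Ψ t' '' Ω s) ≤ 48 * δ + 48 * δ := fun t t' htt => by
    have hsub : Ψ t '' Ω s \ Ψ t' '' Ω s ⊆ Ψ t '' (Ω s \ K) ∪ Ψ t' '' (W \ Ω s) := by
      rintro _ ⟨⟨x, hx, rfl⟩, hx'⟩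
      by_cases hxK : x ∈ K
      · refine Or.inr ⟨(Ψ t').symm (Ψ t x), ⟨htt x hxK, fun h' => hx' ⟨_, h', ?_⟩⟩, ?_⟩ <;> simp
      · exact Or.inl ⟨x, ⟨hx, hxK⟩, rfl⟩
    refine (measure_mono hsub).trans ((measure_union_le _ _).trans (add_le_add ?_ ?_))
    · exact ((h.near t).volume_image_le hr ((hΩ s).diff hK.measurableSet)).trans (by gcongr)
    · exact ((h.near t').volume_image_le hr (hW.measurableSet.diff (hΩ s))).trans (by gcongr)
  filter_upwards [e1, e2, ENNReal.tendsto_nhds_zero.1 hc δ (pos_iff_ne_zero.2 hδ)] with t h1 h2 h3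
  have s1 : Ψ t '' Ω t \ Ψ s '' Ω s ⊆ Ψ t '' (Ω t \ Ω s) ∪ (Ψ t '' Ω s \ Ψ s '' Ω s) := by
    rintro _ ⟨⟨x, hx, rfl⟩, hx'⟩
    by_cases hxs : x ∈ Ω s
    · exact Or.inr ⟨⟨x, hxs, rfl⟩, hx'⟩
    · exact Or.inl ⟨x, ⟨hx, hxs⟩, rfl⟩
  have s2 : Ψ s '' Ω s \ Ψ t '' Ω t ⊆ (Ψ s '' Ω s \ Ψ t '' Ω s) ∪ Ψ t '' (Ω s \ Ω t) := by
    rintro y ⟨hy, hy'⟩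
    by_cases hyt : y ∈ Ψ t '' Ω s
    · obtain ⟨x, hx, rfl⟩ := hyt
      exact Or.inr ⟨x, ⟨hx, fun h' => hy' ⟨x, h', rfl⟩⟩, rfl⟩
    · exact Or.inl ⟨hy, hyt⟩
  have v1 := (h.near t).volume_image_le hr ((hΩ t).diff (hΩ s))
  have v2 := (h.near t).volume_image_le hr ((hΩ s).diff (hΩ t))
  calc _ ≤ (volume (Ψ t '' (Ω t \ Ω s)) + volume (Ψ t '' Ω s \ Ψ s '' Ω s)) +
        (volume (Ψ s '' Ω s \ Ψ t '' Ω s) + volume (Ψ t '' (Ω s \ Ω t))) :=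
        add_le_add ((measure_mono s1).trans (measure_union_le _ _))
          ((measure_mono s2).trans (measure_union_le _ _))
    _ ≤ (48 * volume (Ω t \ Ω s) + (48 * δ + 48 * δ)) + ((48 * δ + 48 * δ) +
        48 * volume (Ω s \ Ω t)) :=
        add_le_add (add_le_add v1 (key t s h1)) (add_le_add (key s t h2) v2)
    _ = 48 * (volume (Ω t \ Ω s) + volume (Ω s \ Ω t)) + 192 * δ := by ring
    _ ≤ 48 * δ + 192 * δ := by gcongr
    _ = 240 * δ := by ring
    _ = ε := ENNReal.mul_div_cancel (by simp) (by simp)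

theorem IsSweepoutWith.isSlice {r : ℕ∞} {M : Set E3} (hM : IsClosed M) {c : PairPath}
    {S G Ω : I01 → Set E3} (h : IsSweepoutWith r M c S G Ω) (t : I01) :
    IsSlice r M (c.inner t) (c.outer t) (S t) (G t) (Ω t) where
  isClosed_M := hM
  isClosed_inner := h.inner_family.isClosed t
  isClosed_outer := h.outer_family.isClosed t
  finite_inner := h.inner_family.finite_sing t
  finite_outer := h.outer_family.finite_sing t
  regular_inner := (h.inner_family.isSurface t).regular
  outer_subset := h.outer_subset t
  boundary_inner := h.boundary_inner t
  boundary_outer := h.boundary_outer t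
  internal := h.internal t
  external := h.external t
  finite_perimeter := h.finite_perimeter t
  subset := by
    obtain ⟨O, -, hO⟩ := h.rel_open t
    rw [hO]; exact inter_subset_left

/-- The sweepout moved by a family of diffeomorphisms. -/
def PairPath.image (c : PairPath) (Ψ : I01 → E3 ≃ₜ E3) : PairPath where
  inner t := Ψ t '' c.inner t
  outer t := Ψ t '' c.outer t

theorem IsSweepoutWith.image {r : ℕ∞} (hr : 2 ≤ r) {M : Set E3} (hM : IsCompact M) {c : PairPath}
    {S G Ω : I01 → Set E3} (h : IsSweepoutWith r M c S G Ω) {Ψ : I01 → E3 ≃ₜ E3}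
    (hΨ : IsNearDiffeoFamily r M Ψ) : IsSweepoutWith r M (c.image Ψ) (fun t => Ψ t '' S t)
      (fun t => Ψ t '' G t) (fun t => Ψ t '' Ω t) where
  inner_family := h.inner_family.image hr hM hΨ
  outer_family := h.outer_family.image hr hM hΨ
  rel_open t := by
    obtain ⟨O, hO, hΩ⟩ := h.rel_open t
    refine ⟨Ψ t '' O, (Ψ t).isOpenMap _ hO, ?_⟩
    rw [hΩ, image_inter (Ψ t).injective, hΨ.image_eq]
  finite_perimeter t := (h.finite_perimeter t).image hr (hΨ.near t)
  outer_subset t := by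
    rw [← hΨ.image_frontier t]
    exact image_mono (h.outer_subset t)
  boundary_inner t p hp := by
    obtain ⟨q, rfl⟩ := (Ψ t).surjective p
    rw [← image_union, (Ψ t).injective.mem_set_image] at hp
    show Ψ t q ∈ Ψ t '' _ ∩ Ψ t '' _ ↔ IsBoundaryPoint r (Ψ t '' _) (Ψ t q)
    rw [(hΨ.near t).isBoundaryPoint_image_iff hr, ← h.boundary_inner t q hp,
      ← image_inter (Ψ t).injective, (Ψ t).injective.mem_set_image]
  boundary_outer t p hp := by
    obtain ⟨q, rfl⟩ := (Ψ t).surjective p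
    rw [← image_union, (Ψ t).injective.mem_set_image] at hp
    show Ψ t q ∈ Ψ t '' _ ∩ Ψ t '' _ ↔ IsBoundaryPoint r (Ψ t '' _) (Ψ t q)
    rw [(hΨ.near t).isBoundaryPoint_image_iff hr, ← h.boundary_outer t q hp,
      ← image_inter (Ψ t).injective, (Ψ t).injective.mem_set_image]
  internal t := ((h.isSlice hM.isClosed t).image_boundaries hr (hΨ.near t) (hΨ.mem_interior_iff t)
    (hΨ.mem_frontier_iff t)).1
  external t := ((h.isSlice hM.isClosed t).image_boundaries hr (hΨ.near t) (hΨ.mem_interior_iff t)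
    (hΨ.mem_frontier_iff t)).2
  start := by rw [h.start, image_empty]
  finish := by rw [h.finish, hΨ.image_eq]
  volume_continuous s := hΨ.tendsto_volume hr hM (fun t => (h.finite_perimeter t).1)
    (fun t => (h.isSlice hM.isClosed t).subset) s (h.volume_continuous s)


/-! ### Deformations -/

theorem exists_forall_norm_le {E G : Type*} [NormedAddCommGroup E] [NormedSpace ℝ E]
    [FiniteDimensional ℝ E] [NormedAddCommGroup G] {F : ℝ × E → G} (hF : Continuous F)
    (h0 : ∀ x, F (0, x) = 0) {R : ℝ} (hR : ∀ s x, R < ‖x‖ → F (s, x) = 0) {ε : ℝ} (hε : 0 < ε) :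
    ∃ δ > 0, ∀ s, |s| ≤ δ → ∀ x, ‖F (s, x)‖ ≤ ε := by
  have : ProperSpace E := FiniteDimensional.proper ℝ E
  have h1 : ∀ᶠ s in 𝓝 (0 : ℝ), ∀ x ∈ Metric.closedBall (0 : E) R, ‖F (s, x)‖ < ε := by
    refine (isCompact_closedBall (0 : E) R).eventually_forall_of_forall_eventually fun x _ => ?_
    refine (hF.norm.tendsto (0, x)).eventually_lt_const ?_
    rw [h0, norm_zero]; exact hε
  obtain ⟨δ, hδ, h2⟩ := Metric.eventually_nhds_iff.1 h1
  refine ⟨δ / 2, by positivity, fun s hs x => ?_⟩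
  by_cases hx : R < ‖x‖
  · rw [hR s x hx, norm_zero]; exact hε.le
  · refine (h2 ?_ x (by simpa using hx)).le
    rw [Real.dist_eq, sub_zero]; linarith

/-- A one-parameter family of `C^r` maps of `ℝ³` that starts at the identity, is constant outside a
ball, and preserves `M`. -/
structure Deformation (r : ℕ∞) (M : Set E3) where
  toFun : ℝ × E3 → E3
  contDiff : ContDiff ℝ r toFun
  zero : ∀ x, toFun (0, x) = x
  radius : ℝ
  eq_self : ∀ s x, radius < ‖x‖ → toFun (s, x) = x
  mem_iff : ∀ s x, toFun (s, x) ∈ M ↔ x ∈ M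

namespace Deformation

variable {r : ℕ∞} {M : Set E3} (D : Deformation r M)

/-- The map at time `s`. -/
def slice (s : ℝ) (x : E3) : E3 := D.toFun (s, x)

/-- The initial velocity. -/
def field (x : E3) : E3 := fderiv ℝ D.toFun (0, x) (1, 0)

theorem slice_zero : D.slice 0 = id := funext D.zero

theorem contDiff_slice (s : ℝ) : ContDiff ℝ r (D.slice s) :=
  D.contDiff.comp (contDiff_const.prodMk contDiff_id)

theorem contDiff_fderiv (hr : 2 ≤ r) : ContDiff ℝ 1 (fderiv ℝ D.toFun) :=
  (D.contDiff.of_le (two_le_coe hr)).fderiv_right (by norm_num)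

theorem hasFDerivAt (hr : 2 ≤ r) (z : ℝ × E3) :
    HasFDerivAt D.toFun (fderiv ℝ D.toFun z) z :=
  (D.contDiff.differentiable (coe_ne_zero_of_two_le hr) z).hasFDerivAt

theorem hasFDerivAt_fderiv (hr : 2 ≤ r) (z : ℝ × E3) :
    HasFDerivAt (fderiv ℝ D.toFun) (fderiv ℝ (fderiv ℝ D.toFun) z) z :=
  ((D.contDiff_fderiv hr).differentiable one_ne_zero z).hasFDerivAt

theorem hasFDerivAt_slice (hr : 2 ≤ r) (s : ℝ) (x : E3) :
    HasFDerivAt (D.slice s) (fderiv ℝ D.toFun (s, x) ∘L ContinuousLinearMap.inr ℝ ℝ E3) x :=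
  (D.hasFDerivAt hr (s, x)).comp x (hasFDerivAt_prodMk_right s x)

theorem contDiff_field (hr : 2 ≤ r) : ContDiff ℝ 1 D.field :=
  ((D.contDiff_fderiv hr).comp (contDiff_const.prodMk contDiff_id)).clm_apply contDiff_const

theorem fderiv_slice_of_lt {s : ℝ} {x : E3} (hx : D.radius < ‖x‖) :
    fderiv ℝ (D.slice s) x = ContinuousLinearMap.id ℝ E3 := by
  have h1 : D.slice s =ᶠ[𝓝 x] id := by
    filter_upwards [(isOpen_lt continuous_const continuous_norm).mem_nhds hx] with y hy
    exact D.eq_self s y hy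
  rw [h1.fderiv_eq, fderiv_id]

/-- Symmetry of second derivatives: the space derivative of the initial velocity is the time
derivative of the space derivative. -/
theorem fderiv_field (hr : 2 ≤ r) (x : E3) : fderiv ℝ D.field x =
    fderiv ℝ (fderiv ℝ D.toFun) (0, x) (1, 0) ∘L ContinuousLinearMap.inr ℝ ℝ E3 := by
  have h1 : HasFDerivAt D.field _ x :=
    ((D.hasFDerivAt_fderiv hr (0, x)).comp x (hasFDerivAt_prodMk_right (0 : ℝ) x)).clm_apply
      (hasFDerivAt_const ((1 : ℝ), (0 : E3)) x)
  rw [h1.fderiv]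
  ext1 v
  have := second_derivative_symmetric (fun y => D.hasFDerivAt hr y)
    (D.hasFDerivAt_fderiv hr (0, x)) (0, v) (1, 0)
  simpa using this

theorem hasDerivAt_fderiv_slice (hr : 2 ≤ r) (s : ℝ) (x : E3) :
    HasDerivAt (fun s => fderiv ℝ (D.slice s) x)
      (fderiv ℝ (fderiv ℝ D.toFun) (s, x) (1, 0) ∘L ContinuousLinearMap.inr ℝ ℝ E3) s := by
  have h1 : (fun s => fderiv ℝ (D.slice s) x) =
      fun s => fderiv ℝ D.toFun (s, x) ∘L ContinuousLinearMap.inr ℝ ℝ E3 :=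
    funext fun s => (D.hasFDerivAt_slice hr s x).fderiv
  rw [h1]
  have h2 : HasFDerivAt (fun s : ℝ => fderiv ℝ D.toFun (s, x)) _ s :=
    (D.hasFDerivAt_fderiv hr (s, x)).comp s (hasFDerivAt_prodMk_left s x)
  have h3 := (h2.clm_comp (hasFDerivAt_const (ContinuousLinearMap.inr ℝ ℝ E3) s)).hasDerivAt
  simpa using h3

/-- The mean value inequality in time. The derivative of the left-hand side is the variation of a
continuous mixed second derivative, which vanishes outside a fixed ball and is thus uniformly small
for small times. -/
theorem exists_expansion (hr : 2 ≤ r) {η : ℝ} (hη : 0 < η) : ∃ δ > 0, ∀ s, |s| ≤ δ → ∀ x,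
    ‖fderiv ℝ (D.slice s) x - ContinuousLinearMap.id ℝ E3 - s • fderiv ℝ D.field x‖ ≤ η * |s| := by
  set H : ℝ × E3 → (E3 →L[ℝ] E3) := fun z =>
    fderiv ℝ (fderiv ℝ D.toFun) z (1, 0) ∘L ContinuousLinearMap.inr ℝ ℝ E3 with hH
  have hHc : Continuous H :=
    (((D.contDiff_fderiv hr).continuous_fderiv one_ne_zero).clm_apply continuous_const).clm_comp
      continuous_const
  have hHR : ∀ s x, D.radius < ‖x‖ → H (s, x) = 0 := by
    intro s x hx
    have h1 := D.hasDerivAt_fderiv_slice hr s x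
    simp only [D.fderiv_slice_of_lt hx] at h1
    exact h1.unique (hasDerivAt_const _ _)
  obtain ⟨δ, hδ, h⟩ := exists_forall_norm_le (F := fun z => H z - H (0, z.2))
    (hHc.sub (hHc.comp (continuous_const.prodMk continuous_snd))) (by simp) (R := D.radius)
    (fun s x hx => by simp [hHR _ _ hx]) hη
  refine ⟨δ, hδ, fun s hs x => ?_⟩
  have hd : ∀ y ∈ Icc (-δ) δ, HasDerivWithinAt
      (fun s => fderiv ℝ (D.slice s) x - s • fderiv ℝ D.field x) (H (y, x) - H (0, x))
      (Icc (-δ) δ) y := by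
    intro y hy
    have h1 := (D.hasDerivAt_fderiv_slice hr y x).fun_sub
      ((hasDerivAt_id y).smul_const (fderiv ℝ D.field x))
    rw [one_smul, D.fderiv_field hr x] at h1
    rw [D.fderiv_field hr x]
    exact h1.hasDerivWithinAt
  have h2 := (convex_Icc (-δ) δ).norm_image_sub_le_of_norm_hasDerivWithin_le hd
    (fun y hy => h y (abs_le.2 hy) x) (x := 0) (y := s) ⟨by linarith, hδ.le⟩ (abs_le.1 hs)
  have e : (0 : ℝ) • fderiv ℝ D.field x = 0 := by ext1 v; exact zero_smul ℝ (fderiv ℝ D.field x v)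
  rw [e, sub_zero, sub_zero, D.slice_zero, fderiv_id, Real.norm_eq_abs] at h2
  rwa [sub_right_comm]

theorem exists_isCloseToId (hr : 2 ≤ r) {ε : ℝ≥0} (hε : 0 < ε) :
    ∃ δ > 0, ∀ s, |s| ≤ δ → IsCloseToId (D.slice s) univ ε := by
  have hε' : (0 : ℝ) < ε := hε
  obtain ⟨δ₁, hδ₁, h1⟩ := exists_forall_norm_le (F := fun z => D.toFun z - z.2)
    (D.contDiff.continuous.sub continuous_snd) (by simp [D.zero]) (R := D.radius)
    (fun s x hx => by simp [D.eq_self s x hx]) hε'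
  have h0 : ∀ z : ℝ × E3, fderiv ℝ (D.slice z.1) z.2 =
      fderiv ℝ D.toFun z ∘L ContinuousLinearMap.inr ℝ ℝ E3 :=
    fun z => (D.hasFDerivAt_slice hr z.1 z.2).fderiv
  obtain ⟨δ₂, hδ₂, h2⟩ := exists_forall_norm_le
    (F := fun z : ℝ × E3 => fderiv ℝ (D.slice z.1) z.2 - ContinuousLinearMap.id ℝ E3)
    (by
      simp only [h0]
      exact ((D.contDiff_fderiv hr).continuous.clm_comp continuous_const).sub continuous_const)
    (by simp [D.slice_zero]) (R := D.radius)
    (fun s x hx => by simp [D.fderiv_slice_of_lt hx]) hε'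
  refine ⟨min δ₁ δ₂, lt_min hδ₁ hδ₂, fun s hs => ⟨isOpen_univ, convex_univ, ?_, ?_, ?_⟩⟩
  · exact ((D.contDiff_slice s).differentiable (coe_ne_zero_of_two_le hr)).differentiableOn
  · intro x _
    rw [dist_eq_norm]
    exact h1 s (hs.trans (min_le_left _ _)) x
  · intro x _
    exact h2 s (hs.trans (min_le_right _ _)) x

theorem isNearDiffeoFamily {P : Type} [TopologicalSpace P] {σ : P → ℝ} (hσ : Continuous σ)
    (h : ∀ t, IsCloseToId (D.slice (σ t)) univ (1 / 4)) :
    IsNearDiffeoFamily r M fun t => (h t).homeo le_rfl where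
  near t := ⟨D.contDiff_slice _, h t⟩
  jets k hk := (continuous_iteratedFDeriv_partial D.contDiff hk).comp
    (hσ.prodMap continuous_id)
  mem_iff t x := D.mem_iff _ x

/-- A sweepout moved by a deformation, by a time that depends on the slice, is a homotopic
sweepout. -/
theorem exists_sweepout (hr : 2 ≤ r) (hM : IsCompact M) {𝒮 : Set PairPath}
    (h𝒮 : IsHomotopicallyClosed r M 𝒮) {c : PairPath} (hc : c ∈ 𝒮) {δ : ℝ}
    (hδ : ∀ s, |s| ≤ δ → IsCloseToId (D.slice s) univ (1 / 4)) {σ : I01 → ℝ} (hσ : Continuous σ)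
    (hσδ : ∀ t, |σ t| ≤ δ) : ∃ c' ∈ 𝒮, ∀ t, c'.inner t = D.slice (σ t) '' c.inner t ∧
      c'.outer t = D.slice (σ t) '' c.outer t := by
  obtain ⟨S, G, Ω, hS⟩ := h𝒮.isSweepout c hc
  have h1 : ∀ t, IsCloseToId (D.slice (σ t)) univ (1 / 4) := fun t => hδ _ (hσδ t)
  have hΨ := D.isNearDiffeoFamily hσ h1
  -- The homotopy scales the time of motion from 0 to `σ t`; `|σ t * s| ≤ δ` keeps every
  -- intermediate map a diffeomorphism.
  have hσ2 : Continuous fun z : I01 × I01 => σ z.1 * z.2 :=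
    (hσ.comp continuous_fst).mul (continuous_subtype_val.comp continuous_snd)
  have h2 : ∀ z : I01 × I01, IsCloseToId (D.slice (σ z.1 * z.2)) univ (1 / 4) := fun z => by
    refine hδ _ ?_
    rw [abs_mul, abs_of_nonneg z.2.2.1]
    exact (mul_le_of_le_one_right (abs_nonneg _) z.2.2.2).trans (hσδ _)
  have hΨ2 := D.isNearDiffeoFamily hσ2 h2
  refine ⟨c.image fun t => (h1 t).homeo le_rfl, ?_, fun t => ⟨rfl, rfl⟩⟩
  refine h𝒮.closed c hc _ ⟨_, _, _, hS.image hr hM hΨ⟩ ⟨_, _,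
    ⟨_, (hS.inner_family.comp continuous_fst).image hr hM hΨ2⟩,
    ⟨_, (hS.outer_family.comp continuous_fst).image hr hM hΨ2⟩, fun t => ⟨?_, ?_⟩, fun t => ⟨?_, ?_⟩⟩
  · simp [IsCloseToId.coe_homeo, D.slice_zero]
  · simp [IsCloseToId.coe_homeo, D.slice_zero]
  · simp [IsCloseToId.coe_homeo, PairPath.image]
  · simp [IsCloseToId.coe_homeo, PairPath.image]

/-- The test function of the first variation. -/
def testFun (D : Deformation r M) (z : E3 × Plane) : ℝ := tangDiv z.2 D.field z.1

theorem continuous_testFun (hr : 2 ≤ r) : Continuous D.testFun :=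
  continuous_tangDiv (D.contDiff_field hr)

end Deformation


/-! ### Area and test integrals along a deformation, uniformly over all surfaces. -/

namespace Deformation

variable {r : ℕ∞} {M : Set E3} (D : Deformation r M)

theorem hasCompactSupport_field (hr : 2 ≤ r) : HasCompactSupport D.field := by
  refine HasCompactSupport.of_support_subset_isCompact
    (isCompact_closedBall (0 : E3) D.radius) fun x hx => ?_
  by_contra hxR
  have hxR' : D.radius < ‖x‖ := by simpa using hxR
  have h1 : HasFDerivAt (fun s : ℝ => D.toFun (s, x)) _ 0 :=
    (D.hasFDerivAt hr (0, x)).comp (0 : ℝ) (hasFDerivAt_prodMk_left (0 : ℝ) x)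
  have h2 := h1.hasDerivAt
  simp only [D.eq_self _ x hxR'] at h2
  have h3 := h2.unique (hasDerivAt_const _ _)
  exact hx (by simpa [field] using h3)

theorem exists_norm_fderiv_field_le (hr : 2 ≤ r) : ∃ C, ∀ x, ‖fderiv ℝ D.field x‖ ≤ C :=
  ((D.hasCompactSupport_field hr).fderiv ℝ).exists_bound_of_continuous
    ((D.contDiff_field hr).continuous_fderiv one_ne_zero)

theorem exists_abs_testFun_le (hr : 2 ≤ r) : ∃ C, ∀ z, |D.testFun z| ≤ C := by
  obtain ⟨C, hC⟩ := D.exists_norm_fderiv_field_le hr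
  refine ⟨3 * C, fun z => ?_⟩
  rw [testFun, tangDiv_eq]
  refine (abs_traceL_le _).trans ?_
  have h1 := (ContinuousLinearMap.opNorm_comp_le z.2.proj (fderiv ℝ D.field z.1)).trans
    (mul_le_of_le_one_left (norm_nonneg _) z.2.norm_proj_le)
  linarith [hC z.1]

theorem integrable_testFun (hr : 2 ≤ r) (V : FiniteMeasure (E3 × Plane)) :
    Integrable D.testFun (V : Measure (E3 × Plane)) := by
  obtain ⟨C, hC⟩ := D.exists_abs_testFun_le hr
  exact Integrable.of_bound (D.continuous_testFun hr).aestronglyMeasurable C (ae_of_all _ hC)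

theorem exists_dirichlet_le (hr : 2 ≤ r) {η : ℝ} (hη : 0 < η) : ∃ δ > 0, ∀ s, 0 ≤ s → s ≤ δ →
    ∀ z : E3 × Plane, dirichlet z.2 (fderiv ℝ (D.slice s) z.1) ≤
      1 + s * D.testFun z + s * (6 * η) := by
  obtain ⟨C, hC⟩ := D.exists_norm_fderiv_field_le hr
  have hC0 : 0 ≤ C := (norm_nonneg _).trans (hC 0)
  obtain ⟨δ, hδ, h⟩ := D.exists_expansion hr hη
  -- The second bound makes `‖E‖² ≤ s η`. The error is then `3 s η` from the linear term and `(3/2)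
  -- s η` from the quadratic one.
  refine ⟨min δ (η / (C + η) ^ 2), by positivity, fun s hs0 hs z => ?_⟩
  have h1 := h s ((abs_of_nonneg hs0).le.trans (hs.trans (min_le_left _ _))) z.1
  rw [abs_of_nonneg hs0] at h1
  set E := fderiv ℝ (D.slice s) z.1 - ContinuousLinearMap.id ℝ E3 with hE
  have hE1 : fderiv ℝ (D.slice s) z.1 = ContinuousLinearMap.id ℝ E3 + E := by rw [hE]; abel
  rw [hE1]
  refine (dirichlet_id_add_le z.2 E).trans ?_
  set e := E - s • fderiv ℝ D.field z.1 with he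
  have hE2 : E = s • fderiv ℝ D.field z.1 + e := by rw [he]; abel
  have h2 : traceL (z.2.proj ∘L E) = s * D.testFun z + traceL (z.2.proj ∘L e) := by
    rw [hE2, ContinuousLinearMap.comp_add, map_add, ContinuousLinearMap.comp_smul, map_smul,
      smul_eq_mul, testFun, tangDiv_eq]
  have h3 : traceL (z.2.proj ∘L e) ≤ 3 * (η * s) := by
    refine (le_abs_self _).trans ((abs_traceL_le _).trans ?_)
    have := (ContinuousLinearMap.opNorm_comp_le z.2.proj e).trans
      (mul_le_of_le_one_left (norm_nonneg _) z.2.norm_proj_le)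
    linarith
  have h4 : ‖E‖ ≤ s * (C + η) := by
    rw [hE2]
    refine (norm_add_le _ _).trans ?_
    rw [norm_smul, Real.norm_eq_abs, abs_of_nonneg hs0]
    nlinarith [hC z.1]
  have h5 : ‖E‖ ^ 2 ≤ s * η := by
    have h6 : s * (C + η) ^ 2 ≤ η := by
      rw [← le_div_iff₀ (by positivity)]
      exact hs.trans (min_le_right _ _)
    calc ‖E‖ ^ 2 ≤ (s * (C + η)) ^ 2 := by gcongr
      _ = s * (s * (C + η) ^ 2) := by ring
      _ ≤ s * η := by gcongr
  rw [h2]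
  nlinarith [mul_nonneg hs0 hη.le]

/-- The first variation formula as an inequality: the image area is bounded by the integral of the
Dirichlet density, which is expanded to first order. The range of `s` does not depend on the
surface, so all slices of all sweepouts are treated at once. -/
theorem exists_area_le (hr : 2 ≤ r) {η : ℝ} (hη : 0 < η) : ∃ δ > 0, ∀ s, 0 ≤ s → s ≤ δ →
    ∀ A S : Set E3, IsSurface r A S → (μHE[2] (D.slice s '' A)).toReal ≤ (μHE[2] A).toReal +
      s * (∫ z, D.testFun z ∂(inducedVarifold A : Measure (E3 × Plane))) +
      s * η * (μHE[2] A).toReal := by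
  obtain ⟨δ₁, hδ₁, h1⟩ := D.exists_dirichlet_le hr (η := η / 6) (by positivity)
  obtain ⟨δ₂, hδ₂, h2⟩ := D.exists_isCloseToId hr (ε := 1 / 4) (by positivity)
  refine ⟨min δ₁ δ₂, lt_min hδ₁ hδ₂, fun s hs0 hs A S hA => ?_⟩
  have h3 := h1 s hs0 (hs.trans (min_le_left _ _))
  have h4 := h2 s ((abs_of_nonneg hs0).le.trans (hs.trans (min_le_right _ _)))
  have hmass := hA.mass_inducedVarifold hr
  set V := inducedVarifold A
  set g : E3 × Plane → ℝ := fun z => 1 + s * D.testFun z + s * η with hg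
  have hgc : Continuous g :=
    (continuous_const.add (continuous_const.mul (D.continuous_testFun hr))).add continuous_const
  have hg0 : ∀ z, dirichlet z.2 (fderiv ℝ (D.slice s) z.1) ≤ g z := fun z => by
    refine (h3 z).trans (le_of_eq ?_)
    rw [hg]; ring
  have hgi : Integrable g (V : Measure (E3 × Plane)) :=
    ((integrable_const _).add ((D.integrable_testFun hr V).const_mul s)).add (integrable_const _)
  have h5 : μHE[2] (D.slice s '' A) ≤ ENNReal.ofReal (∫ z, g z ∂(V : Measure (E3 × Plane))) := by
    refine (hA.area_image_le hr ((D.contDiff_slice s).of_le (one_le_coe_of_two_le hr)) fun x =>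
      (h4.fderiv_le x (mem_univ x)).trans (by norm_num)).trans ?_
    have h6 := hA.lintegral_inducedVarifold hr (ENNReal.measurable_ofReal.comp hgc.measurable)
    simp only [Function.comp_apply] at h6
    rw [ofReal_integral_eq_lintegral_ofReal hgi
      (ae_of_all _ fun z => (dirichlet_nonneg _ _).trans (hg0 z)), h6]
    exact lintegral_mono fun x => ENNReal.ofReal_le_ofReal (hg0 (x, tangentPlane A x))
  have h6 : ∫ z, g z ∂(V : Measure (E3 × Plane)) = (μHE[2] A).toReal +
      s * (∫ z, D.testFun z ∂(V : Measure (E3 × Plane))) + s * η * (μHE[2] A).toReal := by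
    have h7 := (D.integrable_testFun hr V).const_mul s
    have h8 : Integrable (fun z => 1 + s * D.testFun z) (V : Measure (E3 × Plane)) :=
      (integrable_const _).add h7
    simp only [hg]
    rw [integral_add h8 (integrable_const _), integral_add (integrable_const _) h7,
      integral_const_mul, integral_const, integral_const,
      measureReal_def, hmass]
    simp only [smul_eq_mul]
    ring
  rw [← h6]
  refine ENNReal.toReal_le_of_le_ofReal (integral_nonneg fun z =>
    (dirichlet_nonneg _ _).trans (hg0 z)) h5

theorem isSurface_image (hr : 2 ≤ r) {s : ℝ} (hs : IsCloseToId (D.slice s) univ (1 / 4))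
    {A S : Set E3} (hA : IsSurface r A S) : IsSurface r (D.slice s '' A) (D.slice s '' S) :=
  (D.isNearDiffeoFamily (P := Unit) continuous_const fun _ => hs).isSurface_image hr hA ()

/-- A short motion is close to the identity in `C¹`, so integrals of `u` change by a small multiple
of the area. Since `δ` is uniform over surfaces, a later tightening step can be made harmless for
the conclusions of the earlier ones. -/
theorem eventually_abs_planeInt_sub_le (hr : 2 ≤ r) (hM : IsCompact M) {u : E3 × Plane → ℝ≥0}
    (hu : Continuous u) {C : ℝ≥0} (hC : ∀ z, u z ≤ C) {ω : ℝ} (hω : 0 < ω) :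
    ∀ᶠ δ in 𝓝[>] (0 : ℝ), ∀ s, |s| ≤ δ → ∀ A S : Set E3, IsSurface r A S → A ⊆ M →
      |(planeInt (D.slice s '' A) u).toReal - (planeInt A u).toReal| ≤ ω * (μHE[2] A).toReal := by
  -- The factor generously absorbs the accumulated errors, which are multiples of `ω'` and `ω' C`
  -- times the area.
  obtain ⟨ω', hω', hω1, h0⟩ : ∃ ω' : ℝ≥0, 0 < ω' ∧ (ω' : ℝ) ≤ 1 ∧
      (ω' * (9 * (C + 1) + 4) : ℝ) ≤ ω := by
    have hC1 : (0 : ℝ) < 9 * (C + 1) + 4 := by positivity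
    have hp : 0 < min 1 (ω / (9 * (C + 1) + 4)) := lt_min one_pos (by positivity)
    refine ⟨Real.toNNReal (min 1 (ω / (9 * (C + 1) + 4))), Real.toNNReal_pos.2 hp, ?_⟩
    rw [Real.coe_toNNReal _ hp.le, ← le_div_iff₀ hC1]
    exact ⟨min_le_left _ _, min_le_right _ _⟩
  obtain ⟨κ, hκ, hmod⟩ := exists_modulus (NNReal.continuous_coe.comp hu) hM
    (ω := ω') (by exact_mod_cast hω')
  obtain ⟨ε, hε⟩ : ∃ ε : ℝ≥0, ε = min (min (1 / 4) (ω' / 4)) (Real.toNNReal κ / 3) := ⟨_, rfl⟩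
  have hε0 : 0 < ε := by
    have := Real.toNNReal_pos.2 hκ
    rw [hε]; positivity
  have hε1 : ε ≤ 1 / 4 := hε ▸ (min_le_left _ _).trans (min_le_left _ _)
  have hε2 : 4 * (ε : ℝ) ≤ ω' := by
    have : ε ≤ ω' / 4 := hε ▸ (min_le_left _ _).trans (min_le_right _ _)
    have : (ε : ℝ) ≤ ω' / 4 := by exact_mod_cast this
    linarith
  have hε3 : 3 * (ε : ℝ) ≤ κ := by
    have : ε ≤ Real.toNNReal κ / 3 := hε ▸ min_le_right _ _
    have : (ε : ℝ) ≤ Real.toNNReal κ / 3 := by exact_mod_cast this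
    rw [Real.coe_toNNReal _ hκ.le] at this
    linarith
  obtain ⟨δ, hδ, h⟩ := D.exists_isCloseToId hr hε0
  filter_upwards [Ioo_mem_nhdsGT hδ] with δ' hδ' s hs A S hA hAM
  have h1 := h s (hs.trans hδ'.2.le)
  have h2 := h1.lintegral_compare hε1 hr hA (A' := D.slice s '' A) (u := u) (ω := ω')
    (by rw [inter_univ, image_univ, inter_eq_left]; exact image_subset_range _ _)
    (fun x hx y S T hy hST => hmod x (hAM hx.1) y S T (hy.trans (by
      have : (0 : ℝ) ≤ ε := ε.2
      linarith)) (hST.trans hε3))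
  have h3 : D.slice s '' A ∩ D.slice s '' univ = D.slice s '' A := by
    rw [inter_eq_left]; exact image_mono (subset_univ _)
  rw [h3, inter_univ] at h2
  change planeInt _ u ≤ _ * (planeInt A u + _) ∧ planeInt A u ≤ _ * planeInt _ u + _ at h2
  have hm := hA.finite_area.ne
  have hP : planeInt A u ≤ C * μHE[2] A := by
    rw [planeInt, ← setLIntegral_const]
    exact lintegral_mono fun x => ENNReal.coe_le_coe.2 (hC _)
  have hPt : planeInt A u ≠ ∞ := ne_top_of_le_ne_top (ENNReal.mul_ne_top ENNReal.coe_ne_top hm) hP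
  have hsum : planeInt A u + ω' * μHE[2] A ≠ ∞ :=
    ENNReal.add_ne_top.2 ⟨hPt, ENNReal.mul_ne_top ENNReal.coe_ne_top hm⟩
  have hκt : (((1 + 2 * ε : ℝ≥0) : ℝ≥0∞) ^ 2) ≠ ∞ := ENNReal.pow_ne_top ENNReal.coe_ne_top
  have hP't := ne_top_of_le_ne_top (ENNReal.mul_ne_top hκt hsum) h2.1
  have r0 := ENNReal.toReal_mono (ENNReal.mul_ne_top ENNReal.coe_ne_top hm) hP
  have r1 := ENNReal.toReal_mono (ENNReal.mul_ne_top hκt hsum) h2.1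
  have r2 := ENNReal.toReal_mono (ENNReal.add_ne_top.2 ⟨ENNReal.mul_ne_top hκt hP't,
    ENNReal.mul_ne_top ENNReal.coe_ne_top hm⟩) h2.2
  rw [ENNReal.toReal_mul, ENNReal.toReal_pow, ENNReal.toReal_add hPt
    (ENNReal.mul_ne_top ENNReal.coe_ne_top hm), ENNReal.toReal_mul] at r1
  rw [ENNReal.toReal_add (ENNReal.mul_ne_top hκt hP't) (ENNReal.mul_ne_top ENNReal.coe_ne_top hm),
    ENNReal.toReal_mul, ENNReal.toReal_pow, ENNReal.toReal_mul] at r2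
  rw [ENNReal.toReal_mul] at r0
  simp only [ENNReal.coe_toReal] at r0 r1 r2
  have hk1 : (((1 + 2 * ε : ℝ≥0) : ℝ)) ^ 2 ≤ 1 + 5 / 4 * ω' := by
    have e1 : (ε : ℝ) ≤ 1 / 4 := by exact_mod_cast hε1
    have e2 : (0 : ℝ) ≤ ε := ε.2
    push_cast
    nlinarith
  have hk2 : (((1 + 2 * ε : ℝ≥0) : ℝ)) ^ 2 ≤ 9 / 4 := by
    have e1 : (ε : ℝ) ≤ 1 / 4 := by exact_mod_cast hε1
    have e2 : (0 : ℝ) ≤ ε := ε.2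
    push_cast
    nlinarith
  generalize (((1 + 2 * ε : ℝ≥0) : ℝ)) ^ 2 = k at *
  have hmn : 0 ≤ (μHE[2] A).toReal := ENNReal.toReal_nonneg
  have hpn : 0 ≤ (planeInt A u).toReal := ENNReal.toReal_nonneg
  have hpn' : 0 ≤ (planeInt (D.slice s '' A) u).toReal := ENNReal.toReal_nonneg
  generalize (μHE[2] A).toReal = m at *
  generalize (planeInt A u).toReal = p at *
  generalize (planeInt (D.slice s '' A) u).toReal = p' at *
  have hω0 : (0 : ℝ) ≤ ω' := ω'.2
  have hC0 : (0 : ℝ) ≤ C := C.2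
  generalize (ω' : ℝ) = w at *
  generalize (C : ℝ) = K at *
  have e1 := mul_le_mul_of_nonneg_right h0 hmn
  have e2 : (k - 1) * p ≤ 5 / 4 * w * (K * m) :=
    mul_le_mul (by linarith) r0 hpn (by positivity)
  have e3 : k * (w * m) ≤ 9 / 4 * (w * m) := mul_le_mul_of_nonneg_right hk2 (by positivity)
  have e4 : p' ≤ 9 / 4 * (K * m + m) := r1.trans (mul_le_mul hk2
    (add_le_add r0 (mul_le_of_le_one_left hmn hω1)) (by positivity) (by norm_num))
  have e5 : (k - 1) * p' ≤ 5 / 4 * w * (9 / 4 * (K * m + m)) :=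
    mul_le_mul (by linarith) e4 hpn' (by positivity)
  have e6 : 0 ≤ w * m := by positivity
  have e7 : 0 ≤ w * (K * m) := by positivity
  rw [abs_le]
  constructor <;> nlinarith

end Deformation


/-! ### Tightening -/

theorem IsSurface.integral_eq_sub {r : ℕ∞} (hr : 2 ≤ r) {A S : Set E3} (hA : IsSurface r A S)
    {u : E3 × Plane → ℝ} (hu : Continuous u)
    (hi : Integrable u (inducedVarifold A : Measure (E3 × Plane))) :
    ∫ z, u z ∂(inducedVarifold A : Measure (E3 × Plane)) =
      (planeInt A fun z => (u z).toNNReal).toReal - (planeInt A fun z => (-u z).toNNReal).toReal := by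
  rw [integral_eq_lintegral_pos_part_sub_lintegral_neg_part hi]
  congr 2
  · exact hA.lintegral_coe_inducedVarifold hr (continuous_real_toNNReal.comp hu).measurable
  · exact hA.lintegral_coe_inducedVarifold hr (continuous_real_toNNReal.comp hu.neg).measurable

theorem Deformation.eventually_abs_integral_sub_le {r : ℕ∞} {M : Set E3} (D : Deformation r M)
    (hr : 2 ≤ r) (hM : IsCompact M) {u : E3 × Plane → ℝ} (hu : Continuous u) {C : ℝ}
    (hC : ∀ z, |u z| ≤ C) {ω : ℝ} (hω : 0 < ω) :
    ∀ᶠ δ in 𝓝[>] (0 : ℝ), ∀ s, |s| ≤ δ → ∀ A S : Set E3, IsSurface r A S → A ⊆ M →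
      |(∫ z, u z ∂(inducedVarifold (D.slice s '' A) : Measure (E3 × Plane))) -
        ∫ z, u z ∂(inducedVarifold A : Measure (E3 × Plane))| ≤ ω * (μHE[2] A).toReal := by
  obtain ⟨δ₀, hδ₀, h0⟩ := D.exists_isCloseToId hr (ε := 1 / 4) (by positivity)
  filter_upwards [Ioo_mem_nhdsGT hδ₀,
    D.eventually_abs_planeInt_sub_le hr hM (continuous_real_toNNReal.comp hu) (C := C.toNNReal)
      (fun z => Real.toNNReal_le_toNNReal ((le_abs_self _).trans (hC z))) (half_pos hω),
    D.eventually_abs_planeInt_sub_le hr hM (continuous_real_toNNReal.comp hu.neg) (C := C.toNNReal)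
      (fun z => Real.toNNReal_le_toNNReal ((neg_le_abs _).trans (hC z))) (half_pos hω)]
    with δ hδ h1 h2 s hs A S hA hAM
  have hi : ∀ V : FiniteMeasure (E3 × Plane), Integrable u (V : Measure (E3 × Plane)) := fun V =>
    Integrable.of_bound hu.aestronglyMeasurable C (ae_of_all _ hC)
  rw [hA.integral_eq_sub hr hu (hi _),
    (D.isSurface_image hr (h0 s (hs.trans hδ.2.le)) hA).integral_eq_sub hr hu (hi _)]
  have h3 := abs_le.1 (h1 s hs A S hA hAM)
  have h4 := abs_le.1 (h2 s hs A S hA hAM)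
  simp only [Function.comp_def, Pi.neg_apply] at h3 h4
  rw [abs_le]
  constructor <;> linarith [h3.1, h3.2, h4.1, h4.2]

/-- The value of a pair of varifolds on a test function. -/
def pairInt (a : ℝ) (V W : FiniteMeasure (E3 × Plane)) (u : E3 × Plane → ℝ) : ℝ :=
  (∫ z, u z ∂(V : Measure (E3 × Plane))) + a * ∫ z, u z ∂(W : Measure (E3 × Plane))

/-- The value of the pair of varifolds induced by a slice on a test function. -/
def sliceInt (a : ℝ) (c : PairPath) (t : I01) (u : E3 × Plane → ℝ) : ℝ :=
  pairInt a (inducedVarifold (c.inner t)) (inducedVarifold (c.outer t)) u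

/-- The energy of a slice. -/
def sliceEnergy (a : ℝ) (c : PairPath) (t : I01) : ℝ :=
  (μHE[2] (c.inner t)).toReal + a * (μHE[2] (c.outer t)).toReal

variable {r : ℕ∞} {M : Set E3} {a : ℝ} {c : PairPath}

theorem IsSweepout.energy_eq (h : IsSweepout r M c) (ha : 0 ≤ a) (t : I01) :
    energy a (c.inner t) (c.outer t) = ENNReal.ofReal (sliceEnergy a c t) := by
  obtain ⟨S, G, Ω, hS⟩ := h
  rw [energy, sliceEnergy, ENNReal.ofReal_add ENNReal.toReal_nonneg (by positivity),
    ENNReal.ofReal_mul ha, ENNReal.ofReal_toReal (hS.inner_family.finite_area t).ne,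
    ENNReal.ofReal_toReal (hS.outer_family.finite_area t).ne]

theorem sliceEnergy_nonneg (ha : 0 ≤ a) (t : I01) : 0 ≤ sliceEnergy a c t := by
  unfold sliceEnergy; positivity

theorem tendsto_integral_of_tendsto {ι X : Type*} [TopologicalSpace X] [MeasurableSpace X]
    [OpensMeasurableSpace X] {l : Filter ι} {V : ι → FiniteMeasure X} {V₀ : FiniteMeasure X}
    (h : Tendsto V l (𝓝 V₀)) {u : X → ℝ} (hu : Continuous u) {C : ℝ} (hC : ∀ z, |u z| ≤ C) :
    Tendsto (fun i => ∫ z, u z ∂(V i : Measure X)) l (𝓝 (∫ z, u z ∂(V₀ : Measure X))) :=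
  FiniteMeasure.tendsto_iff_forall_integral_tendsto.1 h
    (BoundedContinuousFunction.ofNormedAddCommGroup u hu C hC)

theorem IsSweepout.continuous_sliceInt (hr : 2 ≤ r) (h : IsSweepout r M c) {u : E3 × Plane → ℝ}
    (hu : Continuous u) {C : ℝ} (hC : ∀ z, |u z| ≤ C) : Continuous fun t => sliceInt a c t u := by
  obtain ⟨S, G, Ω, hS⟩ := h
  rw [continuous_iff_continuousAt]
  intro t
  exact (tendsto_integral_of_tendsto ((hS.inner_family.continuous_inducedVarifold hr).tendsto t)
    hu hC).add ((tendsto_integral_of_tendsto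
      ((hS.outer_family.continuous_inducedVarifold hr).tendsto t) hu hC).const_mul a)

/-- One step of the tightening: the sweepouts are moved by a deformation wherever its first
variation is less than `-θ`. -/
theorem Deformation.exists_tightening (D : Deformation r M) (hr : 2 ≤ r) (hM : IsCompact M)
    (ha : 0 ≤ a) {𝒮 : Set PairPath} (h𝒮 : IsHomotopicallyClosed r M 𝒮) (D' : ℕ → Deformation r M)
    (n : ℕ) {L θ ω : ℝ} (hL : 0 < L) (hθ : 0 < θ) (hω : 0 < ω) :
    ∃ δ > 0, ∀ c ∈ 𝒮, (∀ t, sliceEnergy a c t ≤ L) → ∃ c' ∈ 𝒮, ∀ t,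
      sliceEnergy a c' t ≤ sliceEnergy a c t ∧
      (∀ j ≤ n, |sliceInt a c' t (D' j).testFun - sliceInt a c t (D' j).testFun| ≤ ω) ∧
      (sliceEnergy a c t - δ ≤ sliceEnergy a c' t → -θ ≤ sliceInt a c t D.testFun) := by
  obtain ⟨δ₁, hδ₁, h1⟩ := D.exists_isCloseToId hr (ε := 1 / 4) (by positivity)
  -- On slices of energy at most `L` the error term is then at most `s θ / 4`, half of the gain `s θ
  -- / 2` wherever the slice is moved.
  obtain ⟨δ₂, hδ₂, h2⟩ := D.exists_area_le hr (η := θ / (4 * L)) (by positivity)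
  have h3 : ∀ j ∈ Finset.range (n + 1), ∀ᶠ δ in 𝓝[>] (0 : ℝ), ∀ s, |s| ≤ δ → ∀ A S : Set E3,
      IsSurface r A S → A ⊆ M →
      |(∫ z, (D' j).testFun z ∂(inducedVarifold (D.slice s '' A) : Measure (E3 × Plane))) -
        ∫ z, (D' j).testFun z ∂(inducedVarifold A : Measure (E3 × Plane))| ≤
          ω / L * (μHE[2] A).toReal := fun j _ => by
    obtain ⟨C, hC⟩ := (D' j).exists_abs_testFun_le hr
    exact D.eventually_abs_integral_sub_le hr hM ((D' j).continuous_testFun hr) hC (by positivity)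
  obtain ⟨ε, hε3, hε⟩ := (((Finset.range (n + 1)).eventually_all.2 h3).and
    (Ioo_mem_nhdsGT (lt_min hδ₁ hδ₂))).exists
  have hεθ : 0 < ε * min 1 (θ / 2) := mul_pos hε.1 (lt_min one_pos (by positivity))
  -- Where the first variation is below `-θ` one has `σ t ≥ ε * min 1 (θ / 2)`, and the energy drops
  -- by at least `σ t * (θ / 4)`, which is twice this `δ`.
  refine ⟨ε * min 1 (θ / 2) * (θ / 8), by positivity, fun c hc hcL => ?_⟩
  -- A continuous time that vanishes unless the first variation is below `-θ / 2`, so that energies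
  -- never increase. The gap between `θ / 2` and `θ` makes room for continuity.
  set σ : I01 → ℝ := fun t => ε * max 0 (min 1 (-sliceInt a c t D.testFun - θ / 2)) with hσ
  have hσ0 : ∀ t, 0 ≤ σ t := fun t => mul_nonneg hε.1.le (le_max_left _ _)
  have hσε : ∀ t, σ t ≤ ε := fun t => mul_le_of_le_one_right hε.1.le
    (max_le zero_le_one (min_le_left _ _))
  have hσa : ∀ t, |σ t| ≤ ε := fun t => (abs_of_nonneg (hσ0 t)).le.trans (hσε t)
  have hsw := h𝒮.isSweepout c hc
  obtain ⟨C, hC⟩ := D.exists_abs_testFun_le hr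
  have hσc : Continuous σ := continuous_const.mul (continuous_const.max (continuous_const.min
    ((hsw.continuous_sliceInt hr (D.continuous_testFun hr) hC).neg.sub continuous_const)))
  obtain ⟨c', hc', h4⟩ := D.exists_sweepout hr hM h𝒮 hc (δ := ε)
    (fun s hs => h1 s (hs.trans (hε.2.le.trans (min_le_left _ _)))) hσc hσa
  obtain ⟨S, G, Ω, hS⟩ := hsw
  have hdrop : ∀ t, sliceEnergy a c' t ≤ sliceEnergy a c t - σ t * (θ / 4) := by
    intro t
    have hσ2 := (hσε t).trans (hε.2.le.trans (min_le_right _ _))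
    have e1 := h2 (σ t) (hσ0 t) hσ2 _ _ (hS.inner_family.isSurface t)
    have e2 := mul_le_mul_of_nonneg_left
      (h2 (σ t) (hσ0 t) hσ2 _ _ (hS.outer_family.isSurface t)) ha
    have e3 : sliceEnergy a c' t ≤ sliceEnergy a c t + σ t * sliceInt a c t D.testFun +
        σ t * (θ / (4 * L)) * sliceEnergy a c t := by
      rw [sliceEnergy, (h4 t).1, (h4 t).2, sliceEnergy, sliceInt, pairInt]
      linarith
    have e4 : σ t * (θ / (4 * L)) * sliceEnergy a c t ≤ σ t * (θ / 4) := by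
      have : θ / (4 * L) * sliceEnergy a c t ≤ θ / (4 * L) * L :=
        mul_le_mul_of_nonneg_left (hcL t) (by positivity)
      have e5 : θ / (4 * L) * L = θ / 4 := by field_simp
      rw [mul_assoc]
      exact mul_le_mul_of_nonneg_left (this.trans e5.le) (hσ0 t)
    have e6 : σ t * sliceInt a c t D.testFun ≤ σ t * (-(θ / 2)) := by
      rcases (hσ0 t).eq_or_lt with h | h
      · rw [← h, zero_mul, zero_mul]
      · refine mul_le_mul_of_nonneg_left ?_ (hσ0 t)
        by_contra! hlt
        have : min 1 (-sliceInt a c t D.testFun - θ / 2) ≤ 0 :=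
          (min_le_right _ _).trans (by linarith)
        rw [hσ] at h
        simp only [max_eq_left this, mul_zero, lt_self_iff_false] at h
    linarith
  refine ⟨c', hc', fun t => ⟨?_, fun j hj => ?_, fun hE => ?_⟩⟩
  · have := hdrop t
    have := mul_nonneg (hσ0 t) hθ.le
    linarith
  · have h5 := hε3 j (Finset.mem_range_succ_iff.2 hj) (σ t) (hσa t)
    have e1 := abs_le.1 (h5 _ _ (hS.inner_family.isSurface t) (hS.inner_family.subset t))
    have e2 := abs_le.1 (h5 _ _ (hS.outer_family.isSurface t) (hS.outer_family.subset t))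
    have e3 := mul_le_mul_of_nonneg_left e2.1 ha
    have e4 := mul_le_mul_of_nonneg_left e2.2 ha
    have e5 : ω / L * sliceEnergy a c t ≤ ω := by
      refine (mul_le_mul_of_nonneg_left (hcL t) (by positivity)).trans (le_of_eq ?_)
      field_simp
    rw [sliceEnergy] at e5
    rw [sliceInt, sliceInt, pairInt, pairInt, (h4 t).1, (h4 t).2, abs_le]
    constructor <;> linarith [e1.1, e1.2]
  · by_contra! hlt
    have e1 : ε * min 1 (θ / 2) ≤ σ t := by
      refine mul_le_mul_of_nonneg_left ?_ hε.1.le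
      exact (min_le_min le_rfl (by linarith)).trans (le_max_right _ _)
    have e2 := mul_le_mul_of_nonneg_right e1 (by positivity : 0 ≤ θ / 4)
    have := hdrop t
    nlinarith [mul_pos hεθ hθ]

/-- The iterated tightening. -/
theorem exists_iterated_tightening (hr : 2 ≤ r) (hM : IsCompact M) (ha : 0 ≤ a)
    {𝒮 : Set PairPath} (h𝒮 : IsHomotopicallyClosed r M 𝒮) (D : ℕ → Deformation r M) {L : ℝ}
    (hL : 0 < L) :
    ∃ δ : ℕ → ℝ, (∀ i, 0 < δ i) ∧ ∀ c ∈ 𝒮, (∀ t, sliceEnergy a c t ≤ L) → ∀ n, ∃ c' ∈ 𝒮, ∀ t,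
      sliceEnergy a c' t ≤ sliceEnergy a c t ∧ ∀ i < n, sliceEnergy a c t - δ i ≤ sliceEnergy a c' t →
        -(2 * (1 / ((i : ℝ) + 1))) + 1 / ((n : ℝ) + 1) ≤ sliceInt a c' t (D i).testFun := by
  -- The disturbance allowed at step `n`. These telescope, so the loss suffered by the bound of
  -- index `i` at step `i` and later stays below `1 / (i + 1)`; together with `θ = 1 / (i + 1)` this
  -- gives the bound `-2 / (i + 1)`.
  have hw : ∀ n : ℕ, 0 < 1 / ((n : ℝ) + 1) - 1 / (((n + 1 : ℕ) : ℝ) + 1) := fun n =>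
    sub_pos.2 (one_div_lt_one_div_of_lt (by positivity) (by push_cast; linarith))
  choose δ hδ hstep using fun n : ℕ => (D n).exists_tightening hr hM ha h𝒮 D n hL
    (θ := 1 / ((n : ℝ) + 1)) (by positivity) (hw n)
  refine ⟨δ, hδ, fun c hc hcL n => ?_⟩
  induction n with
  | zero => exact ⟨c, hc, fun t => ⟨le_rfl, fun i hi => absurd hi (by simp)⟩⟩
  | succ n ih =>
    obtain ⟨c₁, hc₁, h1⟩ := ih
    obtain ⟨c₂, hc₂, h2⟩ := hstep n c₁ hc₁ fun t => (h1 t).1.trans (hcL t)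
    refine ⟨c₂, hc₂, fun t => ⟨(h2 t).1.trans (h1 t).1, fun i hi hE => ?_⟩⟩
    have e1 := (abs_le.1 ((h2 t).2.1 i (Nat.lt_succ_iff.1 hi))).1
    rcases Nat.lt_succ_iff_lt_or_eq.1 hi with hi | rfl
    · have e2 := (h1 t).2 i hi (hE.trans (h2 t).1)
      linarith
    · have e2 := (h2 t).2.2 ((sub_le_sub_right (h1 t).1 _).trans hE)
      have e3 : 0 < 1 / ((i : ℝ) + 1) := by positivity
      linarith


/-! ### Charts of the domain -/

/-- `φ` is a `C^r` diffeomorphism of open sets that takes `M` to the half-space `{y₂ ≤ 0}`. -/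
structure IsDomainChart (r : ℕ∞) (M : Set E3) (φ : OpenPartialHomeomorph E3 E3) : Prop where
  contDiffOn : ContDiffOn ℝ r φ φ.source
  contDiffOn_symm : ContDiffOn ℝ r φ.symm φ.target
  mem_iff : ∀ x ∈ φ.source, x ∈ M ↔ φ x 2 ≤ 0

/-- The shear `v + (ℓ v - v₂) u` with `u₂ = 1` has third coordinate `ℓ v`; it is injective as soon
as `ℓ u ≠ 0`. -/
theorem exists_equiv_coord {ℓ : E3 →L[ℝ] ℝ} (hℓ : ℓ ≠ 0) : ∃ A : E3 ≃L[ℝ] E3, ∀ v, A v 2 = ℓ v := by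
  obtain ⟨u, hu, hℓu⟩ : ∃ u : E3, u 2 = 1 ∧ ℓ u ≠ 0 := by
    by_cases h2 : ℓ (stdE 2) = 0
    · obtain ⟨v, hv⟩ : ∃ v, ℓ v ≠ 0 := by
        by_contra! h
        exact hℓ (ContinuousLinearMap.ext h)
      exact ⟨stdE 2 + (v - v 2 • stdE 2), by simp [stdE_apply], by simp [h2, hv]⟩
    · exact ⟨stdE 2, by simp [stdE_apply], h2⟩
  let T : E3 →ₗ[ℝ] E3 := LinearMap.id + (ℓ - coordL 2).toLinearMap.smulRight u
  have hT : ∀ v, T v = v + (ℓ v - v 2) • u := fun v => rfl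
  have hinj : Function.Injective T := by
    rw [← LinearMap.ker_eq_bot, LinearMap.ker_eq_bot']
    intro v hv
    have h1 : T v 2 = 0 := by rw [hv]; rfl
    have h2 : ℓ v = 0 := by simpa [hT, hu] using h1
    have h3 : ℓ (T v) = 0 := by rw [hv, map_zero]
    rw [hT, map_add, map_smul, h2, zero_add, zero_sub, smul_eq_mul, neg_mul, neg_eq_zero,
      mul_eq_zero, or_iff_left hℓu] at h3
    simpa [hT, h2, h3] using hv
  refine ⟨(LinearEquiv.ofInjectiveEndo T hinj).toContinuousLinearEquiv, fun v => ?_⟩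
  change T v 2 = ℓ v
  simp [hT, hu]

theorem exists_chart_of_mem_interior (r : ℕ∞) {M : Set E3} {p : E3} (hp : p ∈ interior M) :
    ∃ φ, IsDomainChart r M φ ∧ p ∈ φ.source := by
  obtain ⟨ρ, hρ, hball⟩ := Metric.isOpen_iff.1 isOpen_interior p hp
  -- This translation carries the whole ball below the plane `{y₂ = 0}`.
  let v : E3 := (-(p 2 + ρ)) • stdE 2
  let φ := (Homeomorph.addRight v).toOpenPartialHomeomorph.restrOpen (Metric.ball p ρ)
    Metric.isOpen_ball
  have hs : φ.source = Metric.ball p ρ := univ_inter _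
  have h1 : ∀ x, φ x = x + v := fun x => rfl
  have h2 : ∀ x, φ.symm x = x + -v := fun x => rfl
  refine ⟨φ, ⟨?_, ?_, fun x hx => ?_⟩, hs ▸ Metric.mem_ball_self hρ⟩
  · exact (contDiff_id.add contDiff_const).contDiffOn
  · exact (contDiff_id.add contDiff_const).contDiffOn
  · rw [hs] at hx
    refine iff_of_true (interior_subset (hball hx)) ?_
    rw [h1]
    have h3 : |x 2 - p 2| ≤ ‖x - p‖ := by
      have := PiLp.norm_apply_le (x - p) 2
      simpa using this
    have h4 := (le_abs_self _).trans (h3.trans (dist_eq_norm x p ▸ (Metric.mem_ball.1 hx).le))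
    simp only [v, PiLp.add_apply, PiLp.smul_apply, stdE_apply, if_true, smul_eq_mul, mul_one]
    linarith

/-- The map `ψ x = x + (g x - ℓ (x - p)) w` with `ℓ w = 1` satisfies `ℓ (ψ x - p) = g x` and has
derivative the identity at `p`. So it is a diffeomorphism on a small ball, and a linear change of
coordinates turns `ℓ` into the third coordinate. -/
theorem exists_chart_of_defining_function {r : ℕ∞} (hr : 2 ≤ r) {M U : Set E3} {p : E3}
    (hU : IsOpen U) (hpU : p ∈ U) {g : E3 → ℝ} (hg : ContDiffOn ℝ r g U) (hg0 : fderiv ℝ g p ≠ 0)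
    (hgp : g p = 0) (hM : ∀ x ∈ U, x ∈ M ↔ g x ≤ 0) : ∃ φ, IsDomainChart r M φ ∧ p ∈ φ.source := by
  obtain ⟨A, hA⟩ := exists_equiv_coord hg0
  set ℓ := fderiv ℝ g p with hℓ
  set w : E3 := A.symm (stdE 2) with hw
  have hℓw : ℓ w = 1 := by rw [← hA, hw, A.apply_symm_apply, stdE_apply, if_pos rfl]
  set ψ : E3 → E3 := fun x => x + (g x - ℓ (x - p)) • w with hψ
  have hψp : ψ p = p := by simp [hψ, hgp]
  have hψd : ContDiffOn ℝ r ψ U := contDiffOn_id.add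
    ((hg.sub ((ℓ.contDiff.comp (contDiff_id.sub contDiff_const)).contDiffOn)).smul contDiffOn_const)
  have hℓψ : ∀ x, ℓ (ψ x - p) = g x := fun x => by
    have : ψ x - p = (x - p) + (g x - ℓ (x - p)) • w := by rw [hψ]; simp only; abel
    rw [this, map_add, map_smul, hℓw, smul_eq_mul]; ring
  have hn0 := coe_ne_zero_of_two_le hr
  have hψf : ContinuousOn (fderiv ℝ ψ) U := hψd.continuousOn_fderiv_of_isOpen hU
    (one_le_coe_of_two_le hr)
  have hψfp : fderiv ℝ ψ p = ContinuousLinearMap.id ℝ E3 := by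
    have h1 : HasFDerivAt g ℓ p := ((hg.differentiableOn hn0).differentiableAt
      (hU.mem_nhds hpU)).hasFDerivAt
    have h2 : HasFDerivAt (fun x => ℓ (x - p)) ℓ p :=
      ℓ.hasFDerivAt.comp p ((hasFDerivAt_id p).sub_const p)
    have h3 : HasFDerivAt ψ _ p := (hasFDerivAt_id p).add ((h1.fun_sub h2).smul_const w)
    rw [h3.fderiv]; ext v; simp
  have h1 : ∀ᶠ x in 𝓝 p, x ∈ U ∧ dist (ψ x) x ≤ 1 / 4 ∧
      ‖fderiv ℝ ψ x - ContinuousLinearMap.id ℝ E3‖ ≤ 1 / 4 := by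
    have c1 : ContinuousAt ψ p := hψd.continuousOn.continuousAt (hU.mem_nhds hpU)
    have c2 := hψf.continuousAt (hU.mem_nhds hpU)
    have t1 : Tendsto (fun x => dist (ψ x) x) (𝓝 p) (𝓝 0) := by
      have := c1.tendsto.dist (tendsto_id (x := 𝓝 p)); rwa [hψp, dist_self] at this
    have t2 : Tendsto (fun x => ‖fderiv ℝ ψ x - ContinuousLinearMap.id ℝ E3‖) (𝓝 p) (𝓝 0) := by
      have := (c2.tendsto.sub_const (ContinuousLinearMap.id ℝ E3)).norm
      rwa [hψfp, sub_self, norm_zero] at this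
    exact (hU.eventually_mem hpU).and ((t1.eventually_le_const (by norm_num)).and
      (t2.eventually_le_const (by norm_num)))
  obtain ⟨ρ, hρ, hball⟩ := Metric.mem_nhds_iff.1 h1
  have hBU : Metric.ball p ρ ⊆ U := fun x hx => (hball hx).1
  have hclose : IsCloseToId ψ (Metric.ball p ρ) (1 / 4) :=
    ⟨Metric.isOpen_ball, convex_ball p ρ, (hψd.differentiableOn hn0).mono hBU,
      fun x hx => by simpa using (hball hx).2.1, fun x hx => by simpa using (hball hx).2.2⟩
  let e := hclose.toOPH le_rfl
  have hes : e.source = Metric.ball p ρ := rfl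
  have heψ : ⇑e = ψ := rfl
  let a : E3 ≃ₜ E3 := (Homeomorph.addRight (-p)).trans A.toHomeomorph
  have ha : ∀ y, a y = A (y - p) := fun y => by
    change A (y + -p) = _; rw [sub_eq_add_neg]
  have has : ∀ y, a.symm y = A.symm y + p := fun y => by
    change A.symm y + - -p = _; rw [neg_neg]
  let φ := e.trans a.toOpenPartialHomeomorph
  have hφs : φ.source = Metric.ball p ρ := by simp [φ, hes]
  have hφ : ∀ x, φ x = A (ψ x - p) := fun x => ha (ψ x)
  have hesymm : ContDiffOn ℝ r e.symm e.target := by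
    intro y hy
    obtain ⟨L, hL⟩ := hclose.exists_fderiv_equiv le_rfl (e.map_target hy)
    have hd : HasFDerivAt ψ (L : E3 →L[ℝ] E3) (e.symm y) := hL ▸
      (((hψd.differentiableOn hn0).differentiableAt
        (hU.mem_nhds (hBU (e.map_target hy)))).hasFDerivAt)
    exact (e.contDiffAt_symm hy hd
      (hψd.contDiffAt (hU.mem_nhds (hBU (e.map_target hy))))).contDiffWithinAt
  refine ⟨φ, ⟨?_, ?_, fun x hx => ?_⟩, hφs ▸ Metric.mem_ball_self hρ⟩
  · rw [hφs]
    exact A.contDiff.comp_contDiffOn ((hψd.mono hBU).sub contDiffOn_const)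
  · have h2 : ContDiff ℝ r a.symm := by
      have : ⇑a.symm = fun y => A.symm y + p := funext has
      rw [this]; exact A.symm.contDiff.add contDiff_const
    exact hesymm.comp h2.contDiffOn (by intro y hy; simpa [φ] using hy)
  · rw [hφs] at hx
    rw [hM x (hBU hx), hφ, hA, hℓψ]

theorem IsConvexDomain.exists_chart {r : ℕ∞} (hr : 2 ≤ r) {M : Set E3} (hM : IsConvexDomain r M)
    {p : E3} (hp : p ∈ M) : ∃ φ, IsDomainChart r M φ ∧ p ∈ φ.source := by
  by_cases hi : p ∈ interior M
  · exact exists_chart_of_mem_interior r hi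
  have hf : p ∈ frontier M := ⟨subset_closure hp, hi⟩
  obtain ⟨α, κ, -, -, -, h⟩ := hM.boundary
  obtain ⟨U, g, hU, hpU, hg, -, -, hg0, hgM, -⟩ := h p hf
  refine exists_chart_of_defining_function hr hU hpU hg (hg0 p hpU) ?_ hgM
  refine le_antisymm ((hgM p hpU).1 hp) ?_
  by_contra! hlt
  refine hi (mem_interior_iff_mem_nhds.2 ?_)
  have hgc : ContinuousAt g p := hg.continuousOn.continuousAt (hU.mem_nhds hpU)
  filter_upwards [hgc.eventually_lt_const hlt, hU.mem_nhds hpU] with x hx hxU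
  exact (hgM x hxU).2 hx.le

theorem frontier_halfSpace : frontier {y : E3 | y 2 ≤ 0} = {y | y 2 = 0} := by
  have h1 : IsOpenMap (coordL 2) := (coordL 2).isOpenMap fun t => ⟨t • stdE 2, by simp [stdE_apply]⟩
  have h2 := h1.preimage_frontier_eq_frontier_preimage (coordL 2).continuous (Iic 0)
  rw [frontier_Iic] at h2
  exact h2.symm

namespace IsDomainChart

variable {r : ℕ∞} {M : Set E3} {φ : OpenPartialHomeomorph E3 E3}

theorem mem_frontier_iff (h : IsDomainChart r M φ) {x : E3} (hx : x ∈ φ.source) :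
    x ∈ frontier M ↔ φ x 2 = 0 := by
  have h1 : φ.IsImage M {y | y 2 ≤ 0} := fun x hx => (h.mem_iff x hx).symm
  have h2 := h1.frontier hx
  rw [frontier_halfSpace] at h2
  exact h2.symm

theorem isInteriorPoint (h : IsDomainChart r M φ) {x : E3} (hx : x ∈ φ.source)
    (hxM : x ∈ frontier M) : IsInteriorPoint r (frontier M) x := by
  let a := Homeomorph.addRight (-φ x)
  have ha : ∀ y, (φ.trans a.toOpenPartialHomeomorph) y = φ y + -φ x := fun y => rfl
  have hs : (φ.trans a.toOpenPartialHomeomorph).source = φ.source := by simp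
  have hx2 := (h.mem_frontier_iff hx).1 hxM
  refine ⟨φ.trans a.toOpenPartialHomeomorph, hs ▸ hx, by rw [ha, add_neg_cancel], ?_, ?_, ?_⟩
  · rw [hs]; exact h.contDiffOn.add contDiffOn_const
  · have h2 : ContDiff ℝ r a.symm := contDiff_id.add contDiff_const
    exact h.contDiffOn_symm.comp h2.contDiffOn (by intro y hy; simpa using hy)
  · intro y hy
    rw [hs] at hy
    rw [h.mem_frontier_iff hy, ha]
    simp [hx2]

theorem coord_eq_zero (h : IsDomainChart r M φ) (hr : 2 ≤ r) {x : E3} (hx : x ∈ φ.source)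
    (hxM : x ∈ frontier M) {v : E3} (hv : v ∈ (tangentPlane (frontier M) x).space) :
    fderiv ℝ φ x v 2 = 0 := by
  obtain ⟨L, hL, hL', -⟩ := exists_chart_deriv (one_le_coe_of_two_le hr) φ h.contDiffOn
    h.contDiffOn_symm
  have h1 := (hasTangentPlane_of_chart φ (Or.inl rfl) (fun y hy => h.mem_frontier_iff hy) hx hxM
    (hL' x hx)).tangentPlane_eq
  rw [h1, Plane.mem_map] at hv
  obtain ⟨w, hw, rfl⟩ := hv
  rw [(hL x hx).fderiv]
  simpa [mem_horizontal] using hw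

end IsDomainChart


/-! ### Vector fields and deformations in charts -/

open Classical in
/-- The pullback of a vector field by a chart, extended by zero. -/
def pullField (φ : OpenPartialHomeomorph E3 E3) (Z : E3 → E3) (x : E3) : E3 :=
  if x ∈ φ.source then fderiv ℝ φ.symm (φ x) (Z (φ x)) else 0

theorem isCompact_symm_image {φ : OpenPartialHomeomorph E3 E3} {K : Set E3} (hK : IsCompact K)
    (hKφ : K ⊆ φ.target) : IsCompact (φ.symm '' K) :=
  hK.image_of_continuousOn (φ.continuousOn_symm.mono hKφ)

theorem notMem_of_notMem_symm_image {φ : OpenPartialHomeomorph E3 E3} {K : Set E3} {x : E3}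
    (hx : x ∈ φ.source) (hxK : x ∉ φ.symm '' K) : φ x ∉ K :=
  fun h => hxK ⟨φ x, h, φ.left_inv hx⟩

namespace IsDomainChart

variable {r : ℕ∞} {M : Set E3} {φ : OpenPartialHomeomorph E3 E3}

theorem differentiableAt (h : IsDomainChart r M φ) (hr : 2 ≤ r) {x : E3} (hx : x ∈ φ.source) :
    DifferentiableAt ℝ φ x :=
  (h.contDiffOn.differentiableOn (coe_ne_zero_of_two_le hr)).differentiableAt
    (φ.open_source.mem_nhds hx)

theorem contDiffOn_fderiv_symm (h : IsDomainChart r M φ) (hr : 2 ≤ r) :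
    ContDiffOn ℝ 1 (fun x => fderiv ℝ φ.symm (φ x)) φ.source :=
  ((h.contDiffOn_symm.of_le (two_le_coe hr)).fderiv_of_isOpen φ.open_target (m := 1)
    (by norm_num)).comp (h.contDiffOn.of_le (one_le_coe_of_two_le hr)) φ.mapsTo

theorem hasFDerivAt_pullField (h : IsDomainChart r M φ) (hr : 2 ≤ r) {Z : E3 → E3} {x : E3}
    (hx : x ∈ φ.source) (hZ : DifferentiableAt ℝ Z (φ x)) :
    HasFDerivAt (pullField φ Z)
      (fderiv ℝ φ.symm (φ x) ∘L (fderiv ℝ Z (φ x) ∘L fderiv ℝ φ x) +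
        (fderiv ℝ (fun x => fderiv ℝ φ.symm (φ x)) x).flip (Z (φ x))) x := by
  have h1 : HasFDerivAt (fun x => fderiv ℝ φ.symm (φ x)) _ x :=
    (((h.contDiffOn_fderiv_symm hr).differentiableOn one_ne_zero).differentiableAt
      (φ.open_source.mem_nhds hx)).hasFDerivAt
  have h2 := h1.clm_apply (hZ.hasFDerivAt.comp x (h.differentiableAt hr hx).hasFDerivAt)
  refine h2.congr_of_eventuallyEq ?_
  filter_upwards [φ.open_source.mem_nhds hx] with y hy
  simp [pullField, hy]

theorem pullField_eventuallyEq {Z : E3 → E3} {K : Set E3} (hK : IsCompact K) (hKφ : K ⊆ φ.target)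
    (hZ : ∀ y ∉ K, Z y = 0) {x : E3} (hx : x ∉ φ.symm '' K) : pullField φ Z =ᶠ[𝓝 x] 0 := by
  filter_upwards [(isCompact_symm_image hK hKφ).isClosed.isOpen_compl.mem_nhds hx] with y hy
  by_cases hys : y ∈ φ.source
  · simp [pullField, hys, hZ _ (notMem_of_notMem_symm_image hys hy)]
  · simp [pullField, hys]

/-- The pullback is linear in `Z` and involves derivatives of the chart and its inverse of order at
most 2, which are bounded on the compact set where the field lives. `C` depends on `K` but not on
`Z`. -/
theorem exists_norm_fderiv_pullField_le (h : IsDomainChart r M φ) (hr : 2 ≤ r) {K : Set E3}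
    (hK : IsCompact K) (hKφ : K ⊆ φ.target) : ∃ C : ℝ, 0 < C ∧ ∀ Z : E3 → E3, Differentiable ℝ Z →
      (∀ y ∉ K, Z y = 0) → ∀ η : ℝ, 0 ≤ η → (∀ y, ‖Z y‖ ≤ η) → (∀ y, ‖fderiv ℝ Z y‖ ≤ η) →
      ∀ x, DifferentiableAt ℝ (pullField φ Z) x ∧ ‖fderiv ℝ (pullField φ Z) x‖ ≤ C * η := by
  have hK' := isCompact_symm_image hK hKφ
  have hKs : φ.symm '' K ⊆ φ.source := by
    rintro _ ⟨y, hy, rfl⟩; exact φ.map_target (hKφ hy)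
  have hB := h.contDiffOn_fderiv_symm hr
  obtain ⟨C₁, h1⟩ := hK'.exists_bound_of_continuousOn (hB.continuousOn.mono hKs)
  obtain ⟨C₂, h2⟩ := hK'.exists_bound_of_continuousOn
    ((h.contDiffOn.continuousOn_fderiv_of_isOpen φ.open_source (one_le_coe_of_two_le hr)).mono hKs)
  obtain ⟨C₃, h3⟩ := hK'.exists_bound_of_continuousOn
    ((hB.continuousOn_fderiv_of_isOpen φ.open_source le_rfl).mono hKs)
  refine ⟨|C₁| * |C₂| + |C₃| + 1, by positivity, fun Z hZ hZK η hη hη1 hη2 x => ?_⟩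
  by_cases hx : x ∈ φ.symm '' K
  · have h4 := h.hasFDerivAt_pullField hr (hKs hx) (hZ (φ x))
    refine ⟨h4.differentiableAt, ?_⟩
    rw [h4.fderiv]
    have e1 := (h1 x hx).trans (le_abs_self _)
    have e2 := (h2 x hx).trans (le_abs_self _)
    have e3 := (h3 x hx).trans (le_abs_self _)
    have e4 : ‖fderiv ℝ φ.symm (φ x) ∘L (fderiv ℝ Z (φ x) ∘L fderiv ℝ φ x)‖ ≤
        |C₁| * (η * |C₂|) :=
      (ContinuousLinearMap.opNorm_comp_le _ _).trans (mul_le_mul e1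
        ((ContinuousLinearMap.opNorm_comp_le _ _).trans (mul_le_mul (hη2 _) e2 (norm_nonneg _) hη))
        (norm_nonneg _) (abs_nonneg _))
    have e5 : ‖(fderiv ℝ (fun x => fderiv ℝ φ.symm (φ x)) x).flip (Z (φ x))‖ ≤ |C₃| * η := by
      refine (ContinuousLinearMap.le_opNorm _ _).trans ?_
      rw [ContinuousLinearMap.opNorm_flip]
      exact mul_le_mul e3 (hη1 _) (norm_nonneg _) (abs_nonneg _)
    refine (norm_add_le _ _).trans ?_
    linarith
  · have h4 := pullField_eventuallyEq hK hKφ hZK hx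
    refine ⟨(differentiableAt_const 0).congr_of_eventuallyEq h4, ?_⟩
    rw [h4.fderiv_eq]
    simp only [Pi.zero_def, fderiv_fun_const, norm_zero]
    positivity

end IsDomainChart

open Classical in
/-- The map that moves the points of a chart domain along a vector field. -/
def chartMap (φ : OpenPartialHomeomorph E3 E3) (Z : E3 → E3) (ε : ℝ) (z : ℝ × E3) : E3 :=
  if z.2 ∈ φ.source then φ.symm (φ z.2 + (ε * Real.sin z.1) • Z (φ z.2)) else z.2

namespace IsDomainChart

variable {r : ℕ∞} {M : Set E3} {φ : OpenPartialHomeomorph E3 E3} {Z : E3 → E3} {ε : ℝ}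

theorem chartMap_eq_self {z : ℝ × E3} (hz : z.2 ∈ φ.source → Z (φ z.2) = 0) :
    chartMap φ Z ε z = z.2 := by
  by_cases h : z.2 ∈ φ.source
  · rw [chartMap, if_pos h, hz h, smul_zero, add_zero, φ.left_inv h]
  · rw [chartMap, if_neg h]

/-- Moving along segments in the chart keeps the class `C^r`, whereas the velocity field on `ℝ³`
contains a derivative of the chart and may be one degree less regular. The factor `sin s` bounds the
displacement for all real `s` and has derivative 1 at `s = 0`. -/
theorem contDiff_chartMap (h : IsDomainChart r M φ) (hZ : ContDiff ℝ r Z) {K : Set E3}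
    (hK : IsCompact K) (hKφ : K ⊆ φ.target) (hZK : ∀ y ∉ K, Z y = 0)
    (hε : ∀ y ∈ φ.target, ∀ s, y + (ε * Real.sin s) • Z y ∈ φ.target) :
    ContDiff ℝ r (chartMap φ Z ε) := by
  rw [contDiff_iff_contDiffAt]
  rintro ⟨s, x⟩
  by_cases hx : x ∈ φ.source
  · have hO : IsOpen ((univ : Set ℝ) ×ˢ φ.source) := isOpen_univ.prod φ.open_source
    have hm : ((univ : Set ℝ) ×ˢ φ.source) ∈ 𝓝 (s, x) := hO.mem_nhds ⟨mem_univ _, hx⟩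
    have h1 : ContDiffOn ℝ r (fun z : ℝ × E3 => φ z.2) (univ ×ˢ φ.source) :=
      h.contDiffOn.comp contDiffOn_snd fun z hz => hz.2
    have h2 : ContDiffOn ℝ r (fun z : ℝ × E3 => φ z.2 + (ε * Real.sin z.1) • Z (φ z.2))
        (univ ×ˢ φ.source) :=
      h1.add ((contDiff_const.mul (Real.contDiff_sin.comp contDiff_fst)).contDiffOn.fun_smul
        (hZ.comp_contDiffOn h1))
    have h3 := h.contDiffOn_symm.comp h2 fun z hz => hε _ (φ.map_source hz.2) _
    refine (h3.contDiffAt hm).congr_of_eventuallyEq ?_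
    filter_upwards [hm] with z hz
    simp only [chartMap, if_pos hz.2, Function.comp_apply]
  · have hx' : x ∉ φ.symm '' K := by
      rintro ⟨y, hy, rfl⟩; exact hx (φ.map_target (hKφ hy))
    refine contDiffAt_snd.congr_of_eventuallyEq ?_
    filter_upwards [(isOpen_univ.prod (isCompact_symm_image hK hKφ).isClosed.isOpen_compl).mem_nhds
      (show (s, x) ∈ (univ : Set ℝ) ×ˢ (φ.symm '' K)ᶜ from ⟨mem_univ _, hx'⟩)] with z hz
    exact chartMap_eq_self fun hzs => hZK _ (notMem_of_notMem_symm_image hzs hz.2)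

/-- The third coordinate changes by at most half its size, so its sign is preserved; in particular
points of `∂M` stay on `∂M`. -/
theorem chartMap_mem_iff (h : IsDomainChart r M φ)
    (hε : ∀ y ∈ φ.target, ∀ s, y + (ε * Real.sin s) • Z y ∈ φ.target)
    (hε2 : ∀ y, |ε * Z y 2| ≤ |y 2| / 2) (z : ℝ × E3) : chartMap φ Z ε z ∈ M ↔ z.2 ∈ M := by
  by_cases hz : z.2 ∈ φ.source
  · have h1 := hε _ (φ.map_source hz) z.1
    rw [chartMap, if_pos hz, h.mem_iff _ (φ.map_target h1), φ.right_inv h1, h.mem_iff _ hz]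
    set y := φ z.2
    have h2 : |ε * Real.sin z.1 * Z y 2| ≤ |y 2| / 2 := by
      rw [mul_right_comm, abs_mul]
      exact (mul_le_of_le_one_right (abs_nonneg _) (Real.abs_sin_le_one _)).trans (hε2 y)
    simp only [PiLp.add_apply, PiLp.smul_apply, smul_eq_mul]
    generalize ε * Real.sin z.1 * Z y 2 = b at *
    have h3 := abs_le.1 h2
    constructor
    · intro h4
      by_contra! h5
      rw [abs_of_pos h5] at h3
      linarith [h3.1]
    · intro h4
      rw [abs_of_nonpos h4] at h3
      linarith [h3.2]
  · rw [chartMap, if_neg hz]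

theorem fderiv_chartMap (h : IsDomainChart r M φ) (hr : 2 ≤ r) (hC : ContDiff ℝ r (chartMap φ Z ε))
    (x : E3) : fderiv ℝ (chartMap φ Z ε) (0, x) (1, 0) = ε • pullField φ Z x := by
  have h0 : HasFDerivAt (chartMap φ Z ε) (fderiv ℝ (chartMap φ Z ε) (0, x)) ((0 : ℝ), x) :=
    (hC.differentiable (coe_ne_zero_of_two_le hr) (0, x)).hasFDerivAt
  have h0' : HasFDerivAt (fun s : ℝ => (s, x)) (ContinuousLinearMap.inl ℝ ℝ E3) 0 :=
    hasFDerivAt_prodMk_left 0 x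
  have h2 : HasDerivAt (fun s : ℝ => chartMap φ Z ε (s, x))
      (fderiv ℝ (chartMap φ Z ε) (0, x) (1, 0)) 0 :=
    (HasFDerivAt.comp (g := chartMap φ Z ε) (0 : ℝ) h0 h0').hasDerivAt
  by_cases hx : x ∈ φ.source
  · have h3 : HasDerivAt (fun s : ℝ => φ x + (ε * Real.sin s) • Z (φ x)) (ε • Z (φ x)) 0 := by
      have := (((Real.hasDerivAt_sin 0).const_mul ε).smul_const (Z (φ x))).const_add (φ x)
      simpa using this
    have h4 : HasFDerivAt φ.symm (fderiv ℝ φ.symm (φ x))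
        (φ x + (ε * Real.sin 0) • Z (φ x)) := by
      rw [Real.sin_zero, mul_zero, zero_smul, add_zero]
      exact ((h.contDiffOn_symm.differentiableOn (coe_ne_zero_of_two_le hr)).differentiableAt
        (φ.open_target.mem_nhds (φ.map_source hx))).hasFDerivAt
    have h5 := h4.comp_hasDerivAt (0 : ℝ) h3
    have h6 : (fun s : ℝ => chartMap φ Z ε (s, x)) =
        φ.symm ∘ fun s : ℝ => φ x + (ε * Real.sin s) • Z (φ x) := by
      ext1 s; simp [chartMap, hx]
    rw [h6] at h2
    rw [h2.unique h5, map_smul, pullField, if_pos hx]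
  · have h6 : (fun s : ℝ => chartMap φ Z ε (s, x)) = fun _ => x := by
      ext1 s; simp [chartMap, hx]
    rw [h6] at h2
    rw [h2.unique (hasDerivAt_const _ _), pullField, if_neg hx, smul_zero]

/-- The deformation generated by a vector field in a chart. -/
theorem exists_deformation (h : IsDomainChart r M φ) (hr : 2 ≤ r) (hZ : ContDiff ℝ r Z) {K : Set E3}
    (hK : IsCompact K) (hKφ : K ⊆ φ.target) (hZK : ∀ y ∉ K, Z y = 0)
    (hZ2 : ∀ y : E3, y 2 = 0 → Z y 2 = 0) :
    ∃ (D : Deformation r M) (ε : ℝ), 0 < ε ∧ D.field = ε • pullField φ Z := by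
  have hcs : HasCompactSupport Z := HasCompactSupport.of_support_subset_isCompact hK fun y hy => by
    by_contra hyK; exact hy (hZK y hyK)
  obtain ⟨C, hC⟩ := hcs.exists_bound_of_continuous hZ.continuous
  obtain ⟨C', hC'⟩ := (hZ.of_le (one_le_coe_of_two_le hr)).lipschitzWith_of_hasCompactSupport hcs
    one_ne_zero
  obtain ⟨ρ, hρ, hthick⟩ := hK.exists_thickening_subset_open φ.open_target hKφ
  have hC0 : 0 ≤ C := (norm_nonneg _).trans (hC 0)
  -- The first bound keeps the points of `K` within the `ρ`-thickening inside the chart. The second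
  -- controls the normal displacement: `Z y 2` vanishes on the plane and is `C'`-Lipschitz, so it is
  -- at most `C' |y₂|`.
  set ε : ℝ := min (ρ / (2 * (C + 1))) (1 / (2 * (C' + 1))) with hε
  have hε0 : 0 < ε := by positivity
  have hε1 : ε * C < ρ := by
    have h1 : ε * (2 * (C + 1)) ≤ ρ := (le_div_iff₀ (by positivity)).1 (min_le_left _ _)
    nlinarith
  have hε2 : ε * C' ≤ 1 / 2 := by
    have h1 : ε * (2 * (C' + 1)) ≤ 1 := (le_div_iff₀ (by positivity)).1 (min_le_right _ _)
    nlinarith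
  have hmaps : ∀ y ∈ φ.target, ∀ s, y + (ε * Real.sin s) • Z y ∈ φ.target := by
    intro y hy s
    by_cases hyK : y ∈ K
    · refine hthick (Metric.mem_thickening_iff.2 ⟨y, hyK, ?_⟩)
      rw [dist_eq_norm, add_sub_cancel_left, norm_smul, Real.norm_eq_abs, abs_mul,
        abs_of_pos hε0]
      refine lt_of_le_of_lt ?_ hε1
      exact mul_le_mul (mul_le_of_le_one_right hε0.le (Real.abs_sin_le_one s)) (hC y)
        (norm_nonneg _) hε0.le
    · rw [hZK y hyK, smul_zero, add_zero]; exact hy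
  have hsmall : ∀ y, |ε * Z y 2| ≤ |y 2| / 2 := by
    intro y
    set y' : E3 := y - y 2 • stdE 2 with hy'
    have h1 : Z y' 2 = 0 := hZ2 y' (by simp [hy', stdE_apply])
    have h2 : |Z y 2| ≤ C' * |y 2| := by
      have h3 := hC'.dist_le_mul y y'
      have h4 : dist y y' = |y 2| := by
        rw [dist_eq_norm, hy', sub_sub_cancel, norm_smul]; simp [stdE]
      rw [h4, dist_eq_norm] at h3
      have h5 := PiLp.norm_apply_le (Z y - Z y') 2
      rw [PiLp.sub_apply, h1, sub_zero, Real.norm_eq_abs] at h5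
      exact h5.trans h3
    rw [abs_mul, abs_of_pos hε0]
    nlinarith [abs_nonneg (y 2)]
  have hd := h.contDiff_chartMap hZ hK hKφ hZK hmaps
  obtain ⟨R, hR⟩ := (isCompact_symm_image hK hKφ).isBounded.exists_norm_le
  refine ⟨⟨chartMap φ Z ε, hd, fun x => ?_, R, fun s x hx => ?_, fun s x =>
    h.chartMap_mem_iff hmaps hsmall (s, x)⟩, ε, hε0, ?_⟩
  · by_cases hx : x ∈ φ.source
    · simp [chartMap, hx]
    · simp [chartMap, hx]
  · exact chartMap_eq_self fun hxs => hZK _ (notMem_of_notMem_symm_image hxs fun hxK =>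
      absurd (hR x hxK) (not_le.2 hx))
  · ext1 x
    exact h.fderiv_chartMap hr hd x

end IsDomainChart


/-! ### Smooth approximation of vector fields -/

/-- Mollification commutes with differentiation, and both `Y` and `DY` are uniformly continuous. -/
theorem exists_smooth_approx {Y : E3 → E3} (hY : ContDiff ℝ 1 Y) (hYc : HasCompactSupport Y)
    {η : ℝ} (hη : 0 < η) (n : ℕ∞) : ∃ Y' : E3 → E3, ContDiff ℝ n Y' ∧
      ∀ y, ‖Y' y - Y y‖ ≤ η ∧ ‖fderiv ℝ Y' y - fderiv ℝ Y y‖ ≤ η := by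
  have hc' := hY.continuous_fderiv one_ne_zero
  have hu1 := hYc.uniformContinuous_of_continuous hY.continuous
  have hu2 := (hYc.fderiv ℝ).uniformContinuous_of_continuous hc'
  obtain ⟨δ₁, hδ₁, h1⟩ := Metric.uniformContinuous_iff.1 hu1 η hη
  obtain ⟨δ₂, hδ₂, h2⟩ := Metric.uniformContinuous_iff.1 hu2 η hη
  have hδ : 0 < min δ₁ δ₂ := lt_min hδ₁ hδ₂
  let ρ : ContDiffBump (0 : E3) := ⟨min δ₁ δ₂ / 2, min δ₁ δ₂, by positivity, by linarith⟩
  have hloc : LocallyIntegrable (ρ.normed volume) (volume : Measure E3) :=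
    ρ.continuous_normed.locallyIntegrable
  refine ⟨convolution (ρ.normed volume) Y (ContinuousLinearMap.lsmul ℝ ℝ) volume,
    ρ.hasCompactSupport_normed.contDiff_convolution_left _ ρ.contDiff_normed
      hY.continuous.locallyIntegrable, fun y => ⟨?_, ?_⟩⟩
  · rw [← dist_eq_norm]
    exact ρ.dist_normed_convolution_le hY.continuous.aestronglyMeasurable fun x hx =>
      (h1 (lt_of_lt_of_le (Metric.mem_ball.1 hx) (min_le_left _ _))).le
  · rw [(hYc.hasFDerivAt_convolution_right (ContinuousLinearMap.lsmul ℝ ℝ) hloc hY y).fderiv]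
    have h3 : convolution (ρ.normed volume) (fderiv ℝ Y)
        ((ContinuousLinearMap.lsmul ℝ ℝ).precompR E3) volume y =
        convolution (ρ.normed volume) (fderiv ℝ Y) (ContinuousLinearMap.lsmul ℝ ℝ) volume y := by
      rw [convolution, convolution]
      congr 1
    rw [h3, ← dist_eq_norm]
    exact ρ.dist_normed_convolution_le hc'.aestronglyMeasurable fun x hx =>
      (h2 (lt_of_lt_of_le (Metric.mem_ball.1 hx) (min_le_right _ _))).le

/-- The orthogonal projection to the plane `{y₂ = 0}`. -/
def flatProj : E3 →L[ℝ] E3 :=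
  ContinuousLinearMap.id ℝ E3 - (coordL 2).smulRight (stdE 2)

theorem flatProj_apply (y : E3) : flatProj y = y - y 2 • stdE 2 := rfl

theorem flatProj_two (y : E3) : flatProj y 2 = 0 := by simp [flatProj_apply, stdE_apply]

theorem flatProj_eq {y : E3} (hy : y 2 = 0) : flatProj y = y := by simp [flatProj_apply, hy]

theorem exists_smooth_cutoff {K T : Set E3} (hK : IsClosed K) (hKT : K ⊆ interior T) (n : ℕ∞) :
    ∃ ζ : E3 → ℝ, ContDiff ℝ n ζ ∧ (∀ᶠ x in 𝓝ˢ K, ζ x = 1) ∧ (∀ x ∉ T, ζ x = 0) ∧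
      ∀ x, ζ x ∈ Icc (0 : ℝ) 1 := by
  obtain ⟨ζ, h1, h2, h3⟩ := exists_contMDiffMap_one_nhds_of_subset_interior (n := n)
    (modelWithCornersSelf ℝ E3) hK hKT
  exact ⟨ζ, ζ.contMDiff.contDiff, h1, h2, h3⟩

theorem norm_fderiv_smul_le {ζ : E3 → ℝ} {V : E3 → E3} (hζ : Differentiable ℝ ζ)
    (hV : Differentiable ℝ V) (hζ1 : ∀ x, ζ x ∈ Icc (0 : ℝ) 1) {C v v' : ℝ}
    (hC : ∀ x, ‖fderiv ℝ ζ x‖ ≤ C) {y : E3} (hv : ‖V y‖ ≤ v) (hv' : ‖fderiv ℝ V y‖ ≤ v') :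
    ‖ζ y • V y‖ ≤ v ∧ ‖fderiv ℝ (fun y => ζ y • V y) y‖ ≤ v' + C * v := by
  have h1 : ‖ζ y‖ ≤ 1 := by
    rw [Real.norm_eq_abs, abs_of_nonneg (hζ1 y).1]; exact (hζ1 y).2
  refine ⟨?_, ?_⟩
  · rw [norm_smul]
    exact (mul_le_of_le_one_left (norm_nonneg _) h1).trans hv
  · rw [((hζ y).hasFDerivAt.fun_smul (hV y).hasFDerivAt).fderiv]
    refine (norm_add_le _ _).trans (add_le_add ?_ ?_)
    · rw [norm_smul]
      exact (mul_le_of_le_one_left (norm_nonneg _) h1).trans hv'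
    · refine (ContinuousLinearMap.norm_smulRight_apply _ _).le.trans ?_
      exact mul_le_mul (hC y) hv (norm_nonneg _) ((norm_nonneg _).trans (hC y))

/-- Smooth approximation of a vector field that is tangential along the plane `{y₂ = 0}`. -/
theorem exists_smooth_tangential_approx {Y : E3 → E3} (hY : ContDiff ℝ 1 Y) {K U : Set E3}
    (hK : IsCompact K) (hU : IsOpen U) (hKU : K ⊆ U) (hYK : ∀ y ∉ K, Y y = 0)
    (hY2 : ∀ y : E3, y 2 = 0 → Y y 2 = 0) (n : ℕ∞) : ∃ K' ⊆ U, IsCompact K' ∧ K ⊆ K' ∧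
      ∀ η > 0, ∃ Z : E3 → E3, ContDiff ℝ n Z ∧ (∀ y ∉ K', Z y = 0) ∧
        (∀ y : E3, y 2 = 0 → Z y 2 = 0) ∧
        ∀ y, ‖Z y - Y y‖ ≤ η ∧ ‖fderiv ℝ (fun y => Z y - Y y) y‖ ≤ η := by
  obtain ⟨K', hK', hKK', hK'U⟩ := exists_compact_between hK hU hKU
  -- Order `n + 1` guarantees differentiability even for `n = 0`.
  obtain ⟨ζ, hζd, hζ1, hζ0, hζr⟩ := exists_smooth_cutoff hK.isClosed hKK' (n + 1)
  have hζd1 : ContDiff ℝ 1 ζ := hζd.of_le (by exact_mod_cast le_add_self)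
  have hYc : HasCompactSupport Y := HasCompactSupport.of_support_subset_isCompact hK fun y hy => by
    by_contra hyK; exact hy (hYK y hyK)
  have hζc : HasCompactSupport ζ := HasCompactSupport.of_support_subset_isCompact hK'
    fun y hy => by by_contra hyK; exact hy (hζ0 y hyK)
  obtain ⟨C, hC⟩ := (hζc.fderiv ℝ).exists_bound_of_continuous
    (hζd1.continuous_fderiv one_ne_zero)
  have hC0 : 0 ≤ C := (norm_nonneg _).trans (hC 0)
  have hζY : ∀ y, ζ y • Y y = Y y := fun y => by
    by_cases hy : y ∈ K
    · rw [(hζ1.self_of_nhdsSet y hy), one_smul]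
    · rw [hYK y hy, smul_zero]
  refine ⟨K', hK'U, hK', hKK'.trans interior_subset, fun η hη => ?_⟩
  -- `T` is the projection onto the normal direction. Mollifying destroys tangency, so the normal
  -- component on the plane, extended independently of `y₂`, is subtracted again; it is small in
  -- `C¹` because `Y` has none.
  set T : E3 →L[ℝ] E3 := (coordL 2).smulRight (stdE 2) with hT
  have hTY : ∀ y, T (Y (flatProj y)) = 0 := fun y => by
    simp [hT, hY2 _ (flatProj_two y)]
  -- By this factor the correction and the cutoff can enlarge the `C¹` error of the mollification.
  set N := (1 + ‖T‖ * ‖flatProj‖) + C * (1 + ‖T‖) + (1 + ‖T‖) with hN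
  have hN0 : 0 < N := by positivity
  obtain ⟨Y', hY'd, hY'⟩ := exists_smooth_approx hY hYc (div_pos hη hN0) (n + 1)
  set η' := η / N with hη'
  have hη'0 : 0 < η' := div_pos hη hN0
  have hηN : η' * N = η := div_mul_cancel₀ _ hN0.ne'
  have hY'1 : Differentiable ℝ Y' := hY'd.differentiable (by
    have : (1 : WithTop ℕ∞) ≤ ((n + 1 : ℕ∞) : WithTop ℕ∞) := by exact_mod_cast le_add_self
    rintro h; rw [h] at this; exact absurd this (by norm_num))
  have hY1 := hY.differentiable one_ne_zero
  have hn1 : (n : WithTop ℕ∞) ≤ ((n + 1 : ℕ∞) : WithTop ℕ∞) := by exact_mod_cast le_self_add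
  refine ⟨fun y => ζ y • (Y' y - T (Y' (flatProj y))), ?_, fun y hy => ?_, fun y hy => ?_,
    fun y => ?_⟩
  · exact (hζd.of_le hn1).smul ((hY'd.of_le hn1).sub
      (T.contDiff.comp ((hY'd.of_le hn1).comp flatProj.contDiff)))
  · simp only [hζ0 y hy, zero_smul]
  · simp [flatProj_eq hy, hT, stdE_apply]
  · set W : E3 → E3 := fun y => Y' y - Y y with hW
    have hWd : Differentiable ℝ W := hY'1.sub hY1
    have hW1 : ∀ y, ‖W y‖ ≤ η' := fun y => (hY' y).1
    have hW2 : ∀ y, ‖fderiv ℝ W y‖ ≤ η' := fun y => by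
      rw [((hY'1 y).hasFDerivAt.fun_sub (hY1 y).hasFDerivAt).fderiv]; exact (hY' y).2
    have hVf : HasFDerivAt (fun y => W y - T (W (flatProj y)))
        (fderiv ℝ W y - T ∘L (fderiv ℝ W (flatProj y) ∘L flatProj)) y :=
      (hWd y).hasFDerivAt.fun_sub
        (T.hasFDerivAt.comp y ((hWd (flatProj y)).hasFDerivAt.comp y flatProj.hasFDerivAt))
    have hVd : Differentiable ℝ fun y => W y - T (W (flatProj y)) :=
      hWd.sub (T.differentiable.comp (hWd.comp flatProj.differentiable))
    have hV1 : ‖W y - T (W (flatProj y))‖ ≤ η' * (1 + ‖T‖) := by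
      refine (norm_sub_le _ _).trans ?_
      have := (T.le_opNorm (W (flatProj y))).trans
        (mul_le_mul_of_nonneg_left (hW1 _) (norm_nonneg _))
      linarith [hW1 y]
    have hV2 : ‖fderiv ℝ (fun y => W y - T (W (flatProj y))) y‖ ≤ η' * (1 + ‖T‖ * ‖flatProj‖) := by
      rw [hVf.fderiv]
      refine (norm_sub_le _ _).trans ?_
      have e1 := (ContinuousLinearMap.opNorm_comp_le (fderiv ℝ W (flatProj y)) flatProj).trans
        (mul_le_mul_of_nonneg_right (hW2 _) (norm_nonneg _))
      have e2 := (ContinuousLinearMap.opNorm_comp_le T _).trans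
        (mul_le_mul_of_nonneg_left e1 (norm_nonneg _))
      linarith [hW2 y]
    have hfun : (fun y => ζ y • (Y' y - T (Y' (flatProj y))) - Y y) =
        fun y => ζ y • (W y - T (W (flatProj y))) := by
      ext1 y
      simp only [hW, map_sub, hTY, sub_zero]
      conv_lhs => rw [← hζY y]
      rw [← smul_sub]
      congr 1
      abel
    have h5 := norm_fderiv_smul_le (hζd1.differentiable one_ne_zero) hVd hζr hC hV1 hV2
    have h6 : 0 ≤ C * (1 + ‖T‖) := by positivity
    have h7 : 0 ≤ ‖T‖ * ‖flatProj‖ := by positivity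
    rw [hfun]
    refine ⟨?_, h5.2.trans ?_⟩
    · rw [congrFun hfun y]
      refine h5.1.trans ?_
      rw [← hηN, hN]
      exact mul_le_mul_of_nonneg_left (by linarith) hη'0.le
    · rw [← hηN, hN]
      have := mul_nonneg hη'0.le (by positivity : 0 ≤ 1 + ‖T‖)
      linarith


/-! ### Stationarity -/

theorem pullField_sub (φ : OpenPartialHomeomorph E3 E3) (Y Z : E3 → E3) :
    pullField φ (fun y => Z y - Y y) = fun x => pullField φ Z x - pullField φ Y x := by
  ext1 x
  by_cases hx : x ∈ φ.source <;> simp [pullField, hx]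

theorem pullField_eq_zero {φ : OpenPartialHomeomorph E3 E3} {Z : E3 → E3} {K : Set E3}
    (hZ : ∀ y ∉ K, Z y = 0) {x : E3} (hx : x ∉ φ.symm '' K) : pullField φ Z x = 0 := by
  by_cases hxs : x ∈ φ.source
  · rw [pullField, if_pos hxs, hZ _ (notMem_of_notMem_symm_image hxs hx), map_zero]
  · rw [pullField, if_neg hxs]

namespace IsDomainChart

variable {r : ℕ∞} {M : Set E3} {φ : OpenPartialHomeomorph E3 E3}

theorem contDiff_pullField (h : IsDomainChart r M φ) (hr : 2 ≤ r) {Z : E3 → E3}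
    (hZ : ContDiff ℝ 1 Z) {K : Set E3} (hK : IsCompact K) (hKφ : K ⊆ φ.target)
    (hZK : ∀ y ∉ K, Z y = 0) : ContDiff ℝ 1 (pullField φ Z) := by
  rw [contDiff_iff_contDiffAt]
  intro x
  by_cases hx : x ∈ φ.source
  · have h1 := (h.contDiffOn_fderiv_symm hr).clm_apply
      (hZ.comp_contDiffOn (h.contDiffOn.of_le (one_le_coe_of_two_le hr)))
    refine (h1.contDiffAt (φ.open_source.mem_nhds hx)).congr_of_eventuallyEq ?_
    filter_upwards [φ.open_source.mem_nhds hx] with y hy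
    simp [pullField, hy]
  · have hx' : x ∉ φ.symm '' K := by
      rintro ⟨y, hy, rfl⟩; exact hx (φ.map_target (hKφ hy))
    exact contDiffAt_const.congr_of_eventuallyEq (pullField_eventuallyEq hK hKφ hZK hx')

theorem symm (h : IsDomainChart r M φ) : IsDomainChart r {y | φ.symm y 2 ≤ 0} φ.symm :=
  ⟨h.contDiffOn_symm, h.contDiffOn, fun _ _ => Iff.rfl⟩

theorem pullField_pullField_symm (h : IsDomainChart r M φ) (hr : 2 ≤ r) {X : E3 → E3} {x : E3}
    (hx : x ∉ φ.source → X x = 0) : pullField φ (pullField φ.symm X) x = X x := by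
  by_cases hxs : x ∈ φ.source
  · obtain ⟨L, hL, hL', -⟩ := exists_chart_deriv (one_le_coe_of_two_le hr) φ h.contDiffOn
      h.contDiffOn_symm
    have h1 : φ x ∈ φ.symm.source := φ.map_source hxs
    rw [pullField, if_pos hxs, pullField, if_pos h1, (hL' x hxs).fderiv, φ.left_inv hxs]
    change (L x).symm (fderiv ℝ φ x (X x)) = X x
    rw [(hL x hxs).fderiv]
    exact (L x).symm_apply_apply (X x)
  · rw [pullField, if_neg hxs, hx hxs]

end IsDomainChart

theorem exists_abs_tangDiv_le {X : E3 → E3} (hX : ContDiff ℝ 1 X) (hXc : HasCompactSupport X) :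
    ∃ C, ∀ z : E3 × Plane, |tangDiv z.2 X z.1| ≤ C := by
  obtain ⟨C, hC⟩ := (hXc.fderiv ℝ).exists_bound_of_continuous (hX.continuous_fderiv one_ne_zero)
  refine ⟨3 * C, fun z => ?_⟩
  rw [tangDiv_eq]
  refine (abs_traceL_le _).trans ?_
  have h1 := (ContinuousLinearMap.opNorm_comp_le z.2.proj (fderiv ℝ X z.1)).trans
    (mul_le_of_le_one_left (norm_nonneg _) z.2.norm_proj_le)
  linarith [hC z.1]

theorem integrable_tangDiv {X : E3 → E3} (hX : ContDiff ℝ 1 X) (hXc : HasCompactSupport X)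
    (V : FiniteMeasure (E3 × Plane)) :
    Integrable (fun z : E3 × Plane => tangDiv z.2 X z.1) (V : Measure (E3 × Plane)) := by
  obtain ⟨C, hC⟩ := exists_abs_tangDiv_le hX hXc
  exact Integrable.of_bound (continuous_tangDiv hX).aestronglyMeasurable C (ae_of_all _ hC)

theorem hasCompactSupport_of_forall_notMem {X : E3 → E3} {K : Set E3} (hK : IsCompact K)
    (hXK : ∀ x ∉ K, X x = 0) : HasCompactSupport X :=
  HasCompactSupport.of_support_subset_isCompact hK fun y hy => by
    by_contra hyK; exact hy (hXK y hyK)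

/-- The first variation of a pair of varifolds that need not be carried by the domain. -/
def pairDiv (a : ℝ) (V W : FiniteMeasure (E3 × Plane)) (X : E3 → E3) : ℝ :=
  pairInt a V W fun z => tangDiv z.2 X z.1

theorem tangDiv_smul (S : Plane) (ε : ℝ) (X : E3 → E3) (x : E3) :
    tangDiv S (ε • X) x = ε * tangDiv S X x := by
  rw [tangDiv_eq, tangDiv_eq, fderiv_const_smul_field, Pi.smul_apply,
    ContinuousLinearMap.comp_smul, map_smul,
    smul_eq_mul]

theorem pairDiv_smul (a : ℝ) (V W : FiniteMeasure (E3 × Plane)) (ε : ℝ) (X : E3 → E3) :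
    pairDiv a V W (ε • X) = ε * pairDiv a V W X := by
  simp only [pairDiv, pairInt, tangDiv_smul, integral_const_mul]
  ring

theorem pairDiv_add (a : ℝ) (V W : FiniteMeasure (E3 × Plane)) {X Y : E3 → E3}
    (hX : ContDiff ℝ 1 X) (hXc : HasCompactSupport X) (hY : ContDiff ℝ 1 Y)
    (hYc : HasCompactSupport Y) : pairDiv a V W (X + Y) = pairDiv a V W X + pairDiv a V W Y := by
  have h1 : ∀ z : E3 × Plane, tangDiv z.2 (X + Y) z.1 = tangDiv z.2 X z.1 + tangDiv z.2 Y z.1 := by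
    intro z
    rw [tangDiv_eq, tangDiv_eq, tangDiv_eq, fderiv_add (hX.differentiable one_ne_zero _)
      (hY.differentiable one_ne_zero _), ContinuousLinearMap.comp_add, map_add]
  simp only [pairDiv, pairInt, h1]
  rw [integral_add (integrable_tangDiv hX hXc V) (integrable_tangDiv hY hYc V),
    integral_add (integrable_tangDiv hX hXc W) (integrable_tangDiv hY hYc W)]
  ring

theorem abs_pairInt_sub_le {a : ℝ} (ha : 0 ≤ a) {V W : FiniteMeasure (E3 × Plane)}
    {u v : E3 × Plane → ℝ}
    (hu : ∀ V : FiniteMeasure (E3 × Plane), Integrable u (V : Measure (E3 × Plane)))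
    (hv : ∀ V : FiniteMeasure (E3 × Plane), Integrable v (V : Measure (E3 × Plane))) {η : ℝ}
    (hV : ∀ᵐ z ∂(V : Measure (E3 × Plane)), |u z - v z| ≤ η)
    (hW : ∀ᵐ z ∂(W : Measure (E3 × Plane)), |u z - v z| ≤ η) :
    |pairInt a V W u - pairInt a V W v| ≤ η * (V.mass + a * W.mass) := by
  have h1 : ∀ V : FiniteMeasure (E3 × Plane), (∀ᵐ z ∂(V : Measure (E3 × Plane)), |u z - v z| ≤ η) →
      |(∫ z, u z ∂(V : Measure (E3 × Plane))) - ∫ z, v z ∂(V : Measure (E3 × Plane))| ≤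
        η * V.mass := fun V hV => by
    rw [← integral_sub (hu V) (hv V)]
    exact norm_integral_le_of_norm_le_const (f := fun z => u z - v z) (C := η) hV
  have h2 := abs_le.1 (h1 V hV)
  have h3 := abs_le.1 (h1 W hW)
  have h4 := mul_le_mul_of_nonneg_left h3.1 ha
  have h5 := mul_le_mul_of_nonneg_left h3.2 ha
  rw [pairInt, pairInt, abs_le]
  constructor <;> linarith [h2.1, h2.2]

/-- Read in the chart, `X` becomes a `C¹` field tangential along `{y₂ = 0}`, a `C¹`-limit of `C^r`
tangential fields supported in a fixed compact set. Each of these generates a deformation, so it has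
non-negative first variation, and the first variation is continuous in `C¹`. -/
theorem IsDomainChart.pairDiv_nonneg {r : ℕ∞} {M : Set E3} {φ : OpenPartialHomeomorph E3 E3}
    (hφ : IsDomainChart r M φ) (hr : 2 ≤ r) {a : ℝ} (ha : 0 ≤ a) {V W : FiniteMeasure (E3 × Plane)}
    (h : ∀ D : Deformation r M, 0 ≤ pairInt a V W D.testFun) {X : E3 → E3}
    (hX : IsTangentialField M X) {K : Set E3} (hK : IsCompact K) (hKφ : K ⊆ φ.source)
    (hXK : ∀ x ∉ K, X x = 0) : 0 ≤ pairDiv a V W X := by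
  have hXc := hasCompactSupport_of_forall_notMem hK hXK
  set Y := pullField φ.symm X with hY
  have hY1 : ContDiff ℝ 1 Y := hφ.symm.contDiff_pullField hr hX.1 hK hKφ hXK
  have hK1 : IsCompact (φ '' K) := hK.image_of_continuousOn (φ.continuousOn.mono hKφ)
  have hK1φ : φ '' K ⊆ φ.target := by
    rintro _ ⟨x, hx, rfl⟩; exact φ.map_source (hKφ hx)
  have hYK : ∀ y ∉ φ '' K, Y y = 0 := fun y hy =>
    pullField_eq_zero (φ := φ.symm) hXK (by rwa [φ.symm_symm])
  have hY2 : ∀ y : E3, y 2 = 0 → Y y 2 = 0 := by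
    intro y hy
    by_cases hyt : y ∈ φ.symm.source
    · rw [hY, pullField, if_pos hyt]
      have hxs : φ.symm y ∈ φ.source := φ.map_target hyt
      have hxf : φ.symm y ∈ frontier M := by
        rw [hφ.mem_frontier_iff hxs, φ.right_inv hyt]; exact hy
      exact hφ.coord_eq_zero hr hxs hxf (hX.2 _ hxf)
    · rw [hY, pullField, if_neg hyt]; rfl
  have hXY : pullField φ Y = X := funext fun x =>
    hφ.pullField_pullField_symm hr fun hx => hXK x fun hxK => hx (hKφ hxK)
  obtain ⟨K', hK'φ, hK', hKK', happ⟩ := exists_smooth_tangential_approx hY1 hK1 φ.open_target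
    hK1φ hYK hY2 r
  obtain ⟨C, hC0, hC⟩ := hφ.exists_norm_fderiv_pullField_le hr hK' hK'φ
  have key : ∀ η > 0, -(3 * (C * η) * (V.mass + a * W.mass)) ≤ pairDiv a V W X := by
    intro η hη
    obtain ⟨Z, hZ, hZK, hZ2, hZY⟩ := happ η hη
    have hZ1 : ContDiff ℝ 1 Z := hZ.of_le (one_le_coe_of_two_le hr)
    obtain ⟨D, ε, hε, hD⟩ := hφ.exists_deformation hr hZ hK' hK'φ hZK hZ2
    have hP1 := hφ.contDiff_pullField hr hZ1 hK' hK'φ hZK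
    have hPc := hasCompactSupport_of_forall_notMem (isCompact_symm_image hK' hK'φ)
      fun x hx => pullField_eq_zero (φ := φ) hZK hx
    have h1 : 0 ≤ pairDiv a V W (pullField φ Z) := by
      have h2 := h D
      have h3 : pairInt a V W D.testFun = pairDiv a V W D.field := rfl
      rw [h3, hD, pairDiv_smul] at h2
      exact nonneg_of_mul_nonneg_right h2 hε
    have h4 : ∀ z : E3 × Plane, |tangDiv z.2 X z.1 - tangDiv z.2 (pullField φ Z) z.1| ≤
        3 * (C * η) := by
      intro z
      rw [abs_sub_comm]
      refine (abs_tangDiv_sub_le _ _ _ _).trans ?_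
      have h5 := (hC (fun y => Z y - Y y) ((hZ1.sub hY1).differentiable one_ne_zero)
        (fun y hy => by rw [hZK y hy, hYK y fun h => hy (hKK' h), sub_zero]) η hη.le
        (fun y => (hZY y).1) (fun y => (hZY y).2) z.1).2
      rw [pullField_sub, hXY, fderiv_fun_sub (hP1.differentiable one_ne_zero _)
        (hX.1.differentiable one_ne_zero _)] at h5
      linarith
    have h6 := (abs_le.1 (abs_pairInt_sub_le (V := V) (W := W) ha
      (fun V => integrable_tangDiv hX.1 hXc V) (fun V => integrable_tangDiv hP1 hPc V)
      (ae_of_all _ h4) (ae_of_all _ h4))).1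
    rw [pairDiv] at h1 ⊢
    linarith
  by_contra! hlt
  set m : ℝ := V.mass + a * W.mass with hm
  have hm0 : 0 ≤ m := by positivity
  -- This `η` makes the approximation error less than half of the supposed negative value.
  have h1 := key (-pairDiv a V W X / (3 * C * (m + 1) * 2))
    (div_pos (by linarith) (by positivity))
  have h2 : 3 * (C * (-pairDiv a V W X / (3 * C * (m + 1) * 2))) * m =
      -pairDiv a V W X / 2 * (m / (m + 1)) := by
    have : m + 1 ≠ 0 := by positivity
    field_simp
  have h3 : m / (m + 1) ≤ 1 := (div_le_one (by positivity)).2 (by linarith)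
  rw [h2] at h1
  nlinarith

theorem IsTangentialField.smul {M : Set E3} {X : E3 → E3} (hX : IsTangentialField M X) {ζ : E3 → ℝ}
    (hζ : ContDiff ℝ 1 ζ) : IsTangentialField M fun x => ζ x • X x :=
  ⟨hζ.smul hX.1, fun x hx => Submodule.smul_mem _ _ (hX.2 x hx)⟩

/-- Tangency is preserved under `X ↦ -X` and the first variation is odd, so non-negativity for all
fields is vanishing. -/
theorem IsDomainChart.pairDiv_eq_zero {r : ℕ∞} {M : Set E3} {φ : OpenPartialHomeomorph E3 E3}
    (hφ : IsDomainChart r M φ) (hr : 2 ≤ r) {a : ℝ} (ha : 0 ≤ a) {V W : FiniteMeasure (E3 × Plane)}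
    (h : ∀ D : Deformation r M, 0 ≤ pairInt a V W D.testFun) {X : E3 → E3}
    (hX : IsTangentialField M X) {K : Set E3} (hK : IsCompact K) (hKφ : K ⊆ φ.source)
    (hXK : ∀ x ∉ K, X x = 0) : pairDiv a V W X = 0 := by
  have h1 := hφ.pairDiv_nonneg hr ha h hX hK hKφ hXK
  have hX' : IsTangentialField M ((-1 : ℝ) • X) := hX.smul (ζ := fun _ => -1) contDiff_const
  have h2 := hφ.pairDiv_nonneg hr ha h hX' hK hKφ fun x hx => by simp [hXK x hx]
  rw [pairDiv_smul] at h2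
  linarith

/-- The first variation vanishes on fields with compact support in a neighbourhood of `M`. -/
theorem exists_nhds_pairDiv_eq_zero {r : ℕ∞} (hr : 2 ≤ r) {M : Set E3} (hM : IsConvexDomain r M)
    {a : ℝ} (ha : 0 ≤ a) {V W : FiniteMeasure (E3 × Plane)}
    (h : ∀ D : Deformation r M, 0 ≤ pairInt a V W D.testFun) : ∃ U, IsOpen U ∧ M ⊆ U ∧
      ∀ X, IsTangentialField M X → ∀ K ⊆ U, IsCompact K → (∀ x ∉ K, X x = 0) →
        pairDiv a V W X = 0 := by
  refine hM.isCompact.induction_on (p := fun s => ∃ U, IsOpen U ∧ s ⊆ U ∧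
      ∀ X, IsTangentialField M X → ∀ K ⊆ U, IsCompact K → (∀ x ∉ K, X x = 0) →
        pairDiv a V W X = 0) ?_ ?_ ?_ ?_
  · refine ⟨∅, isOpen_empty, subset_rfl, fun X hX K hK _ hXK => ?_⟩
    have h1 : X = (0 : ℝ) • X := by
      ext1 x
      rw [zero_smul]
      exact hXK x fun hx => hK hx
    rw [h1, pairDiv_smul, zero_mul]
  · rintro s t hst ⟨U, hU, htU, hX⟩
    exact ⟨U, hU, hst.trans htU, hX⟩
  · rintro s t ⟨U₁, hU₁, hs, h1⟩ ⟨U₂, hU₂, ht, h2⟩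
    refine ⟨U₁ ∪ U₂, hU₁.union hU₂, union_subset_union hs ht, fun X hX K hKU hK hXK => ?_⟩
    -- The support is divided between the two open sets and `X` is split by a cutoff; multiplication
    -- by a function keeps the field tangential.
    obtain ⟨K₁, K₂, hK₁, hK₂, hKU₁, hKU₂, rfl⟩ := hK.binary_compact_cover hU₁ hU₂ hKU
    obtain ⟨K', hK', hKK', hK'U⟩ := exists_compact_between hK₁ hU₁ hKU₁
    obtain ⟨ζ, hζd, hζ1, hζ0, -⟩ := exists_smooth_cutoff hK₁.isClosed hKK' 1
    have hζd : ContDiff ℝ 1 ζ := hζd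
    have hXa := hX.smul hζd
    have hXb := hX.smul (contDiff_const.sub hζd : ContDiff ℝ 1 fun x => 1 - ζ x)
    have za : ∀ x ∉ K', ζ x • X x = 0 := fun x hx => by rw [hζ0 x hx, zero_smul]
    have zb : ∀ x ∉ K₂, (1 - ζ x) • X x = 0 := fun x hx => by
      by_cases hx1 : x ∈ K₁
      · rw [hζ1.self_of_nhdsSet x hx1, sub_self, zero_smul]
      · rw [hXK x (by simp [hx, hx1]), smul_zero]
    have hsum : X = (fun x => ζ x • X x) + fun x => (1 - ζ x) • X x := by
      ext1 x
      rw [Pi.add_apply, ← add_smul, add_sub_cancel, one_smul]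
    rw [hsum, pairDiv_add a V W hXa.1 (hasCompactSupport_of_forall_notMem hK' za) hXb.1
      (hasCompactSupport_of_forall_notMem hK₂ zb), h1 _ hXa K' hK'U hK' za,
      h2 _ hXb K₂ hKU₂ hK₂ zb, add_zero]
  · intro p hp
    obtain ⟨φ, hφ, hpφ⟩ := hM.exists_chart hr hp
    exact ⟨φ.source, mem_nhdsWithin_of_mem_nhds (φ.open_source.mem_nhds hpφ), φ.source,
      φ.open_source, subset_rfl, fun X hX K hKφ hK hXK =>
        hφ.pairDiv_eq_zero hr ha h hX hK hKφ hXK⟩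

theorem varifolds_ae {M : Set E3} {V : FiniteMeasure (E3 × Plane)} (hV : V ∈ varifolds M) :
    ∀ᵐ z ∂(V : Measure (E3 × Plane)), z.1 ∈ M := by
  rw [ae_iff]; exact hV

theorem boundaryVarifolds_ae {M : Set E3} {W : FiniteMeasure (E3 × Plane)}
    (hW : W ∈ boundaryVarifolds M) :
    ∀ᵐ z ∂(W : Measure (E3 × Plane)), z.1 ∈ frontier M ∧ z.2 = tangentPlane (frontier M) z.1 := by
  rw [ae_iff]; exact hW

/-- A pair of varifolds with non-negative first variation along all deformations is stationary. -/
theorem isStationaryPair_of_deformations {r : ℕ∞} (hr : 2 ≤ r) {M : Set E3}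
    (hM : IsConvexDomain r M) {a : ℝ} (ha : 0 ≤ a) {V W : FiniteMeasure (E3 × Plane)}
    (hV : V ∈ varifolds M) (hW : W ∈ boundaryVarifolds M)
    (h : ∀ D : Deformation r M, 0 ≤ pairInt a V W D.testFun) : IsStationaryPair M a V W := by
  intro X hX
  obtain ⟨U, hU, hMU, hUX⟩ := exists_nhds_pairDiv_eq_zero hr hM ha h
  -- An arbitrary tangential field need not have compact support. A cutoff equal to 1 near `M` does
  -- not change its first variation, since both varifolds are carried by `M`.
  obtain ⟨K', hK', hMK', hK'U⟩ := exists_compact_between hM.isCompact hU hMU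
  obtain ⟨ζ, hζd, hζ1, hζ0, -⟩ := exists_smooth_cutoff hM.isCompact.isClosed hMK' 1
  have h1 := hUX _ (hX.smul hζd) K' hK'U hK' fun x hx => by rw [hζ0 x hx, zero_smul]
  have h2 : ∀ x ∈ M, ∀ S : Plane, tangDiv S (fun x => ζ x • X x) x = tangDiv S X x := by
    intro x hx S
    have h3 : (fun x => ζ x • X x) =ᶠ[𝓝 x] X := by
      filter_upwards [hζ1.filter_mono (nhds_le_nhdsSet hx)] with y hy
      rw [hy, one_smul]
    rw [tangDiv_eq, tangDiv_eq, h3.fderiv_eq]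
  rw [pairDiv, pairInt] at h1
  rw [firstVariation, ← h1]
  congr 1
  · refine integral_congr_ae ?_
    filter_upwards [varifolds_ae hV] with z hz
    exact (h2 _ hz _).symm
  · congr 1
    refine integral_congr_ae ?_
    filter_upwards [boundaryVarifolds_ae hW] with z hz
    rw [h2 _ (hM.isCompact.isClosed.frontier_subset hz.1), ← hz.2]


/-! ### The boundary of the domain as a surface -/

theorem area_flatPlane_inter_closedBall_lt_top (R : ℝ) :
    μHE[2] (flatPlane ∩ Metric.closedBall 0 R) < ∞ := by
  have h1 : flatPlane ∩ Metric.closedBall 0 R =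
      Subtype.val '' (Metric.closedBall (0 : horizontal.space) R) := by
    ext x
    simp only [mem_inter_iff, mem_image, Metric.mem_closedBall, dist_zero_right]
    constructor
    · rintro ⟨h1, h2⟩
      exact ⟨⟨x, mem_horizontal.2 h1⟩, h2, rfl⟩
    · rintro ⟨y, hy, rfl⟩
      exact ⟨mem_horizontal.1 y.2, hy⟩
  have h2 : (μHE[2] : Measure horizontal.space) = volume := by
    have := InnerProductSpace.euclideanHausdorffMeasure_eq_volume (V := horizontal.space)
    rwa [horizontal.finrank_eq] at this
  rw [h1, isometry_subtype_coe.euclideanHausdorffMeasure_image, h2]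
  exact measure_closedBall_lt_top

theorem area_flatPlane_inter_ball_lt_top (y : E3) (ρ : ℝ) :
    μHE[2] (flatPlane ∩ Metric.ball y ρ) < ∞ := by
  refine (measure_mono (inter_subset_inter_right _ fun z hz => ?_)).trans_lt
    (area_flatPlane_inter_closedBall_lt_top (ρ + ‖y‖))
  rw [mem_closedBall_zero_iff]
  have h1 := norm_le_norm_add_norm_sub' z y
  have h2 : ‖z - y‖ < ρ := by rw [← dist_eq_norm]; exact hz
  linarith

theorem IsDomainChart.exists_nhds_area_lt_top {r : ℕ∞} (hr : 2 ≤ r) {M : Set E3}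
    {φ : OpenPartialHomeomorph E3 E3} (h : IsDomainChart r M φ) {p : E3} (hp : p ∈ φ.source) :
    ∃ U ∈ 𝓝 p, μHE[2] (frontier M ∩ U) < ∞ := by
  have hd : ContDiffAt ℝ 1 φ.symm (φ p) :=
    (h.contDiffOn_symm.contDiffAt (φ.open_target.mem_nhds (φ.map_source hp))).of_le
      (one_le_coe_of_two_le hr)
  obtain ⟨K, t, ht, hK⟩ := hd.exists_lipschitzOnWith
  obtain ⟨ρ, hρ, hball⟩ := Metric.mem_nhds_iff.1 ht
  refine ⟨φ.source ∩ φ ⁻¹' Metric.ball (φ p) ρ, inter_mem (φ.open_source.mem_nhds hp)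
    ((φ.continuousAt hp).preimage_mem_nhds (Metric.ball_mem_nhds _ hρ)), ?_⟩
  have hsub : frontier M ∩ (φ.source ∩ φ ⁻¹' Metric.ball (φ p) ρ) ⊆
      φ.symm '' (flatPlane ∩ Metric.ball (φ p) ρ) := by
    rintro x ⟨hx, hxs, hxb⟩
    exact ⟨φ x, ⟨(h.mem_frontier_iff hxs).1 hx, hxb⟩, φ.left_inv hxs⟩
  have h1 := area_image_le_of_lipschitzOn
    (hK.mono ((inter_subset_right (s := flatPlane)).trans hball))
  refine (measure_mono hsub).trans_lt (h1.trans_lt ?_)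
  exact ENNReal.mul_lt_top (ENNReal.pow_lt_top ENNReal.coe_lt_top)
    (area_flatPlane_inter_ball_lt_top _ _)

namespace IsConvexDomain

variable {r : ℕ∞} {M : Set E3}

theorem isCompact_frontier (hM : IsConvexDomain r M) : IsCompact (frontier M) :=
  hM.isCompact.of_isClosed_subset isClosed_frontier hM.isCompact.isClosed.frontier_subset

theorem area_frontier_lt_top (hM : IsConvexDomain r M) (hr : 2 ≤ r) : μHE[2] (frontier M) < ∞ := by
  have h1 : ∃ U, frontier M ⊆ U ∧ μHE[2] (frontier M ∩ U) < ∞ := by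
    refine hM.isCompact_frontier.induction_on (p := fun s => ∃ U, s ⊆ U ∧
      μHE[2] (frontier M ∩ U) < ∞) ⟨∅, subset_rfl, by simp⟩ ?_ ?_ fun p hp => ?_
    · rintro s t hst ⟨U, hU, h⟩
      exact ⟨U, hst.trans hU, h⟩
    · rintro s t ⟨U, hU, h⟩ ⟨U', hU', h'⟩
      refine ⟨U ∪ U', union_subset_union hU hU', ?_⟩
      rw [inter_union_distrib_left]
      exact (measure_union_le _ _).trans_lt (ENNReal.add_lt_top.2 ⟨h, h'⟩)
    · obtain ⟨φ, hφ, hpφ⟩ := hM.exists_chart hr (hM.isCompact.isClosed.frontier_subset hp)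
      obtain ⟨U, hU, h⟩ := hφ.exists_nhds_area_lt_top hr hpφ
      exact ⟨U, mem_nhdsWithin_of_mem_nhds hU, U, subset_rfl, h⟩
  obtain ⟨U, hU, h⟩ := h1
  rwa [inter_eq_left.2 hU] at h

theorem isInteriorPoint (hM : IsConvexDomain r M) (hr : 2 ≤ r) {p : E3} (hp : p ∈ frontier M) :
    IsInteriorPoint r (frontier M) p := by
  obtain ⟨φ, hφ, hpφ⟩ := hM.exists_chart hr (hM.isCompact.isClosed.frontier_subset hp)
  exact hφ.isInteriorPoint hpφ hp

theorem isSurface_frontier (hM : IsConvexDomain r M) (hr : 2 ≤ r) :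
    IsSurface r (frontier M) ∅ where
  isClosed := isClosed_frontier
  finite_area := hM.area_frontier_lt_top hr
  finite_sing := finite_empty
  regular p hp := Or.inl (hM.isInteriorPoint hr hp.1)

/-- The graph of a continuous map on a compact set. Its closedness is what keeps limits of boundary
varifolds boundary varifolds. -/
theorem isCompact_boundaryPlanes (hM : IsConvexDomain r M) (hr : 2 ≤ r) :
    IsCompact {z : E3 × Plane | z.1 ∈ frontier M ∧ z.2 = tangentPlane (frontier M) z.1} := by
  have h1 := (hM.isSurface_frontier hr).continuousOn_tangentPlane hr
  rw [sdiff_empty] at h1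
  have h2 := hM.isCompact_frontier.image_of_continuousOn (continuousOn_id.prodMk h1)
  convert h2 using 1
  ext ⟨x, S⟩
  simp only [mem_ofPred_eq, mem_image, id_eq, Prod.mk.injEq]
  constructor
  · rintro ⟨hx, rfl⟩; exact ⟨x, hx, rfl, rfl⟩
  · rintro ⟨y, hy, rfl, rfl⟩; exact ⟨hy, rfl⟩

end IsConvexDomain

/-! ### Induced varifolds of surfaces in the domain and its boundary -/

theorem IsSurface.inducedVarifold_ae {r : ℕ∞} (hr : 2 ≤ r) {A S : Set E3} (h : IsSurface r A S)
    {T : Set (E3 × Plane)} (hT : MeasurableSet T)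
    (hA : ∀ x ∈ A \ S, (x, tangentPlane A x) ∈ T) :
    (inducedVarifold A : Measure (E3 × Plane)) Tᶜ = 0 := by
  rw [h.toMeasure_inducedVarifold, ← mem_ae_iff]
  refine (ae_map_iff (p := fun z => z ∈ T) (h.aemeasurable_tangentPlane hr) hT).2 ?_
  rw [ae_restrict_iff' h.isClosed.measurableSet]
  filter_upwards [measure_eq_zero_iff_ae_notMem.1 h.measure_sing] with x hx hxA
  exact hA x ⟨hxA, hx⟩

theorem isClosed_fst_mem {M : Set E3} (hM : IsClosed M) :
    IsClosed {z : E3 × Plane | z.1 ∈ M} := hM.preimage continuous_fst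

theorem IsSurface.mem_varifolds {r : ℕ∞} (hr : 2 ≤ r) {A S M : Set E3} (h : IsSurface r A S)
    (hM : IsClosed M) (hA : A ⊆ M) : inducedVarifold A ∈ varifolds M :=
  h.inducedVarifold_ae hr (isClosed_fst_mem hM).measurableSet fun x hx => hA hx.1

theorem HasTangentPlane.eq_of_subset {A B : Set E3} {x : E3} {S T : Plane}
    (hA : HasTangentPlane A x S) (hB : HasTangentPlane B x T) (h : A ⊆ B) : S = T := by
  have h1 : S.space ≤ T.space := by
    rw [← hA, ← hB]
    exact Submodule.span_mono (tangentConeAt_mono h)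
  exact Plane.ext (Submodule.eq_of_le_of_finrank_eq h1 (by rw [S.finrank_eq, T.finrank_eq]))

/-- The tangent cone of `A` is contained in that of `∂M`, and both span planes, so the planes
coincide. -/
theorem IsSurface.mem_boundaryVarifolds {r : ℕ∞} (hr : 2 ≤ r) {A S M : Set E3}
    (h : IsSurface r A S) (hM : IsConvexDomain r M) (hA : A ⊆ frontier M) :
    inducedVarifold A ∈ boundaryVarifolds M := by
  refine h.inducedVarifold_ae hr (hM.isCompact_boundaryPlanes hr).isClosed.measurableSet
    fun x hx => ⟨hA hx.1, ?_⟩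
  have hi : IsRegularPoint r (frontier M) x := Or.inl (hM.isInteriorPoint hr (hA hx.1))
  exact ((h.regular x hx).hasTangentPlane hr hx.1).eq_of_subset
    (hi.hasTangentPlane hr (hA hx.1)) hA

/-! ### Compactness -/

/-- Test with `min 1 (dist (·, T))`, a bounded continuous function that vanishes exactly on `T`. -/
theorem measure_compl_eq_zero_of_tendsto {X : Type*} [TopologicalSpace X]
    [TopologicalSpace.MetrizableSpace X] [MeasurableSpace X] [BorelSpace X]
    {V : ℕ → FiniteMeasure X} {V₀ : FiniteMeasure X} (h : Tendsto V atTop (𝓝 V₀)) {T : Set X}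
    (hT : IsClosed T) (hV : ∀ n, (V n : Measure X) Tᶜ = 0) : (V₀ : Measure X) Tᶜ = 0 := by
  let _ : MetricSpace X := TopologicalSpace.metrizableSpaceMetric X
  have hfin : ∀ x, min 1 (Metric.infEDist x T) ≠ ∞ := fun x =>
    ne_top_of_le_ne_top ENNReal.one_ne_top (min_le_left _ _)
  have hc : Continuous fun x => (min 1 (Metric.infEDist x T)).toNNReal :=
    ENNReal.continuousOn_toNNReal.comp_continuous
      (continuous_const.min Metric.continuous_infEDist) fun x => hfin x
  let f : BoundedContinuousFunction X ℝ≥0 :=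
    BoundedContinuousFunction.mkOfBound ⟨_, hc⟩ 1 (by
      intro x y
      have hb : ∀ x, (min 1 (Metric.infEDist x T)).toNNReal ≤ 1 := fun x => by
        rw [← ENNReal.toNNReal_one]
        exact ENNReal.toNNReal_mono ENNReal.one_ne_top (min_le_left _ _)
      rw [NNReal.dist_eq]
      have h1 : ((min 1 (Metric.infEDist x T)).toNNReal : ℝ) ≤ 1 := by exact_mod_cast hb x
      have h2 : ((min 1 (Metric.infEDist y T)).toNNReal : ℝ) ≤ 1 := by exact_mod_cast hb y
      have h3 : (0 : ℝ) ≤ (min 1 (Metric.infEDist x T)).toNNReal := NNReal.coe_nonneg _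
      have h4 : (0 : ℝ) ≤ (min 1 (Metric.infEDist y T)).toNNReal := NNReal.coe_nonneg _
      exact abs_le.2 ⟨by simp only [ContinuousMap.coe_mk]; linarith,
        by simp only [ContinuousMap.coe_mk]; linarith⟩)
  have hf : ∀ x, f x = (min 1 (Metric.infEDist x T)).toNNReal := fun x => rfl
  have hf0 : ∀ x, f x = 0 ↔ x ∈ T := fun x => by
    rw [hf, ENNReal.toNNReal_eq_zero_iff, or_iff_left (hfin x),
      Metric.mem_iff_infEDist_zero_of_closed hT]
    refine ⟨fun h0 => ?_, fun h0 => by rw [h0]; simp⟩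
    by_contra hne
    exact (lt_min one_pos (pos_iff_ne_zero.2 hne)).ne' h0
  have h1 := FiniteMeasure.tendsto_iff_forall_lintegral_tendsto.1 h f
  have h2 : ∀ n, ∫⁻ x, f x ∂(V n : Measure X) = 0 := fun n => by
    rw [lintegral_eq_zero_iff (by fun_prop)]
    filter_upwards [measure_eq_zero_iff_ae_notMem.1 (hV n)] with x hx
    simpa using (hf0 x).2 (not_not.1 hx)
  simp only [h2] at h1
  have h3 := tendsto_nhds_unique h1 tendsto_const_nhds
  rw [lintegral_eq_zero_iff (by fun_prop)] at h3
  rw [measure_eq_zero_iff_ae_notMem]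
  filter_upwards [h3] with x hx hxT
  exact hxT ((hf0 x).1 (by simpa using hx))

/-- Each measure is its mass times a probability measure. The probabilities have a convergent
subsequence by Prokhorov's theorem, the masses because they lie in `[0, C]`. -/
theorem exists_tendsto_subseq {X : Type*} [TopologicalSpace X]
    [TopologicalSpace.MetrizableSpace X] [TopologicalSpace.SeparableSpace X] [MeasurableSpace X]
    [BorelSpace X] [Nonempty X] {V : ℕ → FiniteMeasure X} {K : Set X} (hK : IsCompact K)
    (hV : ∀ n, (V n : Measure X) Kᶜ = 0) {C : ℝ≥0} (hC : ∀ n, (V n).mass ≤ C) :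
    ∃ (V₀ : FiniteMeasure X) (ψ : ℕ → ℕ), StrictMono ψ ∧ Tendsto (V ∘ ψ) atTop (𝓝 V₀) := by
  obtain ⟨z⟩ := ‹Nonempty X›
  have : Nonempty X := ⟨z⟩
  -- The zero measure has no normalization; it is represented by a point mass at `z`, for which
  -- reason `z` is added to `K`.
  have hP : ∀ n, ∃ P : ProbabilityMeasure X, V n = (V n).mass • P.toFiniteMeasure ∧
      (P : Measure X) (insert z K)ᶜ = 0 := fun n => by
    by_cases h0 : V n = 0
    · refine ⟨⟨Measure.dirac z, inferInstance⟩, by simp [h0], ?_⟩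
      change Measure.dirac z _ = 0
      rw [Measure.dirac_apply' _ (hK.insert z).measurableSet.compl]
      simp
    · refine ⟨(V n).normalize, (V n).self_eq_mass_smul_normalize, ?_⟩
      rw [(V n).toMeasure_normalize_eq_of_nonzero h0, Measure.smul_apply,
        measure_mono_null (compl_subset_compl.2 (subset_insert z K)) (hV n), smul_zero]
  choose P hVP hPK using hP
  have hcomp := isCompact_setOfPred_probabilityMeasure_mass_eq_compl_isCompact_le (E := X)
    (u := fun _ => 0) (K := fun _ => insert z K) tendsto_const_nhds (fun _ => hK.insert z)
    (Or.inr monotone_const)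
  obtain ⟨P₀, -, ψ₁, hψ₁, hP₀⟩ := hcomp.tendsto_subseq (x := P) fun n k => by
    have := hPK n
    rw [← ProbabilityMeasure.null_iff_toMeasure_null] at this
    exact this.le
  obtain ⟨m, -, ψ₂, hψ₂, hm⟩ := (isCompact_Icc (a := (0 : ℝ≥0)) (b := C)).tendsto_subseq
    (x := fun n => (V (ψ₁ n)).mass) fun n => ⟨zero_le, hC _⟩
  refine ⟨m • P₀.toFiniteMeasure, ψ₁ ∘ ψ₂, hψ₁.comp hψ₂, ?_⟩
  rw [FiniteMeasure.tendsto_iff_forall_testAgainstNN_tendsto]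
  intro f
  have h1 := FiniteMeasure.tendsto_iff_forall_testAgainstNN_tendsto.1
    ((ProbabilityMeasure.tendsto_nhds_iff_toFiniteMeasure_tendsto_nhds _).1
      (hP₀.comp hψ₂.tendsto_atTop)) f
  have h2 := hm.mul h1
  rw [FiniteMeasure.smul_testAgainstNN_apply]
  refine h2.congr fun n => ?_
  simp only [Function.comp_apply]
  conv_rhs => rw [hVP (ψ₁ (ψ₂ n)), FiniteMeasure.smul_testAgainstNN_apply]
  rfl


/-! ### The pull-tight argument -/

variable {r : ℕ∞} {M : Set E3} {a : ℝ} {c : PairPath}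

instance : Nonempty (Deformation r M) :=
  ⟨⟨Prod.snd, contDiff_snd, fun _ => rfl, 0, fun _ _ _ => rfl, fun _ _ => Iff.rfl⟩⟩

/-- The test functions restricted to the compact set `M × G(2,3)` form a subset of a separable
metric space of continuous functions, and subsets of such spaces are separable. -/
theorem exists_dense_deformations (hr : 2 ≤ r) (hM : IsCompact M) : ∃ D : ℕ → Deformation r M,
    ∀ D' : Deformation r M, ∀ η > 0, ∃ n, ∀ z : E3 × Plane, z.1 ∈ M →
      |D'.testFun z - (D n).testFun z| ≤ η := by
  let K : Set (E3 × Plane) := M ×ˢ univ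
  have hK : IsCompact K := hM.prod isCompact_univ
  have : CompactSpace K := isCompact_iff_compactSpace.1 hK
  let f : Deformation r M → C(K, ℝ) := fun D =>
    ⟨fun z => D.testFun z, (D.continuous_testFun hr).comp continuous_subtype_val⟩
  have : Nonempty (range f) := (range_nonempty f).to_subtype
  obtain ⟨s, hs⟩ := TopologicalSpace.exists_dense_seq (range f)
  choose D hD using fun n => (s n).2
  refine ⟨D, fun D' η hη => ?_⟩
  obtain ⟨n, hn⟩ := hs.exists_dist_lt ⟨f D', mem_range_self D'⟩ hη
  refine ⟨n, fun z hz => ?_⟩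
  have h1 : dist (f D') (f (D n)) < η := by rw [hD n]; exact hn
  have h2 := (ContinuousMap.dist_apply_le_dist (f := f D') (g := f (D n))
    (⟨z, hz, mem_univ _⟩ : K)).trans h1.le
  exact h2

theorem IsSweepout.sliceEnergy_le (h : IsSweepout r M c) (ha : 0 ≤ a) {L : ℝ}
    (hL : maxEnergy a c ≤ ENNReal.ofReal L) (hL0 : 0 ≤ L) (t : I01) : sliceEnergy a c t ≤ L := by
  have h1 := (le_iSup (fun t => energy a (c.inner t) (c.outer t)) t).trans hL
  rw [h.energy_eq ha] at h1
  exact (ENNReal.ofReal_le_ofReal_iff hL0).1 h1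

theorem IsSweepout.maxEnergy_lt_top (h : IsSweepout r M c) : maxEnergy a c < ∞ := by
  obtain ⟨S, G, Ω, hS⟩ := h
  have hc : Continuous fun t => energy a (c.inner t) (c.outer t) :=
    hS.inner_family.continuous_area.add
      ((ENNReal.continuous_const_mul ENNReal.ofReal_ne_top).comp hS.outer_family.continuous_area)
  obtain ⟨t, -, ht⟩ := isCompact_univ.exists_isMaxOn univ_nonempty hc.continuousOn
  refine (iSup_le fun s => ht (mem_univ s)).trans_lt ?_
  exact ENNReal.add_lt_top.2 ⟨hS.inner_family.finite_area t,
    ENNReal.mul_lt_top ENNReal.ofReal_lt_top (hS.outer_family.finite_area t)⟩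

/-- A tightened minimizing sequence. -/
theorem exists_tight_sequence (hr : 2 ≤ r) (hM : IsCompact M) (ha : 0 ≤ a) {𝒮 : Set PairPath}
    (h𝒮 : IsHomotopicallyClosed r M 𝒮) (D : ℕ → Deformation r M) {m : ℝ} (hm : 0 ≤ m)
    (hm0 : minMaxValue a 𝒮 = ENNReal.ofReal m) :
    ∃ (c : ℕ → PairPath) (δ : ℕ → ℝ), (∀ i, 0 < δ i) ∧ ∀ k, c k ∈ 𝒮 ∧
      maxEnergy a (c k) ≤ ENNReal.ofReal (m + 1 / ((k : ℝ) + 1)) ∧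
      ∀ t, ∀ i < k, m + 1 / ((k : ℝ) + 1) - δ i ≤ sliceEnergy a (c k) t →
        -(2 * (1 / ((i : ℝ) + 1))) ≤ sliceInt a (c k) t (D i).testFun := by
  -- The numbers `δ i` are fixed before any sweepout is chosen, which is possible because all
  -- starting sweepouts have energy at most `m + 1`.
  obtain ⟨δ, hδ, hstep⟩ := exists_iterated_tightening (a := a) hr hM ha h𝒮 D (L := m + 1)
    (by positivity)
  have hex : ∀ k : ℕ, ∃ c ∈ 𝒮, maxEnergy a c < ENNReal.ofReal (m + 1 / ((k : ℝ) + 1)) := by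
    intro k
    have h1 : minMaxValue a 𝒮 < ENNReal.ofReal (m + 1 / ((k : ℝ) + 1)) := by
      have hk : (0 : ℝ) < 1 / ((k : ℝ) + 1) := by positivity
      rw [hm0]
      exact (ENNReal.ofReal_lt_ofReal_iff (by linarith)).2 (by linarith)
    simpa only [minMaxValue, iInf_lt_iff, exists_prop] using h1
  choose c₀ hc₀ hE using hex
  have hL : ∀ k t, sliceEnergy a (c₀ k) t ≤ m + 1 / ((k : ℝ) + 1) := fun k t =>
    (h𝒮.isSweepout _ (hc₀ k)).sliceEnergy_le ha (hE k).le (by positivity) t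
  choose c hc h using fun k => hstep (c₀ k) (hc₀ k) (fun t => (hL k t).trans (by
    have : 1 / ((k : ℝ) + 1) ≤ 1 := by
      rw [div_le_one (by positivity)]; linarith [(Nat.cast_nonneg k : (0 : ℝ) ≤ k)]
    linarith)) k
  refine ⟨c, δ, hδ, fun k => ⟨hc k, iSup_le fun t => ?_, fun t i hi hEi => ?_⟩⟩
  · rw [(h𝒮.isSweepout _ (hc k)).energy_eq ha]
    exact ENNReal.ofReal_le_ofReal (((h k t).1).trans (hL k t))
  · have h1 := (h k t).2 i hi (le_trans (by linarith [hL k t]) hEi)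
    have : (0 : ℝ) < 1 / ((k : ℝ) + 1) := by positivity
    linarith

theorem SlicesConverge.tendsto_sliceInt {c : ℕ → PairPath} {τ : ℕ → I01} {φ : ℕ → ℕ}
    {V W : FiniteMeasure (E3 × Plane)} (h : SlicesConverge c τ φ V W) {u : E3 × Plane → ℝ}
    (hu : Continuous u) {C : ℝ} (hC : ∀ z, |u z| ≤ C) :
    Tendsto (fun k => sliceInt a (c (φ k)) (τ (φ k)) u) atTop (𝓝 (pairInt a V W u)) :=
  (tendsto_integral_of_tendsto h.1 hu hC).add ((tendsto_integral_of_tendsto h.2 hu hC).const_mul a)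

theorem pairInt_testFun_nonneg (hr : 2 ≤ r) (ha : 0 ≤ a) {V W : FiniteMeasure (E3 × Plane)}
    (hV : ∀ᵐ z ∂(V : Measure (E3 × Plane)), z.1 ∈ M)
    (hW : ∀ᵐ z ∂(W : Measure (E3 × Plane)), z.1 ∈ M) {D : ℕ → Deformation r M}
    (hD : ∀ D' : Deformation r M, ∀ η > 0, ∃ n, ∀ z : E3 × Plane, z.1 ∈ M →
      |D'.testFun z - (D n).testFun z| ≤ η)
    (h : ∀ n, 0 ≤ pairInt a V W (D n).testFun) (D' : Deformation r M) :
    0 ≤ pairInt a V W D'.testFun := by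
  have hm : (0 : ℝ) ≤ V.mass + a * W.mass := by positivity
  refine le_of_forall_pos_lt_add fun ε hε => ?_
  obtain ⟨n, hn⟩ := hD D' (ε / (V.mass + a * W.mass + 1)) (by positivity)
  have h1 := (abs_le.1 (abs_pairInt_sub_le (V := V) (W := W) ha (D'.integrable_testFun hr)
    ((D n).integrable_testFun hr) (hV.mono fun z hz => hn z hz) (hW.mono fun z hz => hn z hz))).1
  have h2 : ε / (V.mass + a * W.mass + 1) * (V.mass + a * W.mass) < ε := by
    rw [div_mul_eq_mul_div, div_lt_iff₀ (by positivity)]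
    nlinarith
  linarith [h n]

end

end Capillarity

theorem mainTheorem8 (r : ℕ∞) (hr : 2 ≤ r) (M : Set E3) (hM : IsConvexDomain r M)
    (a : ℝ) (ha0 : 0 ≤ a) (ha1 : a ≤ 1)
    (𝒮 : Set PairPath) (h𝒮 : IsHomotopicallyClosed r M 𝒮) :
    ∃ c : ℕ → PairPath, IsMinimizingSequence a 𝒮 c ∧
      ∀ τ : ℕ → I01, IsMinMaxSequence a 𝒮 c τ →
        (∃ φ : ℕ → ℕ, StrictMono φ ∧ ∃ V ∈ varifolds M, ∃ W ∈ boundaryVarifolds M,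
          SlicesConverge c τ φ V W ∧ IsStationaryPair M a V W) ∧
        (∀ φ : ℕ → ℕ, StrictMono φ → ∀ V W : FiniteMeasure (E3 × Plane),
          SlicesConverge c τ φ V W →
            V ∈ varifolds M ∧ W ∈ boundaryVarifolds M ∧ IsStationaryPair M a V W) := by
  have hMc := hM.isCompact.isClosed
  obtain ⟨c₁, hc₁⟩ := h𝒮.nonempty
  have hfin : minMaxValue a 𝒮 ≠ ∞ :=
    ((iInf₂_le c₁ hc₁).trans_lt (h𝒮.isSweepout c₁ hc₁).maxEnergy_lt_top).ne
  obtain ⟨m, hm⟩ : ∃ m, m = (minMaxValue a 𝒮).toReal := ⟨_, rfl⟩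
  have hm0 : 0 ≤ m := hm ▸ ENNReal.toReal_nonneg
  have hmE : minMaxValue a 𝒮 = ENNReal.ofReal m := by rw [hm, ENNReal.ofReal_toReal hfin]
  obtain ⟨D, hD⟩ := exists_dense_deformations hr hM.isCompact
  -- Through `Nat.unpair` each `D n` occurs at infinitely many indices `i`, so its first variation
  -- is bounded below by `-2 / (i + 1)` for arbitrarily large `i`.
  obtain ⟨c, δ, hδ, hc⟩ := exists_tight_sequence hr hM.isCompact ha0 h𝒮
    (fun i => D (Nat.unpair i).1) hm0 hmE
  have hsw := fun k => h𝒮.isSweepout _ (hc k).1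
  have hlim : Tendsto (fun k : ℕ => m + 1 / ((k : ℝ) + 1)) atTop (𝓝 m) := by
    simpa using tendsto_one_div_add_atTop_nhds_zero_nat.const_add m
  have hVk : ∀ k t, inducedVarifold ((c k).inner t) ∈ varifolds M := fun k t => by
    obtain ⟨S, G, Ω, hS⟩ := hsw k
    exact (hS.inner_family.isSurface t).mem_varifolds hr hMc (hS.inner_family.subset t)
  have hWk : ∀ k t, inducedVarifold ((c k).outer t) ∈ boundaryVarifolds M := fun k t => by
    obtain ⟨S, G, Ω, hS⟩ := hsw k
    exact (hS.outer_family.isSurface t).mem_boundaryVarifolds hr hM (hS.outer_subset t)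
  have hmass1 : ∀ k t, (inducedVarifold ((c k).inner t)).mass ≤ (m + 1).toNNReal := fun k t => by
    obtain ⟨S, G, Ω, hS⟩ := hsw k
    rw [← ENNReal.coe_le_coe, FiniteMeasure.ennreal_mass,
      (hS.inner_family.isSurface t).mass_inducedVarifold hr]
    refine (le_self_add.trans
      (le_iSup (fun t => energy a ((c k).inner t) ((c k).outer t)) t)).trans ((hc k).2.1.trans ?_)
    refine ENNReal.ofReal_le_ofReal ?_
    have : 1 / ((k : ℝ) + 1) ≤ 1 := by
      rw [div_le_one (by positivity)]; linarith [(Nat.cast_nonneg k : (0 : ℝ) ≤ k)]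
    linarith
  -- For `a = 0` the energy does not control the outer surfaces; the area of `∂M` does.
  have hmass2 : ∀ k t, (inducedVarifold ((c k).outer t)).mass ≤ (μHE[2] (frontier M)).toNNReal :=
    fun k t => by
    obtain ⟨S, G, Ω, hS⟩ := hsw k
    rw [← ENNReal.coe_le_coe, FiniteMeasure.ennreal_mass,
      (hS.outer_family.isSurface t).mass_inducedVarifold hr,
      ENNReal.coe_toNNReal (hM.area_frontier_lt_top hr).ne]
    exact measure_mono (hS.outer_subset t)
  have key : ∀ τ, IsMinMaxSequence a 𝒮 c τ → ∀ φ : ℕ → ℕ, StrictMono φ →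
      ∀ V W : FiniteMeasure (E3 × Plane), SlicesConverge c τ φ V W →
        V ∈ varifolds M ∧ W ∈ boundaryVarifolds M ∧ IsStationaryPair M a V W := by
    intro τ hτ φ hφ V W hVW
    have hV : V ∈ varifolds M := measure_compl_eq_zero_of_tendsto hVW.1
      (T := {z | z.1 ∈ M}) (isClosed_fst_mem hMc) fun k => hVk _ _
    have hW : W ∈ boundaryVarifolds M := measure_compl_eq_zero_of_tendsto hVW.2
      (hM.isCompact_boundaryPlanes hr).isClosed fun k => hWk _ _
    have hE : Tendsto (fun k => sliceEnergy a (c k) (τ k)) atTop (𝓝 m) := by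
      have h1 := (ENNReal.tendsto_toReal hfin).comp hτ
      rw [← hm] at h1
      refine h1.congr fun k => ?_
      rw [Function.comp_apply, (hsw k).energy_eq ha0,
        ENNReal.toReal_ofReal (sliceEnergy_nonneg ha0 _)]
    have hq : ∀ i : ℕ, -(2 * (1 / ((i : ℝ) + 1))) ≤ pairInt a V W (D (Nat.unpair i).1).testFun := by
      intro i
      obtain ⟨C, hC⟩ := (D (Nat.unpair i).1).exists_abs_testFun_le hr
      refine ge_of_tendsto (hVW.tendsto_sliceInt ((D _).continuous_testFun hr) hC) ?_
      -- Both the initial bound `m + 1 / (k + 1)` and the energy of the slice tend to `m`, so the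
      -- gap eventually falls below the fixed `δ i`.
      have h2 : ∀ᶠ k : ℕ in atTop, m + 1 / ((k : ℝ) + 1) - δ i ≤ sliceEnergy a (c k) (τ k) :=
        ((hlim.sub_const (δ i)).eventually_lt hE (by linarith [hδ i])).mono fun _ => le_of_lt
      filter_upwards [hφ.tendsto_atTop.eventually (h2.and (eventually_gt_atTop i))] with k hk
      exact (hc (φ k)).2.2 (τ (φ k)) i hk.2 hk.1
    have hq0 : ∀ n, 0 ≤ pairInt a V W (D n).testFun := by
      intro n
      have h3 : Tendsto (fun j : ℕ => -(2 * (1 / ((j : ℝ) + 1)))) atTop (𝓝 0) := by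
        simpa using (tendsto_one_div_add_atTop_nhds_zero_nat.const_mul (2 : ℝ)).neg
      refine le_of_tendsto' h3 fun j => ?_
      have h4 := hq (Nat.pair n j)
      rw [Nat.unpair_pair] at h4
      refine le_trans ?_ h4
      have h5 : (j : ℝ) ≤ Nat.pair n j := by exact_mod_cast Nat.right_le_pair n j
      have h6 := one_div_le_one_div_of_le (by positivity : (0 : ℝ) < (j : ℝ) + 1)
        (by linarith : (j : ℝ) + 1 ≤ (Nat.pair n j : ℝ) + 1)
      linarith
    exact ⟨hV, hW, isStationaryPair_of_deformations hr hM ha0 hV hW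
      (pairInt_testFun_nonneg hr ha0 (varifolds_ae hV)
        ((boundaryVarifolds_ae hW).mono fun z hz => hMc.frontier_subset hz.1) hD hq0)⟩
  refine ⟨c, ⟨fun k => (hc k).1, ?_⟩, fun τ hτ => ⟨?_, key τ hτ⟩⟩
  · refine tendsto_of_tendsto_of_tendsto_of_le_of_le tendsto_const_nhds ?_
      (fun k => iInf₂_le (c k) (hc k).1) fun k => (hc k).2.1
    rw [hmE]
    exact (ENNReal.continuous_ofReal.tendsto m).comp hlim
  · obtain ⟨V, ψ₁, hψ₁, hV⟩ := exists_tendsto_subseq (hM.isCompact.prod isCompact_univ)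
      (V := fun k => inducedVarifold ((c k).inner (τ k)))
      (fun k => by
        refine measure_mono_null (fun z hz hzM => hz ⟨hzM, mem_univ _⟩) (hVk k (τ k)))
      fun k => hmass1 k (τ k)
    obtain ⟨W, ψ₂, hψ₂, hW⟩ := exists_tendsto_subseq (hM.isCompact_boundaryPlanes hr)
      (V := fun k => inducedVarifold ((c (ψ₁ k)).outer (τ (ψ₁ k))))
      (fun k => hWk _ _) fun k => hmass2 _ _
    have hφ := hψ₁.comp hψ₂
    have hVW : SlicesConverge c τ (ψ₁ ∘ ψ₂) V W := ⟨hV.comp hψ₂.tendsto_atTop, hW⟩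
    obtain ⟨h1, h2, h3⟩ := key τ hτ _ hφ V W hVW
    exact ⟨_, hφ, V, h1, W, h2, hVW, h3⟩
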